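/- Let $s>0$, $d,\sigma'\in\mathbb R$, $\kappa\,(=\omega w)\in\mathbb C$ and $\mu_0,\mu_1,\mu_2\in\mathbb C$, not all zero, and if $\mu_2=0$ assume $\mu_1\neq\pm\mathrm i$. Put $\Delta=\sqrt{d^2+s^2}$, $\zeta(\gamma)=\sqrt{\kappa^2-\gamma^2}$ (the root in the upper half plane, and the nonnegative root if $\kappa^2-\gamma^2\ge 0$), and $$D(\gamma)=\cos(s\zeta)-\cos(d\gamma+\sigma'),\qquad K(\gamma)=\frac{\zeta\sin(s\zeta)}{4\pi D(\gamma)}+\frac1{4\pi}\left(\mu_0-\mathrm i\mu_1\gamma-\mu_2\gamma^2\right).$$ The acoustic modes (the zeros of $D$) are $\lambda_m^\pm=-f_m\frac d\Delta\pm\frac s\Delta\,\zeta(f_m)$, $f_m=\frac{\sigma'-2\pi m}{\Delta}$, $m\in\mathbb Z$. The kernel zeros are the zeros, with multiplicity, of the entire function $4\pi K D=\zeta\sin(s\zeta)+(\mu_0-\mathrm i\mu_1\gamma-\mu_2\gamma^2)D$. Assume $D(0)\ne0$ and $K(0)\neq 0$. Label all kernel zeros as $\theta_{m,R}^{\pm},\theta_{m,L}^{\pm}$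 ($m\ge1$), with $\theta^+$ in the closed upper and $\theta^-$ in the closed lower half plane (a real zero may be put in either). If $d\neq0$, the $R$ zeros have real part $\ge0$ and the $L$ zeros real part $\le 0$, each sequence being in order of nondecreasing modulus; if $d=0$, the zeros of each half plane are arranged by $|\theta_{m,R}^\pm|\le|\theta_{m,L}^\pm|\le|\theta_{m+1,R}^\pm|$. Such labellings exist, and for each of them the following holds. For every $\gamma$ different from all $\lambda_m^{\pm}$ of the respective sign the limit $$Q_{\mp}(\gamma)=\lim_{M\to\infty}\frac{\prod_{m=1}^{M}(1-\gamma/\theta_{m,R}^{\pm})(1-\gamma/\theta_{m,L}^{\pm})}{\prod_{m=-M}^{M}(1-\gamma/\lambda_m^{\pm})}$$ exists (upper signs: $Q_-$, lower signs: $Q_+$). For an entire function $E$ put $K_-=\mathrm e^{E}Q_-$ and $K_+=\mathrm e^{-E}Q_+K(0)$. Then for every entire $E$: 1. $K(\gamma)=K_+(\gamma)K_-(\gamma)$ whenever $D(\gamma)\ne0$. 2. On $\{\operatorname{Im}\gamma\le0\}$, $K_-$ is analytic at every point other than the (real) $\lambda_m^+$, and is nonzero at each such point that is not one of the (real) $\theta^+_{m,R},\theta_{m,L}^+$.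 On $\{\operatorname{Im}\gamma\ge0\}$, $K_+$ is analytic at every point other than the (real) $\lambda_m^-$, and is nonzero at each such point that is not one of the (real) $\theta^-_{m,R},\theta_{m,L}^-$. 3. $K_-$ and $K_+$ have algebraic growth in the lower and the upper half plane respectively if and only if $E$ is constant. Here $g$ has algebraic growth in a half plane if $g(\gamma)\sim A\gamma^{\alpha}$, for some constants $A\neq0$ and $\alpha\in\mathbb C$, as $\gamma\to\infty$ in that closed half plane (with a branch of $\gamma^\alpha$ continuous there). -/

import Mathlib

open Complex Filter Topology

/-- The data of the rectilinear cascade: blade spacing `(d, s)`, inter-blade phase angle `σ`,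
reduced wavenumber `κ = ω w`, and the coefficients `μ₀, μ₁, μ₂` of the blade boundary condition. -/
structure Cascade where
  s : ℝ
  d : ℝ
  σ : ℝ
  κ : ℂ
  μ₀ : ℂ
  μ₁ : ℂ
  μ₂ : ℂ

namespace Cascade

/-- The square root with nonnegative imaginary part (the nonnegative one on `[0, ∞)`). -/
noncomputable def upperSqrt (z : ℂ) : ℂ :=
  if 0 ≤ z.im then z ^ (1 / 2 : ℂ) else -z ^ (1 / 2 : ℂ)

/-- `ζ(γ) = √(κ² - γ²)` with `Im ζ ≥ 0`. -/
noncomputable def zeta (p : Cascade) (γ : ℂ) : ℂ := upperSqrt (p.κ ^ 2 - γ ^ 2)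

/-- `cos (s ζ) - cos (d γ + σ)`; it is even in `ζ`, so it does not depend on the branch. -/
noncomputable def acoustic (p : Cascade) (γ : ℂ) : ℂ :=
  Complex.cos (p.s * p.zeta γ) - Complex.cos (p.d * γ + p.σ)

/-- The boundary symbol `μ₀ - i μ₁ γ - μ₂ γ²`. -/
noncomputable def symbol (p : Cascade) (γ : ℂ) : ℂ :=
  p.μ₀ - I * p.μ₁ * γ - p.μ₂ * γ ^ 2

/-- The Wiener-Hopf kernel. -/
noncomputable def K (p : Cascade) (γ : ℂ) : ℂ :=
  p.zeta γ * Complex.sin (p.s * p.zeta γ) / (4 * Real.pi * p.acoustic γ)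
    + 1 / (4 * Real.pi) * p.symbol γ

/-- The dispersion function of the duct modes, that is the entire numerator `4 π K · acoustic`
of the kernel: its zeros, with multiplicity, are the kernel zeros. -/
noncomputable def duct (p : Cascade) (γ : ℂ) : ℂ :=
  p.zeta γ * Complex.sin (p.s * p.zeta γ) + p.symbol γ * p.acoustic γ

/-- The blade distance `Δ`. -/
noncomputable def Δ (p : Cascade) : ℝ := Real.sqrt (p.d ^ 2 + p.s ^ 2)

/-- `f_m = (σ - 2 π m) / Δ`. -/
noncomputable def f (p : Cascade) (m : ℤ) : ℝ := (p.σ - 2 * Real.pi * m) / p.Δ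

/-- The acoustic modes `λ_m⁺ = -f_m sin χ + cos χ ζ(f_m)`, `sin χ = d / Δ`, `cos χ = s / Δ`. -/
noncomputable def lamPlus (p : Cascade) (m : ℤ) : ℂ :=
  -(p.f m : ℂ) * (p.d / p.Δ : ℝ) + (p.s / p.Δ : ℝ) * p.zeta (p.f m)

/-- The acoustic modes `λ_m⁻ = -f_m sin χ - cos χ ζ(f_m)`. -/
noncomputable def lamMinus (p : Cascade) (m : ℤ) : ℂ :=
  -(p.f m : ℂ) * (p.d / p.Δ : ℝ) - (p.s / p.Δ : ℝ) * p.zeta (p.f m)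

/-- A labelling of the kernel zeros by four sequences (term `m` here is the zero with label
`m + 1`): `Rp, Lp` for the upper half plane, `Rm, Lm` for the lower one. -/
structure Labels where
  Rp : ℕ → ℂ
  Lp : ℕ → ℂ
  Rm : ℕ → ℂ
  Lm : ℕ → ℂ

/-- How the zeros of one half plane are divided into a right family `R` and a left family `L`.
If `d ≠ 0`, by quadrants, each family in order of nondecreasing modulus. If `d = 0` the zeros
have no preferred quadrant, and are ordered by modulus and assigned alternately. -/
def Arranged (p : Cascade) (R L : ℕ → ℂ) : Prop :=
  (p.d ≠ 0 → (∀ m, 0 ≤ (R m).re) ∧ (∀ m, (L m).re ≤ 0) ∧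
    Monotone (fun m => ‖R m‖) ∧ Monotone (fun m => ‖L m‖)) ∧
  (p.d = 0 → ∀ m, ‖R m‖ ≤ ‖L m‖ ∧ ‖L m‖ ≤ ‖R (m + 1)‖)

/-- `θ` lists every kernel zero exactly as often as its multiplicity; a real zero may be put
in either half plane. -/
structure IsLabelling (p : Cascade) (θ : Labels) : Prop where
  upper : ∀ m, 0 ≤ (θ.Rp m).im ∧ 0 ≤ (θ.Lp m).im
  lower : ∀ m, (θ.Rm m).im ≤ 0 ∧ (θ.Lm m).im ≤ 0
  arranged_upper : p.Arranged θ.Rp θ.Lp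
  arranged_lower : p.Arranged θ.Rm θ.Lm
  multiplicity : ∀ z : ℂ,
    {m | θ.Rp m = z}.encard + {m | θ.Lp m = z}.encard
      + {m | θ.Rm m = z}.encard + {m | θ.Lm m = z}.encard = analyticOrderAt p.duct z

/-- `∏_{m=1}^{M} (1 - γ / R_m) (1 - γ / L_m) / ∏_{m=-M}^{M} (1 - γ / l_m)`. -/
noncomputable def partialQuotient (R L : ℕ → ℂ) (l : ℤ → ℂ) (M : ℕ) (γ : ℂ) : ℂ :=
  (∏ m ∈ Finset.range M, (1 - γ / R m) * (1 - γ / L m)) /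
    ∏ m ∈ Finset.Icc (-(M : ℤ)) M, (1 - γ / l m)

/-- The limit of the partial quotients (their convergence is asserted separately). -/
noncomputable def quotient (R L : ℕ → ℂ) (l : ℤ → ℂ) (γ : ℂ) : ℂ :=
  limUnder atTop (fun M => partialQuotient R L l M γ)

/-- The factor `K₋` belonging to the entire function `E`. -/
noncomputable def KMinus (p : Cascade) (θ : Labels) (E : ℂ → ℂ) (γ : ℂ) : ℂ :=
  Complex.exp (E γ) * quotient θ.Rp θ.Lp p.lamPlus γ

/-- The factor `K₊` belonging to the entire function `E`. -/
noncomputable def KPlus (p : Cascade) (θ : Labels) (E : ℂ → ℂ) (γ : ℂ) : ℂ :=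
  Complex.exp (-E γ) * quotient θ.Rm θ.Lm p.lamMinus γ * p.K 0

/-- `g(γ) ∼ A γ^α` with `A ≠ 0` as `γ → ∞` in the closed lower half plane. The power is written
`(i γ)^α` because the principal branch of this is continuous in that half plane. -/
def AlgebraicInLower (g : ℂ → ℂ) : Prop :=
  ∃ A α : ℂ, A ≠ 0 ∧ Tendsto (fun γ => g γ / (I * γ) ^ α)
    (Bornology.cobounded ℂ ⊓ 𝓟 {γ | γ.im ≤ 0}) (𝓝 A)

/-- `g(γ) ∼ A γ^α` with `A ≠ 0` as `γ → ∞` in the closed upper half plane. -/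
def AlgebraicInUpper (g : ℂ → ℂ) : Prop :=
  ∃ A α : ℂ, A ≠ 0 ∧ Tendsto (fun γ => g γ / (-I * γ) ^ α)
    (Bornology.cobounded ℂ ⊓ 𝓟 {γ | 0 ≤ γ.im}) (𝓝 A)

end Cascade

/-!
The kernel zeros and the acoustic modes have the same asymptotic geometry. Far out, the duct
function `4 π K D` is an exponential sum with exponents `± s γ` and `± i d γ` and coefficients of
power growth. In each quadrant two of the exponentials dominate, and balancing them turns the
equation into a fixed point problem `w = n + g w` with `g w = O(√|w|)` in a cone
(`exists_fixed_points`). For `d = 0` the sum is a quadratic equation for `exp (s γ)`, whose two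
roots are followed separately. So the large zeros are simple and lie within `O(√n)` of arithmetic
progressions in the directions `± dirRight`, `± dirLeft` of the acoustic modes
(`zerosAlong_duct_of_ne`, `zerosAlong_duct_of_eq`), and sorting by modulus cannot spoil this
(`follows_of_monotone`, `IsLabelling.follows`). This is where `μ₁ ≠ ± i` enters for `μ₂ = 0`:
otherwise one of the exponentials has a coefficient of smaller order.

Pairing each zero with a mode, the factors of the quotients `Q_∓` are `1 + O(m ^ (-3/2))` on discs
(`NearOne`), so the quotients converge, and are holomorphic and nonzero away from the modes and
zeros (`Matched.tendsto_quotient`, `Matched.analyticAt_quotient`).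

The duct function is a zero-free entire function `G` times the product over its zeros
(`exists_duct_product`). On suitable large circles `K` is polynomially bounded (`exists_norm_K_le`)
and the product over the modes exceeds the product over the zeros by less than any exponential
(`exists_circle_prod_le`). Hence `G` is subexponential on circles and constant
(`eq_const_of_nonvanishing`), which gives `K = K(0) Q₋ Q₊` (`K_eq_mul_quotient`).

For the growth, in the half-plane away from its poles each quotient is a rational function times
the exponential of a holomorphic function of sublinear growth (`exists_tail_log`,
`Matched.exists_eq_mul_exp`). The sum of the two exponents is, on the strip common to the two
half-planes, a logarithm of `K` over a rational function, and `K` behaves like a power at both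
ends of the strip (`exists_powAsymp_K`). Subtracting logarithms and Cauchy integrals along two
horizontal lines leaves an entire function of sublinear growth, a constant; so each exponent is
logarithmic up to a null term (`wienerHopf_asymptotic`) and the quotients have algebraic growth
(`algebraic_quotients`). If they keep it after multiplication by `exp E` and `exp (-E)`, then
`exp E` is subexponential in both half-planes and has no zeros, so `E` is constant
(`exists_eq_const`).
-/

/-! ### Zero-free entire functions of small growth -/

/-- A nowhere vanishing holomorphic function on a disc centred at the origin has a logarithm. -/
lemma exists_log_on_ball {G : ℂ → ℂ} (hG : Differentiable ℂ G) (h0 : ∀ z, G z ≠ 0) (r : ℝ)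
    (hr : 0 < r) :
    ∃ H : ℂ → ℂ, H 0 = 0 ∧ DifferentiableOn ℂ H (Metric.ball 0 r) ∧
      ∀ z ∈ Metric.ball (0 : ℂ) r, G z = G 0 * exp (H z) := by
  have hd : DifferentiableOn ℂ (fun z => deriv G z / G z) (Metric.ball 0 r) := by
    refine DifferentiableOn.div ?_ hG.differentiableOn fun z _ => h0 z
    exact (hG.differentiableOn (s := Set.univ)).deriv isOpen_univ |>.mono (Set.subset_univ _)
  obtain ⟨H, hH0, hH⟩ := (hd.isConservativeOn.isExactOn_ball hd.continuousOn).with_val_at 0 0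
  have hHd : DifferentiableOn ℂ H (Metric.ball 0 r) :=
    fun z hz => (hH z hz).differentiableAt.differentiableWithinAt
  refine ⟨H, hH0, hHd, fun z hz => ?_⟩
  have key : ∀ w ∈ Metric.ball (0 : ℂ) r, HasDerivAt (fun z => G z * exp (-H z)) 0 w := by
    intro w hw
    have := (hG w).hasDerivAt.mul ((hH w hw).neg.cexp)
    refine this.congr_deriv ?_
    have h := h0 w
    field_simp
    ring
  have hc := (convex_ball (0 : ℂ) r).is_const_of_fderivWithin_eq_zero (𝕜 := ℂ)
    (f := fun z => G z * exp (-H z))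
    (fun w hw => (key w hw).differentiableAt.differentiableWithinAt)
    (fun w hw => by
      rw [fderivWithin_of_isOpen Metric.isOpen_ball hw]
      ext
      simpa using (key w hw).deriv) hz (Metric.mem_ball_self hr)
  simp only [hH0, neg_zero, exp_zero, mul_one] at hc
  rw [← hc, mul_assoc, ← exp_add]
  simp

/-- A nowhere vanishing entire function that is at most `exp (ε r)` on circles of arbitrarily
large radius `r`, for every `ε`, is constant: its logarithm is controlled by the
Borel-Carathéodory inequality. -/
lemma eq_const_of_nonvanishing {G : ℂ → ℂ} (hG : Differentiable ℂ G) (h0 : ∀ z, G z ≠ 0)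
    (hb : ∀ ε > 0, ∀ R : ℝ, ∃ r > R, ∀ z : ℂ, ‖z‖ = r → ‖G z‖ ≤ Real.exp (ε * r)) (z : ℂ) :
    G z = G 0 := by
  have main : ∀ ε > 0, ∃ w : ℂ, G z = G 0 * exp w ∧ ‖w‖ ≤ ε := by
    intro ε hε
    set c0 : ℝ := |Real.log ‖G 0‖| + 1 with hc0
    have hc0p : 0 < c0 := by positivity
    set δ : ℝ := ε / (8 * (‖z‖ + 1)) with hδ
    have hδp : 0 < δ := by positivity
    obtain ⟨r, hr, hbr⟩ := hb δ hδp (max (2 * ‖z‖ + 1) (c0 / δ))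
    have hr1 : 2 * ‖z‖ + 1 < r := lt_of_le_of_lt (le_max_left _ _) hr
    have hr2 : c0 < δ * r := by
      have := lt_of_le_of_lt (le_max_right _ _) hr
      rw [div_lt_iff₀ hδp] at this
      linarith
    have hrp : 0 < r := by linarith [norm_nonneg z]
    obtain ⟨H, hH0, hHd, hH⟩ := exists_log_on_ball hG h0 r hrp
    have hz : z ∈ Metric.ball (0 : ℂ) r := by simp; linarith [norm_nonneg z]
    refine ⟨H z, hH z hz, ?_⟩
    have hmax : ∀ w ∈ Metric.ball (0 : ℂ) r, ‖G w‖ ≤ Real.exp (δ * r) := by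
      intro w hw
      refine Complex.norm_le_of_forall_mem_frontier_norm_le (U := Metric.ball 0 r)
        Metric.isBounded_ball hG.diffContOnCl (fun x hx => ?_) (subset_closure hw)
      rw [frontier_ball _ hrp.ne'] at hx
      exact hbr x (by simpa using hx)
    have hbc := Complex.borelCaratheodory_zero (M := δ * r + c0) (by positivity) hHd ?_ hrp hz hH0
    · refine hbc.trans ?_
      have h1 : r / 2 ≤ r - ‖z‖ := by linarith [norm_nonneg z]
      calc 2 * (δ * r + c0) * ‖z‖ / (r - ‖z‖) ≤ 2 * (δ * r + δ * r) * ‖z‖ / (r / 2) := by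
            gcongr
        _ = 8 * δ * ‖z‖ := by field_simp; ring
        _ = ε * (‖z‖ / (‖z‖ + 1)) := by rw [hδ]; field_simp
        _ ≤ ε * 1 := by
            gcongr
            rw [div_le_one (by positivity)]; linarith
        _ = ε := mul_one _
    · intro w hw
      simp only [Set.mem_ofPred_eq]
      have h2 := hmax w hw
      rw [hH w hw, norm_mul, Complex.norm_exp] at h2
      have hg : 0 < ‖G 0‖ := norm_pos_iff.mpr (h0 0)
      have h3 := Real.log_le_log (by positivity) h2
      rw [Real.log_mul hg.ne' (Real.exp_pos _).ne', Real.log_exp, Real.log_exp] at h3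
      have := neg_abs_le (Real.log ‖G 0‖)
      linarith
  choose! w hw1 hw2 using main
  have hlim : Tendsto (fun n : ℕ => w (1 / ((n : ℝ) + 1))) atTop (𝓝 0) := by
    refine squeeze_zero_norm (fun n => hw2 _ (by positivity)) tendsto_one_div_add_atTop_nhds_zero_nat
  have h1 : Tendsto (fun n : ℕ => G 0 * exp (w (1 / ((n : ℝ) + 1)))) atTop (𝓝 (G 0 * exp 0)) :=
    ((continuous_exp.tendsto 0).comp hlim).const_mul _
  have h2 : (fun n : ℕ => G 0 * exp (w (1 / ((n : ℝ) + 1)))) = fun _ => G z := by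
    ext n
    exact (hw1 _ (by positivity)).symm
  rw [h2, exp_zero, mul_one] at h1
  exact tendsto_nhds_unique tendsto_const_nhds h1

/-- An entire function of sublinear growth is constant. -/
lemma eq_const_of_sublinear {W : ℂ → ℂ} (hW : Differentiable ℂ W) (C : ℝ)
    (hb : ∀ z, ‖W z‖ ≤ C * (1 + ‖z‖) ^ (3 / 4 : ℝ)) (z w : ℂ) : W z = W w := by
  have hC : 0 ≤ C := by
    have := (norm_nonneg _).trans (hb 0)
    simpa using this
  refine is_const_of_deriv_eq_zero hW (fun x => ?_) z w
  have hbound : ∀ r : ℝ, 0 < r → ‖deriv W x‖ ≤ C * (1 + ‖x‖ + r) ^ (3 / 4 : ℝ) / r := by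
    intro r hr
    refine Complex.norm_deriv_le_of_forall_mem_sphere_norm_le hr hW.diffContOnCl fun y hy => ?_
    refine (hb y).trans ?_
    have : ‖y‖ ≤ ‖x‖ + r := by
      have h1 : ‖y - x‖ = r := by simpa [dist_eq_norm] using hy
      have := norm_add_le (y - x) x
      simp at this; linarith
    exact mul_le_mul_of_nonneg_left
      (Real.rpow_le_rpow (by positivity) (by linarith) (by norm_num)) hC
  have hlim : Tendsto (fun r : ℝ => C * (1 + ‖x‖ + r) ^ (3 / 4 : ℝ) / r) atTop (𝓝 0) := by
    have h1 : Tendsto (fun r : ℝ => C * ((1 + ‖x‖) + 1) ^ (3 / 4 : ℝ) * r ^ (-(1 / 4) : ℝ)) atTop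
        (𝓝 (C * ((1 + ‖x‖) + 1) ^ (3 / 4 : ℝ) * 0)) :=
      (tendsto_rpow_neg_atTop (by norm_num)).const_mul _
    rw [mul_zero] at h1
    refine squeeze_zero' ?_ ?_ h1
    · filter_upwards [eventually_gt_atTop 0] with r hr
      positivity
    · filter_upwards [eventually_ge_atTop 1] with r hr
      have hr0 : 0 < r := by linarith
      rw [div_le_iff₀ hr0]
      have h2 : (r : ℝ) ^ (-(1 / 4) : ℝ) * r = r ^ (3 / 4 : ℝ) := by
        nth_rewrite 2 [← Real.rpow_one r]
        rw [← Real.rpow_add hr0]; norm_num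
      rw [mul_assoc, h2, mul_assoc, ← Real.mul_rpow (by positivity) hr0.le]
      gcongr
      nlinarith [norm_nonneg x]
  exact norm_le_zero_iff.mp (ge_of_tendsto hlim (by
    filter_upwards [eventually_gt_atTop 0] with r hr using hbound r hr))

/-! ### Cauchy integrals along horizontal lines -/

open MeasureTheory intervalIntegral in
/-- The principal value of `∫ dx / (x + i y)` over the real line. -/
lemma tendsto_integral_inv_add_mul_I {y : ℝ} (hy : y ≠ 0) (x₀ : ℝ) :
    Tendsto (fun T : ℝ => ∫ x in (x₀ - T)..(x₀ + T), 1 / (((x - x₀ : ℝ) : ℂ) + y * I)) atTop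
      (𝓝 (if 0 < y then -(Real.pi * I) else Real.pi * I)) := by
  have hne : ∀ u : ℝ, ((u : ℂ) + y * I) ≠ 0 := fun u h => hy (by simpa using congrArg im h)
  have hFTC : ∀ T : ℝ, ∫ x in (x₀ - T)..(x₀ + T), 1 / (((x - x₀ : ℝ) : ℂ) + y * I)
      = -(2 * Real.arctan (T / y) : ℝ) * I := by
    intro T
    have h1 := intervalIntegral.integral_comp_sub_right
      (fun u : ℝ => 1 / ((u : ℂ) + y * I)) x₀ (a := x₀ - T) (b := x₀ + T)
    rw [h1, integral_eq_sub_of_hasDerivAt (f := fun u : ℝ =>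
      ((Real.log (u ^ 2 + y ^ 2) / 2 : ℝ) : ℂ) - (Real.arctan (u / y) : ℝ) * I)]
    · have e : x₀ + T - x₀ = T := by ring
      have e' : x₀ - T - x₀ = -T := by ring
      rw [e, e', neg_div, Real.arctan_neg]
      push_cast
      simp only [neg_sq]
      ring
    · intro u _
      have hpos : 0 < u ^ 2 + y ^ 2 := by positivity
      have d1 : HasDerivAt (fun u : ℝ => Real.log (u ^ 2 + y ^ 2) / 2)
          ((2 * u) / (u ^ 2 + y ^ 2) / 2) u := by
        have d0 : HasDerivAt (fun u : ℝ => u ^ 2 + y ^ 2) (2 * u) u := by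
          simpa using (hasDerivAt_pow 2 u).add_const (y ^ 2)
        exact (d0.log hpos.ne').div_const 2
      have d2 : HasDerivAt (fun u : ℝ => Real.arctan (u / y)) (1 / (1 + (u / y) ^ 2) * (1 / y)) u :=
        ((hasDerivAt_id u).div_const y).arctan
      refine (d1.ofReal_comp.sub (d2.ofReal_comp.mul_const I)).congr_deriv ?_
      have h2 : (1 + (u / y) ^ 2) ≠ 0 := by positivity
      have h3 : (2 * u) / (u ^ 2 + y ^ 2) / 2 = u / (u ^ 2 + y ^ 2) := by field_simp
      have h4 : 1 / (1 + (u / y) ^ 2) * (1 / y) = y / (u ^ 2 + y ^ 2) := by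
        field_simp; ring
      rw [h3, h4, eq_div_iff (hne u)]
      have h5 : ((u : ℂ) ^ 2 + y ^ 2) ≠ 0 := by exact_mod_cast hpos.ne'
      push_cast
      field_simp
      ring_nf
      simp
    · refine Continuous.intervalIntegrable ?_ _ _
      exact continuous_const.div (by fun_prop) hne
  simp_rw [hFTC]
  rcases lt_or_gt_of_ne hy with h | h
  · rw [if_neg h.not_gt]
    have h1 : Tendsto (fun T : ℝ => T / y) atTop atBot :=
      tendsto_id.atTop_div_const_of_neg h
    have h2 := ((Real.tendsto_arctan_atBot.mono_right nhdsWithin_le_nhds).comp h1).const_mul 2 |>.neg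
    have h3 := ((continuous_ofReal.tendsto _).comp h2).mul_const I
    refine (h3.congr fun T => ?_).trans (le_of_eq ?_)
    · simp
    · congr 1; push_cast; ring
  · rw [if_pos h]
    have h1 : Tendsto (fun T : ℝ => T / y) atTop atTop := tendsto_id.atTop_div_const h
    have h2 := ((Real.tendsto_arctan_atTop.mono_right nhdsWithin_le_nhds).comp h1).const_mul 2 |>.neg
    have h3 := ((continuous_ofReal.tendsto _).comp h2).mul_const I
    refine (h3.congr fun T => ?_).trans (le_of_eq ?_)
    · simp
    · congr 1; push_cast; ring

/-- The Cauchy integral of `ℓ` along the horizontal line at height `h`, up to the factor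
`1 / (2 π i)`. -/
noncomputable def lineCauchy (ℓ : ℂ → ℂ) (h : ℝ) (γ : ℂ) : ℂ :=
  ∫ x : ℝ, ℓ (x + h * I) / (x + h * I - γ)

lemma le_norm_line_sub {γ : ℂ} {h e : ℝ} (he : 0 < e) (hγ : e ≤ |h - γ.im|) (x : ℝ) :
    e / (1 + e) * (1 + |x - γ.re|) ≤ ‖(x : ℂ) + h * I - γ‖ := by
  have h1 : |x - γ.re| ≤ ‖(x : ℂ) + h * I - γ‖ := by
    simpa using abs_re_le_norm ((x : ℂ) + h * I - γ)
  have h2 : e ≤ ‖(x : ℂ) + h * I - γ‖ := by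
    refine hγ.trans ?_
    simpa using abs_im_le_norm ((x : ℂ) + h * I - γ)
  rw [div_mul_eq_mul_div, div_le_iff₀ (by positivity)]
  nlinarith [abs_nonneg (x - γ.re)]

open MeasureTheory in
lemma integrable_one_add_abs_sub (x₀ : ℝ) {r : ℝ} (hr : 1 < r) :
    Integrable (fun x : ℝ => (1 + |x - x₀|) ^ (-r)) := by
  have := (integrable_one_add_norm (E := ℝ) (μ := volume) (r := r) (by simpa using hr)).comp_sub_right x₀
  simpa [Real.norm_eq_abs] using this

/-- The elementary inequality behind the decay of Cauchy integrals. -/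
lemma inv_mul_inv_le {A B S : ℝ} (hA : 0 < A) (hB : 0 < B) (hS : 0 < S) (h : S ≤ A + B) :
    A⁻¹ * B⁻¹ ≤ 2 * S ^ (-(1 / 2) : ℝ) * (A ^ (-(3 / 2) : ℝ) + B ^ (-(3 / 2) : ℝ)) := by
  have key : ∀ A B : ℝ, 0 < A → 0 < B → S ≤ A + B → A ≤ B →
      A⁻¹ * B⁻¹ ≤ 2 * S ^ (-(1 / 2) : ℝ) * A ^ (-(3 / 2) : ℝ) := by
    intro A B hA hB h hAB
    have h1 : S / 2 ≤ B := by linarith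
    have hAe : A⁻¹ = A ^ (-(3 / 2) : ℝ) * A ^ (1 / 2 : ℝ) := by
      rw [← Real.rpow_add hA, ← Real.rpow_neg_one]; norm_num
    have hBe : B⁻¹ = B ^ (-(1 / 2) : ℝ) * B ^ (-(1 / 2) : ℝ) := by
      rw [← Real.rpow_add hB, ← Real.rpow_neg_one]; norm_num
    have h2 : A ^ (1 / 2 : ℝ) * B ^ (-(1 / 2) : ℝ) ≤ 1 := by
      calc A ^ (1 / 2 : ℝ) * B ^ (-(1 / 2) : ℝ) ≤ B ^ (1 / 2 : ℝ) * B ^ (-(1 / 2) : ℝ) := by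
            gcongr
        _ = 1 := by rw [← Real.rpow_add hB]; norm_num
    have h3 : B ^ (-(1 / 2) : ℝ) ≤ 2 * S ^ (-(1 / 2) : ℝ) := by
      calc B ^ (-(1 / 2) : ℝ) ≤ (S / 2) ^ (-(1 / 2) : ℝ) :=
            Real.rpow_le_rpow_of_nonpos (by positivity) h1 (by norm_num)
        _ = S ^ (-(1 / 2) : ℝ) * 2 ^ (1 / 2 : ℝ) := by
            rw [Real.div_rpow hS.le (by norm_num), div_eq_mul_inv, ← Real.rpow_neg (by norm_num)]
            norm_num
        _ ≤ S ^ (-(1 / 2) : ℝ) * 2 ^ (1 : ℝ) := by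
            gcongr <;> norm_num
        _ = _ := by rw [Real.rpow_one]; ring
    calc A⁻¹ * B⁻¹ = (A ^ (1 / 2 : ℝ) * B ^ (-(1 / 2) : ℝ)) * (B ^ (-(1 / 2) : ℝ) *
          A ^ (-(3 / 2) : ℝ)) := by rw [hAe, hBe]; ring
      _ ≤ 1 * (2 * S ^ (-(1 / 2) : ℝ) * A ^ (-(3 / 2) : ℝ)) := by gcongr
      _ = _ := one_mul _
  rcases le_total A B with hAB | hAB
  · refine (key A B hA hB h hAB).trans ?_
    gcongr
    exact le_add_of_nonneg_right (by positivity)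
  · rw [mul_comm A⁻¹]
    refine (key B A hB hA (by linarith) hAB).trans ?_
    gcongr
    exact le_add_of_nonneg_left (by positivity)

section LineCauchy

variable {ℓ : ℂ → ℂ} {h C : ℝ}

open MeasureTheory

/-- The factors `1 + |t|` and `|t - γ|` in the denominator add up to at least `1 + |γ|`. This
allows trading half a power for decay in `γ` while integrable powers `-3/2` remain. -/
lemma norm_lineCauchy_integrand_le (hC : 0 ≤ C)
    (hb : ∀ x : ℝ, ‖ℓ (x + h * I)‖ ≤ C / (1 + ‖(x : ℂ) + h * I‖))
    {γ : ℂ} {e : ℝ} (he : 0 < e) (hγ : e ≤ |h - γ.im|) (x : ℝ) :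
    ‖ℓ (x + h * I) / (x + h * I - γ)‖ ≤ C * (2 * (1 + ‖γ‖) ^ (-(1 / 2) : ℝ) *
      ((1 + |x - 0|) ^ (-(3 / 2) : ℝ) +
        (e / (1 + e)) ^ (-(3 / 2) : ℝ) * (1 + |x - γ.re|) ^ (-(3 / 2) : ℝ))) := by
  have hB := le_norm_line_sub he hγ x
  have hB0 : 0 < ‖(x : ℂ) + h * I - γ‖ := lt_of_lt_of_le (by positivity) hB
  have hA0 : 0 < 1 + ‖(x : ℂ) + h * I‖ := by positivity
  have hsum : 1 + ‖γ‖ ≤ (1 + ‖(x : ℂ) + h * I‖) + ‖(x : ℂ) + h * I - γ‖ := by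
    have := norm_sub_le ((x : ℂ) + h * I) ((x : ℂ) + h * I - γ)
    simp only [sub_sub_cancel] at this
    linarith
  have hA : 1 + |x - 0| ≤ 1 + ‖(x : ℂ) + h * I‖ := by
    have : |x| ≤ ‖(x : ℂ) + h * I‖ := by simpa using abs_re_le_norm ((x : ℂ) + h * I)
    simpa using this
  rw [norm_div, div_eq_mul_inv]
  calc ‖ℓ (x + h * I)‖ * ‖(x : ℂ) + h * I - γ‖⁻¹
      ≤ C / (1 + ‖(x : ℂ) + h * I‖) * ‖(x : ℂ) + h * I - γ‖⁻¹ := by gcongr; exact hb x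
    _ = C * ((1 + ‖(x : ℂ) + h * I‖)⁻¹ * ‖(x : ℂ) + h * I - γ‖⁻¹) := by ring
    _ ≤ C * (2 * (1 + ‖γ‖) ^ (-(1 / 2) : ℝ) * ((1 + ‖(x : ℂ) + h * I‖) ^ (-(3 / 2) : ℝ) +
          ‖(x : ℂ) + h * I - γ‖ ^ (-(3 / 2) : ℝ))) := by
        exact mul_le_mul_of_nonneg_left (inv_mul_inv_le hA0 hB0 (by positivity) hsum) hC
    _ ≤ _ := by
        rw [← Real.mul_rpow (by positivity) (by positivity)]
        have h1 := Real.rpow_le_rpow_of_nonpos (by positivity) hA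
          (show (-(3 / 2) : ℝ) ≤ 0 by norm_num)
        have h2 := Real.rpow_le_rpow_of_nonpos (by positivity) hB
          (show (-(3 / 2) : ℝ) ≤ 0 by norm_num)
        gcongr

lemma integrable_lineCauchy_bound (γ : ℂ) (c : ℝ) :
    Integrable (fun x : ℝ => (1 + |x - 0|) ^ (-(3 / 2) : ℝ) +
        c * (1 + |x - γ.re|) ^ (-(3 / 2) : ℝ)) :=
  (integrable_one_add_abs_sub 0 (by norm_num)).add
    ((integrable_one_add_abs_sub _ (by norm_num)).const_mul _)

lemma integrable_lineCauchy (hC : 0 ≤ C) (hc : Continuous fun x : ℝ => ℓ (x + h * I))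
    (hb : ∀ x : ℝ, ‖ℓ (x + h * I)‖ ≤ C / (1 + ‖(x : ℂ) + h * I‖)) {γ : ℂ} (hγ : γ.im ≠ h) :
    Integrable (fun x : ℝ => ℓ (x + h * I) / (x + h * I - γ)) := by
  have he : 0 < |h - γ.im| := abs_pos.mpr (sub_ne_zero.mpr hγ.symm)
  refine Integrable.mono' (((integrable_lineCauchy_bound γ _).const_mul _).const_mul C) ?_
    (ae_of_all _ (norm_lineCauchy_integrand_le hC hb he le_rfl))
  refine Continuous.aestronglyMeasurable (hc.div (by fun_prop) fun x hx => hγ ?_)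
  have := congrArg im hx
  simp at this; linarith

/-- Decay of the Cauchy integral of a function of size `1 / |t|`, away from the line. -/
lemma exists_norm_lineCauchy_le (hC : 0 ≤ C)
    (hb : ∀ x : ℝ, ‖ℓ (x + h * I)‖ ≤ C / (1 + ‖(x : ℂ) + h * I‖)) {e : ℝ} (he : 0 < e) :
    ∃ A : ℝ, 0 ≤ A ∧ ∀ γ : ℂ, e ≤ |h - γ.im| →
      ‖lineCauchy ℓ h γ‖ ≤ A * (1 + ‖γ‖) ^ (-(1 / 2) : ℝ) := by
  set J : ℝ := ∫ x : ℝ, (1 + |x|) ^ (-(3 / 2) : ℝ) with hJ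
  have hJ0 : 0 ≤ J := integral_nonneg fun x => by positivity
  refine ⟨C * (2 * (J + (e / (1 + e)) ^ (-(3 / 2) : ℝ) * J)), by positivity, fun γ hγ => ?_⟩
  have h1 := norm_integral_le_of_norm_le
    (((integrable_lineCauchy_bound γ ((e / (1 + e)) ^ (-(3 / 2) : ℝ))).const_mul _).const_mul C)
    (ae_of_all volume (norm_lineCauchy_integrand_le hC hb he hγ))
  refine h1.trans (le_of_eq ?_)
  rw [integral_const_mul, integral_const_mul, integral_add
    (integrable_one_add_abs_sub 0 (by norm_num))
    ((integrable_one_add_abs_sub _ (by norm_num)).const_mul _), integral_const_mul,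
    integral_sub_right_eq_self (fun x : ℝ => (1 + |x|) ^ (-(3 / 2) : ℝ)) (0 : ℝ),
    integral_sub_right_eq_self (fun x : ℝ => (1 + |x|) ^ (-(3 / 2) : ℝ)) γ.re]
  ring

/-- The Cauchy integral is holomorphic off the line, by differentiation under the integral sign.
-/
lemma differentiableAt_lineCauchy (hC : 0 ≤ C) (hc : Continuous fun x : ℝ => ℓ (x + h * I))
    (hb : ∀ x : ℝ, ‖ℓ (x + h * I)‖ ≤ C / (1 + ‖(x : ℂ) + h * I‖)) {γ : ℂ} (hγ : γ.im ≠ h) :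
    DifferentiableAt ℂ (lineCauchy ℓ h) γ := by
  set e : ℝ := |h - γ.im| with hedef
  have he : 0 < e := abs_pos.mpr (sub_ne_zero.mpr hγ.symm)
  have hfar : ∀ w ∈ Metric.ball γ (e / 2), ∀ x : ℝ,
      e / (1 + e) * (1 + |x - γ.re|) / 2 ≤ ‖(x : ℂ) + h * I - w‖ := by
    intro w hw x
    have h1 := le_norm_line_sub he le_rfl x (γ := γ) (h := h)
    have h2 : e ≤ ‖(x : ℂ) + h * I - γ‖ := by
      simpa [hedef] using abs_im_le_norm ((x : ℂ) + h * I - γ)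
    have h3 : ‖w - γ‖ < e / 2 := by simpa [dist_eq_norm] using hw
    have h4 := norm_add_le ((x : ℂ) + h * I - w) (w - γ)
    rw [sub_add_sub_cancel] at h4
    linarith
  have hbound : ∀ x : ℝ, ‖ℓ (x + h * I)‖ ≤ C := fun x =>
    (hb x).trans (div_le_self hC (by linarith [norm_nonneg ((x : ℂ) + h * I)]))
  have hne : ∀ w ∈ Metric.ball γ (e / 2), ∀ x : ℝ, (x : ℂ) + h * I - w ≠ 0 := fun w hw x =>
    norm_pos_iff.mp (lt_of_lt_of_le (by positivity) (hfar w hw x))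
  refine (hasDerivAt_integral_of_dominated_loc_of_deriv_le (μ := volume)
    (F := fun w (x : ℝ) => ℓ (x + h * I) / (x + h * I - w))
    (F' := fun w (x : ℝ) => ℓ (x + h * I) / (x + h * I - w) ^ 2)
    (bound := fun x => C * (e / (1 + e) / 2) ^ (-2 : ℝ) * (1 + |x - γ.re|) ^ (-2 : ℝ))
    (Metric.ball_mem_nhds γ (half_pos he)) ?_ ?_ ?_ ?_ ?_ ?_).2.differentiableAt
  · filter_upwards [Metric.ball_mem_nhds γ (half_pos he)] with w hw
    exact (hc.div (by fun_prop) (hne w hw)).aestronglyMeasurable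
  · exact integrable_lineCauchy hC hc hb hγ
  · exact (hc.div (by fun_prop) fun x => pow_ne_zero 2
      (hne γ (Metric.mem_ball_self (half_pos he)) x)).aestronglyMeasurable
  · refine ae_of_all _ fun x w hw => ?_
    have h1 := hfar w hw x
    have h1' : e / (1 + e) / 2 * (1 + |x - γ.re|) ≤ ‖(x : ℂ) + h * I - w‖ := by
      refine le_trans (le_of_eq ?_) h1; ring
    rw [norm_div, norm_pow, div_eq_mul_inv, mul_assoc,
      ← Real.mul_rpow (by positivity) (by positivity), Real.rpow_neg (by positivity)]
    gcongr
    · exact hbound x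
    · exact_mod_cast pow_le_pow_left₀ (by positivity) h1' 2
  · exact (integrable_one_add_abs_sub _ (by norm_num)).const_mul _
  · refine ae_of_all _ fun x w hw => ?_
    have hd : HasDerivAt (fun w : ℂ => (x : ℂ) + h * I - w) (-1) w := by
      simpa using (hasDerivAt_id w).const_sub ((x : ℂ) + h * I)
    refine ((hasDerivAt_const w (ℓ (x + h * I))).div hd (hne w hw x)).congr_deriv ?_
    simp

end LineCauchy

/-! ### Additive decomposition in a strip -/

/-- Cauchy's integral formula in a horizontal strip. -/
lemma strip_cauchy {ℓ : ℂ → ℂ} {h C : ℝ} (hh : 0 < h) (hC : 0 ≤ C) {U : Set ℂ} (hU : IsOpen U)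
    (hUs : ∀ z : ℂ, |z.im| ≤ h → z ∈ U) (hd : DifferentiableOn ℂ ℓ U)
    (hb : ∀ z : ℂ, |z.im| ≤ h → ‖ℓ z‖ ≤ C / (1 + ‖z‖)) {γ : ℂ} (hγ : |γ.im| < h) :
    lineCauchy ℓ (-h) γ - lineCauchy ℓ h γ = 2 * Real.pi * I * ℓ γ := by
  have hγU : γ ∈ U := hUs γ hγ.le
  have hcont : ∀ y : ℝ, |y| ≤ h → Continuous fun x : ℝ => ℓ (x + y * I) := by
    intro y hy
    refine hd.continuousOn.comp_continuous (by fun_prop) fun x => hUs _ (by simpa using hy)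
  have hbl : ∀ y : ℝ, |y| ≤ h → ∀ x : ℝ, ‖ℓ (x + y * I)‖ ≤ C / (1 + ‖(x : ℂ) + y * I‖) :=
    fun y hy x => hb _ (by simpa using hy)
  set g := dslope ℓ γ with hg
  have hgd : DifferentiableOn ℂ g U := (differentiableOn_dslope (hU.mem_nhds hγU)).mpr hd
  have hgne : ∀ z, z ≠ γ → g z = ℓ z / (z - γ) - ℓ γ * (1 / (z - γ)) := by
    intro z hz
    rw [hg, dslope_of_ne _ hz, slope_def_field]
    ring
  -- horizontal sides
  have hor : ∀ y : ℝ, |y| = h → Tendsto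
      (fun T : ℝ => ∫ x in (γ.re - T)..(γ.re + T), g (x + y * I)) atTop
      (𝓝 (lineCauchy ℓ y γ - ℓ γ *
        (if 0 < y - γ.im then -(Real.pi * I) else Real.pi * I))) := by
    intro y hy
    have hyγ : γ.im ≠ y := fun hc => by rw [hc, hy] at hγ; exact lt_irrefl _ hγ
    have hne : ∀ x : ℝ, (x : ℂ) + y * I - γ ≠ 0 := fun x hx => hyγ (by
      have := congrArg im hx; simp at this; linarith)
    have hint := integrable_lineCauchy hC (hcont y hy.le) (hbl y hy.le) hyγ
    have t1 : Tendsto (fun T : ℝ => ∫ x in (γ.re - T)..(γ.re + T),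
        ℓ (x + y * I) / (x + y * I - γ)) atTop (𝓝 (lineCauchy ℓ y γ)) :=
      MeasureTheory.intervalIntegral_tendsto_integral hint
        (tendsto_atBot_add_const_left _ γ.re tendsto_neg_atTop_atBot)
        (tendsto_atTop_add_const_left _ γ.re tendsto_id)
    have t2 := tendsto_integral_inv_add_mul_I (sub_ne_zero.mpr hyγ.symm) γ.re
    refine (t1.sub (t2.const_mul (ℓ γ))).congr fun T => ?_
    rw [← intervalIntegral.integral_const_mul, ← intervalIntegral.integral_sub]
    · refine intervalIntegral.integral_congr fun x _ => ?_
      rw [hgne _ (sub_ne_zero.mp (hne x))]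
      have e : (((x - γ.re : ℝ) : ℂ) + ((y - γ.im : ℝ) : ℂ) * I) = (x : ℂ) + y * I - γ := by
        apply Complex.ext <;> simp
      rw [e]
    · exact hint.intervalIntegrable
    · refine Continuous.intervalIntegrable ?_ _ _
      refine continuous_const.mul (continuous_const.div (by fun_prop) fun x hx => hne x ?_)
      rw [← hx]; apply Complex.ext <;> simp
  -- vertical sides
  have ver : ∀ σ : ℝ, |σ| = 1 → Tendsto
      (fun T : ℝ => ∫ y in (-h)..h, g (((γ.re + σ * T : ℝ) : ℂ) + y * I)) atTop (𝓝 0) := by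
    intro σ hσ
    have hlim : Tendsto (fun T : ℝ => (C + ‖ℓ γ‖) / T * |h - -h|) atTop (𝓝 (0 * |h - -h|)) :=
      (tendsto_const_nhds.div_atTop tendsto_id).mul_const _
    rw [zero_mul] at hlim
    refine squeeze_zero_norm' ?_ hlim
    filter_upwards [eventually_gt_atTop 0] with T hT
    refine intervalIntegral.norm_integral_le_of_norm_le_const fun y hy => ?_
    have hy' : |y| ≤ h := by
      rw [Set.uIoc_of_le (by linarith)] at hy
      exact abs_le.mpr ⟨hy.1.le, hy.2⟩
    set z : ℂ := ((γ.re + σ * T : ℝ) : ℂ) + y * I with hz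
    have hTz : T ≤ ‖z - γ‖ := by
      have := abs_re_le_norm (z - γ)
      have e : (z - γ).re = σ * T := by simp [hz]
      rwa [e, abs_mul, hσ, one_mul, abs_of_pos hT] at this
    have hzγ : z ≠ γ := fun hc => by rw [hc] at hTz; simp at hTz; linarith
    have hℓz : ‖ℓ z‖ ≤ C := (hb z (by simpa [hz] using hy')).trans
      (div_le_self hC (by linarith [norm_nonneg z]))
    rw [hg, dslope_of_ne _ hzγ, slope_def_field, norm_div]
    exact div_le_div₀ (by positivity) ((norm_sub_le _ _).trans (by linarith)) hT hTz
  have rect : ∀ T : ℝ, 0 < T →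
      (∫ x in (γ.re - T)..(γ.re + T), g (x + (-h : ℝ) * I)) -
        (∫ x in (γ.re - T)..(γ.re + T), g (x + (h : ℝ) * I)) +
        I • (∫ y in (-h)..h, g (((γ.re + 1 * T : ℝ) : ℂ) + y * I)) -
        I • (∫ y in (-h)..h, g (((γ.re + (-1) * T : ℝ) : ℂ) + y * I)) = 0 := by
    intro T hT
    have := Complex.integral_boundary_rect_eq_zero_of_differentiableOn g
      (((γ.re - T : ℝ) : ℂ) + (-h : ℝ) * I) (((γ.re + T : ℝ) : ℂ) + (h : ℝ) * I)
      (hgd.mono fun z hz => hUs z ?_)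
    · simpa [sub_eq_add_neg] using this
    · have h2 := hz.2
      simp only [Set.mem_preimage, add_im, ofReal_im, mul_im, ofReal_re, I_im, mul_one, I_re,
        mul_zero, add_zero, zero_add] at h2
      rw [Set.uIcc_of_le (by linarith)] at h2
      exact abs_le.mpr h2
  have hneg := hor (-h) (by rw [abs_neg, abs_of_pos hh])
  have hpos := hor h (abs_of_pos hh)
  have lim := ((hneg.sub hpos).add ((ver 1 (by simp)).const_smul I)).sub
    ((ver (-1) (by simp)).const_smul I)
  have h0 := tendsto_nhds_unique (lim.congr' (by
    filter_upwards [eventually_gt_atTop 0] with T hT using rect T hT)) tendsto_const_nhds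
  rw [if_neg (by linarith [(abs_lt.mp hγ).1]), if_pos (by linarith [(abs_lt.mp hγ).2])] at h0
  simp only [smul_zero, add_zero, sub_zero] at h0
  linear_combination h0

/-- If `a` is holomorphic below and `b` above, both of sublinear growth, and `a + b` decays like
`1 / |γ|` in the common strip, then `a` and `b` converge at infinity: up to a constant they
are the Cauchy integrals of `a + b`. -/
lemma exists_const_of_add_small {a b : ℂ → ℂ} {C C' : ℝ}
    (ha : DifferentiableOn ℂ a {z | z.im < 1}) (hb : DifferentiableOn ℂ b {z | -1 < z.im})
    (hga : ∀ z : ℂ, z.im < 1 → ‖a z‖ ≤ C * (1 + ‖z‖) ^ (3 / 4 : ℝ))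
    (hgb : ∀ z : ℂ, -1 < z.im → ‖b z‖ ≤ C * (1 + ‖z‖) ^ (3 / 4 : ℝ))
    (hab : ∀ z : ℂ, |z.im| ≤ 1 / 2 → ‖a z + b z‖ ≤ C' / (1 + ‖z‖)) :
    ∃ c : ℂ, ∃ A : ℝ, (∀ z : ℂ, z.im ≤ 0 → ‖a z - c‖ ≤ A * (1 + ‖z‖) ^ (-(1 / 2) : ℝ)) ∧
      ∀ z : ℂ, 0 ≤ z.im → ‖b z + c‖ ≤ A * (1 + ‖z‖) ^ (-(1 / 2) : ℝ) := by
  have hC' : 0 ≤ C' := by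
    have := (norm_nonneg _).trans (hab 0 (by simp))
    simpa using this
  set ℓ : ℂ → ℂ := fun z => a z + b z with hℓ
  set U : Set ℂ := {z | z.im < 1} ∩ {z | -1 < z.im} with hU
  have hUo : IsOpen U := (isOpen_lt continuous_im continuous_const).inter
    (isOpen_lt continuous_const continuous_im)
  have hℓd : DifferentiableOn ℂ ℓ U :=
    (ha.mono Set.inter_subset_left).add (hb.mono Set.inter_subset_right)
  have hUs : ∀ z : ℂ, |z.im| ≤ 1 / 2 → z ∈ U := fun z hz => by
    have := abs_le.mp hz
    constructor
    · simp only [Set.mem_ofPred_eq]; linarith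
    · simp only [Set.mem_ofPred_eq]; linarith
  have hcont : ∀ y : ℝ, |y| ≤ 1 / 2 → Continuous fun x : ℝ => ℓ (x + y * I) := fun y hy =>
    hℓd.continuousOn.comp_continuous (by fun_prop) fun x => hUs _ (by simpa using hy)
  have hbl : ∀ y : ℝ, |y| ≤ 1 / 2 → ∀ x : ℝ, ‖ℓ (x + y * I)‖ ≤ C' / (1 + ‖(x : ℂ) + y * I‖) :=
    fun y hy x => hab _ (by simpa using hy)
  have hpos : |(1 / 2 : ℝ)| ≤ 1 / 2 := by norm_num
  have hneg : |(-(1 / 2) : ℝ)| ≤ 1 / 2 := by rw [abs_neg]; norm_num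
  obtain ⟨A₁, hA₁, hb₁⟩ := exists_norm_lineCauchy_le hC' (hbl _ hpos) (e := 1 / 2) (by norm_num)
  obtain ⟨A₂, hA₂, hb₂⟩ := exists_norm_lineCauchy_le hC' (hbl _ hneg) (e := 1 / 2) (by norm_num)
  set k : ℂ := (2 * Real.pi * I)⁻¹ with hk
  have hk0 : (2 * Real.pi * I : ℂ) ≠ 0 := by simp [Real.pi_ne_zero]
  -- `a` and `-b`, corrected by the two Cauchy integrals, agree on the strip by the integral
  -- formula and so glue to an entire function `W`
  set Wd : ℂ → ℂ := fun z => a z + k * lineCauchy ℓ (1 / 2) z with hWd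
  set Wu : ℂ → ℂ := fun z => k * lineCauchy ℓ (-(1 / 2)) z - b z with hWu
  have heq : ∀ z : ℂ, |z.im| < 1 / 2 → Wd z = Wu z := by
    intro z hz
    have h1 := strip_cauchy (by norm_num) hC' hUo hUs hℓd hab hz
    have h2 : k * (lineCauchy ℓ (-(1 / 2)) z - lineCauchy ℓ (1 / 2) z) = ℓ z := by
      rw [h1, hk]; field_simp
    simp only [hWd, hWu]
    simp only [hℓ] at h2 ⊢
    linear_combination -h2
  set W : ℂ → ℂ := fun z => if z.im < 1 / 2 then Wd z else Wu z with hW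
  have hWlow : ∀ z : ℂ, z.im < 1 / 2 → W z = Wd z := fun z hz => if_pos hz
  have hWup : ∀ z : ℂ, -(1 / 2) < z.im → W z = Wu z := by
    intro z hz
    by_cases h : z.im < 1 / 2
    · rw [hWlow z h]; exact heq z (abs_lt.mpr ⟨hz, h⟩)
    · exact if_neg h
  have hWdiff : Differentiable ℂ W := by
    intro z
    by_cases h : z.im < 1 / 2
    · have hev : W =ᶠ[𝓝 z] Wd := by
        filter_upwards [(isOpen_lt continuous_im continuous_const).mem_nhds h] with w hw
        exact hWlow w hw
      refine DifferentiableAt.congr_of_eventuallyEq ?_ hev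
      refine DifferentiableAt.add (ha.differentiableAt
        ((isOpen_lt continuous_im continuous_const).mem_nhds
          (by simp only [Set.mem_ofPred_eq]; linarith))) ?_
      exact (differentiableAt_lineCauchy hC' (hcont _ hpos) (hbl _ hpos) h.ne).const_mul _
    · have h' : -(1 / 2) < z.im := by push Not at h; linarith
      have hev : W =ᶠ[𝓝 z] Wu := by
        filter_upwards [(isOpen_lt continuous_const continuous_im).mem_nhds h'] with w hw
        exact hWup w hw
      refine DifferentiableAt.congr_of_eventuallyEq ?_ hev
      refine DifferentiableAt.sub ?_ (hb.differentiableAt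
        ((isOpen_lt continuous_const continuous_im).mem_nhds
          (by simp only [Set.mem_ofPred_eq]; linarith)))
      exact (differentiableAt_lineCauchy hC' (hcont _ hneg) (hbl _ hneg) h'.ne').const_mul _
  have hone : ∀ z : ℂ, (1 + ‖z‖) ^ (-(1 / 2) : ℝ) ≤ (1 + ‖z‖) ^ (3 / 4 : ℝ) := fun z =>
    Real.rpow_le_rpow_of_exponent_le (by linarith [norm_nonneg z]) (by norm_num)
  have hfar₁ : ∀ z : ℂ, z.im ≤ 0 → ‖k * lineCauchy ℓ (1 / 2) z‖ ≤
      ‖k‖ * (A₁ + A₂) * (1 + ‖z‖) ^ (-(1 / 2) : ℝ) := by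
    intro z hz
    rw [norm_mul, mul_assoc]
    gcongr
    refine (hb₁ z ?_).trans (by gcongr; linarith)
    rw [abs_of_nonneg] <;> linarith
  have hfar₂ : ∀ z : ℂ, 0 ≤ z.im → ‖k * lineCauchy ℓ (-(1 / 2)) z‖ ≤
      ‖k‖ * (A₁ + A₂) * (1 + ‖z‖) ^ (-(1 / 2) : ℝ) := by
    intro z hz
    rw [norm_mul, mul_assoc]
    gcongr
    refine (hb₂ z ?_).trans (by gcongr; linarith)
    rw [abs_of_nonpos] <;> linarith
  -- `W` has sublinear growth and is therefore constant
  have hgrow : ∀ z, ‖W z‖ ≤ (C + ‖k‖ * (A₁ + A₂)) * (1 + ‖z‖) ^ (3 / 4 : ℝ) := by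
    intro z
    have hk' : ‖k‖ * (A₁ + A₂) * (1 + ‖z‖) ^ (-(1 / 2) : ℝ) ≤
        ‖k‖ * (A₁ + A₂) * (1 + ‖z‖) ^ (3 / 4 : ℝ) := by gcongr ?_ * ?_; exact hone z
    rcases le_total z.im 0 with hz | hz
    · rw [hWlow z (by linarith), add_mul]
      exact (norm_add_le _ _).trans (add_le_add (hga z (by linarith)) ((hfar₁ z hz).trans hk'))
    · rw [hWup z (by linarith), add_mul, add_comm]
      exact (norm_sub_le _ _).trans (add_le_add ((hfar₂ z hz).trans hk') (hgb z (by linarith)))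
  have hconst := eq_const_of_sublinear hWdiff _ hgrow
  refine ⟨W 0, ‖k‖ * (A₁ + A₂), fun z hz => ?_, fun z hz => ?_⟩
  · have h1 := hconst z 0
    rw [hWlow z (by linarith)] at h1
    rw [← h1, ← norm_neg]
    simpa [hWd] using hfar₁ z hz
  · have h1 := hconst z 0
    rw [hWup z (by linarith)] at h1
    rw [← h1]
    simpa [hWu] using hfar₂ z hz

/-! ### Wiener-Hopf asymptotics -/

/-- A function whose exponential behaves like `c z ^ n` at the right end of a strip behaves there
like `n log z` up to a constant. -/
lemma exists_log_asymptotic {g : ℂ → ℂ} {c : ℂ} (hc : c ≠ 0) {n : ℤ} {T M : ℝ}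
    (hg : ContinuousOn g {z | |z.im| < 1})
    (h : ∀ z : ℂ, |z.im| < 1 → T ≤ z.re → ‖exp (g z) / (c * z ^ n) - 1‖ ≤ M / ‖z‖) :
    ∃ d : ℂ, exp d = c ∧ ∃ T' : ℝ, 0 < T' ∧ ∃ M' : ℝ, ∀ z : ℂ, |z.im| < 1 → T' < z.re →
      ‖g z - n * log z - d‖ ≤ M' / ‖z‖ := by
  -- beyond `T'` the relative error is at most `1 / 2`, so its principal logarithm is defined
  set T' : ℝ := max (max T 1) (2 * M) with hT'
  have hT1 : 1 ≤ T' := (le_max_right _ _).trans (le_max_left _ _)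
  have hTT : T ≤ T' := (le_max_left _ _).trans (le_max_left _ _)
  have hTM : 2 * M ≤ T' := le_max_right _ _
  set S : Set ℂ := {z | |z.im| < 1 ∧ T' < z.re} with hS
  have hScv : Convex ℝ S := by
    have h1 : Convex ℝ {z : ℂ | z.im < 1} := convex_halfSpace_im_lt 1
    have h2 : Convex ℝ {z : ℂ | -1 < z.im} := convex_halfSpace_im_gt (-1)
    have h3 : Convex ℝ {z : ℂ | T' < z.re} := convex_halfSpace_re_gt T'
    have : S = {z : ℂ | -1 < z.im} ∩ {z : ℂ | z.im < 1} ∩ {z : ℂ | T' < z.re} := by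
      ext z; simp [hS, abs_lt]
    rw [this]
    exact (h2.inter h1).inter h3
  set ε : ℂ → ℂ := fun z => exp (g z) / (c * z ^ n) - 1 with hε
  have hzre : ∀ z ∈ S, T' < ‖z‖ := fun z hz => hz.2.trans_le (re_le_norm z)
  have hz0 : ∀ z ∈ S, z ≠ 0 := fun z hz => norm_pos_iff.mp (by linarith [hzre z hz])
  have hεle : ∀ z ∈ S, ‖ε z‖ ≤ M / ‖z‖ := fun z hz => h z hz.1 (hTT.trans hz.2.le)
  have hεhalf : ∀ z ∈ S, ‖ε z‖ ≤ 1 / 2 := by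
    intro z hz
    refine (hεle z hz).trans ?_
    rw [div_le_iff₀ (by linarith [hzre z hz])]
    linarith [hzre z hz]
  have hslit : ∀ z ∈ S, 1 + ε z ∈ slitPlane := fun z hz =>
    mem_slitPlane_of_norm_lt_one (by linarith [hεhalf z hz])
  set f : ℂ → ℂ := fun z => g z - n * log z - log (1 + ε z) with hf
  have hgS : ContinuousOn g S := hg.mono fun z hz => hz.1
  have hfc : ContinuousOn f S := by
    refine (hgS.sub (continuousOn_const.mul (continuousOn_id.clog fun z hz => Or.inl ?_))).sub
      (ContinuousOn.clog ?_ hslit)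
    · exact lt_trans (by linarith) hz.2
    · refine continuousOn_const.add (((continuous_exp.comp_continuousOn hgS).div
        (continuousOn_const.mul ?_) ?_).sub continuousOn_const)
      · exact continuousOn_id.zpow₀ n fun z hz => Or.inl (hz0 z hz)
      · exact fun z hz => mul_ne_zero hc (zpow_ne_zero n (hz0 z hz))
  have hfexp : ∀ z ∈ S, exp (f z) = c := by
    intro z hz
    have hz' := hz0 z hz
    have h1 : exp (n * log z) = z ^ n := by rw [exp_int_mul, exp_log hz']
    simp only [hf]
    rw [exp_sub, exp_sub, h1, exp_log (slitPlane_ne_zero (hslit z hz))]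
    simp only [hε]
    have := zpow_ne_zero n hz'
    have := exp_ne_zero (g z)
    field_simp
    ring_nf
  -- a continuous function with constant exponential on a convex set is constant
  have hconst : ∀ z ∈ S, ∀ w ∈ S, f z = f w := by
    intro z hz w hw
    have hpre : IsPreconnected S := hScv.isPreconnected
    set φ : ℂ → ℝ := fun x => (f x - f w).im / (2 * Real.pi) with hφ
    have hφc : ContinuousOn φ S :=
      (continuous_im.comp_continuousOn (hfc.sub continuousOn_const)).div_const _
    have hint : ∀ x ∈ S, ∃ k : ℤ, f x - f w = k * (2 * Real.pi * I) := by
      intro x hx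
      have : exp (f x - f w) = 1 := by rw [exp_sub, hfexp x hx, hfexp w hw, div_self hc]
      exact exp_eq_one_iff.mp this
    have hφint : ∀ x ∈ S, ∀ k : ℤ, f x - f w = k * (2 * Real.pi * I) → φ x = k := by
      intro x hx k hk
      simp only [hφ, hk]
      have : (2 * Real.pi : ℝ) ≠ 0 := by positivity
      field_simp
      simp
      ring
    obtain ⟨k, hk⟩ := hint z hz
    have hk0 : k = 0 := by
      by_contra hne
      have him := hpre.image φ hφc
      have hz1 : (k : ℝ) ∈ φ '' S := ⟨z, hz, hφint z hz k hk⟩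
      have hw1 : (0 : ℝ) ∈ φ '' S := ⟨w, hw, by simp [hφ]⟩
      have hnot : ∀ t : ℝ, t ∈ φ '' S → ∃ j : ℤ, t = j := by
        rintro t ⟨x, hx, rfl⟩
        obtain ⟨j, hj⟩ := hint x hx
        exact ⟨j, hφint x hx j hj⟩
      rcases lt_or_gt_of_ne hne with hlt | hgt
      · have hk1 : (k : ℝ) ≤ -1 := by exact_mod_cast Int.le_sub_one_of_lt hlt
        obtain ⟨j, hj⟩ := hnot (-(1 / 2)) (him.ordConnected.out hz1 hw1 ⟨by linarith, by norm_num⟩)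
        have h2 : (2 * j : ℝ) = -1 := by linarith
        have h3 : 2 * j = -1 := by exact_mod_cast h2
        omega
      · have hk1 : (1 : ℝ) ≤ k := by exact_mod_cast hgt
        obtain ⟨j, hj⟩ := hnot (1 / 2) (him.ordConnected.out hw1 hz1 ⟨by norm_num, by linarith⟩)
        have h2 : (2 * j : ℝ) = 1 := by linarith
        have h3 : 2 * j = 1 := by exact_mod_cast h2
        omega
    rw [hk0] at hk
    simpa [sub_eq_zero] using hk
  set w₀ : ℂ := ((T' + 1 : ℝ) : ℂ) with hw₀
  have hw₀S : w₀ ∈ S := ⟨by simp [hw₀], by simp [hw₀]⟩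
  refine ⟨f w₀, hfexp w₀ hw₀S, T', by linarith, 3 / 2 * M, fun z hz1 hz2 => ?_⟩
  have hz : z ∈ S := ⟨hz1, hz2⟩
  rw [← hconst z hz w₀ hw₀S]
  simp only [hf]
  rw [show g z - n * log z - (g z - n * log z - log (1 + ε z)) = log (1 + ε z) by ring]
  refine (norm_log_one_add_half_le_self (hεhalf z hz)).trans ?_
  rw [mul_div_assoc]
  gcongr
  exact hεle z hz

lemma norm_log_le_rpow {w : ℂ} (hw : 1 ≤ ‖w‖) : ‖log w‖ ≤ 8 * ‖w‖ ^ (3 / 4 : ℝ) := by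
  have h1 : ‖log w‖ ≤ |Real.log ‖w‖| + |w.arg| := by
    have := norm_le_abs_re_add_abs_im (log w)
    rwa [log_re, log_im] at this
  have h2 : |Real.log ‖w‖| ≤ ‖w‖ ^ (3 / 4 : ℝ) / (3 / 4) := by
    rw [abs_of_nonneg (Real.log_nonneg hw)]
    exact Real.log_le_rpow_div (norm_nonneg w) (by norm_num)
  have h3 := abs_arg_le_pi w
  have h4 := Real.pi_lt_four
  have h5 : 1 ≤ ‖w‖ ^ (3 / 4 : ℝ) := Real.one_le_rpow hw (by norm_num)
  linarith

/-- Wiener-Hopf decomposition: if `exp a` is holomorphic below, `exp b` above, both with logarithms of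
sublinear growth, and the product is asymptotic to powers at both ends of the common strip,
then `a` and `b` are logarithmic at infinity up to a null term. -/
lemma wienerHopf_asymptotic {a b : ℂ → ℂ} {C : ℝ}
    (ha : DifferentiableOn ℂ a {z | z.im < 1}) (hb : DifferentiableOn ℂ b {z | -1 < z.im})
    (hga : ∀ z : ℂ, z.im < 1 → ‖a z‖ ≤ C * (1 + ‖z‖) ^ (3 / 4 : ℝ))
    (hgb : ∀ z : ℂ, -1 < z.im → ‖b z‖ ≤ C * (1 + ‖z‖) ^ (3 / 4 : ℝ))
    {n : ℤ} {c₁ c₂ : ℂ} (hc₁ : c₁ ≠ 0) (hc₂ : c₂ ≠ 0) {T M : ℝ}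
    (h₁ : ∀ z : ℂ, |z.im| < 1 → T ≤ z.re → ‖exp (a z + b z) / (c₁ * z ^ n) - 1‖ ≤ M / ‖z‖)
    (h₂ : ∀ z : ℂ, |z.im| < 1 → z.re ≤ -T → ‖exp (a z + b z) / (c₂ * z ^ n) - 1‖ ≤ M / ‖z‖) :
    ∃ α β c c' : ℂ, ∃ A : ℝ,
      (∀ z : ℂ, z.im ≤ 0 → ‖a z - α * log (2 + I * z) - c‖ ≤ A * (1 + ‖z‖) ^ (-(1 / 2) : ℝ)) ∧
      (∀ z : ℂ, 0 ≤ z.im → ‖b z - β * log (2 - I * z) - c'‖ ≤ A * (1 + ‖z‖) ^ (-(1 / 2) : ℝ)) := by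
  set g : ℂ → ℂ := fun z => a z + b z with hg
  have hgc : ContinuousOn g {z | |z.im| < 1} := by
    have i1 : ContinuousOn a {z | |z.im| < 1} :=
      ha.continuousOn.mono fun z hz => (abs_lt.mp (show |z.im| < 1 from hz)).2
    have i2 : ContinuousOn b {z | |z.im| < 1} :=
      hb.continuousOn.mono fun z hz => (abs_lt.mp (show |z.im| < 1 from hz)).1
    exact i1.add i2
  have hslit₁ : ∀ z : ℂ, z.im < 1 → 2 + I * z ∈ slitPlane := fun z hz =>
    Or.inl (by simp; linarith)
  have hslit₂ : ∀ z : ℂ, -1 < z.im → 2 - I * z ∈ slitPlane := fun z hz =>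
    Or.inl (by simp; linarith)
  obtain ⟨d₁, -, T₁, hT₁, M₁, hd₁⟩ := exists_log_asymptotic hc₁ hgc h₁
  obtain ⟨d₂, -, T₂, hT₂, M₂, hd₂⟩ := exists_log_asymptotic (g := fun z => g (-z))
    (c := c₂ * (-1) ^ n) (n := n) (T := T) (M := M) (mul_ne_zero hc₂ (zpow_ne_zero _ (by norm_num)))
    (hgc.comp continuous_neg.continuousOn fun z hz => by simpa using hz)
    (fun z hz hz' => by
      have := h₂ (-z) (by simpa using hz) (by simpa using hz')
      rw [neg_eq_neg_one_mul z, mul_zpow, ← mul_assoc] at this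
      simpa using this)
  have hlin : ∀ κ : ℂ, κ ≠ 0 → ‖κ‖ = 1 → ∀ z : ℂ, 1 ≤ z.re →
      ‖(2 + κ * z) / (κ * z ^ (1 : ℤ)) - 1‖ ≤ 2 / ‖z‖ := by
    intro κ hκ hκ1 z hz
    have hz0 : z ≠ 0 := fun h => by rw [h] at hz; simp at hz; linarith
    rw [zpow_one, add_div, div_self (mul_ne_zero hκ hz0), add_sub_cancel_right, norm_div, norm_mul,
      hκ1]
    simp
  obtain ⟨e₁, he₁, R₁, hR₁, N₁, hl₁⟩ := exists_log_asymptotic (g := fun z => log (2 + I * z))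
    (c := I) (n := 1) (T := 1) (M := 2) I_ne_zero
    (ContinuousOn.clog (by fun_prop) fun z hz => hslit₁ z (abs_lt.mp hz).2)
    (fun z hz hz' => by
      rw [exp_log (slitPlane_ne_zero (hslit₁ z (abs_lt.mp hz).2))]
      exact hlin I I_ne_zero (by simp) z hz')
  obtain ⟨e₂, he₂, R₂, hR₂, N₂, hl₂⟩ := exists_log_asymptotic (g := fun z => log (2 - I * z))
    (c := -I) (n := 1) (T := 1) (M := 2) (neg_ne_zero.mpr I_ne_zero)
    (ContinuousOn.clog (by fun_prop) fun z hz => hslit₂ z (abs_lt.mp hz).1)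
    (fun z hz hz' => by
      rw [exp_log (slitPlane_ne_zero (hslit₂ z (abs_lt.mp hz).1))]
      simpa [sub_eq_add_neg] using hlin (-I) (neg_ne_zero.mpr I_ne_zero) (by simp) z hz')
  -- at the right end `log (2 ± i z) = log z + e` with `exp e = ± i`, so that the two constants
  -- differ
  have hne : e₁ - e₂ ≠ 0 := fun h => by
    rw [sub_eq_zero] at h
    rw [h, he₂] at he₁
    have := congrArg im he₁
    norm_num at this
  -- the exponents and the constant are fixed by the behaviour at the two ends
  set δ : ℂ := (d₁ - d₂) / (e₁ - e₂) with hδ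
  set α : ℂ := (n + δ) / 2 with hα
  set β : ℂ := (n - δ) / 2 with hβ
  set c : ℂ := (d₁ + d₂ - n * (e₁ + e₂)) / 2 with hc
  have hδ' : δ * (e₁ - e₂) = d₁ - d₂ := by rw [hδ]; field_simp
  -- what is left after subtraction of the logarithms is small at both ends of the strip
  set a' : ℂ → ℂ := fun z => a z - α * log (2 + I * z) - c with ha'
  set b' : ℂ → ℂ := fun z => b z - β * log (2 - I * z) with hb'
  have ha'd : DifferentiableOn ℂ a' {z | z.im < 1} :=
    (ha.sub ((DifferentiableOn.clog (by fun_prop) hslit₁).const_mul _)).sub_const _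
  have hb'd : DifferentiableOn ℂ b' {z | -1 < z.im} :=
    hb.sub ((DifferentiableOn.clog (by fun_prop) hslit₂).const_mul _)
  have hlog : ∀ κ : ℂ, ‖κ‖ = 1 → ∀ z : ℂ, 1 ≤ (2 + κ * z).re →
      ‖log (2 + κ * z)‖ ≤ 16 * (1 + ‖z‖) ^ (3 / 4 : ℝ) := by
    intro κ hκ z hz
    refine (norm_log_le_rpow (hz.trans (re_le_norm _))).trans ?_
    have h1 : ‖2 + κ * z‖ ≤ 2 * (1 + ‖z‖) := by
      refine (norm_add_le _ _).trans ?_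
      rw [norm_mul, hκ]
      simp
      linarith [norm_nonneg z]
    have h2 : (2 : ℝ) ^ (3 / 4 : ℝ) ≤ 2 := by
      conv_rhs => rw [← Real.rpow_one 2]
      exact Real.rpow_le_rpow_of_exponent_le (by norm_num) (by norm_num)
    calc 8 * ‖2 + κ * z‖ ^ (3 / 4 : ℝ) ≤ 8 * (2 * (1 + ‖z‖)) ^ (3 / 4 : ℝ) := by gcongr
      _ = 8 * (2 : ℝ) ^ (3 / 4 : ℝ) * (1 + ‖z‖) ^ (3 / 4 : ℝ) := by
          rw [Real.mul_rpow (by norm_num) (by positivity)]; ring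
      _ ≤ 8 * 2 * (1 + ‖z‖) ^ (3 / 4 : ℝ) := by gcongr
      _ = _ := by ring
  have hone : ∀ z : ℂ, (1 : ℝ) ≤ (1 + ‖z‖) ^ (3 / 4 : ℝ) := fun z =>
    Real.one_le_rpow (by linarith [norm_nonneg z]) (by norm_num)
  set D : ℝ := C + ‖α‖ * 16 + ‖β‖ * 16 + ‖c‖ with hD
  have hC0 : 0 ≤ C := by simpa using (norm_nonneg _).trans (hga 0 (by simp))
  have ha'g : ∀ z : ℂ, z.im < 1 → ‖a' z‖ ≤ D * (1 + ‖z‖) ^ (3 / 4 : ℝ) := by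
    intro z hz
    have h1 := hlog I (by simp) z (by simp; linarith)
    calc ‖a' z‖ ≤ ‖a z‖ + ‖α‖ * ‖log (2 + I * z)‖ + ‖c‖ := by
          refine (norm_sub_le _ _).trans (add_le_add_left ((norm_sub_le _ _).trans ?_) _)
          rw [norm_mul]
      _ ≤ C * (1 + ‖z‖) ^ (3 / 4 : ℝ) + ‖α‖ * (16 * (1 + ‖z‖) ^ (3 / 4 : ℝ)) +
          ‖c‖ * (1 + ‖z‖) ^ (3 / 4 : ℝ) := by
          gcongr
          · exact hga z hz
          · exact le_mul_of_one_le_right (norm_nonneg _) (hone z)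
      _ ≤ D * (1 + ‖z‖) ^ (3 / 4 : ℝ) := by
          rw [hD]
          nlinarith [mul_nonneg (norm_nonneg β) (zero_le_one.trans (hone z))]
  have hb'g : ∀ z : ℂ, -1 < z.im → ‖b' z‖ ≤ D * (1 + ‖z‖) ^ (3 / 4 : ℝ) := by
    intro z hz
    have h1 := hlog (-I) (by simp) z (by simp; linarith)
    rw [neg_mul, ← sub_eq_add_neg] at h1
    calc ‖b' z‖ ≤ ‖b z‖ + ‖β‖ * ‖log (2 - I * z)‖ := by
          refine (norm_sub_le _ _).trans ?_
          rw [norm_mul]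
      _ ≤ C * (1 + ‖z‖) ^ (3 / 4 : ℝ) + ‖β‖ * (16 * (1 + ‖z‖) ^ (3 / 4 : ℝ)) := by
          gcongr
          exact hgb z hz
      _ ≤ D * (1 + ‖z‖) ^ (3 / 4 : ℝ) := by
          rw [hD]
          nlinarith [mul_nonneg (norm_nonneg α) (zero_le_one.trans (hone z)),
            mul_nonneg (norm_nonneg c) (zero_le_one.trans (hone z))]
  -- decay of the sum in the strip
  set T₀ : ℝ := max (max T₁ T₂) (max R₁ R₂) + 1 with hT₀
  have hT₀1 : T₁ < T₀ := by
    have : T₁ ≤ max (max T₁ T₂) (max R₁ R₂) := (le_max_left _ _).trans (le_max_left _ _)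
    linarith
  have hT₀2 : T₂ < T₀ := by
    have : T₂ ≤ max (max T₁ T₂) (max R₁ R₂) := (le_max_right _ _).trans (le_max_left _ _)
    linarith
  have hT₀3 : R₁ < T₀ := by
    have : R₁ ≤ max (max T₁ T₂) (max R₁ R₂) := (le_max_left _ _).trans (le_max_right _ _)
    linarith
  have hT₀4 : R₂ < T₀ := by
    have : R₂ ≤ max (max T₁ T₂) (max R₁ R₂) := (le_max_right _ _).trans (le_max_right _ _)
    linarith
  set B : ℝ := |M₁| + |M₂| + (‖α‖ + ‖β‖) * (|N₁| + |N₂|) with hB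
  have hright : ∀ z : ℂ, |z.im| < 1 → T₀ ≤ z.re → ‖a' z + b' z‖ ≤ B / ‖z‖ := by
    intro z hz hzr
    have hzp : 0 < ‖z‖ := lt_of_lt_of_le (by linarith) (re_le_norm z)
    have i1 := hd₁ z hz (by linarith)
    have i2 := hl₁ z hz (by linarith)
    have i3 := hl₂ z hz (by linarith)
    have e : a' z + b' z = (g z - n * log z - d₁) - α * (log (2 + I * z) - (1 : ℤ) * log z - e₁)
        - β * (log (2 - I * z) - (1 : ℤ) * log z - e₂) := by
      simp only [ha', hb', hg, hα, hβ, hc]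
      push_cast
      linear_combination (-1 / 2 : ℂ) * hδ'
    rw [e]
    calc _ ≤ M₁ / ‖z‖ + ‖α‖ * (N₁ / ‖z‖) + ‖β‖ * (N₂ / ‖z‖) := by
          refine (norm_sub_le _ _).trans (add_le_add ((norm_sub_le _ _).trans (add_le_add i1 ?_)) ?_)
          · rw [norm_mul]; gcongr
          · rw [norm_mul]; gcongr
      _ = (M₁ + ‖α‖ * N₁ + ‖β‖ * N₂) / ‖z‖ := by ring
      _ ≤ B / ‖z‖ := by
          gcongr
          rw [hB]
          have := le_abs_self M₁
          have := abs_nonneg M₂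
          nlinarith [le_abs_self N₁, le_abs_self N₂, norm_nonneg α, norm_nonneg β,
            abs_nonneg N₁, abs_nonneg N₂, mul_nonneg (norm_nonneg α) (abs_nonneg N₂),
            mul_nonneg (norm_nonneg β) (abs_nonneg N₁),
            mul_le_mul_of_nonneg_left (le_abs_self N₁) (norm_nonneg α),
            mul_le_mul_of_nonneg_left (le_abs_self N₂) (norm_nonneg β)]
  have hleft : ∀ z : ℂ, |z.im| < 1 → z.re ≤ -T₀ → ‖a' z + b' z‖ ≤ B / ‖z‖ := by
    intro z hz hzr
    set w : ℂ := -z with hw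
    have hzw : z = -w := by rw [hw, neg_neg]
    have hwi : |w.im| < 1 := by simpa [hw] using hz
    have hwr : T₀ ≤ w.re := by simp only [hw, neg_re]; linarith
    have hzp : 0 < ‖w‖ := lt_of_lt_of_le (by linarith) (re_le_norm w)
    have i1 := hd₂ w hwi (by linarith)
    have i2 := hl₁ w hwi (by linarith)
    have i3 := hl₂ w hwi (by linarith)
    have e : a' z + b' z = (g (-w) - n * log w - d₂) -
        α * (log (2 - I * w) - (1 : ℤ) * log w - e₂)
        - β * (log (2 + I * w) - (1 : ℤ) * log w - e₁) := by
      simp only [ha', hb', hg, hα, hβ, hc, hzw]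
      rw [show 2 + I * -w = 2 - I * w by ring, show 2 - I * -w = 2 + I * w by ring]
      push_cast
      linear_combination (1 / 2 : ℂ) * hδ'
    rw [e, show ‖z‖ = ‖w‖ by rw [hw, norm_neg]]
    calc _ ≤ M₂ / ‖w‖ + ‖α‖ * (N₂ / ‖w‖) + ‖β‖ * (N₁ / ‖w‖) := by
          refine (norm_sub_le _ _).trans (add_le_add ((norm_sub_le _ _).trans (add_le_add i1 ?_)) ?_)
          · rw [norm_mul]; gcongr
          · rw [norm_mul]; gcongr
      _ = (M₂ + ‖α‖ * N₂ + ‖β‖ * N₁) / ‖w‖ := by ring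
      _ ≤ B / ‖w‖ := by
          gcongr
          rw [hB]
          have := le_abs_self M₂
          have := abs_nonneg M₁
          nlinarith [le_abs_self N₁, le_abs_self N₂, norm_nonneg α, norm_nonneg β,
            abs_nonneg N₁, abs_nonneg N₂, mul_nonneg (norm_nonneg α) (abs_nonneg N₁),
            mul_nonneg (norm_nonneg β) (abs_nonneg N₂),
            mul_le_mul_of_nonneg_left (le_abs_self N₂) (norm_nonneg α),
            mul_le_mul_of_nonneg_left (le_abs_self N₁) (norm_nonneg β)]
  have hB0 : 0 ≤ B := by positivity
  obtain ⟨C₁, hC₁⟩ : ∃ C₁ : ℝ, ∀ z : ℂ, |z.im| ≤ 1 / 2 → |z.re| ≤ T₀ → ‖a' z + b' z‖ ≤ C₁ := by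
    have hK : IsCompact (Set.Icc (-T₀) T₀ ×ℂ Set.Icc (-(1 / 2) : ℝ) (1 / 2)) :=
      isCompact_Icc.reProdIm isCompact_Icc
    obtain ⟨C₁, hC₁⟩ := hK.exists_bound_of_continuousOn (f := fun z => a' z + b' z)
      ((ha'd.continuousOn.mono fun z hz => by
          have := hz.2.2; simp only [Set.mem_ofPred_eq]; linarith).add
        (hb'd.continuousOn.mono fun z hz => by
          have := hz.2.1; simp only [Set.mem_ofPred_eq]; linarith))
    exact ⟨C₁, fun z hz hz' => hC₁ z ⟨abs_le.mp hz', abs_le.mp hz⟩⟩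
  have hdecay : ∀ z : ℂ, |z.im| ≤ 1 / 2 →
      ‖a' z + b' z‖ ≤ (2 * B + |C₁| * (2 + T₀)) / (1 + ‖z‖) := by
    intro z hz
    rw [le_div_iff₀ (by positivity)]
    have hT₀p : 1 ≤ T₀ := by
      have : 0 ≤ max (max T₁ T₂) (max R₁ R₂) := hT₁.le.trans ((le_max_left _ _).trans (le_max_left _ _))
      linarith
    rcases le_or_gt |z.re| T₀ with hr | hr
    · have h1 := hC₁ z hz hr
      have h2 : ‖z‖ ≤ T₀ + 1 := (norm_le_abs_re_add_abs_im z).trans (by linarith)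
      have h3 : ‖a' z + b' z‖ ≤ |C₁| := h1.trans (le_abs_self _)
      nlinarith [norm_nonneg z, abs_nonneg C₁, norm_nonneg (a' z + b' z)]
    · have h1 : T₀ ≤ ‖z‖ := hr.le.trans (abs_re_le_norm z)
      have hzp : 0 < ‖z‖ := by linarith
      have h2 : ‖a' z + b' z‖ ≤ B / ‖z‖ := by
        rcases le_abs.mp hr.le with h | h
        · exact hright z (by linarith) h
        · exact hleft z (by linarith) (by linarith)
      rw [le_div_iff₀ hzp] at h2
      have h3 : ‖a' z + b' z‖ ≤ ‖a' z + b' z‖ * ‖z‖ :=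
        le_mul_of_one_le_right (norm_nonneg _) (by linarith)
      have : 0 ≤ |C₁| * (2 + T₀) := by positivity
      nlinarith
  obtain ⟨c₀, A, hA₁, hA₂⟩ := exists_const_of_add_small ha'd hb'd ha'g hb'g hdecay
  refine ⟨α, β, c₀ + c, -c₀, A, fun z hz => ?_, fun z hz => ?_⟩
  · have := hA₁ z hz
    simp only [ha'] at this
    rwa [sub_sub, add_comm c c₀] at this
  · simpa [hb', sub_neg_eq_add] using hA₂ z hz

/-- Exponentials of functions that are logarithmic up to a null term have algebraic growth. -/
lemma tendsto_exp_div_cpow {a : ℂ → ℂ} {κ α c : ℂ} (hκ : ‖κ‖ = 1) {A : ℝ} {S : Set ℂ}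
    (hS : ∀ z ∈ S, 0 ≤ (κ * z).re)
    (h : ∀ z ∈ S, ‖a z - α * log (2 + κ * z) - c‖ ≤ A * (1 + ‖z‖) ^ (-(1 / 2) : ℝ)) :
    Tendsto (fun z => exp (a z) / (κ * z) ^ α) (Bornology.cobounded ℂ ⊓ 𝓟 S) (𝓝 (exp c)) := by
  set l := Bornology.cobounded ℂ ⊓ 𝓟 S
  have hnorm : Tendsto (fun z : ℂ => ‖z‖) l atTop := tendsto_norm_cobounded_atTop.mono_left inf_le_left
  have hmem : ∀ᶠ z in l, z ∈ S := mem_inf_of_right (mem_principal_self S)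
  have t1 : Tendsto (fun z => a z - α * log (2 + κ * z) - c) l (𝓝 0) := by
    have h1 : Tendsto (fun z : ℂ => A * (1 + ‖z‖) ^ (-(1 / 2) : ℝ)) l (𝓝 (A * 0)) :=
      ((tendsto_rpow_neg_atTop (by norm_num : (0 : ℝ) < 1 / 2)).comp
        (tendsto_atTop_add_const_left _ 1 hnorm)).const_mul A
    rw [mul_zero] at h1
    exact squeeze_zero_norm' (hmem.mono fun z hz => h z hz) h1
  have t2 : Tendsto (fun z : ℂ => log (1 + 2 / (κ * z))) l (𝓝 0) := by
    have h1 : Tendsto (fun z : ℂ => 2 / (κ * z)) l (𝓝 0) := by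
      rw [tendsto_zero_iff_norm_tendsto_zero]
      have : (fun z : ℂ => ‖2 / (κ * z)‖) = fun z => 2 / ‖z‖ := by
        ext z; rw [norm_div, norm_mul, hκ]; simp
      rw [this]
      exact tendsto_const_nhds.div_atTop hnorm
    have h2 : Tendsto (fun z : ℂ => 1 + 2 / (κ * z)) l (𝓝 1) := by
      simpa using h1.const_add 1
    have h3 := (continuousAt_clog (Or.inl (by simp) : (1 : ℂ) ∈ slitPlane)).tendsto.comp h2
    simpa [Function.comp_def] using h3
  have t3 : Tendsto (fun z => exp ((a z - α * log (2 + κ * z) - c) +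
      α * log (1 + 2 / (κ * z)) + c)) l (𝓝 (exp (0 + α * 0 + c))) :=
    (continuous_exp.tendsto _).comp ((t1.add (t2.const_mul α)).add_const c)
  simp only [mul_zero, zero_add] at t3
  refine t3.congr' ?_
  filter_upwards [hmem, hnorm.eventually_gt_atTop 0] with z hz hz0
  have hw0 : κ * z ≠ 0 := norm_pos_iff.mp (by rw [norm_mul, hκ, one_mul]; exact hz0)
  set w := κ * z with hw
  have hre : 0 ≤ w.re := hS z hz
  have hre1 : 0 < (1 + 2 / w).re := by
    have : 0 ≤ (2 / w).re := by
      rw [div_re]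
      simp only [re_ofNat, im_ofNat, zero_mul, zero_div, add_zero]
      exact div_nonneg (mul_nonneg zero_le_two hre) (normSq_nonneg w)
    simp only [add_re, one_re]
    linarith
  have hne1 : 1 + 2 / w ≠ 0 := fun h => by rw [h] at hre1; simp at hre1
  have hlog : log (2 + w) = log w + log (1 + 2 / w) := by
    rw [← Complex.log_mul hw0 hne1]
    · congr 1; field_simp; ring
    · have i1 := abs_le.mp (abs_arg_le_pi_div_two_iff.mpr hre)
      have i2 := abs_lt.mp (abs_arg_lt_pi_div_two_iff.mpr (Or.inl hre1))
      constructor <;> linarith [i1.1, i1.2, i2.1, i2.2]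
  rw [cpow_def_of_ne_zero hw0, ← exp_sub, hlog]
  congr 1
  ring

/-! ### Sequences along arithmetic progressions and their products -/

/-- The sequence `u` has no zero term and follows the arithmetic progression `a m` up to an
error of order `√m`. -/
structure Follows (a : ℂ) (u : ℕ → ℂ) : Prop where
  ne_zero : ∀ m, u m ≠ 0
  close : ∃ C : ℝ, ∀ m, ‖u m - a * m‖ ≤ C * √(m + 1)

namespace Follows

variable {a : ℂ} {u v : ℕ → ℂ}

lemma neg (h : Follows a u) : Follows (-a) (fun m => -u m) := by
  refine ⟨fun m => neg_ne_zero.mpr (h.ne_zero m), ?_⟩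
  obtain ⟨C, hC⟩ := h.close
  exact ⟨C, fun m => by rw [neg_mul, neg_sub_neg, norm_sub_rev]; exact hC m⟩

lemma exists_close (h : Follows a u) : ∃ C : ℝ, 0 < C ∧ ∀ m, ‖u m - a * m‖ ≤ C * √(m + 1) := by
  obtain ⟨C, hC⟩ := h.close
  exact ⟨|C| + 1, by positivity, fun m => (hC m).trans
    (mul_le_mul_of_nonneg_right (by linarith [le_abs_self C]) (Real.sqrt_nonneg _))⟩

lemma sqrt_isLittle (K ε : ℝ) (hε : 0 < ε) : ∃ N : ℕ, ∀ m ≥ N, K * √((m : ℝ) + 1) ≤ ε * (m + 1) := by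
  obtain ⟨N, hN⟩ := exists_nat_ge ((|K| / ε) ^ 2)
  refine ⟨N, fun m hm => ?_⟩
  have h1 : (|K| / ε) ^ 2 ≤ (m : ℝ) + 1 := by
    have : (N : ℝ) ≤ m := by exact_mod_cast hm
    linarith
  have h2 : |K| / ε ≤ √((m : ℝ) + 1) := Real.le_sqrt_of_sq_le h1
  have h3 : |K| ≤ ε * √((m : ℝ) + 1) := by rw [div_le_iff₀ hε] at h2; linarith
  have h4 : √((m : ℝ) + 1) * √((m : ℝ) + 1) = m + 1 := Real.mul_self_sqrt (by positivity)
  calc K * √((m : ℝ) + 1) ≤ |K| * √((m : ℝ) + 1) := by gcongr; exact le_abs_self K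
    _ ≤ (ε * √((m : ℝ) + 1)) * √((m : ℝ) + 1) := by gcongr
    _ = ε * (m + 1) := by rw [mul_assoc, h4]

lemma exists_upper (h : Follows a u) : ∃ C : ℝ, 0 < C ∧ ∀ m : ℕ, ‖u m‖ ≤ C * (m + 1) := by
  obtain ⟨C, hC, hu⟩ := h.exists_close
  refine ⟨‖a‖ + C, by positivity, fun m => ?_⟩
  have h1 : √((m : ℝ) + 1) ≤ m + 1 := by
    rw [Real.sqrt_le_left (by positivity)]
    nlinarith [(Nat.cast_nonneg m : (0 : ℝ) ≤ m)]
  calc ‖u m‖ ≤ ‖a * m‖ + ‖u m - a * m‖ := by simpa using norm_add_le (a * (m : ℂ)) (u m - a * m)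
    _ ≤ ‖a‖ * m + C * (m + 1) := by
        rw [norm_mul]
        gcongr
        · simp
        · exact (hu m).trans (by gcongr)
    _ ≤ (‖a‖ + C) * (m + 1) := by nlinarith [norm_nonneg a]

lemma exists_lower (h : Follows a u) (ha : a ≠ 0) :
    ∃ c : ℝ, 0 < c ∧ ∀ m : ℕ, c * (m + 1) ≤ ‖u m‖ := by
  obtain ⟨C, hC, hu⟩ := h.exists_close
  have ha' : 0 < ‖a‖ := norm_pos_iff.mpr ha
  obtain ⟨N, hN⟩ := sqrt_isLittle C (‖a‖ / 4) (by positivity)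
  have hlarge : ∀ m ≥ N + 1, ‖a‖ / 4 * (m + 1) ≤ ‖u m‖ := by
    intro m hm
    have h1 := hN m (by omega)
    have h2 : (1 : ℝ) ≤ m := by exact_mod_cast (by omega : 1 ≤ m)
    have h3 : ‖a * m‖ ≤ ‖u m‖ + ‖u m - a * m‖ := by
      have := norm_sub_le (u m) (u m - a * m)
      simpa using this
    have h4 : ‖a * (m : ℂ)‖ = ‖a‖ * m := by simp
    have h5 := hu m
    rw [h4] at h3
    nlinarith
  have hfin : ∀ n : ℕ, ∃ c : ℝ, 0 < c ∧ ∀ m < n, c * ((m : ℝ) + 1) ≤ ‖u m‖ := by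
    intro n
    induction n with
    | zero => exact ⟨1, one_pos, fun m hm => absurd hm (by omega)⟩
    | succ n ih =>
      obtain ⟨c, hc, hcm⟩ := ih
      have hn : 0 < ‖u n‖ := norm_pos_iff.mpr (h.ne_zero n)
      refine ⟨min c (‖u n‖ / (n + 1)), lt_min hc (by positivity), fun m hm => ?_⟩
      rcases Nat.lt_succ_iff_lt_or_eq.mp hm with hlt | rfl
      · exact (mul_le_mul_of_nonneg_right (min_le_left _ _) (by positivity)).trans (hcm m hlt)
      · refine (mul_le_mul_of_nonneg_right (min_le_right _ _) (by positivity)).trans (le_of_eq ?_)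
        field_simp
  obtain ⟨c, hc, hcm⟩ := hfin (N + 1)
  refine ⟨min c (‖a‖ / 4), lt_min hc (by positivity), fun m => ?_⟩
  by_cases hm : m < N + 1
  · exact (mul_le_mul_of_nonneg_right (min_le_left _ _) (by positivity)).trans (hcm m hm)
  · exact (mul_le_mul_of_nonneg_right (min_le_right _ _) (by positivity)).trans
      (hlarge m (by omega))

/-- Two sequences with the same direction stay within `O(√m)` of each other. -/
lemma exists_sub (hu : Follows a u) (hv : Follows a v) :
    ∃ C : ℝ, 0 < C ∧ ∀ m : ℕ, ‖u m - v m‖ ≤ C * √(m + 1) := by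
  obtain ⟨C, hC, h1⟩ := hu.exists_close
  obtain ⟨C', hC', h2⟩ := hv.exists_close
  refine ⟨C + C', by positivity, fun m => ?_⟩
  have h3 := h2 m
  rw [norm_sub_rev] at h3
  calc ‖u m - v m‖ ≤ ‖u m - a * m‖ + ‖a * m - v m‖ := norm_sub_le_norm_sub_add_norm_sub _ _ _
    _ ≤ _ := by rw [add_mul]; exact add_le_add (h1 m) h3

end Follows

/-- Infinite products with factors uniformly close to `1`, through the sum of the logarithms. -/
lemma tendsto_prod_exp_tsum {g : ℕ → ℂ → ℂ} {U : Set ℂ} {b : ℕ → ℝ} (hU : IsOpen U)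
    (hg : ∀ m, DifferentiableOn ℂ (g m) U) (h2 : ∀ m, ∀ z ∈ U, ‖g m z - 1‖ ≤ 1 / 2)
    (hb : ∀ m, ∀ z ∈ U, ‖g m z - 1‖ ≤ b m) (hs : Summable b) :
    DifferentiableOn ℂ (fun z => ∑' m, log (g m z)) U ∧
      (∀ z ∈ U, ‖∑' m, log (g m z)‖ ≤ 3 / 2 * ∑' m, b m) ∧
      ∀ z ∈ U, Tendsto (fun M => ∏ m ∈ Finset.range M, g m z) atTop
        (𝓝 (exp (∑' m, log (g m z)))) := by
  have hlog : ∀ m, ∀ z ∈ U, ‖log (g m z)‖ ≤ 3 / 2 * b m := by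
    intro m z hz
    have := norm_log_one_add_half_le_self (h2 m z hz)
    rw [add_sub_cancel] at this
    exact this.trans (by gcongr; exact hb m z hz)
  have hslit : ∀ m, ∀ z ∈ U, g m z ∈ slitPlane := by
    intro m z hz
    have := mem_slitPlane_of_norm_lt_one (lt_of_le_of_lt (h2 m z hz) (by norm_num))
    rwa [add_sub_cancel] at this
  have hs' : Summable fun m => 3 / 2 * b m := hs.mul_left _
  refine ⟨differentiableOn_tsum_of_summable_norm hs' (fun m => (hg m).clog (hslit m)) hU hlog,
    fun z hz => ?_, fun z hz => ?_⟩
  · rw [← tsum_mul_left]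
    exact tsum_of_norm_bounded hs'.hasSum fun m => hlog m z hz
  · have hsum : Summable fun m => log (g m z) := Summable.of_norm_bounded hs' fun m => hlog m z hz
    refine ((continuous_exp.tendsto _).comp hsum.hasSum.tendsto_sum_nat).congr fun M => ?_
    simp only [Function.comp_apply]
    rw [exp_sum]
    exact Finset.prod_congr rfl fun m _ => exp_log (slitPlane_ne_zero (hslit m z hz))

lemma tendsto_prod_shift {g : ℕ → ℂ} {N : ℕ} {l : ℂ}
    (h : Tendsto (fun M => ∏ m ∈ Finset.range M, g (N + m)) atTop (𝓝 l)) :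
    Tendsto (fun M => ∏ m ∈ Finset.range M, g m) atTop
      (𝓝 ((∏ m ∈ Finset.range N, g m) * l)) := by
  rw [← tendsto_add_atTop_iff_nat N]
  refine (h.const_mul _).congr fun M => ?_
  rw [add_comm M N, Finset.prod_range_add]

lemma summable_shift_rpow (K : ℝ) (N : ℕ) {r : ℝ} (hr : 1 < r) :
    Summable fun m : ℕ => K * (((N + m : ℕ) : ℝ) + 1) ^ (-r) := by
  have h1 : Summable fun n : ℕ => (n : ℝ) ^ (-r) := Real.summable_nat_rpow.mpr (by linarith)
  have h2 := ((summable_nat_add_iff (N + 1)).mpr h1).mul_left K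
  refine h2.congr fun m => ?_
  push_cast
  congr 2
  ring

/-- The functions `g m` are holomorphic for large `m` and `1 + O(m ^ (-3/2))` on every disc. -/
def NearOne (g : ℕ → ℂ → ℂ) : Prop :=
  ∀ ρ : ℝ, ∃ N : ℕ, ∃ K : ℝ, ∀ m ≥ N, DifferentiableOn ℂ (g m) (Metric.ball 0 ρ) ∧
    ∀ z ∈ Metric.ball (0 : ℂ) ρ, ‖g m z - 1‖ ≤ K * ((m : ℝ) + 1) ^ (-(3 / 2) : ℝ)

/-- On each disc the infinite product is a finite product times an exponential, and the remaining
factors have no zeros there. -/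
lemma NearOne.exists_local {g : ℕ → ℂ → ℂ} (hg : NearOne g) (ρ : ℝ) :
    ∃ N : ℕ, ∃ L : ℂ → ℂ, DifferentiableOn ℂ L (Metric.ball 0 ρ) ∧
      (∀ m ≥ N, ∀ z ∈ Metric.ball (0 : ℂ) ρ, g m z ≠ 0) ∧
      ∀ z ∈ Metric.ball (0 : ℂ) ρ, Tendsto (fun M => ∏ m ∈ Finset.range M, g m z) atTop
        (𝓝 ((∏ m ∈ Finset.range N, g m z) * exp (L z))) := by
  obtain ⟨N₀, K, h⟩ := hg ρ
  have hlim : Tendsto (fun m : ℕ => K * ((m : ℝ) + 1) ^ (-(3 / 2) : ℝ)) atTop (𝓝 (K * 0)) :=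
    ((tendsto_rpow_neg_atTop (by norm_num : (0 : ℝ) < 3 / 2)).comp
      (tendsto_atTop_add_const_right _ 1 tendsto_natCast_atTop_atTop)).const_mul K
  rw [mul_zero] at hlim
  obtain ⟨N₁, hN₁⟩ := eventually_atTop.mp (hlim.eventually_le_const (by norm_num : (0 : ℝ) < 1 / 2))
  set N := max N₀ N₁
  have hN₀ : ∀ m, N₀ ≤ N + m := fun m => (le_max_left _ _).trans (Nat.le_add_right _ _)
  have hN₁' : ∀ m, N₁ ≤ N + m := fun m => (le_max_right _ _).trans (Nat.le_add_right _ _)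
  obtain ⟨hd, -, ht⟩ := tendsto_prod_exp_tsum (g := fun m => g (N + m))
    (b := fun m => K * (((N + m : ℕ) : ℝ) + 1) ^ (-(3 / 2) : ℝ)) Metric.isOpen_ball
    (fun m => (h _ (hN₀ m)).1)
    (fun m z hz => ((h _ (hN₀ m)).2 z hz).trans (hN₁ _ (hN₁' m)))
    (fun m z hz => (h _ (hN₀ m)).2 z hz) (summable_shift_rpow K N (by norm_num))
  refine ⟨N, _, hd, fun m hm z hz hzero => ?_, fun z hz => tendsto_prod_shift (ht z hz)⟩
  have h1 := ((h m ((le_max_left _ _).trans hm)).2 z hz).trans (hN₁ m ((le_max_right _ _).trans hm))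
  rw [hzero, zero_sub, norm_neg, norm_one] at h1
  norm_num at h1

lemma NearOne.mul {g k : ℕ → ℂ → ℂ} (hg : NearOne g) (hk : NearOne k) :
    NearOne fun m z => g m z * k m z := by
  intro ρ
  obtain ⟨N, K, h⟩ := hg ρ
  obtain ⟨N', K', h'⟩ := hk ρ
  refine ⟨max N N', |K| + |K'| + |K| * |K'|, fun m hm => ?_⟩
  obtain ⟨h1, h2⟩ := h m ((le_max_left _ _).trans hm)
  obtain ⟨h1', h2'⟩ := h' m ((le_max_right _ _).trans hm)
  refine ⟨h1.mul h1', fun z hz => ?_⟩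
  set t : ℝ := ((m : ℝ) + 1) ^ (-(3 / 2) : ℝ)
  have ht0 : 0 ≤ t := by positivity
  have ht1 : t ≤ 1 := Real.rpow_le_one_of_one_le_of_nonpos
    (by linarith [m.cast_nonneg (α := ℝ)]) (by norm_num)
  have i1 : ‖g m z - 1‖ ≤ |K| * t := (h2 z hz).trans (by gcongr; exact le_abs_self K)
  have i2 : ‖k m z - 1‖ ≤ |K'| * t := (h2' z hz).trans (by gcongr; exact le_abs_self K')
  have e : g m z * k m z - 1 = (g m z - 1) + (k m z - 1) + (g m z - 1) * (k m z - 1) := by ring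
  rw [e]
  refine (norm_add₃_le).trans ?_
  rw [norm_mul]
  calc ‖g m z - 1‖ + ‖k m z - 1‖ + ‖g m z - 1‖ * ‖k m z - 1‖
      ≤ |K| * t + |K'| * t + |K| * t * (|K'| * t) := by gcongr
    _ = |K| * t + |K'| * t + |K| * |K'| * t * t := by ring
    _ ≤ |K| * t + |K'| * t + |K| * |K'| * t * 1 := by gcongr
    _ = _ := by ring

lemma sqrt_div_sq_eq {x : ℝ} (hx : 0 < x) : √x / x ^ 2 = x ^ (-(3 / 2) : ℝ) := by
  rw [Real.sqrt_eq_rpow, ← Real.rpow_natCast x 2, ← Real.rpow_sub hx]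
  norm_num

section Pair

variable {a : ℂ} {u v : ℕ → ℂ}

/-- The factor `(1 - z / u) / (1 - z / v)`. -/
noncomputable def pairFactor (u v : ℕ → ℂ) (m : ℕ) (z : ℂ) : ℂ := (1 - z / u m) / (1 - z / v m)

lemma one_sub_div_ne_zero {z w : ℂ} (hw : w ≠ 0) (h : z ≠ w) : 1 - z / w ≠ 0 := by
  rw [sub_ne_zero]
  intro hc
  exact h ((div_eq_one_iff_eq hw).mp hc.symm)

/-- The numerator `u m - v m` is only `O(√m)`, which makes products of such factors converge. -/
lemma pairFactor_sub_one {m : ℕ} {z : ℂ} (hu : u m ≠ 0) (hv : v m ≠ 0) (hz : z ≠ v m) :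
    pairFactor u v m z - 1 = z * (u m - v m) / (u m * (v m - z)) := by
  have h1 := one_sub_div_ne_zero hv hz
  have h2 : v m - z ≠ 0 := sub_ne_zero.mpr hz.symm
  have e : 1 - z / v m = (v m - z) / v m := by field_simp
  rw [pairFactor, e, div_div_eq_mul_div, div_sub_one h2]
  field_simp
  ring

/-- The size of a factor in terms of the distance to its pole. -/
lemma exists_norm_pairFactor_sub_one_le (ha : a ≠ 0) (hu : Follows a u) (hv : Follows a v) :
    ∃ K : ℝ, 0 < K ∧ ∀ m : ℕ, ∀ z : ℂ, z ≠ v m →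
      ‖pairFactor u v m z - 1‖ ≤ K * ‖z‖ * (√(m + 1) / (m + 1)) / ‖v m - z‖ := by
  obtain ⟨C, hC, hsub⟩ := hu.exists_sub hv
  obtain ⟨c, hc, hlow⟩ := hu.exists_lower ha
  refine ⟨C / c, by positivity, fun m z hz => ?_⟩
  have hd : 0 < ‖v m - z‖ := norm_pos_iff.mpr (sub_ne_zero.mpr hz.symm)
  rw [pairFactor_sub_one (hu.ne_zero m) (hv.ne_zero m) hz, norm_div, norm_mul, norm_mul]
  calc ‖z‖ * ‖u m - v m‖ / (‖u m‖ * ‖v m - z‖)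
      ≤ ‖z‖ * (C * √(m + 1)) / (c * (m + 1) * ‖v m - z‖) := by
        gcongr
        · exact hsub m
        · exact hlow m
    _ = _ := by field_simp

lemma pairFactor_local (ha : a ≠ 0) (hu : Follows a u) (hv : Follows a v) (ρ : ℝ) :
    ∃ N : ℕ, ∃ K : ℝ, ∀ m ≥ N, (∀ z ∈ Metric.ball (0 : ℂ) ρ, z ≠ v m) ∧
      DifferentiableOn ℂ (pairFactor u v m) (Metric.ball 0 ρ) ∧
      ∀ z ∈ Metric.ball (0 : ℂ) ρ,
        ‖pairFactor u v m z - 1‖ ≤ K * ((m : ℝ) + 1) ^ (-(3 / 2) : ℝ) := by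
  obtain ⟨K, hK, hle⟩ := exists_norm_pairFactor_sub_one_le ha hu hv
  obtain ⟨c, hc, hlow⟩ := hv.exists_lower ha
  obtain ⟨N, hN⟩ := exists_nat_ge (2 * ρ / c)
  have hfar : ∀ m ≥ N, ∀ z ∈ Metric.ball (0 : ℂ) ρ, c / 2 * (m + 1) ≤ ‖v m - z‖ := by
    intro m hm z hz
    have h1 : (N : ℝ) ≤ m := by exact_mod_cast hm
    have h2 : 2 * ρ ≤ c * (m + 1) := by
      rw [div_le_iff₀ hc] at hN
      nlinarith
    have h3 : ‖z‖ < ρ := by simpa using hz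
    have h4 := hlow m
    have h5 := norm_sub_norm_le (v m) z
    linarith
  have hne : ∀ m ≥ N, ∀ z ∈ Metric.ball (0 : ℂ) ρ, z ≠ v m := by
    intro m hm z hz heq
    have h1 := hfar m hm z hz
    rw [heq, sub_self, norm_zero] at h1
    have : 0 < c / 2 * ((m : ℝ) + 1) := by positivity
    linarith
  refine ⟨N, K * ρ * (2 / c), fun m hm => ⟨hne m hm, ?_, fun z hz => ?_⟩⟩
  · unfold pairFactor
    exact DifferentiableOn.div (by fun_prop) (by fun_prop) fun z hz =>
      one_sub_div_ne_zero (hv.ne_zero m) (hne m hm z hz)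
  · have hm1 : (0 : ℝ) < (m : ℝ) + 1 := by positivity
    have hz' : ‖z‖ ≤ ρ := by simpa using (Metric.mem_ball.mp hz).le
    refine (hle m z (hne m hm z hz)).trans ?_
    calc K * ‖z‖ * (√(m + 1) / (m + 1)) / ‖v m - z‖
        ≤ K * ρ * (√(m + 1) / (m + 1)) / (c / 2 * (m + 1)) := by
          have := (norm_nonneg z).trans hz'
          gcongr
          exact hfar m hm z hz
      _ = K * ρ * (2 / c) * (√((m : ℝ) + 1) / ((m : ℝ) + 1) ^ 2) := by field_simp
      _ = _ := by rw [sqrt_div_sq_eq hm1]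

/-- In a half-plane away from the direction of the two sequences, the tail of the product of the
factors is the exponential of a holomorphic function of sublinear growth. -/
lemma exists_tail_log (ha : 0 < a.im) (hu : Follows a u) (hv : Follows a v) :
    ∃ N : ℕ, ∃ L : ℂ → ℂ, ∃ C : ℝ, DifferentiableOn ℂ L {z | z.im < 1} ∧
      (∀ z : ℂ, z.im < 1 → ‖L z‖ ≤ C * (1 + ‖z‖) ^ (3 / 4 : ℝ)) ∧
      ∀ z : ℂ, z.im < 1 →
        Tendsto (fun M => ∏ m ∈ Finset.range M, pairFactor u v (N + m) z) atTop
          (𝓝 (exp (L z))) := by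
  have ha0 : a ≠ 0 := fun h => by simp [h] at ha
  obtain ⟨K, hK, hle⟩ := exists_norm_pairFactor_sub_one_le ha0 hu hv
  obtain ⟨C, hC, hcl⟩ := hv.exists_close
  obtain ⟨B, hB, hup⟩ := hv.exists_upper
  obtain ⟨N₁, hN₁⟩ := Follows.sqrt_isLittle C (a.im / 4) (by positivity)
  obtain ⟨N₂, hN₂⟩ := exists_nat_ge ((a.im + 1) / (a.im / 4))
  set c : ℝ := a.im / 2 with hc
  have hcp : 0 < c := by positivity
  have hfar1 : ∀ m ≥ max N₁ N₂, ∀ z : ℂ, z.im < 1 → c * (m + 1) ≤ ‖v m - z‖ := by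
    intro m hm z hz
    have h1 := hN₁ m ((le_max_left _ _).trans hm)
    have h2 : (N₂ : ℝ) ≤ m := by exact_mod_cast (le_max_right _ _).trans hm
    rw [div_le_iff₀ (by positivity)] at hN₂
    have h3 : a.im * m - C * √(m + 1) ≤ (v m).im := by
      have h4 := (abs_le.mp ((abs_im_le_norm _).trans (hcl m))).1
      simp at h4
      linarith
    have h5 := le_abs_self (v m - z).im
    have h6 := abs_im_le_norm (v m - z)
    rw [sub_im] at h5 h6
    rw [hc]
    nlinarith
  set k : ℝ := 1 + B / c with hk
  have hkp : 0 < k := by positivity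
  have hfar2 : ∀ m ≥ max N₁ N₂, ∀ z : ℂ, z.im < 1 → ‖z‖ ≤ k * ‖v m - z‖ := by
    intro m hm z hz
    have h1 := hfar1 m hm z hz
    have h2 := hup m
    have h3 : ‖z‖ ≤ ‖v m‖ + ‖v m - z‖ := by simpa using norm_sub_le (v m) (v m - z)
    have h4 : B * (m + 1) ≤ B / c * ‖v m - z‖ := by
      calc B * (m + 1) = B / c * (c * (m + 1)) := by field_simp
        _ ≤ _ := by gcongr
    rw [hk]; linarith
  have hne : ∀ m ≥ max N₁ N₂, ∀ z : ℂ, z.im < 1 → z ≠ v m := by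
    intro m hm z hz heq
    have h1 := hfar1 m hm z hz
    rw [heq, sub_self, norm_zero] at h1
    have : 0 < c * ((m : ℝ) + 1) := by positivity
    linarith
  -- the factor is small both for bounded `z` and, uniformly, for large `m`
  have hb1 : ∀ m ≥ max N₁ N₂, ∀ z : ℂ, z.im < 1 →
      ‖pairFactor u v m z - 1‖ ≤ K * k * (√(m + 1) / (m + 1)) := by
    intro m hm z hz
    have hd : 0 < ‖v m - z‖ := lt_of_lt_of_le (by positivity) (hfar1 m hm z hz)
    refine (hle m z (hne m hm z hz)).trans ?_
    rw [div_le_iff₀ hd]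
    have := hfar2 m hm z hz
    calc K * ‖z‖ * (√(m + 1) / (m + 1)) ≤ K * (k * ‖v m - z‖) * (√(m + 1) / (m + 1)) := by gcongr
      _ = _ := by ring
  -- three quarters of the power of `|z|` are kept and one quarter is absorbed by the distance
  -- `|v m - z|`; this gives a summable bound of sublinear growth
  have hb2 : ∀ m ≥ max N₁ N₂, ∀ z : ℂ, z.im < 1 →
      ‖pairFactor u v m z - 1‖ ≤ K * k ^ (1 / 4 : ℝ) * c ^ (-(3 / 4) : ℝ) * ‖z‖ ^ (3 / 4 : ℝ) *
        ((m : ℝ) + 1) ^ (-(5 / 4) : ℝ) := by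
    intro m hm z hz
    have hm1 : (0 : ℝ) < (m : ℝ) + 1 := by positivity
    have hd : 0 < ‖v m - z‖ := lt_of_lt_of_le (by positivity) (hfar1 m hm z hz)
    refine (hle m z (hne m hm z hz)).trans ?_
    have e1 : ‖z‖ = ‖z‖ ^ (3 / 4 : ℝ) * ‖z‖ ^ (1 / 4 : ℝ) := by
      rw [← Real.rpow_add_of_nonneg (norm_nonneg z) (by norm_num) (by norm_num)]
      norm_num
    have e2 : ‖v m - z‖⁻¹ = ‖v m - z‖ ^ (-(1 / 4) : ℝ) * ‖v m - z‖ ^ (-(3 / 4) : ℝ) := by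
      rw [← Real.rpow_add hd, ← Real.rpow_neg_one]; norm_num
    have i1 : ‖z‖ ^ (1 / 4 : ℝ) * ‖v m - z‖ ^ (-(1 / 4) : ℝ) ≤ k ^ (1 / 4 : ℝ) := by
      rw [Real.rpow_neg hd.le, ← div_eq_mul_inv, ← Real.div_rpow (norm_nonneg _) hd.le]
      refine Real.rpow_le_rpow (by positivity) ?_ (by norm_num)
      rw [div_le_iff₀ hd]; exact hfar2 m hm z hz
    have i2 : ‖v m - z‖ ^ (-(3 / 4) : ℝ) ≤ c ^ (-(3 / 4) : ℝ) * ((m : ℝ) + 1) ^ (-(3 / 4) : ℝ) := by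
      rw [← Real.mul_rpow hcp.le hm1.le]
      exact Real.rpow_le_rpow_of_nonpos (by positivity) (hfar1 m hm z hz) (by norm_num)
    have e3 : √((m : ℝ) + 1) / (m + 1) = ((m : ℝ) + 1) ^ (-(1 / 2) : ℝ) := by
      rw [Real.sqrt_eq_rpow]
      nth_rewrite 2 [← Real.rpow_one ((m : ℝ) + 1)]
      rw [← Real.rpow_sub hm1]; norm_num
    have e4 : ((m : ℝ) + 1) ^ (-(5 / 4) : ℝ) =
        ((m : ℝ) + 1) ^ (-(1 / 2) : ℝ) * ((m : ℝ) + 1) ^ (-(3 / 4) : ℝ) := by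
      rw [← Real.rpow_add hm1]; norm_num
    rw [e3, e4, div_eq_mul_inv, e2]
    calc K * ‖z‖ * ((m : ℝ) + 1) ^ (-(1 / 2) : ℝ) * (‖v m - z‖ ^ (-(1 / 4) : ℝ) *
          ‖v m - z‖ ^ (-(3 / 4) : ℝ))
        = K * ‖z‖ ^ (3 / 4 : ℝ) * ((m : ℝ) + 1) ^ (-(1 / 2) : ℝ) * (‖z‖ ^ (1 / 4 : ℝ) *
          ‖v m - z‖ ^ (-(1 / 4) : ℝ)) * ‖v m - z‖ ^ (-(3 / 4) : ℝ) := by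
          nth_rewrite 1 [e1]; ring
      _ ≤ K * ‖z‖ ^ (3 / 4 : ℝ) * ((m : ℝ) + 1) ^ (-(1 / 2) : ℝ) * k ^ (1 / 4 : ℝ) *
          (c ^ (-(3 / 4) : ℝ) * ((m : ℝ) + 1) ^ (-(3 / 4) : ℝ)) := by gcongr
      _ = _ := by ring
  obtain ⟨N₃, hN₃⟩ := Follows.sqrt_isLittle (K * k) (1 / 2) (by norm_num)
  set N := max (max N₁ N₂) N₃ with hN
  have hNm : ∀ m, max N₁ N₂ ≤ N + m := fun m => (le_max_left _ _).trans (Nat.le_add_right _ _)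
  have hNm3 : ∀ m, N₃ ≤ N + m := fun m => (le_max_right _ _).trans (Nat.le_add_right _ _)
  set A : ℝ := K * k ^ (1 / 4 : ℝ) * c ^ (-(3 / 4) : ℝ) with hA
  have hA0 : 0 ≤ A := by positivity
  set S : ℝ := ∑' m : ℕ, 1 * (((N + m : ℕ) : ℝ) + 1) ^ (-(5 / 4) : ℝ) with hS
  have hhalf : ∀ m, ∀ z : ℂ, z.im < 1 → ‖pairFactor u v (N + m) z - 1‖ ≤ 1 / 2 := by
    intro m z hz
    have h1 := hb1 (N + m) (hNm m) z hz
    have h2 := hN₃ (N + m) (hNm3 m)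
    have h3 : (0 : ℝ) < ((N + m : ℕ) : ℝ) + 1 := by positivity
    refine h1.trans ?_
    rw [← mul_div_assoc, div_le_iff₀ h3]
    exact h2
  have hdiff : ∀ m, DifferentiableOn ℂ (pairFactor u v (N + m)) {z | z.im < 1} := fun m => by
    unfold pairFactor
    exact DifferentiableOn.div (by fun_prop) (by fun_prop) fun z hz =>
      one_sub_div_ne_zero (hv.ne_zero _) (hne _ (hNm m) z hz)
  have hopen : IsOpen {z : ℂ | z.im < 1} := isOpen_lt continuous_im continuous_const
  -- on bounded parts of the half-plane
  have hloc : ∀ ρ : ℝ, 0 < ρ → _ := fun ρ hρ => tendsto_prod_exp_tsum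
    (g := fun m => pairFactor u v (N + m)) (U := {z | z.im < 1} ∩ Metric.ball 0 ρ)
    (b := fun m => A * ρ ^ (3 / 4 : ℝ) * (((N + m : ℕ) : ℝ) + 1) ^ (-(5 / 4) : ℝ))
    (hopen.inter Metric.isOpen_ball) (fun m => (hdiff m).mono Set.inter_subset_left)
    (fun m z hz => hhalf m z hz.1)
    (fun m z hz => by
      refine (hb2 _ (hNm m) z hz.1).trans ?_
      have : ‖z‖ ≤ ρ := by simpa using (Metric.mem_ball.mp hz.2).le
      gcongr)
    (summable_shift_rpow _ N (by norm_num))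
  refine ⟨N, fun z => ∑' m, log (pairFactor u v (N + m) z), 3 / 2 * (A * S), fun z hz => ?_,
    fun z hz => ?_, fun z hz => ?_⟩
  · have h1 := (hloc (‖z‖ + 1) (by positivity)).1
    exact (h1.differentiableAt ((hopen.inter Metric.isOpen_ball).mem_nhds
      ⟨hz, by simp⟩)).differentiableWithinAt
  · have h1 := (hloc (1 + ‖z‖) (by positivity)).2.1 z ⟨hz, by simp⟩
    refine h1.trans (le_of_eq ?_)
    rw [tsum_mul_left, hS]
    simp only [one_mul]
    ring
  · exact (hloc (‖z‖ + 1) (by positivity)).2.2 z ⟨hz, by simp⟩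

end Pair

/-! ### Products on large circles -/

lemma prod_le_exp_sum {ι : Type*} (s : Finset ι) (y : ι → ℝ) (hy : ∀ i ∈ s, 0 ≤ y i) :
    ∏ i ∈ s, (1 + y i) ≤ Real.exp (∑ i ∈ s, y i) := by
  rw [Real.exp_sum]
  refine Finset.prod_le_prod (fun i hi => by linarith [hy i hi]) fun i _ => ?_
  rw [add_comm]; exact Real.add_one_le_exp _

/-- The number of natural numbers `m` for which `α m` lies within `w` of `r`. -/
lemma card_filter_abs_sub_le {α r w : ℝ} (hα : 0 < α) (hw : 0 ≤ w) (s : Finset ℕ)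
    (hs : ∀ m ∈ s, |α * m - r| ≤ w) : (s.card : ℝ) ≤ 2 * w / α + 1 := by
  rcases s.eq_empty_or_nonempty with rfl | hne
  · simp; positivity
  set m₀ := s.min' hne
  have hsub : s ⊆ Finset.Icc m₀ (m₀ + ⌊2 * w / α⌋₊) := by
    intro m hm
    rw [Finset.mem_Icc]
    have h0 : m₀ ≤ m := s.min'_le m hm
    refine ⟨h0, ?_⟩
    have h1 := abs_le.mp (hs m hm)
    have h2 := abs_le.mp (hs m₀ (s.min'_mem hne))
    have h3 : ((m - m₀ : ℕ) : ℝ) ≤ 2 * w / α := by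
      rw [Nat.cast_sub h0, le_div_iff₀ hα]
      linarith [h1.2, h2.1]
    have := Nat.le_floor h3
    omega
  have h1 := Finset.card_le_card hsub
  rw [Nat.card_Icc] at h1
  have h2 : s.card ≤ ⌊2 * w / α⌋₊ + 1 := by omega
  calc (s.card : ℝ) ≤ ⌊2 * w / α⌋₊ + 1 := by exact_mod_cast h2
    _ ≤ _ := by gcongr; exact Nat.floor_le (by positivity)

/-- On large circles keeping a fixed distance from the terms of `u`, the partial products of the
inverse factors are of subexponential size. -/
lemma exists_prod_inv_pairFactor_le {a : ℂ} {u v : ℕ → ℂ} (ha : a ≠ 0) (hu : Follows a u)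
    (hv : Follows a v) {δ ε : ℝ} (hδ : 0 < δ) (hε : 0 < ε) :
    ∃ r₀ : ℝ, ∀ r ≥ r₀, ∀ z : ℂ, ‖z‖ = r → (∀ m, δ ≤ ‖u m - z‖) → ∀ M : ℕ,
      ∏ m ∈ Finset.range M, ‖pairFactor v u m z‖ ≤ Real.exp (ε * r) := by
  obtain ⟨K, hK, hle⟩ := exists_norm_pairFactor_sub_one_le ha hv hu
  obtain ⟨C, hC, hcl⟩ := hu.exists_close
  obtain ⟨c, hc, hlow⟩ := hu.exists_lower ha
  have ha' : 0 < ‖a‖ := norm_pos_iff.mpr ha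
  set B : ℝ := max 1 (2 / c) with hB
  have hB1 : 1 ≤ B := le_max_left _ _
  have hBc : 2 ≤ B * c := by
    have : 2 / c ≤ B := le_max_right _ _
    rwa [div_le_iff₀ hc] at this
  set S : ℝ := ∑' m : ℕ, 1 * (((0 + m : ℕ) : ℝ) + 1) ^ (-(5 / 4) : ℝ) with hS
  have hSs := summable_shift_rpow 1 0 (r := 5 / 4) (by norm_num)
  set A : ℝ := K * (B ^ (3 / 4 : ℝ) + 2 / c) with hA
  -- eventual inequality between powers of the radius
  have hpow : ∀ κ : ℝ, κ < 1 → ∀ Q : ℝ, ∀ η > 0, ∀ᶠ r : ℝ in atTop, Q * r ^ κ ≤ η * r := by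
    intro κ hκ Q η hη
    have h1 : Tendsto (fun r : ℝ => Q * r ^ (-(1 - κ))) atTop (𝓝 (Q * 0)) :=
      (tendsto_rpow_neg_atTop (by linarith)).const_mul Q
    rw [mul_zero] at h1
    filter_upwards [h1.eventually_le_const hη, eventually_gt_atTop 0] with r hr hr0
    calc Q * r ^ κ = Q * r ^ (-(1 - κ)) * r := by
          rw [mul_assoc]
          nth_rewrite 3 [← Real.rpow_one r]
          rw [← Real.rpow_add hr0]; congr 2; ring
      _ ≤ η * r := by gcongr
  set W : ℝ := 2 * (1 + C * √B) / ‖a‖ + 1 with hW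
  set P : ℝ := 16 * (1 + K / δ) with hP
  have hev := (hpow (15 / 16) (by norm_num) (W * P) (ε / 2) (by positivity)).and
    ((hpow (7 / 8) (by norm_num) (A * S) (ε / 2) (by positivity)).and (eventually_ge_atTop (1 : ℝ)))
  obtain ⟨r₀, hr₀⟩ := eventually_atTop.mp hev
  refine ⟨r₀, fun r hr z hz hzu M => ?_⟩
  obtain ⟨hr1, hr2, hr3⟩ := hr₀ r hr
  have hr0 : 0 < r := by linarith
  set y : ℕ → ℝ := fun m => ‖pairFactor v u m z - 1‖ with hy
  have hzne : ∀ m, z ≠ u m := fun m heq => by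
    have := hzu m
    rw [heq, sub_self, norm_zero] at this
    linarith
  have hyle : ∀ m, y m ≤ K * r * (√(m + 1) / (m + 1)) / ‖u m - z‖ := fun m => by
    have := hle m z (hzne m)
    rwa [hz] at this
  have hsq : ∀ m : ℕ, √((m : ℝ) + 1) / (m + 1) = ((m : ℝ) + 1) ^ (-(1 / 2) : ℝ) := by
    intro m
    have hm1 : (0 : ℝ) < (m : ℝ) + 1 := by positivity
    rw [Real.sqrt_eq_rpow]
    nth_rewrite 2 [← Real.rpow_one ((m : ℝ) + 1)]
    rw [← Real.rpow_sub hm1]; norm_num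
  have hsq1 : ∀ m : ℕ, √((m : ℝ) + 1) / (m + 1) ≤ 1 := fun m => by
    rw [hsq]
    exact Real.rpow_le_one_of_one_le_of_nonpos (by linarith [(Nat.cast_nonneg m : (0 : ℝ) ≤ m)])
      (by norm_num)
  -- the terms of `u` that come close to the circle
  -- these number `O(r ^ (7/8))`, and each contributes a factor of at most a multiple of `r`,
  -- hence at most the exponential of a multiple of `r ^ (1/16)`
  set bad : Finset ℕ := (Finset.range M).filter fun m : ℕ =>
    (m : ℝ) + 1 ≤ B * r ∧ ‖u m - z‖ < r ^ (7 / 8 : ℝ) with hbad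
  have hcard : (bad.card : ℝ) ≤ W * r ^ (7 / 8 : ℝ) := by
    have h78 : 1 ≤ r ^ (7 / 8 : ℝ) := Real.one_le_rpow hr3 (by norm_num)
    have h1 : ∀ m ∈ bad, |‖a‖ * m - r| ≤ (1 + C * √B) * r ^ (7 / 8 : ℝ) := by
      intro m hm
      obtain ⟨-, hm1, hm2⟩ := Finset.mem_filter.mp hm
      have i1 : |‖a * m‖ - ‖z‖| ≤ ‖a * m - z‖ := abs_norm_sub_norm_le _ _
      have i2 : ‖a * m - z‖ ≤ ‖u m - a * m‖ + ‖u m - z‖ := by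
        rw [norm_sub_rev (u m)]
        exact norm_sub_le_norm_sub_add_norm_sub _ _ _
      have i3 : √((m : ℝ) + 1) ≤ √B * r ^ (7 / 8 : ℝ) := by
        calc √((m : ℝ) + 1) ≤ √(B * r) := Real.sqrt_le_sqrt hm1
          _ = √B * r ^ (1 / 2 : ℝ) := by rw [Real.sqrt_mul (by positivity), ← Real.sqrt_eq_rpow]
          _ ≤ √B * r ^ (7 / 8 : ℝ) := by
              gcongr ?_ * ?_
              exact Real.rpow_le_rpow_of_exponent_le hr3 (by norm_num)
      have i4 : ‖a * (m : ℂ)‖ = ‖a‖ * m := by simp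
      rw [i4, hz] at i1
      calc |‖a‖ * m - r| ≤ C * √(m + 1) + ‖u m - z‖ :=
            i1.trans (i2.trans (add_le_add_left (hcl m) _))
        _ ≤ C * (√B * r ^ (7 / 8 : ℝ)) + r ^ (7 / 8 : ℝ) := by gcongr
        _ = _ := by ring
    refine (card_filter_abs_sub_le ha' (by positivity) bad h1).trans ?_
    calc 2 * ((1 + C * √B) * r ^ (7 / 8 : ℝ)) / ‖a‖ + 1
        ≤ 2 * ((1 + C * √B) * r ^ (7 / 8 : ℝ)) / ‖a‖ + r ^ (7 / 8 : ℝ) := by gcongr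
      _ = W * r ^ (7 / 8 : ℝ) := by rw [hW]; ring
  have hbadle : ∏ m ∈ bad, (1 + y m) ≤ Real.exp (ε / 2 * r) := by
    have h1 : ∀ m ∈ bad, 1 + y m ≤ Real.exp (P * r ^ (1 / 16 : ℝ)) := by
      intro m _
      have i1 : y m ≤ K * r / δ := by
        refine (hyle m).trans ?_
        calc K * r * (√(m + 1) / (m + 1)) / ‖u m - z‖ ≤ K * r * 1 / δ := by
              gcongr
              · exact hsq1 m
              · exact hzu m
          _ = _ := by ring
      have i2 : 1 + y m ≤ (1 + K / δ) * r := by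
        calc 1 + y m ≤ r + K * r / δ := add_le_add hr3 i1
          _ = _ := by ring
      have i3 : Real.log ((1 + K / δ) * r) ≤ ((1 + K / δ) * r) ^ (1 / 16 : ℝ) / (1 / 16) :=
        Real.log_le_rpow_div (by positivity) (by norm_num)
      have i4 : ((1 + K / δ) * r) ^ (1 / 16 : ℝ) ≤ (1 + K / δ) * r ^ (1 / 16 : ℝ) := by
        rw [Real.mul_rpow (by positivity) hr0.le]
        gcongr
        have h1 : 1 ≤ 1 + K / δ := le_add_of_nonneg_right (by positivity)
        conv_rhs => rw [← Real.rpow_one (1 + K / δ)]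
        exact Real.rpow_le_rpow_of_exponent_le h1 (by norm_num)
      refine i2.trans ?_
      rw [← Real.exp_log (show 0 < (1 + K / δ) * r by positivity)]
      refine Real.exp_le_exp.mpr (i3.trans ?_)
      rw [hP]
      linarith
    calc ∏ m ∈ bad, (1 + y m) ≤ ∏ _m ∈ bad, Real.exp (P * r ^ (1 / 16 : ℝ)) :=
          Finset.prod_le_prod (fun m _ => by positivity) h1
      _ = Real.exp (bad.card * (P * r ^ (1 / 16 : ℝ))) := by
          rw [Finset.prod_const, ← Real.exp_nat_mul]
      _ ≤ Real.exp (ε / 2 * r) := by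
          refine Real.exp_le_exp.mpr (le_trans ?_ hr1)
          have hP0 : 0 ≤ P := by positivity
          calc (bad.card : ℝ) * (P * r ^ (1 / 16 : ℝ))
              ≤ W * r ^ (7 / 8 : ℝ) * (P * r ^ (1 / 16 : ℝ)) := by gcongr
            _ = W * P * (r ^ (7 / 8 : ℝ) * r ^ (1 / 16 : ℝ)) := by ring
            _ = _ := by rw [← Real.rpow_add hr0]; norm_num
  -- for the other terms the deviations from `1` are summable, with sum `O(r ^ (7/8))`
  have hgood : ∀ m ∈ (Finset.range M).filter fun m : ℕ =>
      ¬((m : ℝ) + 1 ≤ B * r ∧ ‖u m - z‖ < r ^ (7 / 8 : ℝ)),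
      y m ≤ A * r ^ (7 / 8 : ℝ) * (((m : ℕ) : ℝ) + 1) ^ (-(5 / 4) : ℝ) := by
    intro m hm
    have hnot := (Finset.mem_filter.mp hm).2
    have hm1 : (0 : ℝ) < (m : ℝ) + 1 := by positivity
    have e4 : ((m : ℝ) + 1) ^ (-(1 / 2) : ℝ) =
        ((m : ℝ) + 1) ^ (3 / 4 : ℝ) * ((m : ℝ) + 1) ^ (-(5 / 4) : ℝ) := by
      rw [← Real.rpow_add hm1]; norm_num
    refine (hyle m).trans ?_
    rw [hsq]
    by_cases hmB : (m : ℝ) + 1 ≤ B * r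
    · have hd : r ^ (7 / 8 : ℝ) ≤ ‖u m - z‖ := by
        by_contra h
        exact hnot ⟨hmB, not_le.mp h⟩
      have hr8 : r = r ^ (7 / 8 : ℝ) * r ^ (1 / 8 : ℝ) := by
        rw [← Real.rpow_add hr0]; norm_num
      calc K * r * ((m : ℝ) + 1) ^ (-(1 / 2) : ℝ) / ‖u m - z‖
          ≤ K * r * ((m : ℝ) + 1) ^ (-(1 / 2) : ℝ) / r ^ (7 / 8 : ℝ) := by gcongr
        _ = K * r ^ (1 / 8 : ℝ) * ((m : ℝ) + 1) ^ (-(1 / 2) : ℝ) := by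
            rw [div_eq_iff (by positivity)]
            nth_rewrite 1 [hr8]; ring
        _ = K * r ^ (1 / 8 : ℝ) * (((m : ℝ) + 1) ^ (3 / 4 : ℝ) *
              ((m : ℝ) + 1) ^ (-(5 / 4) : ℝ)) := by rw [e4]
        _ ≤ K * r ^ (1 / 8 : ℝ) * ((B * r) ^ (3 / 4 : ℝ) *
              ((m : ℝ) + 1) ^ (-(5 / 4) : ℝ)) := by gcongr
        _ = K * B ^ (3 / 4 : ℝ) * (r ^ (1 / 8 : ℝ) * r ^ (3 / 4 : ℝ)) *
              ((m : ℝ) + 1) ^ (-(5 / 4) : ℝ) := by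
            rw [Real.mul_rpow (by positivity) hr0.le]; ring
        _ = K * B ^ (3 / 4 : ℝ) * r ^ (7 / 8 : ℝ) * ((m : ℝ) + 1) ^ (-(5 / 4) : ℝ) := by
            rw [← Real.rpow_add hr0]; norm_num
        _ ≤ A * r ^ (7 / 8 : ℝ) * ((m : ℝ) + 1) ^ (-(5 / 4) : ℝ) := by
            gcongr
            rw [hA]
            gcongr
            exact le_add_of_nonneg_right (by positivity)
    · push Not at hmB
      have hd : c / 2 * (m + 1) ≤ ‖u m - z‖ := by
        have i1 := hlow m
        have i2 := norm_sub_norm_le (u m) z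
        rw [hz] at i2
        nlinarith
      have hrm : r ≤ (m : ℝ) + 1 := by nlinarith
      calc K * r * ((m : ℝ) + 1) ^ (-(1 / 2) : ℝ) / ‖u m - z‖
          ≤ K * r * ((m : ℝ) + 1) ^ (-(1 / 2) : ℝ) / (c / 2 * (m + 1)) := by gcongr
        _ = K * (2 / c) * (r ^ (3 / 4 : ℝ) * r ^ (1 / 4 : ℝ)) *
              (((m : ℝ) + 1) ^ (-(1 / 2) : ℝ) * ((m : ℝ) + 1) ^ (-1 : ℝ)) := by
            rw [← Real.rpow_add hr0, Real.rpow_neg_one]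
            norm_num
            field_simp
        _ = K * (2 / c) * (r ^ (3 / 4 : ℝ) * r ^ (1 / 4 : ℝ)) *
              ((m : ℝ) + 1) ^ (-(3 / 2) : ℝ) := by
            rw [← Real.rpow_add hm1]; norm_num
        _ ≤ K * (2 / c) * (r ^ (7 / 8 : ℝ) * ((m : ℝ) + 1) ^ (1 / 4 : ℝ)) *
              ((m : ℝ) + 1) ^ (-(3 / 2) : ℝ) := by
            have i1 : r ^ (3 / 4 : ℝ) ≤ r ^ (7 / 8 : ℝ) :=
              Real.rpow_le_rpow_of_exponent_le hr3 (by norm_num)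
            have i2 : r ^ (1 / 4 : ℝ) ≤ ((m : ℝ) + 1) ^ (1 / 4 : ℝ) :=
              Real.rpow_le_rpow hr0.le hrm (by norm_num)
            gcongr
        _ = K * (2 / c) * r ^ (7 / 8 : ℝ) *
              (((m : ℝ) + 1) ^ (1 / 4 : ℝ) * ((m : ℝ) + 1) ^ (-(3 / 2) : ℝ)) := by ring
        _ = K * (2 / c) * r ^ (7 / 8 : ℝ) * ((m : ℝ) + 1) ^ (-(5 / 4) : ℝ) := by
            rw [← Real.rpow_add hm1]; norm_num
        _ ≤ A * r ^ (7 / 8 : ℝ) * ((m : ℝ) + 1) ^ (-(5 / 4) : ℝ) := by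
            gcongr
            rw [hA]
            gcongr
            exact le_add_of_nonneg_left (by positivity)
  have hA0 : 0 ≤ A := by positivity
  have hgoodle : ∏ m ∈ (Finset.range M).filter fun m : ℕ =>
      ¬((m : ℝ) + 1 ≤ B * r ∧ ‖u m - z‖ < r ^ (7 / 8 : ℝ)), (1 + y m) ≤
      Real.exp (ε / 2 * r) := by
    refine (prod_le_exp_sum _ y fun m _ => norm_nonneg _).trans (Real.exp_le_exp.mpr ?_)
    refine (Finset.sum_le_sum hgood).trans (le_trans ?_ hr2)
    rw [← Finset.mul_sum]
    have h1 : ∑ m ∈ (Finset.range M).filter fun m : ℕ =>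
        ¬((m : ℝ) + 1 ≤ B * r ∧ ‖u m - z‖ < r ^ (7 / 8 : ℝ)),
        ((m : ℝ) + 1) ^ (-(5 / 4) : ℝ) ≤ S := by
      have := hSs.sum_le_tsum ((Finset.range M).filter fun m : ℕ =>
        ¬((m : ℝ) + 1 ≤ B * r ∧ ‖u m - z‖ < r ^ (7 / 8 : ℝ))) (fun m _ => by positivity)
      simpa [hS] using this
    calc A * r ^ (7 / 8 : ℝ) * _ ≤ A * r ^ (7 / 8 : ℝ) * S := by gcongr
      _ = _ := by ring
  calc ∏ m ∈ Finset.range M, ‖pairFactor v u m z‖ ≤ ∏ m ∈ Finset.range M, (1 + y m) := by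
        refine Finset.prod_le_prod (fun m _ => norm_nonneg _) fun m _ => ?_
        have := norm_add_le (1 : ℂ) (pairFactor v u m z - 1)
        simpa [hy] using this
    _ = (∏ m ∈ bad, (1 + y m)) * _ := (Finset.prod_filter_mul_prod_filter_not _ _ _).symm
    _ ≤ Real.exp (ε / 2 * r) * Real.exp (ε / 2 * r) := by
        refine mul_le_mul hbadle hgoodle (Finset.prod_nonneg fun m _ => ?_) (Real.exp_pos _).le
        positivity
    _ = Real.exp (ε * r) := by rw [← Real.exp_add]; congr 1; ring

/-- Circles of arbitrarily large radius that keep a fixed distance from all terms of finitely many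
sequences growing at least linearly. -/
lemma exists_circles {k : ℕ} {c : ℝ} (hc : 0 < c) (u : Fin k → ℕ → ℂ)
    (hu : ∀ i, ∀ m : ℕ, c * ((m : ℝ) + 1) ≤ ‖u i m‖) :
    ∃ δ > 0, ∀ R : ℝ, ∃ r > R, ∀ z : ℂ, ‖z‖ = r → ∀ i m, δ ≤ ‖u i m - z‖ := by
  -- below `r` there are at most `k r / c` terms altogether, fewer than there are disjoint
  -- intervals of length `2 δ`
  refine ⟨c / (4 * (k + 1)), by positivity, fun R => ?_⟩
  set δ : ℝ := c / (4 * (k + 1)) with hδ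
  have hδ0 : 0 < δ := by positivity
  by_contra hcon
  push Not at hcon
  -- a long interval of radii, every multiple of `2 δ` in which is close to some term
  obtain ⟨X, hX⟩ := exists_nat_gt (|R| / (2 * δ) + 1)
  have hX' : |R| + 2 * δ < 2 * δ * X := by
    have h1 : |R| / (2 * δ) < X - 1 := by linarith
    rw [div_lt_iff₀ (by positivity)] at h1
    linarith
  have hpick : ∀ j : ℕ, ∃ p : Fin k × ℕ, |‖u p.1 p.2‖ - 2 * δ * (X + j)| < δ := by
    intro j
    have hrad : R < 2 * δ * (X + j) := by
      have : 0 ≤ 2 * δ * (j : ℝ) := by positivity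
      linarith [le_abs_self R]
    obtain ⟨z, hz, i, m, him⟩ := hcon _ hrad
    refine ⟨(i, m), ?_⟩
    rw [← hz]
    exact (abs_norm_sub_norm_le _ _).trans_lt him
  choose p hp using hpick
  have hinj : Function.Injective p := by
    intro j j' hj
    have h1 := hp j
    have h2 := hp j'
    rw [hj] at h1
    have h3 : |2 * δ * (X + j') - 2 * δ * ((X : ℝ) + j)| < 2 * δ := by
      rw [abs_lt] at h1 h2 ⊢
      constructor <;> linarith [h1.1, h1.2, h2.1, h2.2]
    rw [show 2 * δ * (X + j') - 2 * δ * ((X : ℝ) + j) = 2 * δ * (j' - j) by ring, abs_mul,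
      abs_of_pos (by positivity)] at h3
    have h4 : |((j' : ℝ) - j)| < 1 := by
      by_contra h
      push Not at h
      nlinarith
    have h5 : |((j' : ℤ) - (j : ℤ) : ℤ)| < 1 := by exact_mod_cast h4
    have := Int.abs_lt_one_iff.mp h5
    omega
  have hrange : ∀ J j : ℕ, j < J → p j ∈
      (Finset.univ : Finset (Fin k)) ×ˢ Finset.range ⌊2 * δ * (X + J) / c⌋₊ := by
    intro J j hjJ
    rw [Finset.mem_product]
    refine ⟨Finset.mem_univ _, Finset.mem_range.mpr ?_⟩
    have h1 := (abs_lt.mp (hp j)).2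
    have h2 := hu (p j).1 (p j).2
    have h3 : (j : ℝ) + 1 ≤ J := by exact_mod_cast hjJ
    have h4 : (((p j).2 + 1 : ℕ) : ℝ) ≤ 2 * δ * (X + J) / c := by
      rw [le_div_iff₀ hc]
      push_cast
      nlinarith [mul_le_mul_of_nonneg_left h3 hδ0.le]
    have := Nat.le_floor h4
    omega
  have hcount : ∀ J : ℕ, (J : ℝ) ≤ k * (2 * δ * (X + J) / c) := by
    intro J
    have h1 : (Finset.range J).card ≤
        ((Finset.univ : Finset (Fin k)) ×ˢ Finset.range ⌊2 * δ * (X + J) / c⌋₊).card :=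
      Finset.card_le_card_of_injOn p
        (fun j hj => hrange J j (Finset.mem_range.mp hj)) hinj.injOn
    rw [Finset.card_range, Finset.card_product, Finset.card_univ, Fintype.card_fin,
      Finset.card_range] at h1
    calc (J : ℝ) ≤ k * ⌊2 * δ * (X + J) / c⌋₊ := by exact_mod_cast h1
      _ ≤ _ := by gcongr; exact Nat.floor_le (by positivity)
  have h1 := hcount (X + 1)
  have h2 : (k : ℝ) * (2 * δ * (X + ((X + 1 : ℕ) : ℝ)) / c) =
      (k / (k + 1)) * (X + 1 / 2) := by
    rw [hδ]; push_cast; field_simp; ring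
  rw [h2] at h1
  have h3 : (k : ℝ) / (k + 1) ≤ 1 := by
    rw [div_le_one (by positivity)]; linarith
  push_cast at h1
  nlinarith [(Nat.cast_nonneg X : (0 : ℝ) ≤ X)]

/-! ### The dispersion function and the acoustic modes -/

namespace Cascade

lemma upperSqrt_sq (z : ℂ) : upperSqrt z ^ 2 = z := by
  have h : (z ^ (1 / 2 : ℂ)) ^ 2 = z := by
    have := cpow_nat_inv_pow z two_ne_zero
    rw [one_div]
    exact_mod_cast this
  unfold upperSqrt
  split_ifs
  · exact h
  · rw [neg_sq, h]

lemma upperSqrt_im_nonneg (z : ℂ) : 0 ≤ (upperSqrt z).im := by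
  rcases eq_or_ne z 0 with rfl | hz
  · simp [upperSqrt]
  have h : (z ^ (1 / 2 : ℂ)).im = Real.exp (Real.log ‖z‖ / 2) * Real.sin (z.arg / 2) := by
    rw [cpow_def_of_ne_zero hz, exp_im]
    have e1 : (log z * (1 / 2)).re = Real.log ‖z‖ / 2 := by
      simp [div_eq_mul_inv, log_re]
    have e2 : (log z * (1 / 2)).im = z.arg / 2 := by
      simp [div_eq_mul_inv, log_im]
    rw [e1, e2]
  unfold upperSqrt
  have hpi := Real.pi_pos
  split_ifs with h0
  · rw [h]
    have := arg_nonneg_iff.mpr h0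
    have := arg_le_pi z
    exact mul_nonneg (Real.exp_pos _).le
      (Real.sin_nonneg_of_nonneg_of_le_pi (by linarith) (by linarith))
  · rw [neg_im, h]
    push Not at h0
    have := arg_neg_iff.mpr h0
    have := neg_pi_lt_arg z
    have := Real.sin_nonpos_of_nonpos_of_neg_pi_le (x := z.arg / 2) (by linarith) (by linarith)
    nlinarith [Real.exp_pos (Real.log ‖z‖ / 2)]

/-- An even function of a square root does not depend on the choice of the root. -/
lemma even_eq_of_sq_eq {h : ℂ → ℂ} (he : ∀ z, h (-z) = h z) {z w : ℂ} (hzw : z ^ 2 = w ^ 2) :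
    h z = h w := by
  rcases sq_eq_sq_iff_eq_or_eq_neg.mp hzw with rfl | rfl
  · rfl
  · exact he w

/-- An even entire function of the square root is entire. -/
lemma differentiable_even_upperSqrt {h : ℂ → ℂ} (hd : Differentiable ℂ h) (he : ∀ z, h (-z) = h z) :
    Differentiable ℂ fun w => h (upperSqrt w) := by
  have hne : ∀ w₀ : ℂ, w₀ ≠ 0 → DifferentiableAt ℂ (fun w => h (upperSqrt w)) w₀ := by
    intro w₀ hw₀
    -- a holomorphic branch near `w₀`
    set r : ℂ → ℂ := fun w => upperSqrt w₀ * (w / w₀) ^ (1 / 2 : ℂ) with hr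
    have hrd : DifferentiableAt ℂ r w₀ := by
      refine DifferentiableAt.const_mul (DifferentiableAt.cpow (by fun_prop) (by fun_prop) ?_) _
      rw [div_self hw₀]
      exact one_mem_slitPlane
    have hrsq : ∀ w, r w ^ 2 = w := by
      intro w
      have : ((w / w₀) ^ (1 / 2 : ℂ)) ^ 2 = w / w₀ := by
        have := cpow_nat_inv_pow (w / w₀) two_ne_zero
        rw [one_div]
        exact_mod_cast this
      simp only [hr]
      rw [mul_pow, upperSqrt_sq, this]
      field_simp
    have heq : (fun w => h (upperSqrt w)) = fun w => h (r w) := by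
      ext w
      exact even_eq_of_sq_eq he (by rw [upperSqrt_sq, hrsq])
    rw [heq]
    exact (hd _).comp _ hrd
  have hcont : ContinuousAt (fun w => h (upperSqrt w)) 0 := by
    have h0 : upperSqrt 0 = 0 := by simp [upperSqrt]
    have : Tendsto upperSqrt (𝓝 0) (𝓝 0) := by
      rw [tendsto_zero_iff_norm_tendsto_zero]
      have e : (fun w => ‖upperSqrt w‖) = fun w => √‖w‖ := by
        ext w
        rw [eq_comm, Real.sqrt_eq_iff_mul_self_eq (norm_nonneg _) (norm_nonneg _), ← norm_mul,
          ← sq, upperSqrt_sq]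
      rw [e]
      have := (Real.continuous_sqrt.comp continuous_norm).tendsto (0 : ℂ)
      simpa [Function.comp_def] using this
    have h1 : ContinuousAt upperSqrt 0 := by
      rw [ContinuousAt, h0]; exact this
    exact (hd.continuous.continuousAt).comp h1
  have h1 := (differentiableOn_compl_singleton_and_continuousAt_iff
    (f := fun w => h (upperSqrt w)) (s := Set.univ) (c := 0) univ_mem).mp
    ⟨fun w hw => (hne w hw.2).differentiableWithinAt, hcont⟩
  exact differentiableOn_univ.mp h1

variable (p : Cascade)

lemma zeta_sq (γ : ℂ) : p.zeta γ ^ 2 = p.κ ^ 2 - γ ^ 2 := upperSqrt_sq _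

lemma acoustic_eq {γ z : ℂ} (hz : z ^ 2 = p.κ ^ 2 - γ ^ 2) :
    p.acoustic γ = cos (p.s * z) - cos (p.d * γ + p.σ) := by
  unfold acoustic
  congr 1
  refine even_eq_of_sq_eq (h := fun z => cos (p.s * z)) (fun w => ?_) ((p.zeta_sq γ).trans hz.symm)
  simp

lemma zeta_mul_sin_eq {γ z : ℂ} (hz : z ^ 2 = p.κ ^ 2 - γ ^ 2) :
    p.zeta γ * sin (p.s * p.zeta γ) = z * sin (p.s * z) := by
  refine even_eq_of_sq_eq (h := fun z => z * sin (p.s * z)) (fun w => ?_)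
    ((p.zeta_sq γ).trans hz.symm)
  simp

lemma differentiable_acoustic : Differentiable ℂ p.acoustic := by
  have h1 := differentiable_even_upperSqrt (h := fun z => cos (p.s * z)) (by fun_prop)
    (fun w => by simp)
  have h2 : Differentiable ℂ fun γ : ℂ => p.κ ^ 2 - γ ^ 2 := by fun_prop
  exact (h1.comp h2).sub (by fun_prop)

lemma differentiable_duct : Differentiable ℂ p.duct := by
  have h1 := differentiable_even_upperSqrt (h := fun z => z * sin (p.s * z)) (by fun_prop)
    (fun w => by simp)
  have h2 : Differentiable ℂ fun γ : ℂ => p.κ ^ 2 - γ ^ 2 := by fun_prop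
  have h3 : Differentiable ℂ p.symbol := by unfold symbol; fun_prop
  exact (h1.comp h2).add (h3.mul p.differentiable_acoustic)

lemma K_eq_duct_div {γ : ℂ} (hγ : p.acoustic γ ≠ 0) :
    p.K γ = p.duct γ / (4 * Real.pi * p.acoustic γ) := by
  unfold K duct
  have : (Real.pi : ℂ) ≠ 0 := by exact_mod_cast Real.pi_ne_zero
  field_simp

/-- The quadratic factor of the dispersion function belonging to the pair of acoustic modes
of index `m`. -/
noncomputable def modePair (m : ℤ) (γ : ℂ) : ℂ :=
  (p.d * γ + p.σ - 2 * Real.pi * m) ^ 2 - (p.s : ℂ) ^ 2 * (p.κ ^ 2 - γ ^ 2)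

lemma Δ_pos (hs : 0 < p.s) : 0 < p.Δ := Real.sqrt_pos.mpr (by positivity)

lemma Δ_sq (hs : 0 < p.s) : (p.Δ : ℂ) ^ 2 = (p.d : ℂ) ^ 2 + (p.s : ℂ) ^ 2 := by
  have : p.Δ ^ 2 = p.d ^ 2 + p.s ^ 2 := Real.sq_sqrt (by positivity)
  exact_mod_cast this

lemma modePair_eq (hs : 0 < p.s) (m : ℤ) (γ : ℂ) :
    p.modePair m γ = (p.Δ : ℂ) ^ 2 * ((γ - p.lamPlus m) * (γ - p.lamMinus m)) := by
  have hΔ : (p.Δ : ℂ) ≠ 0 := by exact_mod_cast (p.Δ_pos hs).ne'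
  have hz := p.zeta_sq (p.f m)
  have hΔ2 := p.Δ_sq hs
  unfold modePair lamPlus lamMinus
  have hf : (p.f m : ℂ) * p.Δ = p.σ - 2 * Real.pi * m := by
    unfold f; push_cast; field_simp
  have e : (p.Δ : ℂ) ^ 2 * ((γ - (-(p.f m : ℂ) * (p.d / p.Δ : ℝ) + (p.s / p.Δ : ℝ) * p.zeta (p.f m))) *
      (γ - (-(p.f m : ℂ) * (p.d / p.Δ : ℝ) - (p.s / p.Δ : ℝ) * p.zeta (p.f m)))) =
      (p.Δ * γ + p.f m * p.d) ^ 2 - (p.s : ℂ) ^ 2 * p.zeta (p.f m) ^ 2 := by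
    push_cast
    field_simp
    ring
  rw [e, hz]
  have e2 : (p.d : ℂ) * γ + p.σ - 2 * Real.pi * m = p.d * γ + p.f m * p.Δ := by rw [hf]; ring
  rw [e2]
  linear_combination ((p.f m : ℂ) ^ 2 - γ ^ 2) * hΔ2

/-- The same quadratic factor in terms of `s ζ`: it vanishes when one of the arguments
`(s ζ ± (d γ + σ)) / 2` is the multiple `± m π`. -/
lemma modePair_eq_mul (m : ℤ) {γ z : ℂ} (hz : z ^ 2 = p.κ ^ 2 - γ ^ 2) :
    p.modePair m γ = -4 * (((p.s * z + (p.d * γ + p.σ)) / 2 - m * Real.pi) *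
      ((p.s * z - (p.d * γ + p.σ)) / 2 + m * Real.pi)) := by
  unfold modePair
  rw [← hz]
  ring

/-- The dispersion function as a product of sines; `z` may be either root. -/
lemma acoustic_eq_sin_mul_sin {γ z : ℂ} (hz : z ^ 2 = p.κ ^ 2 - γ ^ 2) :
    p.acoustic γ = -2 * (sin ((p.s * z + (p.d * γ + p.σ)) / 2) *
      sin ((p.s * z - (p.d * γ + p.σ)) / 2)) := by
  rw [p.acoustic_eq hz, cos_sub_cos]
  ring

lemma acoustic_eq_zero_of_modePair {m : ℤ} {γ : ℂ} (h : p.modePair m γ = 0) : p.acoustic γ = 0 := by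
  rw [p.modePair_eq_mul m (p.zeta_sq γ)] at h
  rw [p.acoustic_eq_sin_mul_sin (p.zeta_sq γ)]
  rcases mul_eq_zero.mp ((mul_eq_zero.mp h).resolve_left (by norm_num)) with h | h
  · rw [sub_eq_zero] at h
    rw [h, sin_int_mul_pi]; simp
  · rw [add_eq_zero_iff_eq_neg] at h
    rw [h, sin_neg, sin_int_mul_pi]; simp

lemma acoustic_lamPlus (hs : 0 < p.s) (m : ℤ) : p.acoustic (p.lamPlus m) = 0 :=
  p.acoustic_eq_zero_of_modePair (m := m) (by rw [p.modePair_eq hs]; simp)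

lemma acoustic_lamMinus (hs : 0 < p.s) (m : ℤ) : p.acoustic (p.lamMinus m) = 0 :=
  p.acoustic_eq_zero_of_modePair (m := m) (by rw [p.modePair_eq hs]; simp)

lemma lamPlus_ne_zero (hs : 0 < p.s) (h0 : p.acoustic 0 ≠ 0) (m : ℤ) : p.lamPlus m ≠ 0 :=
  fun h => h0 (h ▸ p.acoustic_lamPlus hs m)

lemma lamMinus_ne_zero (hs : 0 < p.s) (h0 : p.acoustic 0 ≠ 0) (m : ℤ) : p.lamMinus m ≠ 0 :=
  fun h => h0 (h ▸ p.acoustic_lamMinus hs m)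

end Cascade

lemma prod_Icc_neg (f : ℤ → ℂ) (M : ℕ) :
    ∏ m ∈ Finset.Icc (-(M : ℤ)) M, f m =
      f 0 * ∏ j ∈ Finset.range M, f ((j : ℤ) + 1) * f (-((j : ℤ) + 1)) := by
  induction M with
  | zero => simp
  | succ M ih =>
    have h : Finset.Icc (-((M + 1 : ℕ) : ℤ)) ((M + 1 : ℕ) : ℤ) =
        insert (-((M : ℤ) + 1)) (insert ((M : ℤ) + 1) (Finset.Icc (-(M : ℤ)) M)) := by
      ext x
      simp only [Finset.mem_Icc, Finset.mem_insert]
      push_cast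
      omega
    rw [h, Finset.prod_insert, Finset.prod_insert, ih, Finset.prod_range_succ]
    · ring
    · simp
    · simp only [Finset.mem_insert, Finset.mem_Icc]
      omega

namespace Cascade

variable (p : Cascade)

/-- Euler's product for the sine, in terms of the pairs of acoustic modes. -/
lemma tendsto_modePair_prod (γ : ℂ) :
    Tendsto (fun M : ℕ => 1 / 2 * (p.modePair 0 γ * ∏ j ∈ Finset.range M,
      (p.modePair ((j : ℤ) + 1) γ * p.modePair (-((j : ℤ) + 1)) γ) /
        (16 * (Real.pi : ℂ) ^ 4 * ((j : ℂ) + 1) ^ 4))) atTop (𝓝 (p.acoustic γ)) := by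
  have hpi : (Real.pi : ℂ) ≠ 0 := by exact_mod_cast Real.pi_ne_zero
  have hz := p.zeta_sq γ
  set A : ℂ := (p.s * p.zeta γ + (p.d * γ + p.σ)) / 2 with hA
  set B : ℂ := (p.s * p.zeta γ - (p.d * γ + p.σ)) / 2 with hB
  have h1 := tendsto_euler_sin_prod (A / Real.pi)
  have h2 := tendsto_euler_sin_prod (B / Real.pi)
  rw [mul_div_cancel₀ _ hpi] at h1 h2
  have h3 := (h1.mul h2).const_mul (-2)
  rw [← p.acoustic_eq_sin_mul_sin hz] at h3
  refine h3.congr fun M => ?_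
  rw [p.modePair_eq_mul 0 hz, ← hA, ← hB]
  rw [show A * (∏ j ∈ Finset.range M, (1 - (A / (Real.pi : ℂ)) ^ 2 / ((j : ℂ) + 1) ^ 2)) *
      (B * ∏ j ∈ Finset.range M, (1 - (B / (Real.pi : ℂ)) ^ 2 / ((j : ℂ) + 1) ^ 2)) =
      A * B * ∏ j ∈ Finset.range M, (1 - (A / (Real.pi : ℂ)) ^ 2 / ((j : ℂ) + 1) ^ 2) *
        (1 - (B / (Real.pi : ℂ)) ^ 2 / ((j : ℂ) + 1) ^ 2) by
    rw [Finset.prod_mul_distrib]; ring]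
  have : ∏ j ∈ Finset.range M, (1 - (A / (Real.pi : ℂ)) ^ 2 / ((j : ℂ) + 1) ^ 2) *
        (1 - (B / (Real.pi : ℂ)) ^ 2 / ((j : ℂ) + 1) ^ 2) = ∏ j ∈ Finset.range M,
      (p.modePair ((j : ℤ) + 1) γ * p.modePair (-((j : ℤ) + 1)) γ) /
        (16 * (Real.pi : ℂ) ^ 4 * ((j : ℂ) + 1) ^ 4) := by
    refine Finset.prod_congr rfl fun j _ => ?_
    rw [p.modePair_eq_mul _ hz, p.modePair_eq_mul _ hz, ← hA, ← hB]
    have hj : ((j : ℂ) + 1) ≠ 0 := Nat.cast_add_one_ne_zero j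
    push_cast
    field_simp
    ring
  rw [this]
  push_cast
  ring

/-- The dispersion function of the acoustic modes is the symmetric limit of the product over its
zeros. -/
lemma tendsto_acoustic_prod (hs : 0 < p.s) (h0 : p.acoustic 0 ≠ 0) (γ : ℂ) :
    Tendsto (fun M : ℕ => ∏ m ∈ Finset.Icc (-(M : ℤ)) M,
      ((1 - γ / p.lamPlus m) * (1 - γ / p.lamMinus m))) atTop
      (𝓝 (p.acoustic γ / p.acoustic 0)) := by
  refine ((p.tendsto_modePair_prod γ).div (p.tendsto_modePair_prod 0) h0).congr fun M => ?_
  have hpi : (Real.pi : ℂ) ≠ 0 := by exact_mod_cast Real.pi_ne_zero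
  have hne : ∀ m, p.modePair m 0 ≠ 0 := fun m h => h0 (p.acoustic_eq_zero_of_modePair h)
  have hq : ∀ m, (1 - γ / p.lamPlus m) * (1 - γ / p.lamMinus m) =
      p.modePair m γ / p.modePair m 0 := by
    intro m
    have hΔ : (p.Δ : ℂ) ≠ 0 := by exact_mod_cast (p.Δ_pos hs).ne'
    have h1 := p.lamPlus_ne_zero hs h0 m
    have h2 := p.lamMinus_ne_zero hs h0 m
    rw [p.modePair_eq hs, p.modePair_eq hs]
    field_simp
    ring
  simp only [Pi.div_apply]
  rw [prod_Icc_neg, mul_div_mul_left _ _ (by norm_num : (1 / 2 : ℂ) ≠ 0), hq, mul_div_mul_comm,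
    ← Finset.prod_div_distrib]
  congr 1
  refine Finset.prod_congr rfl fun j _ => ?_
  rw [hq, hq]
  have hj : ((j : ℂ) + 1) ≠ 0 := Nat.cast_add_one_ne_zero j
  have h1 := hne ((j : ℤ) + 1)
  have h2 := hne (-((j : ℤ) + 1))
  field_simp

/-- On the real axis `ζ` stays within `|κ|` of `i |x|`; the product of the two differences is
`κ²`. -/
lemma norm_zeta_real_sub_le (x : ℝ) : ‖p.zeta x - |x| * I‖ ≤ ‖p.κ‖ := by
  have h1 : (p.zeta x - |x| * I) * (p.zeta x + |x| * I) = p.κ ^ 2 := by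
    have hx : ((|x| : ℝ) : ℂ) ^ 2 = (x : ℂ) ^ 2 := by exact_mod_cast sq_abs x
    have hz := p.zeta_sq x
    linear_combination hz - ((|x| : ℝ) : ℂ) ^ 2 * I_sq + hx
  have h2 : ‖p.zeta x - |x| * I‖ ≤ ‖p.zeta x + |x| * I‖ := by
    rw [← sq_le_sq₀ (norm_nonneg _) (norm_nonneg _), ← normSq_eq_norm_sq, ← normSq_eq_norm_sq,
      normSq_apply, normSq_apply]
    have := upperSqrt_im_nonneg (p.κ ^ 2 - (x : ℂ) ^ 2)
    have h3 : 0 ≤ (p.zeta x).im := this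
    simp
    nlinarith [abs_nonneg x]
  have h3 : ‖p.zeta x - |x| * I‖ ^ 2 ≤ ‖p.κ‖ ^ 2 := by
    rw [← norm_pow p.κ, ← h1, norm_mul, sq]
    gcongr
  exact (sq_le_sq₀ (norm_nonneg _) (norm_nonneg _)).mp h3

/-- The direction of the modes `λ_m⁺` as `m → ∞`. -/
noncomputable def dirRight : ℂ := 2 * Real.pi * (p.d + p.s * I) / (p.Δ : ℂ) ^ 2

/-- The direction of the modes `λ_m⁺` as `m → -∞`. -/
noncomputable def dirLeft : ℂ := 2 * Real.pi * (-p.d + p.s * I) / (p.Δ : ℂ) ^ 2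

lemma dirRight_im_pos (hs : 0 < p.s) : 0 < p.dirRight.im := by
  have h : p.dirRight = ((2 * Real.pi / p.Δ ^ 2 * p.d : ℝ) : ℂ) +
      ((2 * Real.pi / p.Δ ^ 2 * p.s : ℝ) : ℂ) * I := by
    unfold dirRight; push_cast; ring
  have := p.Δ_pos hs
  have := Real.pi_pos
  rw [h, add_im, ofReal_im, im_ofReal_mul, I_im]
  positivity

lemma dirLeft_im_pos (hs : 0 < p.s) : 0 < p.dirLeft.im := by
  have h : p.dirLeft = ((2 * Real.pi / p.Δ ^ 2 * -p.d : ℝ) : ℂ) +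
      ((2 * Real.pi / p.Δ ^ 2 * p.s : ℝ) : ℂ) * I := by
    unfold dirLeft; push_cast; ring
  have := p.Δ_pos hs
  have := Real.pi_pos
  rw [h, add_im, ofReal_im, im_ofReal_mul, I_im]
  positivity

/-- The modes of large index lie close to arithmetic progressions along two rays. -/
lemma exists_norm_lam_sub_le (hs : 0 < p.s) : ∃ C : ℝ, ∀ m : ℤ, ∀ ε : ℝ, |ε| = 1 →
    ‖(-(p.f m : ℂ) * (p.d / p.Δ : ℝ) + ε * ((p.s / p.Δ : ℝ) * p.zeta (p.f m))) -
      2 * Real.pi * (m * p.d + ε * |(m : ℝ)| * p.s * I) / (p.Δ : ℂ) ^ 2‖ ≤ C := by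
  have hΔp := p.Δ_pos hs
  have hΔ : (p.Δ : ℂ) ≠ 0 := by exact_mod_cast hΔp.ne'
  refine ⟨|p.σ| * |p.d| / p.Δ ^ 2 + (p.s / p.Δ * ‖p.κ‖ + p.s / p.Δ * (|p.σ| / p.Δ)),
    fun m ε hε => ?_⟩
  have e : (-(p.f m : ℂ) * (p.d / p.Δ : ℝ) + ε * ((p.s / p.Δ : ℝ) * p.zeta (p.f m))) -
      2 * Real.pi * (m * p.d + ε * |(m : ℝ)| * p.s * I) / (p.Δ : ℂ) ^ 2 =
      ((-(p.σ * p.d / p.Δ ^ 2) : ℝ) : ℂ) +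
      (((ε * (p.s / p.Δ) : ℝ) : ℂ) * (p.zeta (p.f m) - |p.f m| * I) +
      ((ε * (p.s / p.Δ) * (|p.f m| - 2 * Real.pi * |(m : ℝ)| / p.Δ) : ℝ) : ℂ) * I) := by
    have hf : (p.f m : ℂ) = (p.σ - 2 * Real.pi * m) / p.Δ := by unfold f; push_cast; rfl
    push_cast
    rw [hf]
    field_simp
    ring
  rw [e]
  have hf : |(|p.f m| - 2 * Real.pi * |(m : ℝ)| / p.Δ)| ≤ |p.σ| / p.Δ := by
    have h1 : 2 * Real.pi * |(m : ℝ)| / p.Δ = |(-(2 * Real.pi * m / p.Δ))| := by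
      rw [abs_neg, abs_div, abs_mul, abs_of_pos hΔp, abs_of_pos Real.two_pi_pos]
    rw [h1]
    refine (abs_abs_sub_abs_le _ _).trans (le_of_eq ?_)
    unfold f
    rw [show (p.σ - 2 * Real.pi * m) / p.Δ - -(2 * Real.pi * m / p.Δ) = p.σ / p.Δ by ring, abs_div,
      abs_of_pos hΔp]
  refine (norm_add_le _ _).trans (add_le_add ?_ ((norm_add_le _ _).trans (add_le_add ?_ ?_)))
  · rw [norm_real, Real.norm_eq_abs, abs_neg, abs_div, abs_mul, abs_of_pos (pow_pos hΔp 2)]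
  · rw [norm_mul, norm_real, Real.norm_eq_abs, abs_mul, hε, one_mul, abs_of_pos (by positivity)]
    gcongr
    exact p.norm_zeta_real_sub_le _
  · rw [norm_mul, norm_real, Real.norm_eq_abs, abs_mul, abs_mul, hε, one_mul, norm_I, mul_one,
      abs_of_pos (by positivity : 0 < p.s / p.Δ)]
    gcongr

lemma follows_of_bound {a b : ℂ} {u : ℕ → ℂ} {C : ℝ} (h0 : ∀ m, u m ≠ 0)
    (h : ∀ m : ℕ, ‖u m - (a * m + b)‖ ≤ C) : Follows a u := by
  refine ⟨h0, C + ‖b‖, fun m => ?_⟩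
  have hC : 0 ≤ C := (norm_nonneg _).trans (h 0)
  have h1 : 1 ≤ √((m : ℝ) + 1) := Real.one_le_sqrt.mpr (by linarith [(Nat.cast_nonneg m : (0 : ℝ) ≤ m)])
  have h2 : ‖u m - a * m‖ ≤ C + ‖b‖ := by
    have := norm_add_le (u m - (a * m + b)) b
    rw [show u m - (a * m + b) + b = u m - a * m by ring] at this
    linarith [h m]
  exact h2.trans (le_mul_of_one_le_right (by positivity) h1)

/-- The modes `λ_m⁺` go off in the directions `dirRight` for `m → ∞` and `dirLeft` for `m → -∞`.
-/
lemma follows_lamPlus (hs : 0 < p.s) (h0 : p.acoustic 0 ≠ 0) :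
    Follows p.dirRight (fun m => p.lamPlus ((m : ℤ) + 1)) ∧
      Follows p.dirLeft (fun m => p.lamPlus (-((m : ℤ) + 1))) := by
  obtain ⟨C, hC⟩ := p.exists_norm_lam_sub_le hs
  constructor
  · refine follows_of_bound (b := p.dirRight) (C := C) (fun m => p.lamPlus_ne_zero hs h0 _) fun m => ?_
    have := hC ((m : ℤ) + 1) 1 (by simp)
    have habs : |((((m : ℤ) + 1 : ℤ)) : ℝ)| = m + 1 := by push_cast; exact abs_of_pos (by positivity)
    rw [habs] at this
    refine le_of_eq_of_le (congrArg norm ?_) this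
    unfold lamPlus dirRight
    push_cast
    ring
  · refine follows_of_bound (b := p.dirLeft) (C := C) (fun m => p.lamPlus_ne_zero hs h0 _) fun m => ?_
    have := hC (-((m : ℤ) + 1)) 1 (by simp)
    have habs : |(((-((m : ℤ) + 1) : ℤ)) : ℝ)| = m + 1 := by
      push_cast; rw [abs_of_neg] <;> linarith [(Nat.cast_nonneg m : (0 : ℝ) ≤ m)]
    rw [habs] at this
    refine le_of_eq_of_le (congrArg norm ?_) this
    unfold lamPlus dirLeft
    push_cast
    ring

/-- The modes `λ_m⁻` have the opposite directions, with the two sides interchanged. -/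
lemma follows_lamMinus (hs : 0 < p.s) (h0 : p.acoustic 0 ≠ 0) :
    Follows (-p.dirLeft) (fun m => p.lamMinus ((m : ℤ) + 1)) ∧
      Follows (-p.dirRight) (fun m => p.lamMinus (-((m : ℤ) + 1))) := by
  obtain ⟨C, hC⟩ := p.exists_norm_lam_sub_le hs
  constructor
  · refine follows_of_bound (b := -p.dirLeft) (C := C) (fun m => p.lamMinus_ne_zero hs h0 _) fun m => ?_
    have := hC ((m : ℤ) + 1) (-1) (by simp)
    have habs : |((((m : ℤ) + 1 : ℤ)) : ℝ)| = m + 1 := by push_cast; exact abs_of_pos (by positivity)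
    rw [habs] at this
    refine le_of_eq_of_le (congrArg norm ?_) this
    unfold lamMinus dirLeft
    push_cast
    ring
  · refine follows_of_bound (b := -p.dirRight) (C := C) (fun m => p.lamMinus_ne_zero hs h0 _) fun m => ?_
    have := hC (-((m : ℤ) + 1)) (-1) (by simp)
    have habs : |(((-((m : ℤ) + 1) : ℤ)) : ℝ)| = m + 1 := by
      push_cast; rw [abs_of_neg] <;> linarith [(Nat.cast_nonneg m : (0 : ℝ) ≤ m)]
    rw [habs] at this
    refine le_of_eq_of_le (congrArg norm ?_) this
    unfold lamMinus dirRight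
    push_cast
    ring

end Cascade

/-! ### Power asymptotics and the size of the kernel -/

/-- `f z ∼ c z ^ n` with relative error `O(1 / z)` along the filter `l`. -/
def PowAsymp (l : Filter ℂ) (f : ℂ → ℂ) (c : ℂ) (n : ℤ) : Prop :=
  (fun z => f z / (c * z ^ n) - 1) =O[l] fun z => z⁻¹

namespace PowAsymp

variable {l : Filter ℂ} {f g : ℂ → ℂ} {c d : ℂ} {n k : ℤ}

lemma eventually_ne (hl : l ≤ Bornology.cobounded ℂ) : ∀ᶠ z in l, z ≠ 0 :=
  hl ((tendsto_norm_cobounded_atTop.eventually_gt_atTop 0).mono fun _ h => norm_pos_iff.mp h)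

lemma tendsto_inv (hl : l ≤ Bornology.cobounded ℂ) : Tendsto (fun z : ℂ => z⁻¹) l (𝓝 0) :=
  tendsto_inv₀_cobounded.mono_left hl

lemma tendsto_one (hl : l ≤ Bornology.cobounded ℂ) (hf : PowAsymp l f c n) :
    Tendsto (fun z => f z / (c * z ^ n)) l (𝓝 1) := by
  have := (hf.trans_tendsto (tendsto_inv hl)).add_const 1
  simpa using this

lemma eventually_ne_zero (hl : l ≤ Bornology.cobounded ℂ) (hf : PowAsymp l f c n) :
    ∀ᶠ z in l, f z ≠ 0 := by
  filter_upwards [(tendsto_one hl hf).eventually_ne one_ne_zero] with z hz h0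
  exact hz (by rw [h0, zero_div])

lemma mul (hl : l ≤ Bornology.cobounded ℂ) (hf : PowAsymp l f c n) (hg : PowAsymp l g d k) :
    PowAsymp l (fun z => f z * g z) (c * d) (n + k) := by
  have h1 : (fun z => (f z / (c * z ^ n) - 1) * (g z / (d * z ^ k))) =O[l] fun z => z⁻¹ := by
    have := Asymptotics.IsBigO.mul hf ((tendsto_one hl hg).isBigO_one ℂ)
    simpa using this
  refine (Asymptotics.IsBigO.add h1 hg).congr' ?_ EventuallyEq.rfl
  filter_upwards [eventually_ne hl] with z hz
  rw [zpow_add₀ hz]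
  have e : f z * g z / (c * d * (z ^ n * z ^ k)) = f z / (c * z ^ n) * (g z / (d * z ^ k)) := by
    rw [div_mul_div_comm]; congr 1; ring
  rw [e]; ring

lemma inv (hl : l ≤ Bornology.cobounded ℂ) (hf : PowAsymp l f c n) :
    PowAsymp l (fun z => (f z)⁻¹) c⁻¹ (-n) := by
  have h1 : Tendsto (fun z => (f z / (c * z ^ n))⁻¹) l (𝓝 1) := by
    simpa using (tendsto_one hl hf).inv₀ one_ne_zero
  have h2 : (fun z => -(f z / (c * z ^ n) - 1) * (f z / (c * z ^ n))⁻¹) =O[l] fun z => z⁻¹ := by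
    have := (Asymptotics.IsBigO.neg_left hf).mul (h1.isBigO_one ℂ)
    simpa using this
  refine h2.congr' ?_ EventuallyEq.rfl
  filter_upwards [(tendsto_one hl hf).eventually_ne one_ne_zero] with z hz
  have e : (f z)⁻¹ / (c⁻¹ * z ^ (-n)) = (f z / (c * z ^ n))⁻¹ := by
    simp only [zpow_neg, div_eq_mul_inv, mul_inv, inv_inv]
  rw [e, neg_mul, sub_mul, mul_inv_cancel₀ hz]
  ring

lemma const (hc : c ≠ 0) : PowAsymp l (fun _ => c) c 0 := by
  unfold PowAsymp
  simp only [zpow_zero, mul_one, div_self hc, sub_self]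
  exact Asymptotics.isBigO_zero _ _

lemma congr' (hf : PowAsymp l f c n) (h : f =ᶠ[l] g) : PowAsymp l g c n := by
  refine Asymptotics.IsBigO.congr' hf ?_ EventuallyEq.rfl
  filter_upwards [h] with z hz
  rw [hz]

/-- An additive error of relative size `1 / z` does not change the asymptotics. -/
lemma add_small (hl : l ≤ Bornology.cobounded ℂ) (hc : c ≠ 0) (hf : PowAsymp l f c n)
    (hg : g =O[l] fun z => z ^ (n - 1)) : PowAsymp l (fun z => f z + g z) c n := by
  have h1 : (fun z => g z / (c * z ^ n)) =O[l] fun z => z⁻¹ := by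
    have h2 := hg.mul (Asymptotics.isBigO_refl (fun z : ℂ => (c * z ^ n)⁻¹) l)
    have h3 : (fun z : ℂ => z ^ (n - 1) * (c * z ^ n)⁻¹) =O[l] fun z => z⁻¹ := by
      refine ((Asymptotics.isBigO_refl (fun z : ℂ => z⁻¹) l).const_mul_left c⁻¹).congr' ?_
        EventuallyEq.rfl
      filter_upwards [eventually_ne hl] with z hz
      rw [zpow_sub_one₀ hz]
      have := zpow_ne_zero n hz
      field_simp
    simpa [div_eq_mul_inv] using h2.trans h3
  refine (Asymptotics.IsBigO.add hf h1).congr_left fun z => ?_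
  rw [add_div]; ring

lemma prod (hl : l ≤ Bornology.cobounded ℂ) {ι : Type*} (s : Finset ι) (f : ι → ℂ → ℂ)
    (h : ∀ i ∈ s, ∃ c ≠ 0, ∃ n, PowAsymp l (f i) c n ) :
    ∃ c ≠ 0, ∃ n, PowAsymp l (fun z => ∏ i ∈ s, f i z) c n := by
  classical
  induction s using Finset.induction_on with
  | empty => exact ⟨1, one_ne_zero, 0, by simpa using const one_ne_zero⟩
  | insert a s ha ih =>
    obtain ⟨c, hc, n, h1⟩ := ih fun i hi => h i (Finset.mem_insert_of_mem hi)
    obtain ⟨d, hd, k, h2⟩ := h a (Finset.mem_insert_self a s)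
    refine ⟨d * c, mul_ne_zero hd hc, k + n, (h2.mul hl h1).congr' ?_⟩
    filter_upwards with z
    rw [Finset.prod_insert ha]

lemma polynomial (hl : l ≤ Bornology.cobounded ℂ) {P : Polynomial ℂ} (hP : P ≠ 0) :
    PowAsymp l (fun z => P.eval z) P.leadingCoeff P.natDegree := by
  have hlc : P.leadingCoeff ≠ 0 := Polynomial.leadingCoeff_ne_zero.mpr hP
  have h1 : (fun z : ℂ => ∑ i ∈ Finset.range P.natDegree,
      P.coeff i * z ^ i / (P.leadingCoeff * z ^ P.natDegree)) =O[l] fun z => z⁻¹ := by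
    refine Asymptotics.IsBigO.fun_sum fun i hi => ?_
    have hi' := Finset.mem_range.mp hi
    have h2 : (fun z : ℂ => (P.coeff i / P.leadingCoeff) * (z⁻¹ * (z⁻¹) ^ (P.natDegree - i - 1)))
        =O[l] fun z => z⁻¹ := by
      have h3 := ((Asymptotics.isBigO_refl (fun z : ℂ => z⁻¹) l).mul
        (((tendsto_inv hl).pow (P.natDegree - i - 1)).isBigO_one ℂ)).const_mul_left
          (P.coeff i / P.leadingCoeff)
      simpa using h3
    refine h2.congr' ?_ EventuallyEq.rfl
    filter_upwards [eventually_ne hl] with z hz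
    have e : z ^ P.natDegree = z ^ i * (z * z ^ (P.natDegree - i - 1)) := by
      rw [← pow_succ', ← pow_add]; congr 1; omega
    rw [e, inv_pow]
    have := pow_ne_zero (P.natDegree - i - 1) hz
    field_simp
  refine h1.congr' ?_ EventuallyEq.rfl
  filter_upwards [eventually_ne hl] with z hz
  rw [Polynomial.eval_eq_sum_range, Finset.sum_range_succ, add_div, Finset.sum_div,
    Polynomial.coeff_natDegree, zpow_natCast, div_self (mul_ne_zero hlc (pow_ne_zero _ hz))]
  ring

end PowAsymp

open Polynomial in
/-- A quadratic polynomial given by its coefficients. -/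
noncomputable def quad (a b c : ℂ) : ℂ[X] := C c * X ^ 2 + C b * X + C a

lemma quad_eval (a b c z : ℂ) : (quad a b c).eval z = a + b * z + c * z ^ 2 := by
  simp [quad]; ring

lemma PowAsymp.quadratic {l : Filter ℂ} (hl : l ≤ Bornology.cobounded ℂ) (a b : ℂ) {c : ℂ}
    (hc : c ≠ 0) : PowAsymp l (fun z => a + b * z + c * z ^ 2) c 2 := by
  have h1 : (quad a b c).natDegree = 2 := Polynomial.natDegree_quadratic hc
  have h2 : (quad a b c).leadingCoeff = c := Polynomial.leadingCoeff_quadratic hc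
  have h := polynomial hl (P := quad a b c) (fun h => by rw [h] at h1; simp at h1)
  simp only [quad_eval, h1, h2] at h
  exact h

lemma PowAsymp.linear {l : Filter ℂ} (hl : l ≤ Bornology.cobounded ℂ) (a : ℂ) {b : ℂ}
    (hb : b ≠ 0) : PowAsymp l (fun z => a + b * z) b 1 := by
  have h0 : quad a b 0 = Polynomial.C b * Polynomial.X + Polynomial.C a := by simp [quad]
  have h1 : (quad a b 0).natDegree = 1 := by rw [h0]; exact Polynomial.natDegree_linear hb
  have h2 : (quad a b 0).leadingCoeff = b := by rw [h0]; exact Polynomial.leadingCoeff_linear hb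
  have h := polynomial hl (P := quad a b 0) (fun h => by rw [h] at h1; simp at h1)
  simpa only [quad_eval, h1, h2, zero_mul, add_zero, Nat.cast_one] using h

/-- The cotangent is bounded in terms of the distance to a multiple of `π`. -/
lemma norm_cos_mul_le (A : ℂ) : ∃ k : ℤ,
    ‖cos A‖ * ‖A - k * Real.pi‖ ≤ ‖sin A‖ * (‖A - k * Real.pi‖ + 2) := by
  set k : ℤ := round (A.re / Real.pi) with hk
  refine ⟨k, ?_⟩
  set w : ℂ := A - k * Real.pi with hw
  have hpi := Real.pi_pos
  have hcos : ‖cos A‖ = ‖cos w‖ := by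
    rw [hw, cos_antiperiodic.sub_int_mul_eq k]
    rcases Int.even_or_odd k with h | h
    · simp [Int.negOnePow_even k h]
    · simp [Int.negOnePow_odd k h]
  have hsin : ‖sin A‖ = ‖sin w‖ := by
    rw [hw, sin_antiperiodic.sub_int_mul_eq k]
    rcases Int.even_or_odd k with h | h
    · simp [Int.negOnePow_even k h]
    · simp [Int.negOnePow_odd k h]
  set x := w.re with hx
  set y := w.im with hy
  have hxle : |x| ≤ Real.pi / 2 := by
    have h1 := abs_sub_round (A.re / Real.pi)
    have h2 : x = Real.pi * (A.re / Real.pi - round (A.re / Real.pi)) := by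
      rw [hx, hw, hk]
      simp
      field_simp
    rw [h2, abs_mul, abs_of_pos hpi]
    nlinarith
  have hw' : w = x + y * I := (re_add_im w).symm
  have es : ‖sin w‖ ^ 2 = Real.sin x ^ 2 + Real.sinh y ^ 2 := by
    have h1 := Real.sin_sq_add_cos_sq x
    have h2 := Real.cosh_sq y
    have e : sin w = (Real.sin x * Real.cosh y : ℝ) + (Real.cos x * Real.sinh y : ℝ) * I := by
      rw [hw', sin_add_mul_I]; push_cast; ring
    rw [e, ← normSq_eq_norm_sq, normSq_add_mul_I, mul_pow, mul_pow, h2]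
    linear_combination (Real.sinh y ^ 2) * h1
  have ec : ‖cos w‖ ^ 2 = Real.cos x ^ 2 + Real.sinh y ^ 2 := by
    have h1 := Real.sin_sq_add_cos_sq x
    have h2 := Real.cosh_sq y
    have e : cos w = (Real.cos x * Real.cosh y : ℝ) + (-(Real.sin x * Real.sinh y) : ℝ) * I := by
      rw [hw', cos_add_mul_I]; push_cast; ring
    rw [e, ← normSq_eq_norm_sq, normSq_add_mul_I, mul_pow, neg_sq, mul_pow, h2]
    linear_combination (Real.sinh y ^ 2) * h1
  have hcs : ‖cos w‖ ≤ ‖sin w‖ + 1 := by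
    have := Real.cos_sq_le_one x
    have := sq_nonneg (Real.sin x)
    nlinarith [norm_nonneg (cos w), norm_nonneg (sin w)]
  have hws : ‖w‖ ≤ 2 * ‖sin w‖ := by
    have e : ‖w‖ ^ 2 = x ^ 2 + y ^ 2 := by rw [← normSq_eq_norm_sq, normSq_apply]; ring
    have h1 : |x| ≤ 2 * |Real.sin x| := by
      have := Real.mul_abs_le_abs_sin hxle
      rw [div_mul_eq_mul_div, div_le_iff₀ hpi] at this
      nlinarith [abs_nonneg (Real.sin x), Real.pi_lt_four]
    have h2 : |y| ≤ |Real.sinh y| := by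
      rw [Real.abs_sinh]
      exact Real.self_le_sinh_iff.mpr (abs_nonneg y)
    have h3 : x ^ 2 ≤ 4 * Real.sin x ^ 2 := by
      rw [← sq_abs x, ← sq_abs (Real.sin x)]
      nlinarith [abs_nonneg x]
    have h4 : y ^ 2 ≤ Real.sinh y ^ 2 := sq_le_sq.mpr h2
    nlinarith [norm_nonneg w, norm_nonneg (sin w), sq_nonneg (Real.sinh y)]
  rw [hcos, hsin]
  nlinarith [norm_nonneg w, norm_nonneg (sin w)]

namespace Cascade

variable (p : Cascade)

/-- The kernel in terms of two cotangents; `z` may be either root, so that no branch has to be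
chosen. -/
lemma K_eq_cot {γ z : ℂ} (hz : z ^ 2 = p.κ ^ 2 - γ ^ 2) (hγ : p.acoustic γ ≠ 0) :
    4 * Real.pi * p.K γ = p.symbol γ - z / 2 *
      (cos ((p.s * z + (p.d * γ + p.σ)) / 2) / sin ((p.s * z + (p.d * γ + p.σ)) / 2) +
       cos ((p.s * z - (p.d * γ + p.σ)) / 2) / sin ((p.s * z - (p.d * γ + p.σ)) / 2)) := by
  have hD := p.acoustic_eq_sin_mul_sin hz
  set A : ℂ := (p.s * z + (p.d * γ + p.σ)) / 2 with hA
  set B : ℂ := (p.s * z - (p.d * γ + p.σ)) / 2 with hB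
  have hAB : (p.s : ℂ) * z = A + B := by rw [hA, hB]; ring
  have hA0 : sin A ≠ 0 := fun h => hγ (by rw [hD, h]; ring)
  have hB0 : sin B ≠ 0 := fun h => hγ (by rw [hD, h]; ring)
  have hpi : (Real.pi : ℂ) ≠ 0 := by exact_mod_cast Real.pi_ne_zero
  unfold K
  rw [p.zeta_mul_sin_eq hz, hD, hAB, sin_add]
  field_simp
  ring

lemma norm_zeta_le (γ : ℂ) : ‖p.zeta γ‖ ≤ ‖p.κ‖ + ‖γ‖ := by
  have h1 : ‖p.zeta γ‖ ^ 2 ≤ ‖p.κ‖ ^ 2 + ‖γ‖ ^ 2 := by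
    rw [← norm_pow, p.zeta_sq, ← norm_pow, ← norm_pow]
    exact norm_sub_le _ _
  nlinarith [norm_nonneg p.κ, norm_nonneg γ, norm_nonneg (p.zeta γ)]

lemma norm_symbol_le (γ : ℂ) : ‖p.symbol γ‖ ≤ (‖p.μ₀‖ + ‖p.μ₁‖ + ‖p.μ₂‖) * (1 + ‖γ‖) ^ 2 := by
  unfold symbol
  have h1 : ‖p.μ₀ - I * p.μ₁ * γ - p.μ₂ * γ ^ 2‖ ≤ ‖p.μ₀‖ + ‖p.μ₁‖ * ‖γ‖ + ‖p.μ₂‖ * ‖γ‖ ^ 2 := by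
    refine (norm_sub_le _ _).trans (add_le_add ((norm_sub_le _ _).trans (add_le_add le_rfl ?_)) ?_)
    · simp
    · simp
  refine h1.trans ?_
  nlinarith [norm_nonneg γ, norm_nonneg p.μ₀, norm_nonneg p.μ₁, norm_nonneg p.μ₂,
    mul_nonneg (norm_nonneg p.μ₀) (norm_nonneg γ), mul_nonneg (norm_nonneg p.μ₁) (norm_nonneg γ),
    mul_nonneg (norm_nonneg p.μ₂) (norm_nonneg γ),
    mul_nonneg (norm_nonneg p.μ₀) (sq_nonneg ‖γ‖), mul_nonneg (norm_nonneg p.μ₁) (sq_nonneg ‖γ‖)]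

/-- If the product of the distances of `A` to `k π` and of `B` to `-k π` is bounded below for all
`k`, then near `k π` the second distance is at most about `|A + B|`, so that the first is not
small and the cotangent grows at most like `A + B`. -/
lemma norm_cot_le {A B : ℂ} {ρ Z : ℝ} (hρ : 0 < ρ) (hZ : ‖A + B‖ ≤ Z) (hA : sin A ≠ 0)
    (h : ∀ k : ℤ, ρ ≤ ‖(A - k * Real.pi) * (B + k * Real.pi)‖) :
    ‖cos A / sin A‖ ≤ 3 + 2 * ((Z + 1) / ρ) := by
  obtain ⟨k, hk⟩ := norm_cos_mul_le A
  have hk' := h k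
  rw [norm_mul] at hk'
  have hZ0 : 0 ≤ Z := (norm_nonneg _).trans hZ
  set α := ‖A - k * Real.pi‖ with hα
  have hα0 : 0 < α := by
    rcases (norm_nonneg (A - k * Real.pi)).eq_or_lt with h0 | h0
    · rw [hα, ← h0, zero_mul] at hk'; linarith
    · exact h0
  have hs : 0 < ‖sin A‖ := norm_pos_iff.mpr hA
  have h1 : ‖cos A / sin A‖ ≤ 1 + 2 / α := by
    rw [norm_div, div_le_iff₀ hs]
    have : (1 + 2 / α) * ‖sin A‖ = ‖sin A‖ * (α + 2) / α := by field_simp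
    rw [this, le_div_iff₀ hα0]
    exact hk
  have h2 : 1 / α ≤ 1 + (Z + 1) / ρ := by
    rcases le_total 1 α with h | h
    · have : 1 / α ≤ 1 := by rw [div_le_one hα0]; exact h
      have : 0 ≤ (Z + 1) / ρ := by positivity
      linarith
    · have h3 : ‖B + k * Real.pi‖ ≤ Z + 1 := by
        have := norm_sub_le (A + B) (A - k * Real.pi)
        rw [show A + B - (A - k * Real.pi) = B + k * Real.pi by ring] at this
        linarith
      have h4 : ρ ≤ α * (Z + 1) := hk'.trans (by gcongr)
      have : 1 / α ≤ (Z + 1) / ρ := by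
        rw [div_le_div_iff₀ hα0 hρ]; linarith
      linarith
  have : 2 / α = 2 * (1 / α) := by ring
  linarith

/-- The kernel is polynomially bounded away from its poles. -/
lemma exists_norm_K_le (hs : 0 < p.s) {δ : ℝ} (hδ : 0 < δ) :
    ∃ C : ℝ, ∀ γ : ℂ, (∀ m, δ ≤ ‖γ - p.lamPlus m‖) → (∀ m, δ ≤ ‖γ - p.lamMinus m‖) →
      ‖p.K γ‖ ≤ C * (1 + ‖γ‖) ^ 2 := by
  have hΔ := p.Δ_pos hs
  set ρ : ℝ := p.Δ ^ 2 * δ ^ 2 / 4 with hρ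
  have hρ0 : 0 < ρ := by positivity
  set Q : ℝ := (1 + ‖p.κ‖) with hQ
  have hQ1 : 1 ≤ Q := by rw [hQ]; linarith [norm_nonneg p.κ]
  refine ⟨(‖p.μ₀‖ + ‖p.μ₁‖ + ‖p.μ₂‖) + Q * (3 + 2 * ((p.s * Q + 1) / ρ)), fun γ h1 h2 => ?_⟩
  have hz := p.zeta_sq γ
  set A : ℂ := (p.s * p.zeta γ + (p.d * γ + p.σ)) / 2 with hA
  set B : ℂ := (p.s * p.zeta γ - (p.d * γ + p.σ)) / 2 with hB
  have hAB : A + B = p.s * p.zeta γ := by rw [hA, hB]; ring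
  -- the product of the distances of `γ` to the two modes of index `k` is a constant times this
  -- product
  have hq : ∀ k : ℤ, ρ ≤ ‖(A - k * Real.pi) * (B + k * Real.pi)‖ := by
    intro k
    have e := p.modePair_eq_mul k hz
    rw [p.modePair_eq hs, ← hA, ← hB] at e
    have e' := congrArg norm e
    rw [norm_mul, norm_mul (-4 : ℂ), norm_pow, norm_real, Real.norm_of_nonneg hΔ.le, norm_mul,
      norm_neg] at e'
    have h4 : ‖(4 : ℂ)‖ = 4 := by simp
    rw [h4] at e'
    have h5 : δ ^ 2 ≤ ‖γ - p.lamPlus k‖ * ‖γ - p.lamMinus k‖ := by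
      rw [sq]; exact mul_le_mul (h1 k) (h2 k) hδ.le (norm_nonneg _)
    have h6 : p.Δ ^ 2 * δ ^ 2 ≤ p.Δ ^ 2 * (‖γ - p.lamPlus k‖ * ‖γ - p.lamMinus k‖) := by gcongr
    rw [hρ]; linarith
  have hsA : sin A ≠ 0 := by
    intro h0
    obtain ⟨k, hk⟩ := sin_eq_zero_iff.mp h0
    have := hq k
    rw [hk] at this
    simp at this
    linarith
  have hsB : sin B ≠ 0 := by
    intro h0
    obtain ⟨k, hk⟩ := sin_eq_zero_iff.mp h0
    have := hq (-k)
    rw [hk] at this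
    simp at this
    linarith
  have hD : p.acoustic γ ≠ 0 := by
    rw [p.acoustic_eq_sin_mul_sin hz, ← hA, ← hB]
    exact mul_ne_zero (by norm_num) (mul_ne_zero hsA hsB)
  have hζ : ‖p.zeta γ‖ ≤ Q * (1 + ‖γ‖) := by
    refine (p.norm_zeta_le γ).trans ?_
    rw [hQ]; nlinarith [norm_nonneg p.κ, norm_nonneg γ]
  have hZ : ‖A + B‖ ≤ p.s * (Q * (1 + ‖γ‖)) := by
    rw [hAB, norm_mul, norm_real, Real.norm_of_nonneg hs.le]
    gcongr
  have hγ1 : 1 ≤ 1 + ‖γ‖ := by linarith [norm_nonneg γ]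
  have hcA := norm_cot_le hρ0 hZ hsA hq
  have hcB := norm_cot_le (A := B) (B := A) (Z := p.s * (Q * (1 + ‖γ‖))) hρ0
    (by rwa [add_comm]) hsB (fun k => by
    have := hq (-k)
    rw [mul_comm] at this
    refine this.trans (le_of_eq ?_)
    congr 1
    push_cast
    ring)
  have hfac : 3 + 2 * ((p.s * (Q * (1 + ‖γ‖)) + 1) / ρ) ≤
      (3 + 2 * ((p.s * Q + 1) / ρ)) * (1 + ‖γ‖) := by
    have h3 : (p.s * (Q * (1 + ‖γ‖)) + 1) / ρ ≤ (p.s * Q + 1) / ρ * (1 + ‖γ‖) := by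
      rw [div_mul_eq_mul_div]
      gcongr
      nlinarith
    nlinarith
  have hK := p.K_eq_cot hz hD
  rw [← hA, ← hB] at hK
  have hnorm : ‖4 * Real.pi * p.K γ‖ = 4 * Real.pi * ‖p.K γ‖ := by
    rw [norm_mul, norm_mul, norm_real, Real.norm_of_nonneg Real.pi_pos.le]; simp
  have hmain : 4 * Real.pi * ‖p.K γ‖ ≤ (‖p.μ₀‖ + ‖p.μ₁‖ + ‖p.μ₂‖) * (1 + ‖γ‖) ^ 2 +
      Q * (1 + ‖γ‖) / 2 * ((3 + 2 * ((p.s * Q + 1) / ρ)) * (1 + ‖γ‖) +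
        (3 + 2 * ((p.s * Q + 1) / ρ)) * (1 + ‖γ‖)) := by
    rw [← hnorm, hK]
    refine (norm_sub_le _ _).trans (add_le_add (p.norm_symbol_le γ) ?_)
    rw [norm_mul, norm_div]
    have h4 : ‖(2 : ℂ)‖ = 2 := by simp
    rw [h4]
    gcongr
    exact (norm_add_le _ _).trans (add_le_add (hcA.trans hfac) (hcB.trans hfac))
  have hpi : 1 ≤ 4 * Real.pi := by linarith [Real.pi_gt_three]
  have : ‖p.K γ‖ ≤ 4 * Real.pi * ‖p.K γ‖ := le_mul_of_one_le_left (norm_nonneg _) hpi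
  refine this.trans (hmain.trans (le_of_eq ?_))
  ring

/-- In the upper half-plane the cotangent tends to `-i` exponentially. -/
lemma norm_cot_add_I_le {A : ℂ} (hA : 1 ≤ A.im) :
    sin A ≠ 0 ∧ ‖cos A / sin A + I‖ ≤ 4 * Real.exp (-2 * A.im) := by
  have h1 : ‖exp (A * I)‖ = Real.exp (-A.im) := by rw [norm_exp]; simp
  have h2 : ‖exp (-A * I)‖ = Real.exp A.im := by rw [norm_exp]; simp
  have h3 : Real.exp A.im / 4 ≤ ‖sin A‖ := by
    have e : 2 * sin A = (exp (-A * I) - exp (A * I)) * I := two_sin A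
    have e' := congrArg norm e
    rw [norm_mul, norm_mul, norm_I, mul_one] at e'
    have h4 := norm_sub_norm_le (exp (-A * I)) (exp (A * I))
    rw [h1, h2] at h4
    have h5 : Real.exp (-A.im) ≤ Real.exp A.im / 2 := by
      have h6 : Real.exp (-A.im) ≤ 1 := Real.exp_le_one_iff.mpr (by linarith)
      have h7 : A.im + 1 ≤ Real.exp A.im := Real.add_one_le_exp _
      linarith
    have h8 : ‖(2 : ℂ)‖ = 2 := by simp
    rw [h8] at e'
    linarith
  have hs : sin A ≠ 0 := fun h => by
    rw [h, norm_zero] at h3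
    linarith [Real.exp_pos A.im]
  refine ⟨hs, ?_⟩
  have e : cos A / sin A + I = exp (A * I) / sin A := by
    rw [exp_mul_I]
    field_simp
  rw [e, norm_div, h1, div_le_iff₀ (norm_pos_iff.mpr hs)]
  calc Real.exp (-A.im) = 4 * Real.exp (-2 * A.im) * (Real.exp A.im / 4) := by
        rw [show 4 * Real.exp (-2 * A.im) * (Real.exp A.im / 4) =
          Real.exp (-2 * A.im) * Real.exp A.im by ring, ← Real.exp_add]
        congr 1; ring
    _ ≤ _ := by gcongr

/-- A square root of `γ² - κ²` close to `± γ`. -/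
lemma exists_root_near (ε : ℝ) (hε : |ε| = 1) (γ : ℂ) (hγ : γ ≠ 0) :
    ∃ q : ℂ, q ^ 2 = γ ^ 2 - p.κ ^ 2 ∧ ‖q - ε * γ‖ ≤ ‖p.κ‖ ^ 2 / ‖γ‖ := by
  have hγ0 : 0 < ‖γ‖ := norm_pos_iff.mpr hγ
  have hnorm : ‖(ε : ℂ) * γ‖ = ‖γ‖ := by rw [norm_mul, norm_real, Real.norm_eq_abs, hε, one_mul]
  have hε2 : (ε : ℂ) ^ 2 = 1 := by
    have : ε ^ 2 = 1 := by rw [← sq_abs, hε, one_pow]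
    exact_mod_cast this
  have main : ∀ q : ℂ, q ^ 2 = γ ^ 2 - p.κ ^ 2 → ‖γ‖ ≤ ‖q + ε * γ‖ →
      ‖q - ε * γ‖ ≤ ‖p.κ‖ ^ 2 / ‖γ‖ := by
    intro q hq hle
    have e : (q - ε * γ) * (q + ε * γ) = -p.κ ^ 2 := by
      linear_combination hq - γ ^ 2 * hε2
    have e' := congrArg norm e
    rw [norm_mul, norm_neg, norm_pow] at e'
    rw [le_div_iff₀ hγ0, ← e']
    gcongr
  set q : ℂ := I * p.zeta γ with hq
  have hq2 : q ^ 2 = γ ^ 2 - p.κ ^ 2 := by rw [hq, mul_pow, p.zeta_sq, I_sq]; ring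
  have hsum : 2 * ‖γ‖ ≤ ‖q + ε * γ‖ + ‖-q + ε * γ‖ := by
    have := norm_add_le (q + ε * γ) (-q + ε * γ)
    rw [show q + ε * γ + (-q + ε * γ) = 2 * (ε * γ) by ring, norm_mul, hnorm] at this
    simpa using this
  rcases le_or_gt ‖γ‖ ‖q + ε * γ‖ with h | h
  · exact ⟨q, hq2, main q hq2 h⟩
  · exact ⟨-q, by rw [neg_sq, hq2], main (-q) (by rw [neg_sq, hq2]) (by linarith)⟩

/-- The kernel in a horizontal strip: up to `O(1 / γ)` it is the polynomial `symbol ∓ γ`. -/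
lemma exists_K_strip (hs : 0 < p.s) (ε : ℝ) (hε : |ε| = 1) : ∃ T M : ℝ, ∀ γ : ℂ, |γ.im| < 1 →
    T ≤ ε * γ.re → p.acoustic γ ≠ 0 ∧
      ‖4 * Real.pi * p.K γ - (p.symbol γ - ε * γ)‖ ≤ M / ‖γ‖ := by
  set k : ℝ := ‖p.κ‖ ^ 2 with hk
  have hk0 : 0 ≤ k := by positivity
  refine ⟨max (max 1 k) ((2 * p.s + 2 * |p.d| + 4) / p.s), k + 256 / p.s ^ 2, fun γ hγ hT => ?_⟩
  have hT1 : 1 ≤ ε * γ.re := (le_max_left _ _).trans ((le_max_left _ _).trans hT)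
  have hTk : k ≤ ε * γ.re := (le_max_right _ _).trans ((le_max_left _ _).trans hT)
  have hTs : (2 * p.s + 2 * |p.d| + 4) ≤ ε * γ.re * p.s := by
    have := (le_max_right _ _).trans hT
    rwa [div_le_iff₀ hs] at this
  set x : ℝ := ε * γ.re with hx
  have hxabs : |γ.re| = x := by
    have : |γ.re| = |x| := by rw [hx, abs_mul, hε, one_mul]
    rw [this, abs_of_pos (by linarith)]
  have hxn : x ≤ ‖γ‖ := hxabs ▸ abs_re_le_norm γ
  have hnx : ‖γ‖ ≤ 2 * x := by
    have := norm_le_abs_re_add_abs_im γ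
    rw [hxabs] at this; linarith
  have hγ0 : 0 < ‖γ‖ := by linarith
  obtain ⟨q, hq2, hqγ⟩ := p.exists_root_near ε hε γ (norm_pos_iff.mp hγ0)
  rw [← hk] at hqγ
  have hq1 : ‖q - ε * γ‖ ≤ 1 := hqγ.trans (by rw [div_le_one hγ0]; linarith)
  set z : ℂ := I * q with hz
  have hz2 : z ^ 2 = p.κ ^ 2 - γ ^ 2 := by rw [hz, mul_pow, I_sq, hq2]; ring
  set A : ℂ := (p.s * z + (p.d * γ + p.σ)) / 2 with hA
  set B : ℂ := (p.s * z - (p.d * γ + p.σ)) / 2 with hB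
  -- `Im A` and `Im B` grow linearly, so both cotangents are exponentially close to `-i`
  have hqre : x - 1 ≤ q.re := by
    have h1 := (abs_le.mp ((abs_re_le_norm (q - ε * γ)).trans hq1)).1
    have h2 : (q - ε * γ).re = q.re - x := by simp [hx]
    linarith
  have hAim : A.im = (p.s * q.re + p.d * γ.im) / 2 := by rw [hA, hz]; simp
  have hBim : B.im = (p.s * q.re - p.d * γ.im) / 2 := by rw [hB, hz]; simp
  have hdim : |p.d * γ.im| ≤ |p.d| := by
    rw [abs_mul]; exact mul_le_of_le_one_right (abs_nonneg _) hγ.le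
  have hdim' := abs_le.mp hdim
  have hsq : p.s * (x - 1) ≤ p.s * q.re := by gcongr
  have hA1 : 1 + p.s * x / 4 ≤ 1 + A.im := by rw [hAim]; linarith [hdim'.1]
  have hB1 : 1 + p.s * x / 4 ≤ 1 + B.im := by rw [hBim]; linarith [hdim'.2]
  have hsx : 4 ≤ p.s * x := by linarith [abs_nonneg p.d]
  obtain ⟨hsA, hcA⟩ := norm_cot_add_I_le (A := A) (by linarith)
  obtain ⟨hsB, hcB⟩ := norm_cot_add_I_le (A := B) (by linarith)
  have hD : p.acoustic γ ≠ 0 := by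
    rw [p.acoustic_eq_sin_mul_sin hz2, ← hA, ← hB]
    exact mul_ne_zero (by norm_num) (mul_ne_zero hsA hsB)
  refine ⟨hD, ?_⟩
  have hK := p.K_eq_cot hz2 hD
  rw [← hA, ← hB] at hK
  have e : 4 * Real.pi * p.K γ - (p.symbol γ - ε * γ) =
      -(q - ε * γ) - z / 2 * ((cos A / sin A + I) + (cos B / sin B + I)) := by
    rw [hK, hz]
    linear_combination q * I_sq
  have hexp : Real.exp (-(p.s * x / 2)) ≤ 8 / (p.s * x) ^ 2 := by
    rw [Real.exp_neg, ← one_div, div_le_div_iff₀ (Real.exp_pos _) (by positivity)]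
    have := Real.quadratic_le_exp_of_nonneg (x := p.s * x / 2) (by positivity)
    nlinarith
  have hcA' : ‖cos A / sin A + I‖ ≤ 32 / (p.s * x) ^ 2 := by
    refine hcA.trans ?_
    have : Real.exp (-2 * A.im) ≤ Real.exp (-(p.s * x / 2)) := Real.exp_le_exp.mpr (by linarith)
    calc 4 * Real.exp (-2 * A.im) ≤ 4 * (8 / (p.s * x) ^ 2) := by linarith
      _ = _ := by ring
  have hcB' : ‖cos B / sin B + I‖ ≤ 32 / (p.s * x) ^ 2 := by
    refine hcB.trans ?_
    have : Real.exp (-2 * B.im) ≤ Real.exp (-(p.s * x / 2)) := Real.exp_le_exp.mpr (by linarith)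
    calc 4 * Real.exp (-2 * B.im) ≤ 4 * (8 / (p.s * x) ^ 2) := by linarith
      _ = _ := by ring
  have hzn : ‖z‖ ≤ 2 * ‖γ‖ := by
    rw [hz, norm_mul, norm_I, one_mul]
    have := norm_add_le (q - ε * γ) (ε * γ)
    rw [sub_add_cancel, norm_mul (ε : ℂ), norm_real, Real.norm_eq_abs, hε, one_mul] at this
    linarith
  rw [e]
  refine (norm_sub_le _ _).trans ?_
  rw [norm_neg, norm_mul, norm_div]
  have h2 : ‖(2 : ℂ)‖ = 2 := by simp
  rw [h2]
  calc ‖q - ε * γ‖ + ‖z‖ / 2 * ‖cos A / sin A + I + (cos B / sin B + I)‖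
      ≤ k / ‖γ‖ + 2 * ‖γ‖ / 2 * (32 / (p.s * x) ^ 2 + 32 / (p.s * x) ^ 2) := by
        gcongr
        exact (norm_add_le _ _).trans (add_le_add hcA' hcB')
    _ = k / ‖γ‖ + 64 / p.s ^ 2 * (‖γ‖ / x ^ 2) := by field_simp; ring
    _ ≤ k / ‖γ‖ + 64 / p.s ^ 2 * (4 / ‖γ‖) := by
        have h4 : ‖γ‖ / x ^ 2 ≤ 4 / ‖γ‖ := by
          rw [div_le_div_iff₀ (by positivity) hγ0]
          have := mul_le_mul hnx hnx hγ0.le (by linarith)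
          linarith
        gcongr
    _ = (k + 256 / p.s ^ 2) / ‖γ‖ := by ring

end Cascade

/-! ### Logarithms and fixed points in cones -/

lemma eventually_cobounded_inf_principal {S : Set ℂ} {P : ℂ → Prop} :
    (∀ᶠ z in Bornology.cobounded ℂ ⊓ 𝓟 S, P z) ↔ ∃ R : ℝ, ∀ z ∈ S, R < ‖z‖ → P z := by
  rw [eventually_inf_principal, (Metric.hasBasis_cobounded_compl_closedBall (0 : ℂ)).eventually_iff]
  simp only [true_and, Set.mem_compl_iff, Metric.mem_closedBall, dist_zero_right, not_le]
  exact ⟨fun ⟨R, h⟩ => ⟨R, fun z hz hR => h hR hz⟩, fun ⟨R, h⟩ => ⟨R, fun z hR hz => h z hz hR⟩⟩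

/-- The open cone of slope `ρ` about the positive real axis. -/
def cone (ρ : ℝ) : Set ℂ := {w | |w.im| < ρ * w.re}

lemma re_pos_of_mem_cone {ρ : ℝ} (hρ : 0 < ρ) {w : ℂ} (hw : w ∈ cone ρ) : 0 < w.re := by
  have h : |w.im| < ρ * w.re := hw
  have := (abs_nonneg w.im).trans_lt h
  exact (mul_pos_iff_of_pos_left hρ).mp this

lemma isOpen_cone_inter (ρ R : ℝ) : IsOpen (cone ρ ∩ {w : ℂ | R < ‖w‖}) := by
  refine IsOpen.inter ?_ (isOpen_lt continuous_const continuous_norm)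
  exact isOpen_lt (by fun_prop) (by fun_prop)

lemma norm_log_le_sqrt {w : ℂ} (hw : 1 ≤ ‖w‖) : ‖log w‖ ≤ (2 + Real.pi) * √‖w‖ := by
  have h1 : 1 ≤ √‖w‖ := Real.one_le_sqrt.mpr hw
  have h2 : Real.log ‖w‖ ≤ 2 * √‖w‖ := by
    have h3 : Real.log ‖w‖ = 2 * Real.log √‖w‖ := by rw [Real.log_sqrt (norm_nonneg w)]; ring
    have := Real.log_le_sub_one_of_pos (x := √‖w‖) (by linarith)
    linarith
  have h3 : 0 ≤ Real.log ‖w‖ := Real.log_nonneg hw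
  refine (norm_le_abs_re_add_abs_im _).trans ?_
  rw [log_re, log_im, abs_of_nonneg h3]
  have := abs_arg_le_pi w
  nlinarith [Real.pi_pos]

/-- A logarithm in a cone of a function with power asymptotics. -/
lemma exists_log_cone {ρ : ℝ} (hρ : 0 < ρ) {H : ℂ → ℂ} {c : ℂ} (hc : c ≠ 0) {n : ℤ} {R : ℝ}
    (hd : DifferentiableOn ℂ H (cone ρ ∩ {w | R < ‖w‖}))
    (h : Tendsto (fun w => H w / (c * w ^ n)) (Bornology.cobounded ℂ ⊓ 𝓟 (cone ρ)) (𝓝 1)) :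
    ∃ (R' : ℝ) (g : ℂ → ℂ) (C : ℝ), 0 ≤ C ∧ R ≤ R' ∧
      DifferentiableOn ℂ g (cone ρ ∩ {w | R' < ‖w‖}) ∧
      ∀ w ∈ cone ρ, R' < ‖w‖ → exp (2 * Real.pi * I * g w) = H w ∧ ‖g w‖ ≤ C * √‖w‖ := by
  obtain ⟨R₁, hR₁⟩ := eventually_cobounded_inf_principal.mp
    (h.eventually (Metric.ball_mem_nhds 1 (by norm_num : (0 : ℝ) < 1 / 2)))
  have hb : ∀ w ∈ cone ρ, R₁ < ‖w‖ → ‖H w / (c * w ^ n) - 1‖ < 1 / 2 := fun w hw hr => by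
    simpa [dist_eq_norm] using hR₁ w hw hr
  have h2 : (2 * Real.pi * I : ℂ) ≠ 0 := two_pi_I_ne_zero
  have hslit : ∀ w ∈ cone ρ, w ∈ slitPlane := fun w hw => Or.inl (re_pos_of_mem_cone hρ hw)
  have hslit' : ∀ w ∈ cone ρ, R₁ < ‖w‖ → H w / (c * w ^ n) ∈ slitPlane := fun w hw hr => by
    left
    have := (abs_le.mp ((abs_re_le_norm _).trans (hb w hw hr).le)).1
    simp only [sub_re, one_re] at this
    linarith
  refine ⟨max (max R R₁) 1, fun w => (log c + n * log w + log (H w / (c * w ^ n))) /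
    (2 * Real.pi * I), ‖log c‖ + |(n : ℝ)| * (2 + Real.pi) + 1, by positivity,
    (le_max_left _ _).trans (le_max_left _ _), ?_, ?_⟩
  · rintro w ⟨hw, hr⟩
    have hr' : max (max R R₁) 1 < ‖w‖ := hr
    have hRw : R < ‖w‖ := ((le_max_left _ _).trans (le_max_left _ _)).trans_lt hr'
    have hR₁w : R₁ < ‖w‖ := ((le_max_right _ _).trans (le_max_left _ _)).trans_lt hr'
    have hw0 : w ≠ 0 := slitPlane_ne_zero (hslit w hw)
    have hH : DifferentiableAt ℂ H w :=
      hd.differentiableAt ((isOpen_cone_inter ρ R).mem_nhds ⟨hw, hRw⟩)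
    refine DifferentiableAt.differentiableWithinAt ?_
    have hz : DifferentiableAt ℂ (fun w : ℂ => w ^ n) w := differentiableAt_zpow.mpr (Or.inl hw0)
    have hq : DifferentiableAt ℂ (fun w => H w / (c * w ^ n)) w :=
      hH.div (hz.const_mul c) (mul_ne_zero hc (zpow_ne_zero n hw0))
    exact ((((differentiableAt_id.clog (hslit w hw)).const_mul _).const_add _).add
      (hq.clog (hslit' w hw hR₁w))).div_const _
  · intro w hw hr'
    have hR₁w : R₁ < ‖w‖ := ((le_max_right _ _).trans (le_max_left _ _)).trans_lt hr'
    have h1w : 1 ≤ ‖w‖ := ((le_max_right _ _).trans_lt hr').le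
    have hw0 : w ≠ 0 := slitPlane_ne_zero (hslit w hw)
    constructor
    · rw [mul_div_cancel₀ _ h2, exp_add, exp_add, exp_log hc,
        exp_log (slitPlane_ne_zero (hslit' w hw hR₁w)), exp_int_mul, exp_log hw0]
      exact mul_div_cancel₀ _ (mul_ne_zero hc (zpow_ne_zero n hw0))
    · have hs1 : 1 ≤ √‖w‖ := Real.one_le_sqrt.mpr h1w
      have hl : ‖log (H w / (c * w ^ n))‖ ≤ 1 := by
        have h3 := hb w hw hR₁w
        have := norm_log_one_add_half_le_self (z := H w / (c * w ^ n) - 1) h3.le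
        rw [add_sub_cancel] at this
        linarith
      have hn2 : 1 ≤ ‖(2 * Real.pi * I : ℂ)‖ := by
        rw [norm_mul, norm_mul, norm_I, norm_real, Real.norm_of_nonneg Real.pi_pos.le]
        simp
        linarith [Real.pi_gt_three]
      rw [norm_div]
      refine (div_le_self (norm_nonneg _) hn2).trans ?_
      have h4 : ‖(n : ℂ) * log w‖ ≤ |(n : ℝ)| * ((2 + Real.pi) * √‖w‖) := by
        rw [norm_mul]
        have : ‖(n : ℂ)‖ = |(n : ℝ)| := by
          rw [← ofReal_intCast, norm_real, Real.norm_eq_abs]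
        rw [this]
        gcongr
        exact norm_log_le_sqrt h1w
      refine (norm_add_le _ _).trans ((add_le_add (norm_add_le _ _) le_rfl).trans ?_)
      nlinarith [norm_nonneg (log c), mul_nonneg (norm_nonneg (log c)) (sub_nonneg.mpr hs1)]

/-- The fixed points of `w ↦ k + g w` in a cone, where `g` is analytic and `O(√|w|)`: for each
large `k` there is exactly one, and it is nondegenerate. -/
lemma exists_fixed_points {ρ R C : ℝ} (hρ : 0 < ρ) (hρ1 : ρ ≤ 1) (hC : 0 ≤ C) {g : ℂ → ℂ}
    (hg : DifferentiableOn ℂ g (cone ρ ∩ {w | R < ‖w‖}))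
    (hb : ∀ w ∈ cone ρ, R < ‖w‖ → ‖g w‖ ≤ C * √‖w‖) :
    ∃ (N : ℕ) (R' C' : ℝ) (v : ℕ → ℂ), (∀ n : ℕ, ‖v n - n‖ ≤ C' * √((n : ℝ) + 1)) ∧
      (∀ n ≥ N, v n ∈ cone ρ ∧ R < ‖v n‖ ∧ v n = n + g (v n) ∧ deriv g (v n) ≠ 1) ∧
      ∀ w ∈ cone (ρ / 2), R' < ‖w‖ → ∀ k : ℤ, w = k + g w → ∃ n ≥ N, w = v n := by
  set T : ℝ := max (max (2 * |R| + 1) 1) ((24 * C / ρ) ^ 2) with hT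
  have hT1 : 1 ≤ T := (le_max_right _ _).trans (le_max_left _ _)
  have hTR : 2 * |R| + 1 ≤ T := (le_max_left _ _).trans (le_max_left _ _)
  have hTC : (24 * C / ρ) ^ 2 ≤ T := le_max_right _ _
  -- a truncated narrower cone, in which the disc of radius `ρ / 8 * Re w` about `w` stays in the
  -- domain of `g`
  set S : Set ℂ := {w | |w.im| ≤ ρ / 2 * w.re ∧ T ≤ w.re} with hS
  have hsub : ∀ w ∈ S, ∀ z, ‖z - w‖ ≤ ρ / 8 * w.re → z ∈ cone ρ ∩ {w | R < ‖w‖} ∧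
      ‖z‖ ≤ 2 * w.re := by
    rintro w ⟨h1, h2⟩ z hz
    have hre := abs_le.mp ((abs_re_le_norm (z - w)).trans hz)
    have him := (abs_im_le_norm (z - w)).trans hz
    rw [sub_re] at hre
    rw [sub_im] at him
    have hx : 0 < w.re := by linarith
    have hzim : |z.im| ≤ ρ / 8 * w.re + ρ / 2 * w.re := by
      have := abs_add_le (z.im - w.im) w.im
      rw [sub_add_cancel] at this
      linarith
    have hρx : ρ * w.re ≤ 1 * w.re := by gcongr
    have hzre : w.re * (7 / 8) ≤ z.re := by nlinarith [hre.1]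
    refine ⟨⟨?_, ?_⟩, ?_⟩
    · change |z.im| < ρ * z.re
      nlinarith [mul_le_mul_of_nonneg_left hzre hρ.le, mul_pos hρ hx]
    · change R < ‖z‖
      have := (le_abs_self z.re).trans (abs_re_le_norm z)
      linarith [le_abs_self R, abs_nonneg R]
    · have h3 := norm_le_abs_re_add_abs_im w
      rw [abs_of_pos hx] at h3
      have h4 := norm_add_le (z - w) w
      rw [sub_add_cancel] at h4
      nlinarith
  have hSmem : ∀ w ∈ S, w ∈ cone ρ ∩ {w | R < ‖w‖} ∧ ‖w‖ ≤ 2 * w.re := fun w hw =>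
    hsub w hw w (by
      rw [sub_self, norm_zero]
      have : T ≤ w.re := hw.2
      have : 0 < w.re := by linarith
      positivity)
  have hdiff : ∀ w ∈ S, DifferentiableAt ℂ g w := fun w hw =>
    hg.differentiableAt ((isOpen_cone_inter ρ R).mem_nhds (hSmem w hw).1)
  -- Cauchy's estimate on this disc: the derivative is `O(1 / √|w|)`
  have hderiv : ∀ w ∈ S, ‖deriv g w‖ ≤ 1 / 2 := by
    intro w hw
    have hx : 0 < w.re := by have : T ≤ w.re := hw.2; linarith
    have hr : 0 < ρ / 8 * w.re := by positivity
    have h1 : DiffContOnCl ℂ g (Metric.ball w (ρ / 8 * w.re)) := by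
      refine (hg.mono fun z hz => (hsub w hw z ?_).1).diffContOnCl
      rw [closure_ball _ hr.ne'] at hz
      simpa [dist_eq_norm] using hz
    have h2 := norm_deriv_le_of_forall_mem_sphere_norm_le (C := C * √(2 * w.re)) hr h1 (by
      intro z hz
      have hz' : ‖z - w‖ ≤ ρ / 8 * w.re := by
        rw [mem_sphere_iff_norm] at hz; exact hz.le
      obtain ⟨⟨h3, h4⟩, h5⟩ := hsub w hw z hz'
      exact (hb z h3 h4).trans (by gcongr))
    refine h2.trans ?_
    rw [div_le_iff₀ hr]
    have h3 : 24 * C / ρ ≤ √w.re := Real.le_sqrt_of_sq_le (hTC.trans hw.2)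
    rw [div_le_iff₀ hρ] at h3
    have h4 : √(2 * w.re) ≤ 3 / 2 * √w.re := by
      rw [Real.sqrt_mul (by norm_num)]
      gcongr
      rw [Real.sqrt_le_left (by norm_num)]
      norm_num
    have h5 := Real.mul_self_sqrt hx.le
    have h6 := Real.sqrt_nonneg w.re
    calc C * √(2 * w.re) ≤ C * (3 / 2 * √w.re) := by gcongr
      _ = 24 * C * √w.re / 16 := by ring
      _ ≤ (√w.re * ρ) * √w.re / 16 := by gcongr
      _ = 1 / 2 * (ρ / 8 * w.re) := by linear_combination ρ / 16 * h5
  have hconv : Convex ℝ S := by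
    intro z hz w hw a b ha hb' hab
    obtain ⟨h1, h2⟩ := hz
    obtain ⟨h3, h4⟩ := hw
    have e1 : (a • z + b • w).re = a * z.re + b * w.re := by simp
    have e2 : (a • z + b • w).im = a * z.im + b * w.im := by simp
    refine ⟨?_, ?_⟩
    · rw [e1, e2]
      refine (abs_add_le _ _).trans ?_
      rw [abs_mul, abs_mul, abs_of_nonneg ha, abs_of_nonneg hb']
      nlinarith
    · rw [e1]
      nlinarith
  have hlip : ∀ z ∈ S, ∀ w ∈ S, ‖g w - g z‖ ≤ 1 / 2 * ‖w - z‖ := fun z hz w hw =>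
    hconv.norm_image_sub_le_of_norm_deriv_le hdiff hderiv hz hw
  obtain ⟨N, hN⟩ := exists_nat_ge (max (2 * T) ((8 * C / ρ) ^ 2))
  have hN1 : 2 * T ≤ N := (le_max_left _ _).trans hN
  have hN2 : (8 * C / ρ) ^ 2 ≤ N := (le_max_right _ _).trans hN
  have hex : ∀ n : ℕ, N ≤ n → ∃ w ∈ S, w = n + g w ∧ ‖w‖ ≤ 2 * n := by
    intro n hn
    have hn' : (N : ℝ) ≤ n := by exact_mod_cast hn
    have hn0 : 0 < (n : ℝ) := by linarith
    -- `w ↦ n + g w` maps this disc into itself and contracts it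
    set K : Set ℂ := Metric.closedBall (n : ℂ) (ρ / 4 * n) with hK
    have hKS : ∀ w ∈ K, w ∈ S ∧ ‖w‖ ≤ 2 * n := by
      intro w hw
      rw [hK, mem_closedBall_iff_norm] at hw
      have hre := abs_le.mp ((abs_re_le_norm (w - n)).trans hw)
      have him := (abs_im_le_norm (w - n)).trans hw
      simp only [sub_re, natCast_re, sub_im, natCast_im, sub_zero] at hre him
      have h2 : ρ * n ≤ 1 * n := by gcongr
      refine ⟨⟨?_, by linarith [hre.1]⟩, ?_⟩
      · have h3 : (n : ℝ) * (3 / 4) ≤ w.re := by linarith [hre.1]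
        nlinarith [mul_le_mul_of_nonneg_left h3 hρ.le]
      · have h4 := norm_add_le (w - n) n
        rw [sub_add_cancel, Complex.norm_natCast] at h4
        linarith
    have hgK : ∀ w ∈ K, ‖g w‖ ≤ ρ / 4 * n := by
      intro w hw
      obtain ⟨h1, h2⟩ := hKS w hw
      refine (hb w (hSmem w h1).1.1 (hSmem w h1).1.2).trans ?_
      have h3 : 8 * C / ρ ≤ √n := Real.le_sqrt_of_sq_le (hN2.trans hn')
      rw [div_le_iff₀ hρ] at h3
      have h4 : √‖w‖ ≤ 2 * √n := by
        have : √‖w‖ ≤ √(2 ^ 2 * n) := Real.sqrt_le_sqrt (by linarith)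
        rwa [Real.sqrt_mul (by norm_num), Real.sqrt_sq (by norm_num)] at this
      have h5 := Real.mul_self_sqrt hn0.le
      calc C * √‖w‖ ≤ C * (2 * √n) := by gcongr
        _ = 8 * C * √n / 4 := by ring
        _ ≤ (√n * ρ) * √n / 4 := by gcongr
        _ = ρ / 4 * n := by linear_combination ρ / 4 * h5
    have hmaps : Set.MapsTo (fun w => (n : ℂ) + g w) K K := by
      intro w hw
      rw [hK, mem_closedBall_iff_norm]
      simpa using hgK w hw
    have hcontr : ContractingWith (1 / 2) (hmaps.restrict (fun w => (n : ℂ) + g w) K K) := by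
      refine ⟨by rw [← NNReal.coe_lt_coe]; norm_num, LipschitzWith.of_dist_le_mul fun z w => ?_⟩
      rw [Subtype.dist_eq, Subtype.dist_eq, dist_eq_norm, dist_eq_norm]
      have := hlip w (hKS w w.2).1 z (hKS z z.2).1
      simpa using this
    obtain ⟨y, hy, hfix, -⟩ := hcontr.exists_fixedPoint' Metric.isClosed_closedBall.isComplete hmaps
      (Metric.mem_closedBall_self (by positivity)) (edist_ne_top _ _)
    exact ⟨y, (hKS y hy).1, hfix.symm, (hKS y hy).2⟩
  choose! v hvS hvfix hvle using hex
  refine ⟨N, max (max (2 * T) (16 * C ^ 2)) (4 * N), 2 * C + ∑ n ∈ Finset.range N, ‖v n - n‖, v,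
    ?_, ?_, ?_⟩
  · intro n
    have h1 : 1 ≤ √((n : ℝ) + 1) := Real.one_le_sqrt.mpr (by linarith [n.cast_nonneg (α := ℝ)])
    have h0 : 0 ≤ ∑ n ∈ Finset.range N, ‖v n - n‖ := by positivity
    rcases le_or_gt N n with hn | hn
    · have e : v n - n = g (v n) := by linear_combination hvfix n hn
      have h2 := hb _ (hSmem _ (hvS n hn)).1.1 (hSmem _ (hvS n hn)).1.2
      have h3 : √‖v n‖ ≤ 2 * √((n : ℝ) + 1) := by
        have : √‖v n‖ ≤ √(2 ^ 2 * ((n : ℝ) + 1)) :=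
          Real.sqrt_le_sqrt (by linarith [hvle n hn, n.cast_nonneg (α := ℝ)])
        rwa [Real.sqrt_mul (by norm_num), Real.sqrt_sq (by norm_num)] at this
      rw [e]
      nlinarith
    · have h2 := Finset.single_le_sum (f := fun n : ℕ => ‖v n - n‖) (fun i _ => norm_nonneg _)
        (Finset.mem_range.mpr hn)
      have h2' : ‖v n - n‖ ≤ ∑ n ∈ Finset.range N, ‖v n - n‖ := h2
      nlinarith
  · intro n hn
    refine ⟨(hSmem _ (hvS n hn)).1.1, (hSmem _ (hvS n hn)).1.2, hvfix n hn, fun h => ?_⟩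
    have := hderiv _ (hvS n hn)
    rw [h, norm_one] at this
    norm_num at this
  · intro w hw hr k hk
    have hx := re_pos_of_mem_cone (half_pos hρ) hw
    have hw' : |w.im| < ρ / 2 * w.re := hw
    have h1 : 2 * T < ‖w‖ := ((le_max_left _ _).trans (le_max_left _ _)).trans_lt hr
    have h2 : 16 * C ^ 2 < ‖w‖ := ((le_max_right _ _).trans (le_max_left _ _)).trans_lt hr
    have h3 : 4 * (N : ℝ) < ‖w‖ := (le_max_right _ _).trans_lt hr
    have h4 := norm_le_abs_re_add_abs_im w
    rw [abs_of_pos hx] at h4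
    have h5 : ‖w‖ ≤ 2 * w.re := by nlinarith
    have hwS : w ∈ S := ⟨hw'.le, by linarith⟩
    have h6 := hb w (hSmem w hwS).1.1 (hSmem w hwS).1.2
    have h7 : C * √‖w‖ ≤ ‖w‖ / 4 := by
      have h8 : 4 * C ≤ √‖w‖ := Real.le_sqrt_of_sq_le (by nlinarith)
      have h9 := Real.mul_self_sqrt (norm_nonneg w)
      nlinarith [Real.sqrt_nonneg ‖w‖]
    -- `|g w| ≤ |w| / 4`, so a large fixed point belongs to a large positive `k`
    have hkN : (N : ℝ) ≤ k := by
      have h8 : w.re = k + (g w).re := by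
        conv_lhs => rw [hk]
        simp
      have h9 := (le_abs_self _).trans (abs_re_le_norm (g w))
      linarith
    have hkN' : (N : ℤ) ≤ k := by exact_mod_cast hkN
    obtain ⟨n, rfl⟩ := Int.eq_ofNat_of_zero_le ((Int.natCast_nonneg N).trans hkN')
    have hn : N ≤ n := by exact_mod_cast hkN'
    refine ⟨n, hn, ?_⟩
    have h8 := hlip _ (hvS n hn) w hwS
    have e : g w - g (v n) = w - v n := by
      have h9 := hvfix n hn
      push_cast at hk
      linear_combination h9 - hk
    rw [e] at h8
    have : ‖w - v n‖ = 0 := by linarith [norm_nonneg (w - v n)]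
    exact sub_eq_zero.mp (norm_eq_zero.mp this)

/-! ### Zeros of exponential sums in a quadrant -/

namespace PowAsymp

variable {l : Filter ℂ} {f g : ℂ → ℂ} {c d : ℂ} {n k : ℤ}

lemma mono {l' : Filter ℂ} (hf : PowAsymp l f c n) (h : l' ≤ l) : PowAsymp l' f c n :=
  Asymptotics.IsBigO.mono hf h

lemma comp_mul (hf : PowAsymp (Bornology.cobounded ℂ) f c n) {a : ℂ} (ha : a ≠ 0) :
    PowAsymp (Bornology.cobounded ℂ) (fun z => f (a * z)) (c * a ^ n) n := by
  have h1 : Tendsto (fun z : ℂ => a * z) (Bornology.cobounded ℂ) (Bornology.cobounded ℂ) :=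
    tendsto_mul_left_cobounded ha
  have h2 := Asymptotics.IsBigO.comp_tendsto hf h1
  have h3 : ((fun z : ℂ => z⁻¹) ∘ fun z => a * z) = fun z => a⁻¹ * z⁻¹ := by
    funext z; simp [mul_comm]
  rw [h3] at h2
  refine (h2.trans (Asymptotics.isBigO_const_mul_self _ _ _)).congr_left fun z => ?_
  simp [mul_zpow, mul_assoc]

lemma isBigO_zpow (hl : l ≤ Bornology.cobounded ℂ) (hc : c ≠ 0) (hf : PowAsymp l f c n) :
    f =O[l] fun z => z ^ n := by
  have h1 := ((tendsto_one hl hf).isBigO_one ℂ).mul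
    (Asymptotics.isBigO_const_mul_self c (fun z : ℂ => z ^ n) l)
  simp only [one_mul] at h1
  refine h1.congr' ?_ EventuallyEq.rfl
  filter_upwards [eventually_ne hl] with z hz
  exact div_mul_cancel₀ _ (mul_ne_zero hc (zpow_ne_zero n hz))

/-- Power growth is negligible against exponential decay. -/
lemma mul_exp_isBigO (hl : l ≤ Bornology.cobounded ℂ) (hc : c ≠ 0) (hf : PowAsymp l f c n)
    {φ : ℂ → ℂ} {η : ℝ} (hη : 0 < η) (hφ : ∀ᶠ z in l, (φ z).re ≤ -η * ‖z‖) (k : ℤ) :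
    (fun z => f z * exp (φ z)) =O[l] fun z => z ^ k := by
  have h1 : (fun z => exp (φ z)) =O[l] fun z : ℂ => z ^ (k - n) := by
    have h2 : (fun z : ℂ => Real.exp (-η * ‖z‖)) =O[l] fun z => ‖z‖ ^ ((k - n : ℤ) : ℝ) :=
      ((isLittleO_exp_neg_mul_rpow_atTop hη _).isBigO.comp_tendsto
        tendsto_norm_cobounded_atTop).mono hl
    have h3 : (fun z => exp (φ z)) =O[l] fun z : ℂ => Real.exp (-η * ‖z‖) := by
      refine Asymptotics.IsBigO.of_bound 1 ?_
      filter_upwards [hφ] with z hz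
      rw [norm_exp, Real.norm_eq_abs, Real.abs_exp, one_mul]
      exact Real.exp_le_exp.mpr hz
    refine (h3.trans h2).trans (Asymptotics.IsBigO.of_norm_right ?_)
    simp only [norm_zpow, Real.rpow_intCast]
    exact Asymptotics.isBigO_refl _ _
  refine ((isBigO_zpow hl hc hf).mul h1).congr' EventuallyEq.rfl ?_
  filter_upwards [eventually_ne hl] with z hz
  rw [← zpow_add₀ hz]; congr 1; ring

/-- Power growth in the form `exp (± C √|z|)`, which is all that the location of the zeros needs.
-/
lemma norm_bounds (hl : l ≤ Bornology.cobounded ℂ) (hc : c ≠ 0) (hf : PowAsymp l f c n) :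
    ∃ C : ℝ, 0 ≤ C ∧ ∀ᶠ z in l, Real.exp (-(C * √‖z‖)) ≤ ‖f z‖ ∧ ‖f z‖ ≤ Real.exp (C * √‖z‖) := by
  refine ⟨|Real.log ‖c‖| + 2 * |(n : ℝ)| + 1, by positivity, ?_⟩
  filter_upwards [hl (tendsto_norm_cobounded_atTop.eventually_ge_atTop 1), eventually_ne hl,
    (tendsto_one hl hf).eventually (Metric.ball_mem_nhds 1 (by norm_num : (0 : ℝ) < 1 / 2))]
    with z h1 hz h2
  have h2' : ‖f z / (c * z ^ n) - 1‖ < 1 / 2 := by simpa [dist_eq_norm] using h2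
  set q := f z / (c * z ^ n) with hq
  have hcz : c * z ^ n ≠ 0 := mul_ne_zero hc (zpow_ne_zero n hz)
  have hf0 : f z = q * (c * z ^ n) := (div_mul_cancel₀ _ hcz).symm
  have h3 : 1 / 2 ≤ ‖q‖ := by
    have := norm_sub_norm_le 1 q
    rw [norm_sub_rev, norm_one] at this
    linarith
  have h4 : ‖q‖ ≤ 3 / 2 := by
    have := norm_add_le (q - 1) 1
    rw [sub_add_cancel, norm_one] at this
    linarith
  have hlog : |Real.log ‖q‖| ≤ 1 := by
    rw [abs_le]
    constructor
    · have h5 := Real.one_sub_inv_le_log_of_pos (x := ‖q‖) (by linarith)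
      have h6 : ‖q‖⁻¹ ≤ 2 := by
        rw [inv_le_comm₀ (by linarith) (by norm_num)]; linarith
      linarith
    · have := Real.log_le_sub_one_of_pos (x := ‖q‖) (by linarith)
      linarith
  have hs1 : 1 ≤ √‖z‖ := Real.one_le_sqrt.mpr h1
  have hlz : |Real.log ‖z‖| ≤ 2 * √‖z‖ := by
    rw [abs_of_nonneg (Real.log_nonneg h1)]
    have h3 : Real.log ‖z‖ = 2 * Real.log √‖z‖ := by rw [Real.log_sqrt (norm_nonneg z)]; ring
    have := Real.log_le_sub_one_of_pos (x := √‖z‖) (by linarith)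
    linarith
  have hfz : f z ≠ 0 := by
    rw [hf0]
    exact mul_ne_zero (norm_pos_iff.mp (by linarith)) hcz
  have hL : Real.log ‖f z‖ = Real.log ‖q‖ + (Real.log ‖c‖ + n * Real.log ‖z‖) := by
    rw [hf0, norm_mul, norm_mul, norm_zpow, Real.log_mul (by linarith), Real.log_mul
      (norm_ne_zero_iff.mpr hc) (zpow_ne_zero n (norm_ne_zero_iff.mpr hz)), Real.log_zpow]
    rw [← norm_zpow, ← norm_mul]
    exact norm_ne_zero_iff.mpr hcz
  have hb : |Real.log ‖f z‖| ≤ (|Real.log ‖c‖| + 2 * |(n : ℝ)| + 1) * √‖z‖ := by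
    rw [hL]
    refine (abs_add_le _ _).trans ((add_le_add le_rfl (abs_add_le _ _)).trans ?_)
    rw [abs_mul]
    have := mul_le_mul_of_nonneg_left hlz (abs_nonneg (n : ℝ))
    have := mul_le_mul_of_nonneg_left hs1 (abs_nonneg (Real.log ‖c‖))
    nlinarith
  have hpos : 0 < ‖f z‖ := norm_pos_iff.mpr hfz
  have hb' := abs_le.mp hb
  exact ⟨(Real.le_log_iff_exp_le hpos).mp hb'.1, (Real.log_le_iff_le_exp hpos).mp hb'.2⟩

end PowAsymp

/-- The large zeros of `F` in the region `S` are simple and form a sequence `v n = a n + O(√n)`. -/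
def ZerosAlong (F : ℂ → ℂ) (S : Set ℂ) (a : ℂ) : Prop :=
  ∃ (N : ℕ) (R C : ℝ) (v : ℕ → ℂ), (∀ n : ℕ, ‖v n - a * n‖ ≤ C * √((n : ℝ) + 1)) ∧
    (∀ n ≥ N, F (v n) = 0 ∧ deriv F (v n) ≠ 0) ∧ Set.InjOn v (Set.Ici N) ∧
    ∀ z ∈ S, R < ‖z‖ → F z = 0 → ∃ n ≥ N, z = v n

/-- Rotation and scaling of the variable. -/
lemma ZerosAlong.scale {F : ℂ → ℂ} {S : Set ℂ} {a b : ℂ} (hb : b ≠ 0)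
    (hF : Differentiable ℂ F) (h : ZerosAlong (fun z => F (b * z)) S a) :
    ZerosAlong F {z | z / b ∈ S} (b * a) := by
  obtain ⟨N, R, C, v, h1, h2, h3, h4⟩ := h
  refine ⟨N, ‖b‖ * R, ‖b‖ * C, fun n => b * v n, fun n => ?_, fun n hn => ⟨(h2 n hn).1, ?_⟩,
    ?_, fun z hz hR h0 => ?_⟩
  · rw [mul_assoc, ← mul_sub, norm_mul, mul_assoc]
    exact mul_le_mul_of_nonneg_left (h1 n) (norm_nonneg b)
  · intro h0
    refine (h2 n hn).2 ?_
    have h5 : HasDerivAt (fun z => F (b * z)) (deriv F (b * v n) * b) (v n) := by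
      have := HasDerivAt.comp (h := fun z => b * z) (v n) (hF (b * v n)).hasDerivAt
        ((hasDerivAt_id (v n)).const_mul b)
      rwa [mul_one] at this
    rw [h5.deriv, h0, zero_mul]
  · intro m hm n hn e
    exact h3 hm hn (mul_left_cancel₀ hb e)
  · have hb' : 0 < ‖b‖ := norm_pos_iff.mpr hb
    have h6 : R < ‖z / b‖ := by rw [norm_div, lt_div_iff₀ hb']; linarith
    obtain ⟨n, hn, e⟩ := h4 (z / b) hz h6 (by
      change F (b * (z / b)) = 0
      rw [mul_div_cancel₀ _ hb]; exact h0)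
    exact ⟨n, hn, by simp only [← e, mul_div_cancel₀ _ hb]⟩

/-- A fixed point of `w ↦ n + g w` is a simple zero of `exp (2 π i w) - exp (2 π i g w)`. -/
lemma zero_of_factor {F U g : ℂ → ℂ} {z : ℂ} {n : ℕ}
    (hF : F =ᶠ[𝓝 z] fun w => U w * (exp (2 * Real.pi * I * w) - exp (2 * Real.pi * I * g w)))
    (hU : DifferentiableAt ℂ U z) (hU0 : U z ≠ 0) (hg : DifferentiableAt ℂ g z)
    (hz : z = n + g z) (hg' : deriv g z ≠ 1) : F z = 0 ∧ deriv F z ≠ 0 := by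
  have he : exp (2 * Real.pi * I * z) = exp (2 * Real.pi * I * g z) := by
    conv_lhs => rw [hz, mul_add, exp_add, mul_comm _ (n : ℂ), exp_nat_mul_two_pi_mul_I, one_mul]
  refine ⟨?_, ?_⟩
  · simp only [hF.self_of_nhds, he, sub_self, mul_zero]
  · have h1 : HasDerivAt (fun w => exp (2 * Real.pi * I * w) - exp (2 * Real.pi * I * g w))
        (exp (2 * Real.pi * I * z) * (2 * Real.pi * I) -
          exp (2 * Real.pi * I * g z) * (2 * Real.pi * I * deriv g z)) z := by
      have h2 := ((hasDerivAt_id z).const_mul (2 * Real.pi * I : ℂ)).cexp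
      have h3 := (hg.hasDerivAt.const_mul (2 * Real.pi * I : ℂ)).cexp
      simp only [id, mul_one] at h2
      exact h2.sub h3
    rw [hF.deriv_eq, (hU.hasDerivAt.fun_mul h1).deriv, ← he, sub_self, mul_zero, zero_add]
    have : exp (2 * Real.pi * I * z) * (2 * Real.pi * I) -
        exp (2 * Real.pi * I * z) * (2 * Real.pi * I * deriv g z) =
        exp (2 * Real.pi * I * z) * (2 * Real.pi * I) * (1 - deriv g z) := by ring
    rw [this]
    exact mul_ne_zero hU0 (mul_ne_zero (mul_ne_zero (exp_ne_zero _) two_pi_I_ne_zero)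
      (sub_ne_zero.mpr (Ne.symm hg')))

/-- In a vanishing sum of four terms with two large exponentials, neither of these can exceed
the other by more than the size of the coefficients. -/
lemma sub_le_of_sum_eq_zero {A B C D X Y Z W : ℂ} {x y L : ℝ} (hx : 0 ≤ x) (hy : 0 ≤ y)
    (hX : ‖X‖ = Real.exp x) (hY : ‖Y‖ = Real.exp (-x)) (hZ : ‖Z‖ = Real.exp y)
    (hW : ‖W‖ = Real.exp (-y)) (hA : Real.exp (-L) ≤ ‖A‖) (hB : ‖B‖ ≤ Real.exp L)
    (hC : ‖C‖ ≤ Real.exp L) (hD : ‖D‖ ≤ Real.exp L)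
    (h : A * X + B * Y + C * Z + D * W = 0) : x - y ≤ 2 * L + 2 := by
  have e1 : A * X = -(C * Z + B * Y + D * W) := by linear_combination h
  have e2 := congrArg norm e1
  rw [norm_neg, norm_mul, hX] at e2
  have h1 : ‖C * Z + B * Y + D * W‖ ≤ Real.exp L * Real.exp y + Real.exp L * 1 + Real.exp L * 1 := by
    refine (norm_add_le _ _).trans (add_le_add ((norm_add_le _ _).trans (add_le_add ?_ ?_)) ?_)
    · rw [norm_mul, hZ]; gcongr
    · rw [norm_mul, hY]; gcongr; exact Real.exp_le_one_iff.mpr (by linarith)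
    · rw [norm_mul, hW]; gcongr; exact Real.exp_le_one_iff.mpr (by linarith)
  have h2 : (3 : ℝ) ≤ Real.exp 2 := by linarith [Real.add_one_le_exp (2 : ℝ)]
  have h3 : 1 ≤ Real.exp y := Real.one_le_exp hy
  have h4 : Real.exp (-L) * Real.exp x ≤ Real.exp 2 * (Real.exp L * Real.exp y) := by
    have h5 := Real.exp_pos L
    have h6 : Real.exp L ≤ Real.exp L * Real.exp y := le_mul_of_one_le_right h5.le h3
    have h7 : Real.exp (-L) * Real.exp x ≤ ‖A‖ * Real.exp x := by gcongr
    have h8 : 3 * (Real.exp L * Real.exp y) ≤ Real.exp 2 * (Real.exp L * Real.exp y) := by gcongr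
    linarith
  rw [← Real.exp_add, ← Real.exp_add, ← Real.exp_add, Real.exp_le_exp] at h4
  linarith

set_option maxHeartbeats 800000 in
/-- An exponential sum with coefficients of power growth, whose exponents are `± s` and `± i e`,
has its large zeros in the closed first quadrant where the dominant terms `exp (s z)` and
`exp (-i e z)` balance, that is near the ray through `e + i s`. -/
lemma zerosAlong_quadrant {e s : ℝ} (he : 0 < e) (hs : 0 < s) {F A B C D : ℂ → ℂ} {R : ℝ}
    (hF : ∀ z, R < ‖z‖ → F z = A z * exp (s * z) + B z * exp (-(s * z)) +
      C z * exp (-(I * e * z)) + D z * exp (I * e * z))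
    (hd : ∀ z, R < ‖z‖ → DifferentiableAt ℂ A z ∧ DifferentiableAt ℂ B z ∧
      DifferentiableAt ℂ C z ∧ DifferentiableAt ℂ D z)
    {a b c d : ℂ} (ha : a ≠ 0) (hb : b ≠ 0) (hc : c ≠ 0) (hd0 : d ≠ 0) {i j k m : ℤ}
    (hA : PowAsymp (Bornology.cobounded ℂ) A a i) (hB : PowAsymp (Bornology.cobounded ℂ) B b j)
    (hC : PowAsymp (Bornology.cobounded ℂ) C c k) (hD : PowAsymp (Bornology.cobounded ℂ) D d m)
    (hFd : Differentiable ℂ F) :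
    ZerosAlong F {z | 0 ≤ z.re ∧ 0 ≤ z.im} (2 * Real.pi * (e + s * I) / (e ^ 2 + s ^ 2)) := by
  have hpi := Real.pi_pos
  set Λ : ℝ := 2 * Real.pi / (e ^ 2 + s ^ 2) with hΛ
  have hΛ0 : 0 < Λ := by positivity
  -- with `z = α w` the quotient of the two dominant exponentials is
  -- `exp ((s + i e) z) = exp (2 π i w)`
  set α : ℂ := 2 * Real.pi * (e + s * I) / (e ^ 2 + s ^ 2) with hα
  have hα' : α = Λ * (e + s * I) := by rw [hα, hΛ]; push_cast; ring
  have hsum : (e : ℂ) ^ 2 + s ^ 2 ≠ 0 := by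
    have : e ^ 2 + s ^ 2 ≠ 0 := by positivity
    exact_mod_cast this
  have hαs : (s + I * e) * α = 2 * Real.pi * I := by
    rw [hα]; field_simp; linear_combination (e * s : ℂ) * I_sq
  have hα0 : α ≠ 0 := by
    intro h; rw [h, mul_zero] at hαs; exact two_pi_I_ne_zero hαs.symm
  set ρ : ℝ := min 1 (min (s / (2 * e)) (e / (2 * s))) with hρ
  have hρ0 : 0 < ρ := by positivity
  have hρ1 : ρ ≤ 1 := min_le_left _ _
  have hρe : e * ρ ≤ s / 2 := by
    have : ρ ≤ s / (2 * e) := (min_le_right _ _).trans (min_le_left _ _)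
    rw [le_div_iff₀ (by positivity)] at this
    linarith
  have hρs : s * ρ ≤ e / 2 := by
    have : ρ ≤ e / (2 * s) := (min_le_right _ _).trans (min_le_right _ _)
    rw [le_div_iff₀ (by positivity)] at this
    linarith
  have hre : ∀ w : ℂ, (α * w).re = Λ * (e * w.re - s * w.im) := fun w => by
    rw [hα', mul_assoc, re_ofReal_mul]; simp
  have him : ∀ w : ℂ, (α * w).im = Λ * (s * w.re + e * w.im) := fun w => by
    rw [hα', mul_assoc, im_ofReal_mul]; congr 1; simp; ring
  have hcone : ∀ w ∈ cone ρ, ‖w‖ ≤ 2 * w.re ∧ Λ * (e / 2) * w.re ≤ (α * w).re ∧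
      Λ * (s / 2) * w.re ≤ (α * w).im := by
    intro w hw
    have hx := re_pos_of_mem_cone hρ0 hw
    have hw' : |w.im| < ρ * w.re := hw
    have h1 := abs_le.mp hw'.le
    refine ⟨?_, ?_, ?_⟩
    · have := norm_le_abs_re_add_abs_im w
      rw [abs_of_pos hx] at this
      nlinarith
    · rw [hre, mul_assoc]
      gcongr
      nlinarith [mul_le_mul_of_nonneg_left h1.2 hs.le, mul_le_mul_of_nonneg_right hρs hx.le]
    · rw [him, mul_assoc]
      gcongr
      nlinarith [mul_le_mul_of_nonneg_left h1.1 he.le, mul_le_mul_of_nonneg_right hρe hx.le]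
  set l : Filter ℂ := Bornology.cobounded ℂ ⊓ 𝓟 (cone ρ) with hl
  have hl' : l ≤ Bornology.cobounded ℂ := inf_le_left
  have hlc : ∀ᶠ w in l, w ∈ cone ρ := eventually_inf_principal.mpr (Eventually.of_forall fun _ h => h)
  -- in the cone the two other exponentials are exponentially small against `exp (-i e z)`
  have hN1 : PowAsymp l (fun w => C (α * w) + (D (α * w) * exp (2 * I * e * (α * w)) +
      B (α * w) * exp ((-s + I * e) * (α * w)))) (c * α ^ k) k := by
    have hC' := (hC.comp_mul hα0).mono hl'
    refine hC'.add_small hl' (mul_ne_zero hc (zpow_ne_zero k hα0)) (Asymptotics.IsBigO.add ?_ ?_)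
    · refine ((hD.comp_mul hα0).mono hl').mul_exp_isBigO hl'
        (mul_ne_zero hd0 (zpow_ne_zero m hα0)) (η := e * (Λ * (s / 2))) (by positivity) ?_ _
      filter_upwards [hlc] with w hw
      obtain ⟨h1, -, h3⟩ := hcone w hw
      have : (2 * I * e * (α * w)).re = -2 * e * (α * w).im := by simp
      rw [this]
      have h4 : Λ * (s / 2) * ‖w‖ ≤ 2 * (α * w).im := by
        have : Λ * (s / 2) * ‖w‖ ≤ Λ * (s / 2) * (2 * w.re) := by gcongr
        linarith
      have := mul_le_mul_of_nonneg_left h4 he.le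
      linarith
    · refine ((hB.comp_mul hα0).mono hl').mul_exp_isBigO hl'
        (mul_ne_zero hb (zpow_ne_zero j hα0)) (η := s * (Λ * (e / 4))) (by positivity) ?_ _
      filter_upwards [hlc] with w hw
      obtain ⟨h1, h2, h3⟩ := hcone w hw
      have hx := re_pos_of_mem_cone hρ0 hw
      have : ((-s + I * e) * (α * w)).re = -s * (α * w).re - e * (α * w).im := by simp
      rw [this]
      have h4 : Λ * (e / 4) * ‖w‖ ≤ (α * w).re := by
        have : Λ * (e / 4) * ‖w‖ ≤ Λ * (e / 4) * (2 * w.re) := by gcongr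
        linarith
      have h5 : 0 ≤ e * (α * w).im := mul_nonneg he.le (le_trans (by positivity) h3)
      have := mul_le_mul_of_nonneg_left h4 hs.le
      linarith
  -- in the cone the equation is `exp (2 π i w) = H w`, the other two exponentials being small
  set H : ℂ → ℂ := fun w => -1 * (C (α * w) + (D (α * w) * exp (2 * I * e * (α * w)) +
      B (α * w) * exp ((-s + I * e) * (α * w)))) * (A (α * w))⁻¹ with hH
  have hA' := (hA.comp_mul hα0).mono hl'
  have hHasymp := ((PowAsymp.const (l := l) (c := -1) (by norm_num)).mul hl' hN1).mul hl'
    (hA'.inv hl')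
  have hHc : -1 * (c * α ^ k) * (a * α ^ i)⁻¹ ≠ 0 := by
    refine mul_ne_zero (mul_ne_zero (by norm_num) (mul_ne_zero hc (zpow_ne_zero k hα0)))
      (inv_ne_zero (mul_ne_zero ha (zpow_ne_zero i hα0)))
  obtain ⟨R₁, hR₁⟩ := eventually_cobounded_inf_principal.mp (hA'.eventually_ne_zero hl')
  have hαn : 0 < ‖α‖ := norm_pos_iff.mpr hα0
  have hlarge : ∀ w : ℂ, max R₁ (R / ‖α‖) < ‖w‖ → R < ‖α * w‖ := fun w hw => by
    rw [norm_mul, ← div_lt_iff₀' hαn]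
    exact (le_max_right _ _).trans_lt hw
  have hdA : ∀ {X : ℂ → ℂ} {w : ℂ}, DifferentiableAt ℂ X (α * w) →
      DifferentiableAt ℂ (fun w => X (α * w)) w := fun {X w} h =>
    DifferentiableAt.comp (f := fun w => α * w) w h (by fun_prop)
  have hHd : DifferentiableOn ℂ H (cone ρ ∩ {w | max R₁ (R / ‖α‖) < ‖w‖}) := by
    rintro w ⟨hw, hr⟩
    obtain ⟨h1, h2, h3, h4⟩ := hd _ (hlarge w hr)
    have hA0 := hR₁ w hw ((le_max_left _ _).trans_lt hr)
    have h1' := hdA h1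
    have h2' := hdA h2
    have h3' := hdA h3
    have h4' := hdA h4
    refine DifferentiableAt.differentiableWithinAt ?_
    have h5 := h1'.inv hA0
    fun_prop
  obtain ⟨R₂, g, Cg, hCg, hR₂, hgd, hg⟩ := exists_log_cone hρ0 hHc hHd (hHasymp.tendsto_one hl')
  obtain ⟨N, R₃, C', v, hv1, hv2, hv3⟩ := exists_fixed_points hρ0 hρ1 hCg hgd
    fun w hw hr => (hg w hw hr).2
  have hFw : ∀ w ∈ cone ρ, R₂ < ‖w‖ → F (α * w) = A (α * w) * exp (-(I * e * (α * w))) *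
      (exp (2 * Real.pi * I * w) - exp (2 * Real.pi * I * g w)) := by
    intro w hw hr
    have hA0 := hR₁ w hw ((le_max_left _ _).trans_lt (hR₂.trans_lt hr))
    rw [(hg w hw hr).1, hF _ (hlarge w (hR₂.trans_lt hr)), hH, ← hαs]
    have e1 : exp ((s + I * e) * α * w) = exp (s * (α * w)) * exp (I * e * (α * w)) := by
      rw [← exp_add]; congr 1; ring
    have e2 : exp ((-s + I * e) * (α * w)) = exp (-(s * (α * w))) * exp (I * e * (α * w)) := by
      rw [← exp_add]; congr 1; ring
    have e3 : exp (2 * I * e * (α * w)) = exp (I * e * (α * w)) * exp (I * e * (α * w)) := by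
      rw [← exp_add]; congr 1; ring
    have e4 : exp (-(I * e * (α * w))) = (exp (I * e * (α * w)))⁻¹ := exp_neg _
    have e0 := exp_ne_zero (I * e * (α * w))
    simp only [e1, e2, e3, e4]
    field_simp
    ring
  have hmain : ZerosAlong (fun w => F (α * w)) {w | 0 ≤ (α * w).re ∧ 0 ≤ (α * w).im} 1 := by
    obtain ⟨CA, hCA0, hCA⟩ := hA.norm_bounds le_rfl ha
    obtain ⟨CB, hCB0, hCB⟩ := hB.norm_bounds le_rfl hb
    obtain ⟨CC, hCC0, hCC⟩ := hC.norm_bounds le_rfl hc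
    obtain ⟨CD, hCD0, hCD⟩ := hD.norm_bounds le_rfl hd0
    set M := CA + CB + CC + CD with hM
    have hM0 : 0 ≤ M := by positivity
    obtain ⟨R₄, hR₄⟩ := (eventually_cobounded_inf_principal (S := Set.univ)).mp
      (by rw [principal_univ, inf_top_eq]; exact (hCA.and hCB).and (hCC.and hCD))
    set X : ℝ := (2 * M + 2) * √‖α‖ / (ρ / 4 * (2 * Real.pi)) + 1 with hX
    refine ⟨N, max (max (max R₂ R₃) (max R₄ R / ‖α‖)) (max (X ^ 2) (1 / ‖α‖)), C', v, fun n => by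
      rw [one_mul]; exact hv1 n,
      fun n hn => ?_, ?_, ?_⟩
    · obtain ⟨h1, h2, h3, h4⟩ := hv2 n hn
      have hA0 := hR₁ _ h1 ((le_max_left _ _).trans_lt (hR₂.trans_lt h2))
      have hmem := (isOpen_cone_inter ρ R₂).mem_nhds (show v n ∈ _ from ⟨h1, h2⟩)
      refine zero_of_factor (F := fun w => F (α * w))
        (U := fun w => A (α * w) * exp (-(I * e * (α * w)))) ?_ ?_ ?_
        (hgd.differentiableAt hmem) h3 h4
      · filter_upwards [hmem] with w hw
        exact hFw w hw.1 hw.2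
      · have := hdA (hd _ (hlarge _ (hR₂.trans_lt h2))).1
        exact this.fun_mul (by fun_prop)
      · exact mul_ne_zero hA0 (exp_ne_zero _)
    · intro x hx y hy hxy
      have h1 := (hv2 x hx).2.2.1
      have h2 := (hv2 y hy).2.2.1
      rw [hxy] at h1
      exact_mod_cast add_right_cancel (h1.symm.trans h2)
    · rintro w ⟨hwr, hwi⟩ hr h0
      have hr1 : R₂ < ‖w‖ := ((le_max_left _ _).trans ((le_max_left _ _).trans
        (le_max_left _ _))).trans_lt hr
      have hr2 : R₃ < ‖w‖ := ((le_max_right _ _).trans ((le_max_left _ _).trans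
        (le_max_left _ _))).trans_lt hr
      have hr3 : max R₄ R < ‖α * w‖ := by
        rw [norm_mul, ← div_lt_iff₀' hαn]
        exact ((le_max_right _ _).trans (le_max_left _ _)).trans_lt hr
      have hr4 : X ^ 2 < ‖w‖ := ((le_max_left _ _).trans (le_max_right _ _)).trans_lt hr
      have hr5 : 1 ≤ ‖α * w‖ := by
        rw [norm_mul, ← div_le_iff₀' hαn]
        exact (((le_max_right _ _).trans (le_max_right _ _)).trans_lt hr).le
      obtain ⟨⟨hbA, hbB⟩, hbC, hbD⟩ := hR₄ _ (Set.mem_univ (α * w)) ((le_max_left _ _).trans_lt hr3)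
      have hF0 := hF _ ((le_max_right _ _).trans_lt hr3)
      have h0' : F (α * w) = 0 := h0
      rw [h0'] at hF0
      set γ := α * w with hγ
      set r := √‖γ‖ with hrdef
      have hr1' : 1 ≤ r := Real.one_le_sqrt.mpr hr5
      have nA : ‖exp (s * γ)‖ = Real.exp (s * γ.re) := by rw [norm_exp]; simp
      have nB : ‖exp (-(s * γ))‖ = Real.exp (-(s * γ.re)) := by rw [norm_exp]; simp
      have nC : ‖exp (-(I * e * γ))‖ = Real.exp (e * γ.im) := by rw [norm_exp]; simp
      have nD : ‖exp (I * e * γ)‖ = Real.exp (-(e * γ.im)) := by rw [norm_exp]; simp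
      have hMb : ∀ Y : ℝ, Y ≤ M → Real.exp (Y * r) ≤ Real.exp (M * r) := fun Y h =>
        Real.exp_le_exp.mpr (by gcongr)
      have hMb' : ∀ Y : ℝ, Y ≤ M → Real.exp (-(M * r)) ≤ Real.exp (-(Y * r)) :=
        fun Y h => Real.exp_le_exp.mpr (by gcongr)
      have hsx : 0 ≤ s * γ.re := mul_nonneg hs.le hwr
      have hey : 0 ≤ e * γ.im := mul_nonneg he.le hwi
      have hMA : CA ≤ M := by rw [hM]; linarith
      have hMB : CB ≤ M := by rw [hM]; linarith
      have hMC : CC ≤ M := by rw [hM]; linarith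
      have hMD : CD ≤ M := by rw [hM]; linarith
      have hlast : 2 * (M * r) + 2 ≤ (2 * M + 2) * r := by linarith
      -- the two dominant exponentials have to balance: `s Re γ` and `e Im γ` agree up to
      -- `O(√|γ|)`
      have hk1 : s * γ.re - e * γ.im ≤ (2 * M + 2) * r :=
        (sub_le_of_sum_eq_zero hsx hey nA nB nC nD ((hMb' _ hMA).trans hbA.1)
          (hbB.2.trans (hMb _ hMB)) (hbC.2.trans (hMb _ hMC)) (hbD.2.trans (hMb _ hMD))
          hF0.symm).trans hlast
      have hk2 : e * γ.im - s * γ.re ≤ (2 * M + 2) * r :=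
        (sub_le_of_sum_eq_zero hey hsx nC nD nA nB ((hMb' _ hMC).trans hbC.1)
          (hbD.2.trans (hMb _ hMD)) (hbA.2.trans (hMb _ hMA)) (hbB.2.trans (hMb _ hMB))
          (by linear_combination -hF0)).trans hlast
      have hΛe : Λ * (e ^ 2 + s ^ 2) = 2 * Real.pi := by rw [hΛ]; field_simp
      have hwim : e * γ.im - s * γ.re = 2 * Real.pi * w.im := by
        rw [hγ, him, hre, ← hΛe]; ring
      have hwre : e * γ.re + s * γ.im = 2 * Real.pi * w.re := by
        rw [hγ, him, hre, ← hΛe]; ring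
      have hwre0 : 0 ≤ w.re := by
        have : 0 ≤ 2 * Real.pi * w.re := by
          rw [← hwre]; exact add_nonneg (mul_nonneg he.le hwr) (mul_nonneg hs.le hwi)
        exact (mul_nonneg_iff_of_pos_left (by positivity)).mp this
      have himb : 2 * Real.pi * |w.im| ≤ (2 * M + 2) * r := by
        have : |2 * Real.pi * w.im| ≤ (2 * M + 2) * r := by
          rw [← hwim, abs_le]; exact ⟨by linarith, hk2⟩
        rwa [abs_mul, abs_of_pos (by positivity : 0 < 2 * Real.pi)] at this
      have hrw : r = √‖α‖ * √‖w‖ := by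
        rw [hrdef, hγ, norm_mul, Real.sqrt_mul hαn.le]
      have hXw : X < √‖w‖ := Real.lt_sqrt_of_sq_lt hr4
      have himw : |w.im| < ρ / 4 * ‖w‖ := by
        have h1 : (2 * M + 2) * √‖α‖ / (ρ / 4 * (2 * Real.pi)) < √‖w‖ := by linarith
        rw [div_lt_iff₀ (by positivity)] at h1
        have h2 := Real.mul_self_sqrt (norm_nonneg w)
        have h3 : 0 < √‖w‖ := by
          have : 0 ≤ (2 * M + 2) * √‖α‖ / (ρ / 4 * (2 * Real.pi)) := by positivity
          linarith
        have h4 : 2 * Real.pi * |w.im| < 2 * Real.pi * (ρ / 4 * ‖w‖) := by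
          calc _ ≤ (2 * M + 2) * r := himb
            _ = ((2 * M + 2) * √‖α‖) * √‖w‖ := by rw [hrw]; ring
            _ < (√‖w‖ * (ρ / 4 * (2 * Real.pi))) * √‖w‖ := by gcongr
            _ = 2 * Real.pi * (ρ / 4 * ‖w‖) := by linear_combination (ρ / 4 * (2 * Real.pi)) * h2
        exact lt_of_mul_lt_mul_left h4 (by positivity)
      have hwc : w ∈ cone (ρ / 2) := by
        change |w.im| < ρ / 2 * w.re
        have h1 := norm_le_abs_re_add_abs_im w
        rw [abs_of_nonneg hwre0] at h1
        have h2 := mul_le_mul_of_nonneg_left h1 hρ0.le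
        have h3 := mul_le_mul_of_nonneg_right hρ1 (abs_nonneg w.im)
        have h4 := mul_nonneg hρ0.le hwre0
        linarith
      have hwc' : w ∈ cone ρ := by
        have h1 : |w.im| < ρ / 2 * w.re := hwc
        change |w.im| < ρ * w.re
        have h4 := mul_nonneg hρ0.le hwre0
        linarith
      have hz := hFw w hwc' hr1
      rw [← hγ, h0', eq_comm, mul_eq_zero, or_iff_right (mul_ne_zero
        (hR₁ w hwc' ((le_max_left _ _).trans_lt (hR₂.trans_lt hr1))) (exp_ne_zero _)),
        sub_eq_zero, exp_eq_exp_iff_exists_int] at hz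
      obtain ⟨q, hq⟩ := hz
      exact hv3 w hwc hr2 q (mul_left_cancel₀ two_pi_I_ne_zero (by linear_combination hq))
  have := hmain.scale hα0 hFd
  rw [mul_one] at this
  have hset : {z : ℂ | z / α ∈ {w : ℂ | 0 ≤ (α * w).re ∧ 0 ≤ (α * w).im}} =
      {z | 0 ≤ z.re ∧ 0 ≤ z.im} := by
    ext z; simp only [Set.mem_ofPred_eq, mul_div_cancel₀ z hα0]
  rwa [hset] at this

/-! ### Zeros of exponential sums near the imaginary axis -/

/-- A function that is a product of two exponential equations without common solutions has two
interlaced sequences of zeros in a cone. -/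
lemma zerosAlong_two_factors {F V H₁ H₂ : ℂ → ℂ} {S : Set ℂ} {R : ℝ} {c₁ c₂ : ℂ}
    (hF : ∀ w ∈ cone 1, R < ‖w‖ → F w = V w * (exp (2 * Real.pi * I * w) - H₁ w) *
      (exp (2 * Real.pi * I * w) - H₂ w))
    (hV : ∀ w ∈ cone 1, R < ‖w‖ → V w ≠ 0 ∧ H₁ w ≠ H₂ w)
    (hdV : DifferentiableOn ℂ V (cone 1 ∩ {w | R < ‖w‖}))
    (hd₁ : DifferentiableOn ℂ H₁ (cone 1 ∩ {w | R < ‖w‖}))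
    (hd₂ : DifferentiableOn ℂ H₂ (cone 1 ∩ {w | R < ‖w‖})) (hc₁ : c₁ ≠ 0) (hc₂ : c₂ ≠ 0)
    (h₁ : Tendsto H₁ (Bornology.cobounded ℂ ⊓ 𝓟 (cone 1)) (𝓝 c₁))
    (h₂ : Tendsto H₂ (Bornology.cobounded ℂ ⊓ 𝓟 (cone 1)) (𝓝 c₂))
    (hS : ∀ w ∈ S, R < ‖w‖ → F w = 0 → w ∈ cone (1 / 2)) : ZerosAlong F S (1 / 2) := by
  have hlog : ∀ {H : ℂ → ℂ} {c : ℂ}, DifferentiableOn ℂ H (cone 1 ∩ {w | R < ‖w‖}) → c ≠ 0 →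
      Tendsto H (Bornology.cobounded ℂ ⊓ 𝓟 (cone 1)) (𝓝 c) →
      ∃ (R' : ℝ) (g : ℂ → ℂ) (C : ℝ), 0 ≤ C ∧ R ≤ R' ∧
      DifferentiableOn ℂ g (cone 1 ∩ {w | R' < ‖w‖}) ∧
      ∀ w ∈ cone 1, R' < ‖w‖ → exp (2 * Real.pi * I * g w) = H w ∧ ‖g w‖ ≤ C * √‖w‖ := by
    intro H c hd hc h
    refine exists_log_cone one_pos hc (n := 0) hd ?_
    have := h.div_const c
    rw [div_self hc] at this
    simpa using this
  obtain ⟨R₁, g₁, C₁, hC₁, hR₁, hgd₁, hg₁⟩ := hlog hd₁ hc₁ h₁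
  obtain ⟨R₂, g₂, C₂, hC₂, hR₂, hgd₂, hg₂⟩ := hlog hd₂ hc₂ h₂
  obtain ⟨N₁, T₁, D₁, v₁, ha₁, hb₁, he₁⟩ := exists_fixed_points one_pos le_rfl hC₁ hgd₁
    fun w hw hr => (hg₁ w hw hr).2
  obtain ⟨N₂, T₂, D₂, v₂, ha₂, hb₂, he₂⟩ := exists_fixed_points one_pos le_rfl hC₂ hgd₂
    fun w hw hr => (hg₂ w hw hr).2
  have hval₁ : ∀ n ≥ N₁, exp (2 * Real.pi * I * v₁ n) = H₁ (v₁ n) := fun n hn => by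
    obtain ⟨h1, h2, h3, -⟩ := hb₁ n hn
    rw [← (hg₁ _ h1 h2).1]
    conv_lhs => rw [h3, mul_add, exp_add, mul_comm _ (n : ℂ), exp_nat_mul_two_pi_mul_I, one_mul]
  have hval₂ : ∀ n ≥ N₂, exp (2 * Real.pi * I * v₂ n) = H₂ (v₂ n) := fun n hn => by
    obtain ⟨h1, h2, h3, -⟩ := hb₂ n hn
    rw [← (hg₂ _ h1 h2).1]
    conv_lhs => rw [h3, mul_add, exp_add, mul_comm _ (n : ℂ), exp_nat_mul_two_pi_mul_I, one_mul]
  have hz₁ : ∀ n ≥ N₁, F (v₁ n) = 0 ∧ deriv F (v₁ n) ≠ 0 := by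
    intro n hn
    obtain ⟨h1, h2, h3, h4⟩ := hb₁ n hn
    have hmem := (isOpen_cone_inter 1 R₁).mem_nhds (show v₁ n ∈ _ from ⟨h1, h2⟩)
    have hmem' := (isOpen_cone_inter 1 R).mem_nhds (show v₁ n ∈ _ from ⟨h1, hR₁.trans_lt h2⟩)
    refine zero_of_factor (U := fun w => V w * (exp (2 * Real.pi * I * w) - H₂ w)) ?_ ?_ ?_
      (hgd₁.differentiableAt hmem) h3 h4
    · filter_upwards [hmem] with w hw
      rw [hF w hw.1 (hR₁.trans_lt hw.2), (hg₁ w hw.1 hw.2).1, mul_right_comm]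
    · have d1 := hdV.differentiableAt hmem'
      have d2 := hd₂.differentiableAt hmem'
      fun_prop
    · refine mul_ne_zero (hV _ h1 (hR₁.trans_lt h2)).1 ?_
      rw [hval₁ n hn]
      exact sub_ne_zero.mpr (hV _ h1 (hR₁.trans_lt h2)).2
  have hz₂ : ∀ n ≥ N₂, F (v₂ n) = 0 ∧ deriv F (v₂ n) ≠ 0 := by
    intro n hn
    obtain ⟨h1, h2, h3, h4⟩ := hb₂ n hn
    have hmem := (isOpen_cone_inter 1 R₂).mem_nhds (show v₂ n ∈ _ from ⟨h1, h2⟩)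
    have hmem' := (isOpen_cone_inter 1 R).mem_nhds (show v₂ n ∈ _ from ⟨h1, hR₂.trans_lt h2⟩)
    refine zero_of_factor (U := fun w => V w * (exp (2 * Real.pi * I * w) - H₁ w)) ?_ ?_ ?_
      (hgd₂.differentiableAt hmem) h3 h4
    · filter_upwards [hmem] with w hw
      rw [hF w hw.1 (hR₂.trans_lt hw.2), (hg₂ w hw.1 hw.2).1]
    · have d1 := hdV.differentiableAt hmem'
      have d2 := hd₁.differentiableAt hmem'
      fun_prop
    · refine mul_ne_zero (hV _ h1 (hR₂.trans_lt h2)).1 ?_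
      rw [hval₂ n hn]
      exact sub_ne_zero.mpr (hV _ h1 (hR₂.trans_lt h2)).2.symm
  -- a common term would solve both equations
  have hne : ∀ m ≥ N₁, ∀ n ≥ N₂, v₁ m ≠ v₂ n := by
    intro m hm n hn h
    have h1 := hval₁ m hm
    rw [h, hval₂ n hn] at h1
    obtain ⟨h2, h3, -⟩ := hb₂ n hn
    exact (hV _ h2 (hR₂.trans_lt h3)).2 h1.symm
  have hinj₁ : ∀ m ≥ N₁, ∀ n ≥ N₁, v₁ m = v₁ n → m = n := by
    intro m hm n hn h
    have h1 := (hb₁ m hm).2.2.1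
    have h2 := (hb₁ n hn).2.2.1
    rw [h] at h1
    exact_mod_cast add_right_cancel (h1.symm.trans h2)
  have hinj₂ : ∀ m ≥ N₂, ∀ n ≥ N₂, v₂ m = v₂ n → m = n := by
    intro m hm n hn h
    have h1 := (hb₂ m hm).2.2.1
    have h2 := (hb₂ n hn).2.2.1
    rw [h] at h1
    exact_mod_cast add_right_cancel (h1.symm.trans h2)
  set N := max N₁ N₂ with hN
  have hN₁ : N₁ ≤ N := le_max_left _ _
  have hN₂ : N₂ ≤ N := le_max_right _ _
  set B₀ : ℝ := ∑ n ∈ Finset.range N, (‖v₁ n‖ + ‖v₂ n‖) with hB₀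
  have hBle : ∀ n < N, ‖v₁ n‖ + ‖v₂ n‖ ≤ B₀ := fun n hn =>
    Finset.single_le_sum (f := fun n => ‖v₁ n‖ + ‖v₂ n‖) (fun i _ => by positivity)
      (Finset.mem_range.mpr hn)
  -- both sequences have spacing `1`, so interlacing them gives spacing `1 / 2`
  set v : ℕ → ℂ := fun n => if Even n then v₁ (n / 2) else v₂ (n / 2) with hv
  have hve : ∀ k, v (2 * k) = v₁ k := fun k => by simp [hv]
  have hvo : ∀ k, v (2 * k + 1) = v₂ k := fun k => by
    have h1 : ¬ Even (2 * k + 1) := by simp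
    have h2 : (2 * k + 1) / 2 = k := by omega
    simp [hv, h2]
  refine ⟨2 * N, max (max R (max R₁ R₂)) (max (max T₁ T₂) B₀), |D₁| + |D₂| + 1, v, ?_, ?_, ?_, ?_⟩
  · intro n
    obtain ⟨k, rfl | rfl⟩ := Nat.even_or_odd' n
    · rw [hve]
      have e : (1 / 2 : ℂ) * ((2 * k : ℕ) : ℂ) = k := by push_cast; ring
      rw [e]
      refine (ha₁ k).trans ?_
      have h1 : √((k : ℝ) + 1) ≤ √(((2 * k : ℕ) : ℝ) + 1) :=
        Real.sqrt_le_sqrt (by push_cast; linarith [k.cast_nonneg (α := ℝ)])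
      calc D₁ * √((k : ℝ) + 1) ≤ |D₁| * √((k : ℝ) + 1) := by gcongr; exact le_abs_self _
        _ ≤ _ := by gcongr; linarith [abs_nonneg D₂]
    · rw [hvo]
      have e : v₂ k - (1 / 2 : ℂ) * ((2 * k + 1 : ℕ) : ℂ) = (v₂ k - k) - 1 / 2 := by
        push_cast; ring
      rw [e]
      have h1 : √((k : ℝ) + 1) ≤ √(((2 * k + 1 : ℕ) : ℝ) + 1) :=
        Real.sqrt_le_sqrt (by push_cast; linarith [k.cast_nonneg (α := ℝ)])
      have h2 : 1 ≤ √((k : ℝ) + 1) :=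
        Real.one_le_sqrt.mpr (by linarith [k.cast_nonneg (α := ℝ)])
      have h3 : ‖(1 / 2 : ℂ)‖ ≤ 1 := by simp; norm_num
      calc ‖v₂ k - k - 1 / 2‖ ≤ D₂ * √((k : ℝ) + 1) + 1 :=
            (norm_sub_le _ _).trans (add_le_add (ha₂ k) h3)
        _ ≤ |D₂| * √((k : ℝ) + 1) + √((k : ℝ) + 1) := by
            gcongr; exact le_abs_self _
        _ = (|D₂| + 1) * √((k : ℝ) + 1) := by ring
        _ ≤ _ := by gcongr; linarith [abs_nonneg D₁]
  · intro n hn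
    obtain ⟨k, rfl | rfl⟩ := Nat.even_or_odd' n
    · rw [hve]; exact hz₁ k (by omega)
    · rw [hvo]; exact hz₂ k (by omega)
  · intro m hm n hn h
    rw [Set.mem_Ici] at hm hn
    obtain ⟨k, rfl | rfl⟩ := Nat.even_or_odd' m <;> obtain ⟨j, rfl | rfl⟩ := Nat.even_or_odd' n
    · rw [hve, hve] at h; rw [hinj₁ k (by omega) j (by omega) h]
    · rw [hve, hvo] at h; exact absurd h (hne k (by omega) j (by omega))
    · rw [hvo, hve] at h; exact absurd h.symm (hne j (by omega) k (by omega))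
    · rw [hvo, hvo] at h; rw [hinj₂ k (by omega) j (by omega) h]
  · intro w hw hr h0
    have hrR : R < ‖w‖ := ((le_max_left _ _).trans (le_max_left _ _)).trans_lt hr
    have hrR₁ : R₁ < ‖w‖ :=
      ((le_max_left _ _).trans ((le_max_right _ _).trans (le_max_left _ _))).trans_lt hr
    have hrR₂ : R₂ < ‖w‖ :=
      ((le_max_right _ _).trans ((le_max_right _ _).trans (le_max_left _ _))).trans_lt hr
    have hrT₁ : T₁ < ‖w‖ :=
      ((le_max_left _ _).trans ((le_max_left _ _).trans (le_max_right _ _))).trans_lt hr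
    have hrT₂ : T₂ < ‖w‖ :=
      ((le_max_right _ _).trans ((le_max_left _ _).trans (le_max_right _ _))).trans_lt hr
    have hrB : B₀ < ‖w‖ := ((le_max_right _ _).trans (le_max_right _ _)).trans_lt hr
    have hwc := hS w hw hrR h0
    have hwc1 : w ∈ cone 1 := by
      have h1 := re_pos_of_mem_cone (by norm_num) hwc
      have h2 : |w.im| < 1 / 2 * w.re := hwc
      change |w.im| < 1 * w.re
      linarith
    rw [hF w hwc1 hrR, mul_eq_zero, mul_eq_zero, or_iff_right (hV w hwc1 hrR).1] at h0
    rcases h0 with h0 | h0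
    · rw [sub_eq_zero, ← (hg₁ w hwc1 hrR₁).1, exp_eq_exp_iff_exists_int] at h0
      obtain ⟨q, hq⟩ := h0
      obtain ⟨n, hn, e⟩ := he₁ w hwc hrT₁ q
        (mul_left_cancel₀ two_pi_I_ne_zero (by linear_combination hq))
      refine ⟨2 * n, ?_, by rw [hve, e]⟩
      by_contra hlt
      have := hBle n (by omega)
      rw [← e] at this
      linarith [norm_nonneg (v₂ n)]
    · rw [sub_eq_zero, ← (hg₂ w hwc1 hrR₂).1, exp_eq_exp_iff_exists_int] at h0
      obtain ⟨q, hq⟩ := h0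
      obtain ⟨n, hn, e⟩ := he₂ w hwc hrT₂ q
        (mul_left_cancel₀ two_pi_I_ne_zero (by linear_combination hq))
      refine ⟨2 * n + 1, ?_, by rw [hvo, e]⟩
      by_contra hlt
      have := hBle n (by omega)
      rw [← e] at this
      linarith [norm_nonneg (v₁ n)]

/-- A convergent square root in a cone. -/
lemma exists_sqrt_cone {f : ℂ → ℂ} {c L : ℂ} {n : ℤ} {R : ℝ} (hc : c ≠ 0)
    (hd : DifferentiableOn ℂ f (cone 1 ∩ {w | R < ‖w‖}))
    (hf : Tendsto (fun w => f w / (c * w ^ n)) (Bornology.cobounded ℂ ⊓ 𝓟 (cone 1)) (𝓝 1))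
    (hL : Tendsto f (Bornology.cobounded ℂ ⊓ 𝓟 (cone 1)) (𝓝 L)) :
    ∃ (R' : ℝ) (r : ℂ → ℂ) (ℓ : ℂ), R ≤ R' ∧ DifferentiableOn ℂ r (cone 1 ∩ {w | R' < ‖w‖}) ∧
      (∀ w ∈ cone 1, R' < ‖w‖ → r w ^ 2 = f w ∧ r w ≠ 0) ∧ ℓ ^ 2 = L ∧
      Tendsto r (Bornology.cobounded ℂ ⊓ 𝓟 (cone 1)) (𝓝 ℓ) := by
  -- if `L = 0`, a logarithm comes from the power asymptotics; otherwise the principal logarithm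
  -- of `f / L` is defined near infinity
  rcases eq_or_ne L 0 with rfl | hL0
  · obtain ⟨R', g, C, -, hR, hgd, hg⟩ := exists_log_cone one_pos hc hd hf
    have hsq : ∀ w ∈ cone 1, R' < ‖w‖ → exp (Real.pi * I * g w) ^ 2 = f w := fun w hw hr => by
      rw [← (hg w hw hr).1, ← exp_nat_mul]
      congr 1; push_cast; ring
    refine ⟨R', fun w => exp (Real.pi * I * g w), 0, hR, (hgd.const_mul _).cexp,
      fun w hw hr => ⟨hsq w hw hr, exp_ne_zero _⟩, by norm_num, ?_⟩
    rw [tendsto_zero_iff_norm_tendsto_zero] at hL ⊢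
    have h1 := (Real.continuous_sqrt.tendsto 0).comp hL
    rw [Real.sqrt_zero] at h1
    refine h1.congr' ?_
    filter_upwards [eventually_cobounded_inf_principal.mpr
      ⟨R', fun w hw hr => hsq w hw hr⟩] with w hw
    rw [Function.comp_apply, ← hw, norm_pow, Real.sqrt_sq (norm_nonneg _)]
  · obtain ⟨ℓ, hℓ'⟩ := IsAlgClosed.exists_pow_nat_eq L two_pos
    have hℓ := hℓ'.symm
    have h1 : Tendsto (fun w => f w / L) (Bornology.cobounded ℂ ⊓ 𝓟 (cone 1)) (𝓝 1) := by
      have := hL.div_const L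
      rwa [div_self hL0] at this
    have hslit : ∀ᶠ w in Bornology.cobounded ℂ ⊓ 𝓟 (cone 1), f w / L ∈ slitPlane :=
      h1.eventually (isOpen_slitPlane.mem_nhds one_mem_slitPlane)
    obtain ⟨R₁, hR₁⟩ := eventually_cobounded_inf_principal.mp hslit
    have hℓ0 : ℓ ≠ 0 := by rintro rfl; exact hL0 (by rw [hℓ]; norm_num)
    refine ⟨max R R₁, fun w => ℓ * exp (log (f w / L) / 2), ℓ, le_max_left _ _, ?_, ?_, hℓ.symm, ?_⟩
    · rintro w ⟨hw, hr⟩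
      have hr' : max R R₁ < ‖w‖ := hr
      have hfd : DifferentiableAt ℂ f w := hd.differentiableAt
        ((isOpen_cone_inter 1 R).mem_nhds ⟨hw, (le_max_left _ _).trans_lt hr'⟩)
      exact ((((hfd.div_const L).clog (hR₁ w hw ((le_max_right _ _).trans_lt hr'))).div_const
        2).cexp.const_mul ℓ).differentiableWithinAt
    · intro w hw hr
      have h2 := slitPlane_ne_zero (hR₁ w hw ((le_max_right _ _).trans_lt hr))
      refine ⟨?_, mul_ne_zero hℓ0 (exp_ne_zero _)⟩
      rw [mul_pow, ← hℓ, ← exp_nat_mul]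
      push_cast
      rw [mul_div_cancel₀ _ two_ne_zero, exp_log h2, mul_div_cancel₀ _ hL0]
    · have h2 := ((h1.clog one_mem_slitPlane).div_const 2).cexp.const_mul ℓ
      simpa using h2

set_option maxHeartbeats 400000 in
/-- An exponential sum with exponents `s`, `0` and `-s` whose coefficients have comparable size
has its large zeros in the closed upper half plane near the imaginary axis, where `exp (s z)` is
near a root of a quadratic equation. -/
lemma zerosAlong_halfPlane {s : ℝ} (hs : 0 < s) {F A B C : ℂ → ℂ} {R : ℝ}
    (hF : ∀ z, R < ‖z‖ → F z = A z * exp (s * z) + B z * exp (-(s * z)) + C z)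
    (hd : ∀ z, R < ‖z‖ → DifferentiableAt ℂ A z ∧ DifferentiableAt ℂ B z ∧ DifferentiableAt ℂ C z)
    {a m t δ : ℂ} (ha : a ≠ 0) (hm : m ≠ 0) (hδ : δ ≠ 0) {i q : ℤ}
    (hA : PowAsymp (Bornology.cobounded ℂ) A a i)
    (hB : Tendsto (fun z => B z / A z) (Bornology.cobounded ℂ) (𝓝 m))
    (hC : Tendsto (fun z => C z / A z) (Bornology.cobounded ℂ) (𝓝 t))
    (hD : PowAsymp (Bornology.cobounded ℂ) (fun z => C z ^ 2 / 4 - A z * B z) δ q)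
    (hFd : Differentiable ℂ F) :
    ZerosAlong F {z | 0 ≤ z.im} (Real.pi * I / s) := by
  have hpi := Real.pi_pos
  have hs' : (s : ℂ) ≠ 0 := by exact_mod_cast hs.ne'
  set α : ℂ := 2 * Real.pi * I / s with hα
  have hα0 : α ≠ 0 := div_ne_zero two_pi_I_ne_zero hs'
  have hsα : ∀ w : ℂ, s * (α * w) = 2 * Real.pi * I * w := fun w => by rw [hα]; field_simp
  have hαn : 0 < ‖α‖ := norm_pos_iff.mpr hα0
  have him : ∀ w : ℂ, (α * w).im = 2 * Real.pi / s * w.re := fun w => by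
    have : α * w = ((2 * Real.pi / s : ℝ) : ℂ) * (I * w) := by rw [hα]; push_cast; ring
    rw [this, im_ofReal_mul]; simp
  set l : Filter ℂ := Bornology.cobounded ℂ ⊓ 𝓟 (cone 1) with hl
  have hl' : l ≤ Bornology.cobounded ℂ := inf_le_left
  have hmap : Tendsto (fun w : ℂ => α * w) (Bornology.cobounded ℂ) (Bornology.cobounded ℂ) :=
    tendsto_mul_left_cobounded hα0
  have hB' : Tendsto (fun w => B (α * w) / A (α * w)) l (𝓝 m) := (hB.comp hmap).mono_left hl'
  have hC' : Tendsto (fun w => C (α * w) / A (α * w)) l (𝓝 t) := (hC.comp hmap).mono_left hl'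
  have hA' := hA.comp_mul hα0
  obtain ⟨R₁, hR₁⟩ := (eventually_cobounded_inf_principal (S := Set.univ)).mp
    (by rw [principal_univ, inf_top_eq]; exact hA'.eventually_ne_zero le_rfl)
  have hdA : ∀ {X : ℂ → ℂ} {w : ℂ}, DifferentiableAt ℂ X (α * w) →
      DifferentiableAt ℂ (fun w => X (α * w)) w := fun {X w} h =>
    DifferentiableAt.comp (f := fun w => α * w) w h (by fun_prop)
  set R₂ : ℝ := max R₁ (R / ‖α‖) with hR₂
  have hlarge : ∀ w : ℂ, R₂ < ‖w‖ → R < ‖α * w‖ ∧ A (α * w) ≠ 0 := fun w hw => by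
    refine ⟨?_, hR₁ w (Set.mem_univ w) ((le_max_left _ _).trans_lt hw)⟩
    rw [norm_mul, ← div_lt_iff₀' hαn]
    exact (le_max_right _ _).trans_lt hw
  -- a quarter of the discriminant of `A x² + C x + B`, divided by `A²`
  set f : ℂ → ℂ := fun w => (C (α * w) ^ 2 / 4 - A (α * w) * B (α * w)) *
    ((A (α * w))⁻¹ * (A (α * w))⁻¹) with hf
  have hfd : DifferentiableOn ℂ f (cone 1 ∩ {w | R₂ < ‖w‖}) := by
    rintro w ⟨hw, hr⟩
    obtain ⟨h1, h2, h3⟩ := hd _ (hlarge w hr).1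
    have h1' := hdA h1
    have h2' := hdA h2
    have h3' := hdA h3
    have h5 := h1'.inv (hlarge w hr).2
    refine DifferentiableAt.differentiableWithinAt ?_
    exact (((h3'.fun_pow 2).div_const 4).fun_sub (h1'.fun_mul h2')).fun_mul (h5.fun_mul h5)
  have hfasymp := (((hD.comp_mul hα0).mul le_rfl ((hA'.inv le_rfl).mul le_rfl
    (hA'.inv le_rfl)))).mono hl'
  have hfc : δ * α ^ q * ((a * α ^ i)⁻¹ * (a * α ^ i)⁻¹) ≠ 0 := by
    have h1 := mul_ne_zero ha (zpow_ne_zero i hα0)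
    exact mul_ne_zero (mul_ne_zero hδ (zpow_ne_zero q hα0))
      (mul_ne_zero (inv_ne_zero h1) (inv_ne_zero h1))
  have hfL : Tendsto f l (𝓝 (t ^ 2 / 4 - m)) := by
    refine (((hC'.pow 2).div_const 4).sub hB').congr' ?_
    filter_upwards [hl' (hA'.eventually_ne_zero le_rfl)] with w hw
    rw [hf]; field_simp
  obtain ⟨R₃, r, ℓ, hR₃, hrd, hr, hℓ, hrℓ⟩ := exists_sqrt_cone hfc hfd (hfasymp.tendsto_one hl') hfL
  have hprod : (-(t / 2) + ℓ) * (-(t / 2) - ℓ) = m := by linear_combination -hℓ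
  have hc₁ : -(t / 2) + ℓ ≠ 0 := fun h => hm (by rw [← hprod, h, zero_mul])
  have hc₂ : -(t / 2) - ℓ ≠ 0 := fun h => hm (by rw [← hprod, h, mul_zero])
  have hCd : DifferentiableOn ℂ (fun w => -(C (α * w) / A (α * w) / 2)) (cone 1 ∩ {w | R₃ < ‖w‖}) := by
    rintro w ⟨hw, hr⟩
    obtain ⟨h1, h2, h3⟩ := hd _ (hlarge w (hR₃.trans_lt hr)).1
    exact (((hdA h3).fun_div (hdA h1) (hlarge w (hR₃.trans_lt hr)).2).div_const
      2).fun_neg.differentiableWithinAt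
  -- on the half plane a root of the quadratic equation is bounded and bounded below
  obtain ⟨M, hM0, R₄, hR₄⟩ : ∃ M : ℝ, 1 ≤ M ∧ ∃ R₄, ∀ w : ℂ, R₄ < ‖w‖ →
      ‖B (α * w) / A (α * w)‖ ≤ M ∧ ‖C (α * w) / A (α * w)‖ ≤ M ∧
        1 / M ≤ ‖B (α * w) / A (α * w)‖ := by
    set M := ‖m‖ + ‖t‖ + 2 + 2 / ‖m‖ with hM
    have hmn : 0 < ‖m‖ := norm_pos_iff.mpr hm
    have h2m : 0 < 2 / ‖m‖ := by positivity
    have hMp : 0 < M := by positivity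
    have h1 := (hB.comp hmap).norm.eventually_lt_const (show ‖m‖ < M by
      rw [hM]; linarith [norm_nonneg t])
    have h2 := (hC.comp hmap).norm.eventually_lt_const (show ‖t‖ < M by rw [hM]; linarith)
    have h3 := (hB.comp hmap).norm.eventually_const_lt (show 1 / M < ‖m‖ by
      rw [div_lt_iff₀ hMp, hM]
      have : ‖m‖ * (2 / ‖m‖) = 2 := by field_simp
      nlinarith [norm_nonneg t])
    obtain ⟨R₄, hR₄⟩ := (eventually_cobounded_inf_principal (S := Set.univ)).mp
      (by rw [principal_univ, inf_top_eq]; exact h1.and (h2.and h3))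
    exact ⟨M, by rw [hM]; linarith [norm_nonneg t], R₄, fun w hw =>
      ⟨(hR₄ w (Set.mem_univ w) hw).1.le, (hR₄ w (Set.mem_univ w) hw).2.1.le,
        (hR₄ w (Set.mem_univ w) hw).2.2.le⟩⟩
  have hFw : ∀ w : ℂ, R₂ < ‖w‖ → F (α * w) = A (α * w) * exp (-(2 * Real.pi * I * w)) *
      (exp (2 * Real.pi * I * w) ^ 2 + C (α * w) / A (α * w) * exp (2 * Real.pi * I * w) +
        B (α * w) / A (α * w)) := by
    intro w hw
    obtain ⟨h1, h2⟩ := hlarge w hw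
    have h3 := exp_ne_zero (2 * Real.pi * I * w)
    rw [hF _ h1, hsα, exp_neg]
    field_simp
    ring
  have hsubset : {w : ℂ | max (max R₃ R₄) (8 * M ^ 2) < ‖w‖} ⊆ {w | R₃ < ‖w‖} := fun w hw =>
    show R₃ < ‖w‖ from lt_of_le_of_lt ((le_max_left _ _).trans (le_max_left _ _)) hw
  have hmain : ZerosAlong (fun w => F (α * w)) {w | 0 ≤ (α * w).im} (1 / 2) := by
    refine zerosAlong_two_factors (R := max (max R₃ R₄) (8 * M ^ 2))
      (V := fun w => A (α * w) * exp (-(2 * Real.pi * I * w)))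
      (H₁ := fun w => -(C (α * w) / A (α * w) / 2) + r w)
      (H₂ := fun w => -(C (α * w) / A (α * w) / 2) - r w) ?_ ?_ ?_ ?_ ?_ hc₁ hc₂
      ((hC'.div_const 2).neg.add hrℓ) ((hC'.div_const 2).neg.sub hrℓ) ?_
    · intro w hw hr'
      have hr3 : R₃ < ‖w‖ := ((le_max_left _ _).trans (le_max_left _ _)).trans_lt hr'
      obtain ⟨h1, h2⟩ := hlarge w (hR₃.trans_lt hr3)
      have h3 := (hr w hw hr3).1
      have h4 : r w ^ 2 = (C (α * w) / A (α * w)) ^ 2 / 4 - B (α * w) / A (α * w) := by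
        rw [h3, hf]; field_simp
      rw [hFw w (hR₃.trans_lt hr3)]
      linear_combination (A (α * w) * exp (-(2 * Real.pi * I * w))) * h4
    · intro w hw hr'
      have hr3 : R₃ < ‖w‖ := ((le_max_left _ _).trans (le_max_left _ _)).trans_lt hr'
      refine ⟨mul_ne_zero (hlarge w (hR₃.trans_lt hr3)).2 (exp_ne_zero _), fun h => ?_⟩
      refine (hr w hw hr3).2 ?_
      linear_combination h / 2
    · rintro w ⟨hw, hr'⟩
      have hr3 : R₃ < ‖w‖ := ((le_max_left _ _).trans (le_max_left _ _)).trans_lt hr'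
      have h1 := hdA (hd _ (hlarge w (hR₃.trans_lt hr3)).1).1
      exact (h1.fun_mul (by fun_prop)).differentiableWithinAt
    · exact (hCd.fun_add hrd).mono (Set.inter_subset_inter_right _ hsubset)
    · exact (hCd.fun_sub hrd).mono (Set.inter_subset_inter_right _ hsubset)
    · intro w hw hr' h0
      have hr3 : R₃ < ‖w‖ := ((le_max_left _ _).trans (le_max_left _ _)).trans_lt hr'
      have hr4 : R₄ < ‖w‖ := ((le_max_right _ _).trans (le_max_left _ _)).trans_lt hr'
      have hr5 : 8 * M ^ 2 < ‖w‖ := (le_max_right _ _).trans_lt hr'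
      have hre : 0 ≤ w.re := by
        have h1 : 0 ≤ (α * w).im := hw
        rw [him] at h1
        exact (mul_nonneg_iff_of_pos_left (by positivity)).mp h1
      obtain ⟨hb1, hc1, hb2⟩ := hR₄ w hr4
      have h0' : F (α * w) = 0 := h0
      rw [hFw w (hR₃.trans_lt hr3), mul_eq_zero, or_iff_right
        (mul_ne_zero (hlarge w (hR₃.trans_lt hr3)).2 (exp_ne_zero _))] at h0'
      set Y := exp (2 * Real.pi * I * w) with hY
      have hYn : ‖Y‖ = Real.exp (-(2 * Real.pi * w.im)) := by rw [hY, norm_exp]; simp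
      set b := B (α * w) / A (α * w) with hb
      set c := C (α * w) / A (α * w) with hc
      have hY1 : ‖Y‖ ≤ M + 1 := by
        have e : Y ^ 2 = -(c * Y + b) := by linear_combination h0'
        have e' := congrArg norm e
        rw [norm_pow, norm_neg] at e'
        have h1 : ‖Y‖ ^ 2 ≤ M * ‖Y‖ + M := by
          rw [e']
          refine (norm_add_le _ _).trans (add_le_add ?_ hb1)
          rw [norm_mul]; gcongr
        nlinarith [norm_nonneg Y]
      have hY2 : 1 / M ≤ ‖Y‖ * (2 * M + 1) := by
        have e : b = -(Y * (Y + c)) := by linear_combination h0'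
        have e' := congrArg norm e
        rw [norm_neg, norm_mul] at e'
        rw [e'] at hb2
        refine hb2.trans ?_
        gcongr
        exact (norm_add_le _ _).trans (by linarith)
      -- `|exp (2 π i w)|` is confined to a compact range, so `Im w` is bounded
      have hM' : 0 < M := by linarith
      have h1 : -(2 * Real.pi * w.im) ≤ 3 * M := by
        have h2 := Real.add_one_le_exp (-(2 * Real.pi * w.im))
        rw [← hYn] at h2
        linarith
      have h2 : 2 * Real.pi * w.im ≤ 3 * M * M := by
        have h3 := Real.add_one_le_exp (2 * Real.pi * w.im)
        have h4 : Real.exp (2 * Real.pi * w.im) * ‖Y‖ = 1 := by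
          rw [hYn, ← Real.exp_add, add_neg_cancel, Real.exp_zero]
        have h5 : Real.exp (2 * Real.pi * w.im) ≤ M * (2 * M + 1) := by
          rw [div_le_iff₀ hM'] at hY2
          have h6 := Real.exp_pos (2 * Real.pi * w.im)
          calc Real.exp (2 * Real.pi * w.im) = Real.exp (2 * Real.pi * w.im) * 1 := by ring
            _ ≤ Real.exp (2 * Real.pi * w.im) * (‖Y‖ * (2 * M + 1) * M) := by gcongr
            _ = (Real.exp (2 * Real.pi * w.im) * ‖Y‖) * (M * (2 * M + 1)) := by ring
            _ = _ := by rw [h4, one_mul]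
        nlinarith
      have h6 : |w.im| ≤ M ^ 2 / 2 := by
        have h7 : M ≤ M * M := le_mul_of_one_le_left hM'.le hM0
        have h8 : |2 * Real.pi * w.im| ≤ 3 * M * M := abs_le.mpr ⟨by linarith, h2⟩
        rw [abs_mul, abs_of_pos (by positivity : 0 < 2 * Real.pi)] at h8
        have h9 : 6 * |w.im| ≤ 2 * Real.pi * |w.im| := by gcongr; linarith [Real.pi_gt_three]
        linarith
      have h7 := norm_le_abs_re_add_abs_im w
      rw [abs_of_nonneg hre] at h7
      change |w.im| < 1 / 2 * w.re
      linarith [sq_nonneg M]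
  have h := hmain.scale hα0 hFd
  have hset : {z : ℂ | z / α ∈ {w : ℂ | 0 ≤ (α * w).im}} = {z | 0 ≤ z.im} := by
    ext z; simp only [Set.mem_ofPred_eq, mul_div_cancel₀ z hα0]
  have hdir : α * (1 / 2) = Real.pi * I / s := by rw [hα]; ring
  rwa [hset, hdir] at h

/-! ### Large zeros of the duct function -/

namespace Cascade

variable (p : Cascade)

/-- The root of `γ² - κ²` which is analytic near infinity and close to `γ` there. -/
noncomputable def farRoot (γ : ℂ) : ℂ := γ * exp (log (1 - p.κ ^ 2 / γ ^ 2) / 2)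

lemma one_sub_mem_slitPlane {γ : ℂ} (h : 2 * ‖p.κ‖ < ‖γ‖) : 1 - p.κ ^ 2 / γ ^ 2 ∈ slitPlane := by
  have h0 : 0 < ‖γ‖ := by linarith [norm_nonneg p.κ]
  refine Or.inl ?_
  have h1 : ‖p.κ ^ 2 / γ ^ 2‖ < 1 := by
    rw [norm_div, norm_pow, norm_pow, div_lt_one (by positivity)]
    nlinarith [norm_nonneg p.κ]
  have := (le_abs_self _).trans (abs_re_le_norm (p.κ ^ 2 / γ ^ 2))
  rw [sub_re, one_re]; linarith

lemma farRoot_sq {γ : ℂ} (h : 2 * ‖p.κ‖ < ‖γ‖) : p.farRoot γ ^ 2 = γ ^ 2 - p.κ ^ 2 := by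
  have h0 : γ ≠ 0 := norm_pos_iff.mp (by linarith [norm_nonneg p.κ])
  have h1 := slitPlane_ne_zero (p.one_sub_mem_slitPlane h)
  rw [farRoot, mul_pow, ← exp_nat_mul]
  push_cast
  rw [mul_div_cancel₀ _ two_ne_zero, exp_log h1]
  field_simp

lemma differentiableAt_farRoot {γ : ℂ} (h : 2 * ‖p.κ‖ < ‖γ‖) :
    DifferentiableAt ℂ p.farRoot γ := by
  have h0 : γ ≠ 0 := norm_pos_iff.mp (by linarith [norm_nonneg p.κ])
  have h3 : DifferentiableAt ℂ (fun z : ℂ => z ^ 2) γ := by fun_prop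
  have h1 : DifferentiableAt ℂ (fun z : ℂ => 1 - p.κ ^ 2 / z ^ 2) γ :=
    ((differentiableAt_const (p.κ ^ 2)).fun_div h3 (pow_ne_zero 2 h0)).const_sub 1
  exact differentiableAt_id.mul ((h1.clog (p.one_sub_mem_slitPlane h)).div_const 2).cexp

lemma norm_farRoot_sub_le {γ : ℂ} (h : 2 * ‖p.κ‖ < ‖γ‖) :
    ‖p.farRoot γ - γ‖ ≤ ‖p.κ‖ ^ 2 / ‖γ‖ := by
  have h0 : 0 < ‖γ‖ := by linarith [norm_nonneg p.κ]
  have h1 : ‖γ‖ ≤ ‖p.farRoot γ + γ‖ := by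
    have e : p.farRoot γ + γ = γ * (exp (log (1 - p.κ ^ 2 / γ ^ 2) / 2) + 1) := by
      rw [farRoot]; ring
    rw [e, norm_mul]
    refine le_mul_of_one_le_right h0.le ?_
    refine le_trans ?_ ((le_abs_self _).trans (abs_re_le_norm _))
    have h2 : 0 ≤ (exp (log (1 - p.κ ^ 2 / γ ^ 2) / 2)).re := by
      rw [exp_re]
      refine mul_nonneg (Real.exp_pos _).le (Real.cos_nonneg_of_mem_Icc ?_)
      have h3 : (log (1 - p.κ ^ 2 / γ ^ 2) / 2).im = arg (1 - p.κ ^ 2 / γ ^ 2) / 2 := by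
        rw [div_ofNat_im, log_im]
      rw [h3]
      have := neg_pi_lt_arg (1 - p.κ ^ 2 / γ ^ 2)
      have := arg_le_pi (1 - p.κ ^ 2 / γ ^ 2)
      constructor <;> linarith
    rw [add_re, one_re]; linarith
  have e : (p.farRoot γ - γ) * (p.farRoot γ + γ) = -p.κ ^ 2 := by
    linear_combination p.farRoot_sq h
  have e' := congrArg norm e
  rw [norm_mul, norm_neg, norm_pow] at e'
  rw [le_div_iff₀ h0, ← e']
  gcongr

lemma eventually_far : ∀ᶠ γ in Bornology.cobounded ℂ, 2 * ‖p.κ‖ < ‖γ‖ :=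
  tendsto_norm_cobounded_atTop.eventually_gt_atTop _

lemma farRoot_sub_isBigO :
    (fun γ => p.farRoot γ - γ) =O[Bornology.cobounded ℂ] fun γ => γ⁻¹ := by
  refine Asymptotics.IsBigO.of_bound (‖p.κ‖ ^ 2) ?_
  filter_upwards [p.eventually_far] with γ h
  rw [norm_inv, ← div_eq_mul_inv]
  exact p.norm_farRoot_sub_le h

/-- Replacing `farRoot γ` by `γ` in an exponent costs a factor `1 + O(1 / γ)`. -/
lemma powAsymp_exp_farRoot (t : ℂ) :
    PowAsymp (Bornology.cobounded ℂ) (fun γ => exp (t * (p.farRoot γ - γ))) 1 0 := by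
  have h1 := p.farRoot_sub_isBigO
  have h2 : Tendsto (fun γ => t * (p.farRoot γ - γ)) (Bornology.cobounded ℂ) (𝓝 0) := by
    have := (h1.trans_tendsto tendsto_inv₀_cobounded).const_mul t
    simpa using this
  have h3 : (fun x : ℂ => exp x - 1) =O[𝓝 0] fun x => x := by
    have h4 := (hasDerivAt_exp 0).isBigO_sub
    simpa using h4
  have h5 := (h3.comp_tendsto h2).trans (h1.const_mul_left t)
  unfold PowAsymp
  simpa [Function.comp_def] using h5

lemma symbol_eq (γ : ℂ) : p.symbol γ = p.μ₀ + -I * p.μ₁ * γ + -p.μ₂ * γ ^ 2 := by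
  unfold symbol; ring

/-- The duct function as an exponential sum, for either root `q` of `γ² - κ²`. -/
lemma duct_eq_of_sq {γ q : ℂ} (hq : q ^ 2 = γ ^ 2 - p.κ ^ 2) :
    p.duct γ = (p.symbol γ - q) / 2 * exp (p.s * q) + (p.symbol γ + q) / 2 * exp (-(p.s * q)) -
      p.symbol γ * cos (p.d * γ + p.σ) := by
  have hz : (I * q) ^ 2 = p.κ ^ 2 - γ ^ 2 := by rw [mul_pow, I_sq, hq]; ring
  unfold duct
  rw [p.zeta_mul_sin_eq hz, p.acoustic_eq hz,
    show (p.s : ℂ) * (I * q) = (p.s * q) * I by ring, sin_mul_I, cos_mul_I, sinh, cosh]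
  linear_combination (q * (exp (p.s * q) - exp (-(p.s * q))) / 2) * I_sq

/-- The coefficients `P ∓ q` of the two real exponentials in `duct` have the same power growth,
which dominates that of the symbol. This fails if `μ₂ = 0` and `μ₁ = ± i`. -/
lemma exists_powAsymp_symbol (hμ : p.μ₂ = 0 → p.μ₁ ≠ I ∧ p.μ₁ ≠ -I) :
    ∃ (n : ℤ) (a b t : ℂ), 0 ≤ n ∧ a ≠ 0 ∧ b ≠ 0 ∧
      PowAsymp (Bornology.cobounded ℂ) (fun γ => p.symbol γ - p.farRoot γ) a n ∧
      PowAsymp (Bornology.cobounded ℂ) (fun γ => p.symbol γ + p.farRoot γ) b n ∧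
      Tendsto (fun γ => p.symbol γ / γ ^ n) (Bornology.cobounded ℂ) (𝓝 t) := by
  have hq := p.farRoot_sub_isBigO
  have hsmall : ∀ n : ℤ, 0 ≤ n → (fun γ => p.farRoot γ - γ) =O[Bornology.cobounded ℂ]
      fun γ => γ ^ (n - 1) := by
    intro n hn
    refine hq.trans (Asymptotics.IsBigO.of_bound 1 ?_)
    filter_upwards [tendsto_norm_cobounded_atTop.eventually_ge_atTop (1 : ℝ)] with γ h
    rw [one_mul, norm_zpow, norm_inv, ← zpow_neg_one]
    exact zpow_le_zpow_right₀ h (by omega)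
  by_cases h2 : p.μ₂ = 0
  · obtain ⟨hμ1, hμ2⟩ := hμ h2
    have ha : -I * p.μ₁ - 1 ≠ 0 := fun h => hμ1 (by
      linear_combination I * h + p.μ₁ * I_sq)
    have hb : -I * p.μ₁ + 1 ≠ 0 := fun h => hμ2 (by
      linear_combination I * h + p.μ₁ * I_sq)
    refine ⟨1, _, _, -I * p.μ₁, by norm_num, ha, hb, ?_, ?_, ?_⟩
    · refine ((PowAsymp.linear le_rfl p.μ₀ ha).add_small le_rfl ha
        (hsmall 1 (by norm_num)).neg_left).congr' (Eventually.of_forall fun γ => ?_)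
      simp only [p.symbol_eq, h2]; ring
    · refine ((PowAsymp.linear le_rfl p.μ₀ hb).add_small le_rfl hb
        (hsmall 1 (by norm_num))).congr' (Eventually.of_forall fun γ => ?_)
      simp only [p.symbol_eq, h2]; ring
    · have h3 := (tendsto_inv₀_cobounded (α := ℂ)).const_mul p.μ₀ |>.add_const (-I * p.μ₁)
      rw [mul_zero, zero_add] at h3
      refine h3.congr' ?_
      filter_upwards [PowAsymp.eventually_ne le_rfl] with γ hγ
      rw [p.symbol_eq, h2, zpow_one]; field_simp; ring
  · have hc : -p.μ₂ ≠ 0 := neg_ne_zero.mpr h2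
    refine ⟨2, _, _, -p.μ₂, by norm_num, hc, hc, ?_, ?_, ?_⟩
    · refine ((PowAsymp.quadratic le_rfl p.μ₀ (-I * p.μ₁ - 1) hc).add_small le_rfl hc
        (hsmall 2 (by norm_num)).neg_left).congr' (Eventually.of_forall fun γ => ?_)
      simp only [p.symbol_eq]; ring
    · refine ((PowAsymp.quadratic le_rfl p.μ₀ (-I * p.μ₁ + 1) hc).add_small le_rfl hc
        (hsmall 2 (by norm_num))).congr' (Eventually.of_forall fun γ => ?_)
      simp only [p.symbol_eq]; ring
    · have h3 := (PowAsymp.quadratic le_rfl p.μ₀ (-I * p.μ₁) hc).tendsto_one le_rfl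
      have h4 := h3.const_mul (-p.μ₂)
      rw [mul_one] at h4
      refine h4.congr' ?_
      filter_upwards [PowAsymp.eventually_ne le_rfl] with γ hγ
      have := zpow_ne_zero 2 hγ
      rw [p.symbol_eq]; field_simp

lemma exists_powAsymp_symbol_self (hμ : p.μ₂ = 0 → p.μ₁ = 0 → p.μ₀ ≠ 0) :
    ∃ (n : ℤ) (c : ℂ), c ≠ 0 ∧ PowAsymp (Bornology.cobounded ℂ) p.symbol c n := by
  by_cases h2 : p.μ₂ = 0
  · by_cases h1 : p.μ₁ = 0
    · refine ⟨0, p.μ₀, hμ h2 h1, (PowAsymp.const (hμ h2 h1)).congr'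
        (Eventually.of_forall fun γ => ?_)⟩
      simp [p.symbol_eq, h1, h2]
    · have hb : -I * p.μ₁ ≠ 0 := mul_ne_zero (neg_ne_zero.mpr I_ne_zero) h1
      refine ⟨1, _, hb, (PowAsymp.linear le_rfl p.μ₀ hb).congr'
        (Eventually.of_forall fun γ => ?_)⟩
      simp [p.symbol_eq, h2]
  · have hc : -p.μ₂ ≠ 0 := neg_ne_zero.mpr h2
    exact ⟨2, _, hc, (PowAsymp.quadratic le_rfl p.μ₀ (-I * p.μ₁) hc).congr'
      (Eventually.of_forall fun γ => (p.symbol_eq γ).symm)⟩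

lemma differentiable_symbol : Differentiable ℂ p.symbol := by unfold symbol; fun_prop

end Cascade

/-- `F` is near infinity a sum of the four exponentials `exp (± s z)`, `exp (± i e z)` with
analytic coefficients of power growth. -/
def ExpSum (F : ℂ → ℂ) (s e : ℝ) : Prop :=
  ∃ (A B C D : ℂ → ℂ) (R : ℝ) (a b c d : ℂ) (i j k m : ℤ), a ≠ 0 ∧ b ≠ 0 ∧ c ≠ 0 ∧ d ≠ 0 ∧
    PowAsymp (Bornology.cobounded ℂ) A a i ∧ PowAsymp (Bornology.cobounded ℂ) B b j ∧
    PowAsymp (Bornology.cobounded ℂ) C c k ∧ PowAsymp (Bornology.cobounded ℂ) D d m ∧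
    ∀ z, R < ‖z‖ → (DifferentiableAt ℂ A z ∧ DifferentiableAt ℂ B z ∧
      DifferentiableAt ℂ C z ∧ DifferentiableAt ℂ D z) ∧
      F z = A z * exp (s * z) + B z * exp (-(s * z)) +
        C z * exp (-(I * e * z)) + D z * exp (I * e * z)

namespace ExpSum

variable {F : ℂ → ℂ} {s e : ℝ}

/-- A quarter turn exchanges the roles of the real and the imaginary exponents. -/
lemma rotate (h : ExpSum F s e) : ExpSum (fun z => F (I * z)) e s := by
  obtain ⟨A, B, C, D, R, a, b, c, d, i, j, k, m, ha, hb, hc, hd, hA, hB, hC, hD, h⟩ := h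
  have hI := I_ne_zero
  have hdA : ∀ {X : ℂ → ℂ} {w : ℂ}, DifferentiableAt ℂ X (I * w) →
      DifferentiableAt ℂ (fun w => X (I * w)) w := fun {X w} h =>
    DifferentiableAt.comp (f := fun w => I * w) w h (by fun_prop)
  refine ⟨_, _, _, _, R, _, _, _, _, k, m, j, i, mul_ne_zero hc (zpow_ne_zero _ hI),
    mul_ne_zero hd (zpow_ne_zero _ hI), mul_ne_zero hb (zpow_ne_zero _ hI),
    mul_ne_zero ha (zpow_ne_zero _ hI), hC.comp_mul hI, hD.comp_mul hI, hB.comp_mul hI,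
    hA.comp_mul hI, fun z hz => ?_⟩
  obtain ⟨⟨h1, h2, h3, h4⟩, h5⟩ := h (I * z) (by rwa [norm_mul, norm_I, one_mul])
  refine ⟨⟨hdA h3, hdA h4, hdA h2, hdA h1⟩, ?_⟩
  have e1 : I * e * (I * z) = -(e * z) := by linear_combination (e * z : ℂ) * I_sq
  have e2 : (s : ℂ) * (I * z) = I * s * z := by ring
  simp only [h5, e1, e2, neg_neg]
  ring

lemma swap (h : ExpSum F s e) : ExpSum F s (-e) := by
  obtain ⟨A, B, C, D, R, a, b, c, d, i, j, k, m, ha, hb, hc, hd, hA, hB, hC, hD, h⟩ := h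
  refine ⟨A, B, D, C, R, a, b, d, c, i, j, m, k, ha, hb, hd, hc, hA, hB, hD, hC, fun z hz => ?_⟩
  obtain ⟨⟨h1, h2, h3, h4⟩, h5⟩ := h z hz
  refine ⟨⟨h1, h2, h4, h3⟩, ?_⟩
  rw [h5]
  push_cast
  simp only [mul_neg, neg_mul, neg_neg]
  ring

lemma zerosAlong (h : ExpSum F s e) (he : 0 < e) (hs : 0 < s) (hF : Differentiable ℂ F) :
    ZerosAlong F {z | 0 ≤ z.re ∧ 0 ≤ z.im} (2 * Real.pi * (e + s * I) / (e ^ 2 + s ^ 2)) := by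
  obtain ⟨A, B, C, D, R, a, b, c, d, i, j, k, m, ha, hb, hc, hd, hA, hB, hC, hD, h⟩ := h
  exact zerosAlong_quadrant he hs (fun z hz => (h z hz).2) (fun z hz => (h z hz).1) ha hb hc hd
    hA hB hC hD hF

/-- The second quadrant is a quarter turn of the first. -/
lemma zerosAlong_left (h : ExpSum F s e) (he : 0 < e) (hs : 0 < s) (hF : Differentiable ℂ F) :
    ZerosAlong F {z | z.re ≤ 0 ∧ 0 ≤ z.im} (2 * Real.pi * (-e + s * I) / (e ^ 2 + s ^ 2)) := by
  have hd : Differentiable ℂ fun z => F (I * z) := hF.comp (by fun_prop)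
  have h1 := (h.rotate.zerosAlong hs he hd).scale I_ne_zero hF
  have e1 : {z : ℂ | z / I ∈ {z : ℂ | 0 ≤ z.re ∧ 0 ≤ z.im}} = {z | z.re ≤ 0 ∧ 0 ≤ z.im} := by
    ext z; simp [and_comm]
  have e2 : I * (2 * Real.pi * (s + e * I) / (s ^ 2 + e ^ 2)) =
      2 * Real.pi * (-e + s * I) / (e ^ 2 + s ^ 2) := by
    rw [add_comm ((s : ℂ) ^ 2), ← mul_div_assoc]; congr 1
    linear_combination (2 * Real.pi * e : ℂ) * I_sq
  rwa [e1, e2] at h1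

/-- The lower quadrants are half turns of the upper ones. -/
lemma zerosAlong_lower (h : ExpSum F s e) (he : 0 < e) (hs : 0 < s) (hF : Differentiable ℂ F) :
    ZerosAlong F {z | z.re ≤ 0 ∧ z.im ≤ 0} (-(2 * Real.pi * (e + s * I) / (e ^ 2 + s ^ 2))) ∧
    ZerosAlong F {z | 0 ≤ z.re ∧ z.im ≤ 0} (-(2 * Real.pi * (-e + s * I) / (e ^ 2 + s ^ 2))) := by
  have hd : Differentiable ℂ fun z => F (-1 * z) := hF.comp (by fun_prop)
  have h0 : ExpSum (fun z => F (-1 * z)) s e := by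
    have := h.rotate.rotate
    have e3 : (fun z => F (I * (I * z))) = fun z => F (-1 * z) := by
      funext z; rw [← mul_assoc, I_mul_I]
    rwa [e3] at this
  have h1 := (h0.zerosAlong he hs hd).scale (by norm_num) hF
  have h2 := (h0.zerosAlong_left he hs hd).scale (by norm_num) hF
  have e1 : {z : ℂ | z / -1 ∈ {z : ℂ | 0 ≤ z.re ∧ 0 ≤ z.im}} = {z | z.re ≤ 0 ∧ z.im ≤ 0} := by
    ext z; simp [div_neg]
  have e2 : {z : ℂ | z / -1 ∈ {z : ℂ | z.re ≤ 0 ∧ 0 ≤ z.im}} = {z | 0 ≤ z.re ∧ z.im ≤ 0} := by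
    ext z; simp [div_neg]
  rw [e1, neg_one_mul] at h1
  rw [e2, neg_one_mul] at h2
  exact ⟨h1, h2⟩

end ExpSum

namespace Cascade

variable (p : Cascade)

/-- The coefficient of `exp (s γ)` in `duct`. -/
noncomputable def coeffA (γ : ℂ) : ℂ :=
  1 / 2 * ((p.symbol γ - p.farRoot γ) * exp (p.s * (p.farRoot γ - γ)))

/-- The coefficient of `exp (-s γ)` in `duct`. -/
noncomputable def coeffB (γ : ℂ) : ℂ :=
  1 / 2 * ((p.symbol γ + p.farRoot γ) * exp (-p.s * (p.farRoot γ - γ)))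

/-- Near infinity the exponentials of `farRoot` are replaced by those of `γ`, at the expense of
the coefficients. -/
lemma duct_eq_far {γ : ℂ} (h : 2 * ‖p.κ‖ < ‖γ‖) :
    p.duct γ = p.coeffA γ * exp (p.s * γ) + p.coeffB γ * exp (-(p.s * γ)) +
      -p.symbol γ * cos (p.d * γ + p.σ) := by
  have e1 : exp (p.s * p.farRoot γ) = exp (p.s * (p.farRoot γ - γ)) * exp (p.s * γ) := by
    rw [← exp_add]; congr 1; ring
  have e2 : exp (-(p.s * p.farRoot γ)) =
      exp (-p.s * (p.farRoot γ - γ)) * exp (-(p.s * γ)) := by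
    rw [← exp_add]; congr 1; ring
  rw [p.duct_eq_of_sq (p.farRoot_sq h), e1, e2, coeffA, coeffB]
  ring

lemma differentiableAt_coeff {γ : ℂ} (h : 2 * ‖p.κ‖ < ‖γ‖) :
    DifferentiableAt ℂ p.coeffA γ ∧ DifferentiableAt ℂ p.coeffB γ := by
  have h1 := p.differentiableAt_farRoot h
  have h2 : DifferentiableAt ℂ p.symbol γ := p.differentiable_symbol γ
  unfold coeffA coeffB
  constructor <;> fun_prop

lemma exists_powAsymp_coeff (hμ : p.μ₂ = 0 → p.μ₁ ≠ I ∧ p.μ₁ ≠ -I) :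
    ∃ (n : ℤ) (a b t : ℂ), a ≠ 0 ∧ b ≠ 0 ∧ PowAsymp (Bornology.cobounded ℂ) p.coeffA a n ∧
      PowAsymp (Bornology.cobounded ℂ) p.coeffB b n ∧
      Tendsto (fun γ => p.symbol γ / γ ^ n) (Bornology.cobounded ℂ) (𝓝 t) := by
  obtain ⟨n, a, b, t, -, ha, hb, hA, hB, hP⟩ := p.exists_powAsymp_symbol hμ
  have h2 : PowAsymp (Bornology.cobounded ℂ) (fun _ => (1 / 2 : ℂ)) (1 / 2) 0 :=
    PowAsymp.const (by norm_num)
  refine ⟨n, 1 / 2 * (a * 1), 1 / 2 * (b * 1), t, by simpa using ha, by simpa using hb, ?_, ?_, hP⟩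
  · have h := h2.mul le_rfl (hA.mul le_rfl (p.powAsymp_exp_farRoot p.s))
    rw [zero_add, add_zero] at h
    exact h
  · have h := h2.mul le_rfl (hB.mul le_rfl (p.powAsymp_exp_farRoot (-p.s)))
    rw [zero_add, add_zero] at h
    exact h

lemma expSum_duct (hμ : p.μ₂ = 0 → (p.μ₁ = 0 → p.μ₀ ≠ 0) ∧ p.μ₁ ≠ I ∧ p.μ₁ ≠ -I) :
    ExpSum p.duct p.s p.d := by
  obtain ⟨n, a, b, t, ha, hb, hA, hB, -⟩ := p.exists_powAsymp_coeff fun h => (hμ h).2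
  obtain ⟨k, c, hc, hC⟩ := p.exists_powAsymp_symbol_self fun h => (hμ h).1
  have hconst : ∀ x : ℂ, x ≠ 0 → x * c ≠ 0 ∧ PowAsymp (Bornology.cobounded ℂ)
      (fun γ => x * p.symbol γ) (x * c) k := fun x hx => by
    refine ⟨mul_ne_zero hx hc, ?_⟩
    simpa only [zero_add] using (PowAsymp.const hx).mul le_rfl hC
  have hx : ∀ y : ℂ, -exp y / 2 ≠ 0 := fun y => by simp [exp_ne_zero]
  obtain ⟨hc1, hC1⟩ := hconst _ (hx (-(I * p.σ)))
  obtain ⟨hc2, hC2⟩ := hconst _ (hx (I * p.σ))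
  refine ⟨_, _, _, _, 2 * ‖p.κ‖, a, b, _, _, n, n, k, k, ha, hb, hc1, hc2, hA, hB, hC1, hC2,
    fun z hz => ⟨⟨(p.differentiableAt_coeff hz).1, (p.differentiableAt_coeff hz).2, ?_, ?_⟩, ?_⟩⟩
  · exact (p.differentiable_symbol z).const_mul _
  · exact (p.differentiable_symbol z).const_mul _
  · rw [p.duct_eq_far hz, cos]
    have e1 : exp ((p.d * z + p.σ) * I) = exp (I * p.σ) * exp (I * p.d * z) := by
      rw [← exp_add]; congr 1; ring
    have e2 : exp (-(p.d * z + p.σ) * I) = exp (-(I * p.σ)) * exp (-(I * p.d * z)) := by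
      rw [← exp_add]; congr 1; ring
    rw [e1, e2]; ring

/-- For `d = 0` the discriminant of the quadratic equation for `exp (s γ)` is a polynomial, which
could only vanish identically together with `K 0`. -/
lemma exists_powAsymp_discriminant (hK : p.K 0 ≠ 0) :
    ∃ (q : ℤ) (δ : ℂ), δ ≠ 0 ∧ PowAsymp (Bornology.cobounded ℂ)
      (fun γ => (-p.symbol γ * cos p.σ) ^ 2 / 4 - p.coeffA γ * p.coeffB γ) δ q := by
  set S : ℂ := sin p.σ with hS
  set Q : Polynomial ℂ := Polynomial.C (1 / 4) * (Polynomial.X ^ 2 - Polynomial.C (p.κ ^ 2) -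
    quad p.μ₀ (-I * p.μ₁) (-p.μ₂) ^ 2 * Polynomial.C (S ^ 2)) with hQ
  have hev : ∀ x, Q.eval x = 1 / 4 * (x ^ 2 - p.κ ^ 2 - p.symbol x ^ 2 * S ^ 2) := fun x => by
    rw [hQ, p.symbol_eq]; simp [quad_eval]
  -- vanishing at `0`, `± 1` and `± 2` forces in turn `sin σ ≠ 0`, `μ₂ = 0`, `μ₀ = 0` and `κ = 0`,
  -- so that `K 0 = 0`
  have hQ0 : Q ≠ 0 := by
    intro h
    have h0 : ∀ x, x ^ 2 - p.κ ^ 2 - p.symbol x ^ 2 * S ^ 2 = 0 := fun x => by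
      have := hev x
      rw [h, Polynomial.eval_zero] at this
      linear_combination -4 * this
    have a0 := h0 0
    have a1 := h0 1
    have a2 := h0 2
    have b1 := h0 (-1)
    have b2 := h0 (-2)
    simp only [symbol] at a0 a1 a2 b1 b2
    have h2 : S ^ 2 * p.μ₂ ^ 2 = 0 := by
      linear_combination -(a2 + b2 - 4 * a1 - 4 * b1 + 6 * a0) / 24
    have hS0 : S ≠ 0 := by
      intro hS0
      rw [hS0] at a0 a1
      have : (1 : ℂ) = 0 := by linear_combination a1 - a0
      exact one_ne_zero this
    have hμ2 : p.μ₂ = 0 := by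
      have := (mul_eq_zero.mp h2).resolve_left (pow_ne_zero 2 hS0)
      exact pow_eq_zero_iff (two_ne_zero) |>.mp this
    rw [hμ2] at a0 a1 a2 b1 b2
    have h1 : p.μ₁ ^ 2 * S ^ 2 = -1 := by
      linear_combination (a1 + b1 - 2 * a0) / 2 + p.μ₁ ^ 2 * S ^ 2 * I_sq
    have h01 : p.μ₀ * (p.μ₁ * S ^ 2 * I) = 0 := by
      linear_combination (a1 - b1) / 4
    have hμ1 : p.μ₁ * S ^ 2 * I ≠ 0 := by
      refine mul_ne_zero (mul_ne_zero ?_ (pow_ne_zero 2 hS0)) I_ne_zero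
      intro h; rw [h] at h1; norm_num at h1
    have hμ0 : p.μ₀ = 0 := (mul_eq_zero.mp h01).resolve_right hμ1
    rw [hμ0] at a0
    have hz : p.zeta 0 = 0 := by
      have h3 := p.zeta_sq 0
      have : p.zeta 0 ^ 2 = 0 := by rw [h3]; linear_combination -a0
      exact pow_eq_zero_iff (two_ne_zero) |>.mp this
    exact hK (by simp [K, hz, symbol, hμ0])
  refine ⟨_, _, Polynomial.leadingCoeff_ne_zero.mpr hQ0,
    (PowAsymp.polynomial le_rfl hQ0).congr' ?_⟩
  filter_upwards [p.eventually_far] with γ hγ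
  have h1 := p.farRoot_sq hγ
  have h2 : exp (p.s * (p.farRoot γ - γ)) * exp (-p.s * (p.farRoot γ - γ)) = 1 := by
    rw [← exp_add]; simp
  have h3 : p.coeffA γ * p.coeffB γ = 1 / 4 * (p.symbol γ ^ 2 - p.farRoot γ ^ 2) := by
    rw [coeffA, coeffB]
    linear_combination (1 / 4 * (p.symbol γ ^ 2 - p.farRoot γ ^ 2)) * h2
  rw [hev, h3, h1, hS]
  linear_combination -(p.symbol γ ^ 2 / 4) * sin_sq_add_cos_sq (p.σ : ℂ)

/-- For `d ≠ 0` the large kernel zeros lie near one ray in each open quadrant. -/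
lemma zerosAlong_duct_of_ne (hs : 0 < p.s) (hd : p.d ≠ 0)
    (hμ : p.μ₂ = 0 → (p.μ₁ = 0 → p.μ₀ ≠ 0) ∧ p.μ₁ ≠ I ∧ p.μ₁ ≠ -I) :
    ∃ a b : ℂ, (a = p.dirRight ∧ b = p.dirLeft ∨ a = p.dirLeft ∧ b = p.dirRight) ∧
      0 < a.re ∧ b.re < 0 ∧
      ZerosAlong p.duct {z | 0 ≤ z.re ∧ 0 ≤ z.im} a ∧
      ZerosAlong p.duct {z | z.re ≤ 0 ∧ 0 ≤ z.im} b ∧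
      ZerosAlong p.duct {z | z.re ≤ 0 ∧ z.im ≤ 0} (-a) ∧
      ZerosAlong p.duct {z | 0 ≤ z.re ∧ z.im ≤ 0} (-b) := by
  have h := p.expSum_duct hμ
  have hF := p.differentiable_duct
  have hre : ∀ e : ℝ, (2 * Real.pi * (e + p.s * I) / (e ^ 2 + p.s ^ 2) : ℂ).re =
      2 * Real.pi * e / (e ^ 2 + p.s ^ 2) := fun e => by
    have : (2 * Real.pi * (e + p.s * I) / (e ^ 2 + p.s ^ 2) : ℂ) =
      ((2 * Real.pi / (e ^ 2 + p.s ^ 2) : ℝ) : ℂ) * (e + p.s * I) := by push_cast; ring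
    rw [this, re_ofReal_mul]; simp; ring
  have hΔ : (p.Δ : ℂ) ^ 2 = p.d ^ 2 + p.s ^ 2 := by
    have := p.Δ_sq hs
    exact_mod_cast this
  have hs2 : 0 < p.d ^ 2 + p.s ^ 2 := by positivity
  rcases lt_or_gt_of_ne hd with hd | hd
  · have he : 0 < -p.d := by linarith
    have h' := h.swap
    refine ⟨p.dirLeft, p.dirRight, Or.inr ⟨rfl, rfl⟩, ?_, ?_, ?_⟩
    · rw [dirLeft, hΔ]
      have := hre (-p.d)
      push_cast at this
      rw [neg_sq] at this
      rw [this]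
      have := Real.pi_pos
      positivity
    · rw [dirRight, hΔ, hre]
      exact div_neg_of_neg_of_pos (by nlinarith [Real.pi_pos]) hs2
    · have e1 : (2 * Real.pi * ((-p.d : ℝ) + p.s * I) / ((-p.d : ℝ) ^ 2 + p.s ^ 2) : ℂ) =
        p.dirLeft := by rw [dirLeft, hΔ]; push_cast; rw [neg_sq]
      have e2 : (2 * Real.pi * (-(-p.d : ℝ) + p.s * I) / ((-p.d : ℝ) ^ 2 + p.s ^ 2) : ℂ) =
        p.dirRight := by rw [dirRight, hΔ]; push_cast; rw [neg_sq, neg_neg]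
      have h1 := h'.zerosAlong he hs hF
      have h2 := h'.zerosAlong_left he hs hF
      have h3 := h'.zerosAlong_lower he hs hF
      rw [e1] at h1 h3
      rw [e2] at h2 h3
      exact ⟨h1, h2, h3.1, h3.2⟩
  · refine ⟨p.dirRight, p.dirLeft, Or.inl ⟨rfl, rfl⟩, ?_, ?_, ?_⟩
    · rw [dirRight, hΔ, hre]
      have := Real.pi_pos
      positivity
    · rw [dirLeft, hΔ]
      have := hre (-p.d)
      push_cast at this
      rw [neg_sq] at this
      rw [this]
      exact div_neg_of_neg_of_pos (by nlinarith [Real.pi_pos]) (by positivity)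
    · have e1 : (2 * Real.pi * (p.d + p.s * I) / (p.d ^ 2 + p.s ^ 2) : ℂ) = p.dirRight := by
        rw [dirRight, hΔ]
      have e2 : (2 * Real.pi * (-p.d + p.s * I) / (p.d ^ 2 + p.s ^ 2) : ℂ) = p.dirLeft := by
        rw [dirLeft, hΔ]
      have h1 := h.zerosAlong hd hs hF
      have h2 := h.zerosAlong_left hd hs hF
      have h3 := h.zerosAlong_lower hd hs hF
      rw [e1] at h1 h3
      rw [e2] at h2 h3
      exact ⟨h1, h2, h3.1, h3.2⟩

/-- For `d = 0` the large kernel zeros lie near the imaginary axis. -/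
lemma zerosAlong_duct_of_eq (hs : 0 < p.s) (hd : p.d = 0)
    (hμ : p.μ₂ = 0 → (p.μ₁ = 0 → p.μ₀ ≠ 0) ∧ p.μ₁ ≠ I ∧ p.μ₁ ≠ -I) (hK : p.K 0 ≠ 0) :
    ZerosAlong p.duct {z | 0 ≤ z.im} (p.dirRight / 2) ∧
      ZerosAlong p.duct {z | z.im ≤ 0} (-p.dirRight / 2) := by
  obtain ⟨n, a, b, t, ha, hb, hA, hB, hP⟩ := p.exists_powAsymp_coeff fun h => (hμ h).2
  obtain ⟨q, δ, hδ, hD⟩ := p.exists_powAsymp_discriminant hK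
  have hI : (-1 : ℂ) ≠ 0 := by norm_num
  have hratio : ∀ {X Y : ℂ → ℂ} {x y : ℂ}, y ≠ 0 →
      Tendsto (fun γ => X γ / γ ^ n) (Bornology.cobounded ℂ) (𝓝 x) →
      PowAsymp (Bornology.cobounded ℂ) Y y n →
      Tendsto (fun γ => X γ / Y γ) (Bornology.cobounded ℂ) (𝓝 (x / y)) := by
    intro X Y x y hy hX hY
    have h1 := (hX.div (hY.tendsto_one le_rfl) one_ne_zero).div_const y
    rw [div_one] at h1
    refine h1.congr' ?_
    filter_upwards [PowAsymp.eventually_ne le_rfl, hY.eventually_ne_zero le_rfl] with γ h2 h3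
    have := zpow_ne_zero n h2
    simp only [Pi.div_apply]
    field_simp
  have hpow : ∀ {Y : ℂ → ℂ} {y : ℂ}, y ≠ 0 → PowAsymp (Bornology.cobounded ℂ) Y y n →
      Tendsto (fun γ => Y γ / γ ^ n) (Bornology.cobounded ℂ) (𝓝 y) := by
    intro Y y hy hY
    have h1 := (hY.tendsto_one le_rfl).const_mul y
    rw [mul_one] at h1
    refine h1.congr fun γ => ?_
    rw [mul_div_assoc', mul_div_mul_left _ _ hy]
  have hC : Tendsto (fun γ => -p.symbol γ * cos p.σ / γ ^ n) (Bornology.cobounded ℂ)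
      (𝓝 (-t * cos p.σ)) := by
    refine (hP.neg.mul_const (cos (p.σ : ℂ))).congr fun γ => ?_
    ring
  have hdirs : Real.pi * I / p.s = p.dirRight / 2 := by
    have hΔ : (p.Δ : ℂ) ^ 2 = p.s ^ 2 := by
      have := p.Δ_sq hs
      rw [hd, ofReal_zero, zero_pow two_ne_zero, zero_add] at this
      exact this
    have hs' : (p.s : ℂ) ≠ 0 := by exact_mod_cast hs.ne'
    rw [dirRight, hΔ, hd]; push_cast; field_simp; ring
  have hfar : ∀ γ : ℂ, 2 * ‖p.κ‖ < ‖γ‖ → p.duct γ = p.coeffA γ * exp (p.s * γ) +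
      p.coeffB γ * exp (-(p.s * γ)) + -p.symbol γ * cos p.σ := fun γ h => by
    rw [p.duct_eq_far h, hd]; simp
  have hneg : ∀ {X : ℂ → ℂ} {w : ℂ}, DifferentiableAt ℂ X (-1 * w) →
      DifferentiableAt ℂ (fun w => X (-1 * w)) w := fun {X w} h =>
    DifferentiableAt.comp (f := fun w => -1 * w) w h (by fun_prop)
  constructor
  · rw [← hdirs]
    exact zerosAlong_halfPlane hs (fun γ h => hfar γ h) (fun γ h =>
      ⟨(p.differentiableAt_coeff h).1, (p.differentiableAt_coeff h).2,
        ((p.differentiable_symbol γ).neg.mul_const _)⟩) ha (div_ne_zero hb ha) hδ hA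
      (hratio ha (hpow hb hB) hA) (hratio ha hC hA) hD p.differentiable_duct
  · have hmap : Tendsto (fun z : ℂ => -1 * z) (Bornology.cobounded ℂ) (Bornology.cobounded ℂ) :=
      tendsto_mul_left_cobounded hI
    have hF : Differentiable ℂ fun z => p.duct (-1 * z) := p.differentiable_duct.comp (by fun_prop)
    have h1 : ZerosAlong (fun z => p.duct (-1 * z)) {z | 0 ≤ z.im} (Real.pi * I / p.s) := by
      refine zerosAlong_halfPlane (R := 2 * ‖p.κ‖) (q := q) hs (A := fun z => p.coeffB (-1 * z))
        (B := fun z => p.coeffA (-1 * z)) (C := fun z => -p.symbol (-1 * z) * cos p.σ)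
        (fun γ h => ?_) (fun γ h => ?_) (mul_ne_zero hb (zpow_ne_zero n hI)) (div_ne_zero ha hb)
        (mul_ne_zero hδ (zpow_ne_zero q hI)) (hB.comp_mul hI)
        ((hratio hb (hpow ha hA) hB).comp hmap) ((hratio hb hC hB).comp hmap) ?_ hF
      · have h2 : 2 * ‖p.κ‖ < ‖-1 * γ‖ := by simpa using h
        rw [hfar _ h2]
        simp only [neg_mul, one_mul, mul_neg, neg_neg]
        ring
      · have h2 : 2 * ‖p.κ‖ < ‖-1 * γ‖ := by simpa using h
        exact ⟨hneg (p.differentiableAt_coeff h2).2, hneg (p.differentiableAt_coeff h2).1,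
          (hneg (p.differentiable_symbol (-1 * γ))).neg.mul_const _⟩
      · refine (hD.comp_mul hI).congr' (Eventually.of_forall fun γ => ?_)
        simp only; ring
    have h2 := h1.scale hI p.differentiable_duct
    have e1 : {z : ℂ | z / -1 ∈ {z : ℂ | 0 ≤ z.im}} = {z | z.im ≤ 0} := by
      ext z; simp [div_neg]
    rw [e1, hdirs, neg_one_mul, ← neg_div] at h2
    exact h2

end Cascade

/-! ### Sequences ordered by modulus -/

/-- A sequence ordered by modulus which takes each value of a sequence `v n = a n + O(√n)` once,
and has only finitely many other terms, has the same asymptotics as `v`. -/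
lemma follows_of_monotone {u v : ℕ → ℂ} {a : ℂ} (ha : a ≠ 0) {N : ℕ} {R C : ℝ}
    (hu0 : ∀ m, u m ≠ 0) (hmono : Monotone fun m => ‖u m‖)
    (hv : ∀ n : ℕ, ‖v n - a * n‖ ≤ C * √((n : ℝ) + 1)) (hinj : Set.InjOn v (Set.Ici N))
    (hex : ∀ n ≥ N, ∃ m, u m = v n) (huniq : ∀ n ≥ N, ∀ m m', u m = v n → u m' = v n → m = m')
    (hcov : ∀ m, R < ‖u m‖ → ∃ n ≥ N, u m = v n) : Follows a u := by
  have han : 0 < ‖a‖ := norm_pos_iff.mpr ha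
  have hC : 0 ≤ C := by
    have := (norm_nonneg _).trans (hv 0)
    simpa using this
  set κ := C / ‖a‖ with hκ
  have hκ0 : 0 ≤ κ := by positivity
  set C₁ := 2 * κ + κ ^ 2 with hC₁
  have hC₁0 : 0 ≤ C₁ := by positivity
  have hone : ∀ n : ℕ, 1 ≤ √((n : ℝ) + 1) := fun n =>
    Real.one_le_sqrt.mpr (by linarith [n.cast_nonneg (α := ℝ)])
  have hsq : ∀ n : ℕ, √((n : ℝ) + 1) * √((n : ℝ) + 1) = n + 1 := fun n =>
    Real.mul_self_sqrt (by positivity)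
  have hnorm : ∀ n : ℕ, ‖a‖ * n - C * √((n : ℝ) + 1) ≤ ‖v n‖ ∧
      ‖v n‖ ≤ ‖a‖ * n + C * √((n : ℝ) + 1) := fun n => by
    have h1 := hv n
    have h2 : ‖a * n‖ = ‖a‖ * n := by rw [norm_mul, Complex.norm_natCast]
    have h3 := norm_sub_norm_le (a * n) (v n)
    have h4 := norm_sub_norm_le (v n) (a * n)
    rw [norm_sub_rev] at h3
    rw [h2] at h3 h4
    constructor <;> linarith
  -- `‖v n‖` determines `n` up to `O(√n)`
  have hcmp : ∀ n' n : ℕ, ‖v n'‖ ≤ ‖v n‖ → (n' : ℝ) ≤ n + C₁ * √((n : ℝ) + 1) := by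
    intro n' n h
    set x := √((n' : ℝ) + 1) with hx
    set y := √((n : ℝ) + 1) with hy
    have hx2 : x * x = n' + 1 := hsq n'
    have hy2 : y * y = n + 1 := hsq n
    have hx1 : 1 ≤ x := hone n'
    have hy1 : 1 ≤ y := hone n
    have h1 : ‖a‖ * n' - C * x ≤ ‖a‖ * n + C * y := (hnorm n').1.trans (h.trans (hnorm n).2)
    have h2 : x - y ≤ κ := by
      rw [hκ, le_div_iff₀ han]
      have h3 : (x - y) * ‖a‖ * (x + y) ≤ C * (x + y) := by nlinarith
      exact le_of_mul_le_mul_right h3 (by linarith)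
    have h3 : x * x ≤ (y + κ) * (y + κ) := mul_self_le_mul_self (by linarith) (by linarith)
    have h4 : κ ^ 2 ≤ κ ^ 2 * y := le_mul_of_one_le_right (by positivity) hy1
    rw [hC₁]
    nlinarith
  obtain ⟨n₀, hn₀, hn₀R⟩ : ∃ n ≥ N, R < ‖v n‖ := by
    obtain ⟨M, hM⟩ := Follows.sqrt_isLittle C (‖a‖ / 2) (by positivity)
    obtain ⟨k, hk⟩ := exists_nat_gt (2 * R / ‖a‖ + 1)
    refine ⟨max (max N M) k, (le_max_left _ _).trans (le_max_left _ _),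
      lt_of_lt_of_le ?_ (hnorm _).1⟩
    have h1 := hM (max (max N M) k) ((le_max_right _ _).trans (le_max_left _ _))
    have h2 : (k : ℝ) ≤ (max (max N M) k : ℕ) := by exact_mod_cast le_max_right _ _
    have h3 : 2 * R / ‖a‖ < ((max (max N M) k : ℕ) : ℝ) - 1 := by linarith
    rw [div_lt_iff₀ han] at h3
    linarith
  obtain ⟨m₀, hm₀⟩ := hex n₀ hn₀
  have hexc : ∀ m, (¬ ∃ n ≥ N, u m = v n) → m < m₀ := by
    intro m hm
    by_contra hlt
    have h1 : ‖u m₀‖ ≤ ‖u m‖ := hmono (not_lt.mp hlt)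
    rw [hm₀] at h1
    exact hm (hcov m (hn₀R.trans_le h1))
  choose! φ hφ using hex
  choose! ψ hψN hψ using fun m (h : ∃ n ≥ N, u m = v n) => h
  set C₂ := C₁ + m₀ + N + 1 with hC₂
  -- the terms of smaller modulus are counted by the index in both sequences; this compares the
  -- two indices of a common term
  have hdiff : ∀ m, ∀ n ≥ N, u m = v n → |(m : ℝ) - n| ≤ C₂ * √((n : ℝ) + 1) := by
    intro m n hn hmn
    have hy1 := hone n
    rw [abs_le]
    constructor
    · set k := ⌊(n : ℝ) - C₁ * √((n : ℝ) + 1)⌋₊ with hk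
      have h1 : (Finset.Ico N k).card ≤ (Finset.range m).card := by
        refine Finset.card_le_card_of_injOn φ (fun n' hn' => ?_) (fun n' hn' n'' hn'' h => ?_)
        · rw [Finset.coe_Ico, Set.mem_Ico] at hn'
          rw [Finset.coe_range, Set.mem_Iio]
          by_contra hlt
          have h2 : ‖u m‖ ≤ ‖u (φ n')‖ := hmono (not_lt.mp hlt)
          rw [hmn, hφ n' hn'.1] at h2
          have h3 := hcmp _ _ h2
          have h4 : (n' : ℝ) + 1 ≤ (n : ℝ) - C₁ * √((n : ℝ) + 1) :=
            by exact_mod_cast (Nat.le_floor_iff' (Nat.succ_ne_zero n')).mp hn'.2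
          have h5 : √((n' : ℝ) + 1) ≤ √((n : ℝ) + 1) := by
            refine Real.sqrt_le_sqrt ?_
            have : 0 ≤ C₁ * √((n : ℝ) + 1) := by positivity
            linarith
          have h6 := mul_le_mul_of_nonneg_left h5 hC₁0
          linarith
        · rw [Finset.coe_Ico, Set.mem_Ico] at hn' hn''
          refine hinj hn'.1 hn''.1 ?_
          rw [← hφ n' hn'.1, ← hφ n'' hn''.1, h]
      rw [Nat.card_Ico, Finset.card_range] at h1
      have h2 : (k : ℝ) ≤ m + N := by
        have : k ≤ m + N := by omega
        exact_mod_cast this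
      have h3 := Nat.lt_floor_add_one ((n : ℝ) - C₁ * √((n : ℝ) + 1))
      rw [hC₂]
      nlinarith [m₀.cast_nonneg (α := ℝ), N.cast_nonneg (α := ℝ)]
    · classical
      have h1 : ((Finset.range m).filter fun j => ∃ n ≥ N, u j = v n).card ≤
          (Finset.range (⌊(n : ℝ) + C₁ * √((n : ℝ) + 1)⌋₊ + 1)).card := by
        refine Finset.card_le_card_of_injOn ψ (fun j hj => ?_) (fun j hj j' hj' h => ?_)
        · rw [Finset.mem_coe, Finset.mem_filter, Finset.mem_range] at hj
          rw [Finset.coe_range, Set.mem_Iio, Nat.lt_succ_iff]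
          refine Nat.le_floor (hcmp _ _ ?_)
          rw [← hψ j hj.2, ← hmn]
          exact hmono hj.1.le
        · rw [Finset.mem_coe, Finset.mem_filter] at hj hj'
          exact huniq _ (hψN j hj.2) j j' (hψ j hj.2) (by rw [hψ j' hj'.2, h])
      have h2 : ((Finset.range m).filter fun j => ¬ ∃ n ≥ N, u j = v n).card ≤
          (Finset.range m₀).card := by
        refine Finset.card_le_card fun j hj => ?_
        rw [Finset.mem_filter] at hj
        exact Finset.mem_range.mpr (hexc j hj.2)
      have h3 := Finset.card_filter_add_card_filter_not (s := Finset.range m)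
        (fun j => ∃ n ≥ N, u j = v n)
      rw [Finset.card_range] at h1 h2 h3
      have h4 := Nat.floor_le (show 0 ≤ (n : ℝ) + C₁ * √((n : ℝ) + 1) by positivity)
      have h5 : (m : ℝ) ≤ ⌊(n : ℝ) + C₁ * √((n : ℝ) + 1)⌋₊ + 1 + m₀ := by
        have : m ≤ ⌊(n : ℝ) + C₁ * √((n : ℝ) + 1)⌋₊ + 1 + m₀ := by omega
        exact_mod_cast this
      rw [hC₂]
      nlinarith [m₀.cast_nonneg (α := ℝ), N.cast_nonneg (α := ℝ)]
  have hC₂0 : 0 ≤ C₂ := by positivity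
  refine ⟨hu0, (C + ‖a‖ * C₂) * (1 + C₂) + ∑ m ∈ Finset.range m₀, ‖u m - a * m‖, fun m => ?_⟩
  have hX := hone m
  have hsum : 0 ≤ ∑ m ∈ Finset.range m₀, ‖u m - a * m‖ := by positivity
  by_cases hm : ∃ n ≥ N, u m = v n
  · obtain ⟨n, hn, e⟩ := hm
    have h1 := hdiff m n hn e
    have h2 : ‖u m - a * m‖ ≤ (C + ‖a‖ * C₂) * √((n : ℝ) + 1) := by
      have e2 : u m - a * m = (v n - a * n) - a * ((m : ℂ) - n) := by rw [e]; ring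
      have e3 : ‖(m : ℂ) - n‖ = |(m : ℝ) - n| := by
        rw [← Real.norm_eq_abs, ← norm_real]; push_cast; rfl
      rw [e2]
      refine (norm_sub_le _ _).trans ?_
      rw [norm_mul, e3]
      have := mul_le_mul_of_nonneg_left h1 han.le
      linarith [hv n]
    have h3 : √((n : ℝ) + 1) ≤ (1 + C₂) * √((m : ℝ) + 1) := by
      set y := √((n : ℝ) + 1) with hy
      set x := √((m : ℝ) + 1) with hx
      have hy2 : y * y = n + 1 := hsq n
      have hx2 : x * x = m + 1 := hsq m
      have hy1 : 1 ≤ y := hone n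
      have h4 := (abs_le.mp h1).1
      by_contra hlt
      have h5 : (1 + C₂) * x < y := not_le.mp hlt
      have h6 : x + C₂ < y := by nlinarith
      nlinarith
    calc ‖u m - a * m‖ ≤ (C + ‖a‖ * C₂) * √((n : ℝ) + 1) := h2
      _ ≤ (C + ‖a‖ * C₂) * ((1 + C₂) * √((m : ℝ) + 1)) := by gcongr
      _ ≤ _ := by rw [add_mul, mul_assoc]; linarith [mul_nonneg hsum (zero_le_one.trans hX)]
  · have h1 := Finset.single_le_sum (f := fun m : ℕ => ‖u m - a * m‖) (fun i _ => norm_nonneg _)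
      (Finset.mem_range.mpr (hexc m hm))
    have h1' : ‖u m - a * m‖ ≤ ∑ m ∈ Finset.range m₀, ‖u m - a * m‖ := h1
    have h2 : 0 ≤ (C + ‖a‖ * C₂) * (1 + C₂) := by positivity
    nlinarith

/-- A locally finite family of points with multiplicities can be listed by increasing modulus. -/
lemma exists_sorted_enumeration (mult : ℂ → ℕ) (hfin : ∀ R : ℝ, {z | ‖z‖ ≤ R ∧ mult z ≠ 0}.Finite)
    (hinf : {z | mult z ≠ 0}.Infinite) :
    ∃ u : ℕ → ℂ, (Monotone fun m => ‖u m‖) ∧ ∀ z, {m | u m = z}.encard = mult z := by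
  classical
  -- points repeated according to multiplicity, ordered by modulus with ties broken by the
  -- coordinates and the number of the copy; each has finitely many predecessors, and their number
  -- is its rank
  let T := Σ z : ℂ, Fin (mult z)
  let key : T → ℝ ×ₗ ℝ ×ₗ ℝ ×ₗ ℕ := fun t =>
    toLex (‖t.1‖, toLex (t.1.re, toLex (t.1.im, (t.2 : ℕ))))
  have hkey : Function.Injective key := by
    rintro ⟨z, i⟩ ⟨w, j⟩ h
    simp only [key, EmbeddingLike.apply_eq_iff_eq, Prod.mk.injEq] at h
    obtain ⟨-, h1, h2, h3⟩ := h
    obtain rfl : z = w := Complex.ext h1 h2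
    rw [Fin.ext h3]
  have hle : ∀ t t' : T, key t ≤ key t' → ‖t.1‖ ≤ ‖t'.1‖ := fun t t' h => by
    rcases Prod.Lex.le_iff.mp h with h | h
    · exact h.le
    · exact h.1.le
  have hT : ∀ R : ℝ, {t : T | ‖t.1‖ ≤ R}.Finite := fun R => by
    refine (((hfin R).toFinset.sigma fun _ => Finset.univ).finite_toSet).subset fun t ht => ?_
    simp only [Finset.coe_sigma, Set.mem_sigma_iff, Set.Finite.coe_toFinset, Finset.coe_univ,
      Set.mem_univ, and_true]
    exact ⟨ht, fun h0 => by have := t.2.2; omega⟩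
  have hI : ∀ t, {t' | key t' < key t}.Finite := fun t =>
    (hT ‖t.1‖).subset fun t' h => hle t' t (le_of_lt h)
  let r : T → ℕ := fun t => {t' | key t' < key t}.ncard
  have hr : ∀ t t', key t < key t' → r t < r t' := fun t t' h =>
    Set.ncard_lt_ncard ⟨fun x hx => lt_trans hx h, fun hsub => lt_irrefl (key t) (hsub h)⟩ (hI t')
  have hrinj : Function.Injective r := fun t t' h => by
    rcases lt_trichotomy (key t) (key t') with h1 | h1 | h1
    · exact absurd h (hr _ _ h1).ne
    · exact hkey h1
    · exact absurd h (hr _ _ h1).ne'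
  have hrle : ∀ t t', r t ≤ r t' → ‖t.1‖ ≤ ‖t'.1‖ := fun t t' h => by
    refine hle t t' (not_lt.mp fun h1 => ?_)
    have := hr _ _ h1
    omega
  have : Infinite T := by
    have : Infinite {z | mult z ≠ 0} := hinf.to_subtype
    exact Infinite.of_injective (fun z : {z | mult z ≠ 0} => (⟨z.1, ⟨0, Nat.pos_of_ne_zero z.2⟩⟩ : T))
      fun z w h => Subtype.ext (congrArg Sigma.fst h)
  have : Infinite (Set.range r) := (Set.infinite_range_of_injective hrinj).to_subtype
  let e : ℕ ≃ T := (Nat.Subtype.orderIsoOfNat (Set.range r)).toEquiv.trans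
    (Equiv.ofInjective r hrinj).symm
  have he : ∀ n, r (e n) = Nat.Subtype.orderIsoOfNat (Set.range r) n := fun n =>
    congrArg Subtype.val ((Equiv.ofInjective r hrinj).apply_symm_apply _)
  refine ⟨fun n => (e n).1, fun m n hmn => hrle _ _ ?_, fun z => ?_⟩
  · rw [he, he]
    exact (Nat.Subtype.orderIsoOfNat (Set.range r)).monotone hmn
  · have h1 : {m | (e m).1 = z} = e.symm '' Set.range (Sigma.mk (β := fun z => Fin (mult z)) z) := by
      ext m
      simp only [Set.mem_ofPred_eq, Set.mem_image, Set.mem_range, exists_exists_eq_and]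
      constructor
      · intro h
        refine ⟨h ▸ (e m).2, ?_⟩
        rw [Equiv.symm_apply_eq]
        subst h; rfl
      · rintro ⟨i, hi⟩
        rw [Equiv.symm_apply_eq] at hi
        rw [← hi]
    rw [h1, e.symm.injective.encard_image, ← Set.image_univ,
      (sigma_mk_injective).encard_image, Set.encard_univ]
    simp

/-- The terms of a sequence `a n + O(√n)` eventually lie in each open half-plane that contains
`a`; `b` is the normal of the half-plane, conjugated. -/
lemma eventually_re_pos {v : ℕ → ℂ} {a b : ℂ} {C : ℝ} (hab : 0 < (b * a).re)
    (hv : ∀ n : ℕ, ‖v n - a * n‖ ≤ C * √((n : ℝ) + 1)) : ∀ᶠ n in atTop, 0 < (b * v n).re := by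
  have h1 : Tendsto (fun n : ℕ => √((n : ℝ) + 1)) atTop atTop :=
    Real.tendsto_sqrt_atTop.comp (tendsto_atTop_add_const_right _ _ tendsto_natCast_atTop_atTop)
  filter_upwards [h1.eventually_gt_atTop ((‖b‖ * |C| + (b * a).re) / (b * a).re)] with n hn
  rw [div_lt_iff₀ hab] at hn
  set y := √((n : ℝ) + 1) with hy
  have hy2 : y * y = n + 1 := Real.mul_self_sqrt (by positivity)
  have hy1 : 1 ≤ y := Real.one_le_sqrt.mpr (by linarith [n.cast_nonneg (α := ℝ)])
  have e : b * v n = ((n : ℝ) : ℂ) * (b * a) + b * (v n - a * n) := by push_cast; ring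
  have h2 : ‖b * (v n - a * n)‖ ≤ ‖b‖ * |C| * y := by
    rw [norm_mul, mul_assoc]
    refine mul_le_mul_of_nonneg_left ((hv n).trans ?_) (norm_nonneg b)
    gcongr
    exact le_abs_self C
  have h3 := (abs_le.mp ((abs_re_le_norm _).trans h2)).1
  rw [e, add_re, re_ofReal_mul]
  nlinarith

namespace ZerosAlong

variable {F : ℂ → ℂ} {S T : Set ℂ} {a : ℂ}

/-- Finitely many terms of the sequence of large zeros may be dropped. -/
lemma exists_of_eventually (h : ZerosAlong F S a)
    (hT : ∀ (v : ℕ → ℂ) (C : ℝ), (∀ n : ℕ, ‖v n - a * n‖ ≤ C * √((n : ℝ) + 1)) →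
      ∀ᶠ n in atTop, v n ∈ T) :
    ∃ (N : ℕ) (R C : ℝ) (v : ℕ → ℂ), (∀ n : ℕ, ‖v n - a * n‖ ≤ C * √((n : ℝ) + 1)) ∧
      (∀ n ≥ N, F (v n) = 0 ∧ deriv F (v n) ≠ 0 ∧ v n ∈ T) ∧ Set.InjOn v (Set.Ici N) ∧
      ∀ z ∈ S, R < ‖z‖ → F z = 0 → ∃ n ≥ N, z = v n := by
  obtain ⟨N, R, C, v, h1, h2, h3, h4⟩ := h
  obtain ⟨N', hN'⟩ := eventually_atTop.mp (hT v C h1)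
  refine ⟨max N N', max R (∑ n ∈ Finset.range (max N N'), ‖v n‖), C, v, h1, fun n hn =>
    ⟨(h2 n ((le_max_left _ _).trans hn)).1, (h2 n ((le_max_left _ _).trans hn)).2,
      hN' n ((le_max_right _ _).trans hn)⟩,
    h3.mono (Set.Ici_subset_Ici.mpr (le_max_left _ _)), fun z hz hr h0 => ?_⟩
  obtain ⟨n, hn, rfl⟩ := h4 z hz ((le_max_left _ _).trans_lt hr) h0
  refine ⟨n, ?_, rfl⟩
  by_contra hlt
  have := Finset.single_le_sum (f := fun n : ℕ => ‖v n‖) (fun i _ => norm_nonneg _)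
    (Finset.mem_range.mpr (not_le.mp hlt))
  exact absurd ((le_max_right _ _).trans_lt hr) (not_lt.mpr this)

/-- A region that contains the late terms of the sequence contains infinitely many zeros. -/
lemma infinite (h : ZerosAlong F S a)
    (hT : ∀ (v : ℕ → ℂ) (C : ℝ), (∀ n : ℕ, ‖v n - a * n‖ ≤ C * √((n : ℝ) + 1)) →
      ∀ᶠ n in atTop, v n ∈ T) : {z | z ∈ T ∧ F z = 0}.Infinite := by
  obtain ⟨N, R, C, v, -, h2, h3, -⟩ := h.exists_of_eventually hT
  refine Set.infinite_of_injective_forall_mem (f := fun n => v (N + n)) (fun m n e => ?_)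
    fun n => ⟨(h2 (N + n) (by omega)).2.2, (h2 (N + n) (by omega)).1⟩
  have := h3 (show N ≤ N + m by omega) (show N ≤ N + n by omega) e
  omega

/-- A sequence of zeros in `S`, ordered by modulus, which lists every zero in the smaller region
`T` according to its multiplicity has the asymptotics of the large zeros. -/
lemma follows (h : ZerosAlong F S a) (ha : a ≠ 0) (hF : Differentiable ℂ F) (hF0 : F 0 ≠ 0)
    (hT : ∀ (v : ℕ → ℂ) (C : ℝ), (∀ n : ℕ, ‖v n - a * n‖ ≤ C * √((n : ℝ) + 1)) →
      ∀ᶠ n in atTop, v n ∈ T) {u : ℕ → ℂ} (hmono : Monotone fun m => ‖u m‖)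
    (hu : ∀ m, u m ∈ S ∧ F (u m) = 0)
    (hmult : ∀ z ∈ T, {m | u m = z}.encard = analyticOrderAt F z) : Follows a u := by
  obtain ⟨N, R, C, v, h1, h2, h3, h4⟩ := h.exists_of_eventually hT
  have hone : ∀ n ≥ N, {m | u m = v n}.encard = 1 := fun n hn => by
    obtain ⟨h5, h6, h7⟩ := h2 n hn
    rw [hmult _ h7]
    exact (hF.analyticAt _).analyticOrderAt_eq_one_of_zero_deriv_ne_zero h5 h6
  refine follows_of_monotone ha (fun m h0 => hF0 (h0 ▸ (hu m).2)) hmono h1 h3 (fun n hn => ?_)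
    (fun n hn m m' hm hm' => ?_) (fun m hr => h4 _ (hu m).1 hr (hu m).2)
  · obtain ⟨m, hm⟩ := Set.encard_eq_one.mp (hone n hn)
    have : m ∈ {m | u m = v n} := hm ▸ Set.mem_singleton m
    exact ⟨m, this⟩
  · exact Set.encard_le_one_iff.mp (hone n hn).le m m' hm hm'

end ZerosAlong

/-! ### Labellings of the kernel zeros -/

lemma encard_interleave (u v : ℕ → ℂ) (z : ℂ) :
    {n | (if Even n then u (n / 2) else v (n / 2)) = z}.encard =
      {m | u m = z}.encard + {m | v m = z}.encard := by
  have h : {n | (if Even n then u (n / 2) else v (n / 2)) = z} =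
      (fun m => 2 * m) '' {m | u m = z} ∪ (fun m => 2 * m + 1) '' {m | v m = z} := by
    ext n
    simp only [Set.mem_ofPred_eq, Set.mem_union, Set.mem_image]
    obtain ⟨k, rfl | rfl⟩ := Nat.even_or_odd' n
    · have h1 : ¬ ∃ x, v x = z ∧ 2 * x + 1 = 2 * k := by rintro ⟨x, -, hx⟩; omega
      simp [h1]
    · have h1 : ¬ ∃ x, u x = z ∧ 2 * x = 2 * k + 1 := by rintro ⟨x, -, hx⟩; omega
      have h2 : (2 * k + 1) / 2 = k := by omega
      simp [h1, h2]
  rw [h, Set.encard_union_eq, Function.Injective.encard_image, Function.Injective.encard_image]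
  · intro a b hab; simp only at hab; omega
  · intro a b hab; simp only at hab; omega
  · rw [Set.disjoint_left]
    rintro n ⟨a, -, rfl⟩ ⟨b, -, hb⟩
    simp only at hb; omega

/-- The even and the odd terms of a sequence of direction `a / 2` have direction `a`. -/
lemma Follows.of_interleave {a : ℂ} {u v : ℕ → ℂ}
    (h : Follows (a / 2) fun n => if Even n then u (n / 2) else v (n / 2)) :
    Follows a u ∧ Follows a v := by
  obtain ⟨h0, C, hC⟩ := h
  have hC0 : 0 ≤ C := by
    have := (norm_nonneg _).trans (hC 0)
    simpa using this
  have hu : ∀ k : ℕ, (if Even (2 * k) then u (2 * k / 2) else v (2 * k / 2)) = u k := by simp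
  have hv : ∀ k : ℕ, (if Even (2 * k + 1) then u ((2 * k + 1) / 2) else v ((2 * k + 1) / 2)) = v k :=
    fun k => by
      have h2 : (2 * k + 1) / 2 = k := by omega
      simp [h2]
  have hs : ∀ m k : ℕ, m ≤ 2 * k + 1 → √((m : ℝ) + 1) ≤ 2 * √((k : ℝ) + 1) := fun m k hmk => by
    have h1 : (m : ℝ) + 1 ≤ 2 ^ 2 * ((k : ℝ) + 1) := by
      have : (m : ℝ) ≤ 2 * k + 1 := by exact_mod_cast hmk
      linarith [k.cast_nonneg (α := ℝ)]
    have := Real.sqrt_le_sqrt h1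
    rwa [Real.sqrt_mul (by norm_num), Real.sqrt_sq (by norm_num)] at this
  refine ⟨⟨fun m => ?_, C * 2, fun m => ?_⟩, ⟨fun m => ?_, C * 2 + ‖a‖, fun m => ?_⟩⟩
  · have := h0 (2 * m); simp only [hu] at this; exact this
  · have h1 := hC (2 * m)
    simp only [hu] at h1
    have e : u m - a * m = u m - a / 2 * ((2 * m : ℕ) : ℂ) := by push_cast; ring
    rw [e, mul_assoc]
    exact h1.trans (mul_le_mul_of_nonneg_left (hs _ _ (by omega)) hC0)
  · have := h0 (2 * m + 1); simp only [hv] at this; exact this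
  · have h1 := hC (2 * m + 1)
    simp only [hv] at h1
    have e : v m - a * m = (v m - a / 2 * ((2 * m + 1 : ℕ) : ℂ)) + a / 2 := by push_cast; ring
    have h2 := mul_le_mul_of_nonneg_left (hs (2 * m + 1) m le_rfl) hC0
    have h3 : ‖a / 2‖ ≤ ‖a‖ := by
      rw [norm_div]; exact div_le_self (norm_nonneg a) (by simp)
    have h4 : 1 ≤ √((m : ℝ) + 1) := Real.one_le_sqrt.mpr (by linarith [m.cast_nonneg (α := ℝ)])
    rw [e]
    refine (norm_add_le _ _).trans ?_
    nlinarith [norm_nonneg a]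

lemma analyticOrderAt_ne_top {F : ℂ → ℂ} (hF : Differentiable ℂ F) (hF0 : F 0 ≠ 0) (z : ℂ) :
    analyticOrderAt F z ≠ ⊤ := by
  have h : AnalyticOnNhd ℂ F Set.univ := fun z _ => hF.analyticAt z
  refine h.analyticOrderAt_ne_top_of_isPreconnected isPreconnected_univ (Set.mem_univ 0)
    (Set.mem_univ z) ?_
  rw [(hF.analyticAt 0).analyticOrderAt_eq_zero.mpr hF0]
  exact ENat.zero_ne_top

lemma finite_zeros {F : ℂ → ℂ} (hF : Differentiable ℂ F) (hF0 : F 0 ≠ 0) (R : ℝ) :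
    {z | ‖z‖ ≤ R ∧ F z = 0}.Finite := by
  by_contra hinf
  obtain ⟨z, -, hz⟩ := Set.Infinite.exists_accPt_of_subset_isCompact (K := Metric.closedBall (0 : ℂ) R)
    hinf (isCompact_closedBall 0 R) (fun w hw => by simpa using hw.1)
  have h : AnalyticOnNhd ℂ F Set.univ := fun z _ => hF.analyticAt z
  have h1 := h.eqOn_zero_of_preconnected_of_frequently_eq_zero isPreconnected_univ (Set.mem_univ z)
    ((accPt_iff_frequently_nhdsNE.mp hz).mono fun w hw => hw.2)
  exact hF0 (h1 (Set.mem_univ 0))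

/-- The zeros in a region, with multiplicity and by increasing modulus. -/
lemma exists_enumeration_zeros {F : ℂ → ℂ} (hF : Differentiable ℂ F) (hF0 : F 0 ≠ 0) {T : Set ℂ}
    (hT : {z | z ∈ T ∧ F z = 0}.Infinite) :
    ∃ u : ℕ → ℂ, (Monotone fun m => ‖u m‖) ∧ (∀ m, u m ∈ T) ∧
      (∀ z ∈ T, {m | u m = z}.encard = analyticOrderAt F z) ∧
      ∀ z ∉ T, {m | u m = z}.encard = 0 := by
  classical
  set mult : ℂ → ℕ := fun z => if z ∈ T then analyticOrderNatAt F z else 0 with hm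
  have hzero : ∀ z, mult z ≠ 0 ↔ z ∈ T ∧ F z = 0 := fun z => by
    have h1 := Nat.cast_analyticOrderNatAt (analyticOrderAt_ne_top hF hF0 z)
    have h2 := (hF.analyticAt z).analyticOrderAt_ne_zero
    rw [← h1, Nat.cast_ne_zero] at h2
    by_cases hz : z ∈ T
    · simp only [hm, hz, if_true, true_and]; exact h2
    · simp [hm, hz]
  obtain ⟨u, hmono, hu⟩ := exists_sorted_enumeration mult
    (fun R => (finite_zeros hF hF0 R).subset fun z hz => ⟨hz.1, ((hzero z).mp hz.2).2⟩)
    (by simpa only [hzero] using hT)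
  have hout : ∀ z ∉ T, {m | u m = z}.encard = 0 := fun z hz => by rw [hu]; simp [hm, hz]
  refine ⟨u, hmono, fun m => ?_, fun z hz => ?_, hout⟩
  · by_contra hmT
    have h1 := Set.encard_eq_zero.mp (hout _ hmT)
    exact Set.eq_empty_iff_forall_notMem.mp h1 m rfl
  · rw [hu, ← Nat.cast_analyticOrderNatAt (analyticOrderAt_ne_top hF hF0 z)]
    simp [hm, hz]

namespace Cascade

variable (p : Cascade)

lemma duct_zero_ne (hpole : p.acoustic 0 ≠ 0) (hzero : p.K 0 ≠ 0) : p.duct 0 ≠ 0 := by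
  intro h
  apply hzero
  rw [p.K_eq_duct_div hpole, h, zero_div]

/-- For `d = 0` the zeros of each half-plane are sorted and distributed alternately to the right
and left families; for `d ≠ 0` those of each quadrant are sorted. Zeros on the axes are assigned
to one side, so that the half-planes or quadrants form a partition. -/
lemma exists_labelling (hs : 0 < p.s)
    (hμ : p.μ₂ = 0 → (p.μ₁ = 0 → p.μ₀ ≠ 0) ∧ p.μ₁ ≠ I ∧ p.μ₁ ≠ -I)
    (hpole : p.acoustic 0 ≠ 0) (hzero : p.K 0 ≠ 0) : ∃ θ : Labels, p.IsLabelling θ := by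
  have hF := p.differentiable_duct
  have hF0 := p.duct_zero_ne hpole hzero
  have hR := p.dirRight_im_pos hs
  have hL := p.dirLeft_im_pos hs
  by_cases hd : p.d = 0
  · obtain ⟨h1, h2⟩ := p.zerosAlong_duct_of_eq hs hd hμ hzero
    have hI1 : {z | z ∈ {z : ℂ | 0 ≤ z.im} ∧ p.duct z = 0}.Infinite := h1.infinite fun v C hv => by
      filter_upwards [eventually_re_pos (b := -I) (by simpa using hR) hv] with n hn
      simpa using hn.le
    have hI2 : {z | z ∈ {z : ℂ | z.im < 0} ∧ p.duct z = 0}.Infinite := h2.infinite fun v C hv => by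
      filter_upwards [eventually_re_pos (b := I) (by simp; linarith) hv] with n hn
      simpa using hn
    obtain ⟨u, hu1, hu2, hu3, hu4⟩ := exists_enumeration_zeros hF hF0 hI1
    obtain ⟨w, hw1, hw2, hw3, hw4⟩ := exists_enumeration_zeros hF hF0 hI2
    have hint : ∀ u : ℕ → ℂ, (fun n => if Even n then (fun m => u (2 * m)) (n / 2)
        else (fun m => u (2 * m + 1)) (n / 2)) = u := fun u => by
      funext n
      obtain ⟨k, rfl | rfl⟩ := Nat.even_or_odd' n
      · simp
      · have h2 : (2 * k + 1) / 2 = k := by omega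
        simp [h2]
    have henc : ∀ (u : ℕ → ℂ) (z : ℂ), {m | u (2 * m) = z}.encard + {m | u (2 * m + 1) = z}.encard =
        {n | u n = z}.encard := fun u z => by
      rw [← encard_interleave (fun m => u (2 * m)) (fun m => u (2 * m + 1)) z]
      conv_rhs => rw [← hint u]
    refine ⟨⟨fun m => u (2 * m), fun m => u (2 * m + 1), fun m => w (2 * m), fun m => w (2 * m + 1)⟩,
      fun m => ⟨hu2 _, hu2 _⟩, fun m => ⟨(hw2 _).le, (hw2 _).le⟩,
      ⟨fun h => absurd hd h, fun _ m => ⟨hu1 (by omega), hu1 (by omega)⟩⟩,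
      ⟨fun h => absurd hd h, fun _ m => ⟨hw1 (by omega), hw1 (by omega)⟩⟩, fun z => ?_⟩
    rw [add_assoc, henc u z, henc w z]
    rcases le_or_gt 0 z.im with hz | hz
    · rw [hu3 z hz, hw4 z (not_lt.mpr hz), add_zero]
    · rw [hu4 z (not_le.mpr hz), hw3 z hz, zero_add]
  · obtain ⟨a, b, hab, ha, hb, h1, h2, h3, h4⟩ := p.zerosAlong_duct_of_ne hs hd hμ
    have haim : 0 < a.im := by rcases hab with h | h <;> simp only [h.1, hR, hL]
    have hbim : 0 < b.im := by rcases hab with h | h <;> simp only [h.2, hR, hL]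
    have hI1 : {z | z ∈ {z : ℂ | 0 ≤ z.re ∧ 0 ≤ z.im} ∧ p.duct z = 0}.Infinite :=
      h1.infinite fun v C hv => by
        filter_upwards [eventually_re_pos (b := -I) (by simpa using haim) hv,
          eventually_re_pos (b := 1) (by simpa using ha) hv] with n hn hn'
        exact ⟨by simpa using hn'.le, by simpa using hn.le⟩
    have hI2 : {z | z ∈ {z : ℂ | z.re < 0 ∧ 0 ≤ z.im} ∧ p.duct z = 0}.Infinite :=
      h2.infinite fun v C hv => by
        filter_upwards [eventually_re_pos (b := -I) (by simpa using hbim) hv,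
          eventually_re_pos (b := -1) (by simpa using hb) hv] with n hn hn'
        exact ⟨by simpa using hn', by simpa using hn.le⟩
    have hI3 : {z | z ∈ {z : ℂ | z.re < 0 ∧ z.im < 0} ∧ p.duct z = 0}.Infinite :=
      h3.infinite fun v C hv => by
        filter_upwards [eventually_re_pos (b := I) (by simpa using haim) hv,
          eventually_re_pos (b := -1) (by simpa using ha) hv] with n hn hn'
        exact ⟨by simpa using hn', by simpa using hn⟩
    have hI4 : {z | z ∈ {z : ℂ | 0 ≤ z.re ∧ z.im < 0} ∧ p.duct z = 0}.Infinite :=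
      h4.infinite fun v C hv => by
        filter_upwards [eventually_re_pos (b := I) (by simpa using hbim) hv,
          eventually_re_pos (b := 1) (by simpa using hb) hv] with n hn hn'
        exact ⟨by simpa using hn'.le, by simpa using hn⟩
    obtain ⟨u₁, hm1, hin1, ht1, hf1⟩ := exists_enumeration_zeros hF hF0 hI1
    obtain ⟨u₂, hm2, hin2, ht2, hf2⟩ := exists_enumeration_zeros hF hF0 hI2
    obtain ⟨u₃, hm3, hin3, ht3, hf3⟩ := exists_enumeration_zeros hF hF0 hI3
    obtain ⟨u₄, hm4, hin4, ht4, hf4⟩ := exists_enumeration_zeros hF hF0 hI4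
    refine ⟨⟨u₁, u₂, u₄, u₃⟩, fun m => ⟨(hin1 m).2, (hin2 m).2⟩,
      fun m => ⟨(hin4 m).2.le, (hin3 m).2.le⟩,
      ⟨fun _ => ⟨fun m => (hin1 m).1, fun m => (hin2 m).1.le, hm1, hm2⟩, fun h => absurd h hd⟩,
      ⟨fun _ => ⟨fun m => (hin4 m).1, fun m => (hin3 m).1.le, hm4, hm3⟩, fun h => absurd h hd⟩,
      fun z => ?_⟩
    dsimp only
    rcases le_or_gt 0 z.re with hx | hx <;> rcases le_or_gt 0 z.im with hy | hy
    · rw [ht1 z ⟨hx, hy⟩, hf2 z fun h => absurd h.1 (not_lt.mpr hx),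
        hf3 z fun h => absurd h.1 (not_lt.mpr hx), hf4 z fun h => absurd h.2 (not_lt.mpr hy)]
      simp
    · rw [ht4 z ⟨hx, hy⟩, hf2 z fun h => absurd h.1 (not_lt.mpr hx),
        hf3 z fun h => absurd h.1 (not_lt.mpr hx), hf1 z fun h => absurd h.2 (not_le.mpr hy)]
      simp
    · rw [ht2 z ⟨hx, hy⟩, hf1 z fun h => absurd h.1 (not_le.mpr hx),
        hf4 z fun h => absurd h.1 (not_le.mpr hx), hf3 z fun h => absurd h.2 (not_lt.mpr hy)]
      simp
    · rw [ht3 z ⟨hx, hy⟩, hf1 z fun h => absurd h.1 (not_le.mpr hx),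
        hf4 z fun h => absurd h.1 (not_le.mpr hx), hf2 z fun h => absurd h.2 (not_le.mpr hy)]
      simp

variable {p}

lemma IsLabelling.duct_eq_zero {θ : Labels} (hθ : p.IsLabelling θ) (m : ℕ) :
    p.duct (θ.Rp m) = 0 ∧ p.duct (θ.Lp m) = 0 ∧ p.duct (θ.Rm m) = 0 ∧ p.duct (θ.Lm m) = 0 := by
  have key : ∀ (u : ℕ → ℂ), (∀ z, {m | u m = z}.encard ≤ analyticOrderAt p.duct z) →
      p.duct (u m) = 0 := fun u hu => by
    rw [← (p.differentiable_duct.analyticAt _).analyticOrderAt_ne_zero]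
    intro h0
    have h1 := hu (u m)
    rw [h0, nonpos_iff_eq_zero, Set.encard_eq_zero] at h1
    exact Set.eq_empty_iff_forall_notMem.mp h1 m rfl
  refine ⟨key _ fun z => ?_, key _ fun z => ?_, key _ fun z => ?_, key _ fun z => ?_⟩ <;>
    rw [← hθ.multiplicity z]
  · rw [add_assoc, add_assoc]; exact le_self_add
  · rw [add_assoc, add_comm ({m | θ.Rp m = z}.encard), add_assoc]; exact le_self_add
  · rw [add_comm ({m | θ.Rp m = z}.encard + _), add_assoc]; exact le_self_add
  · exact le_add_self

/-- In any labelling, the four sequences of zeros have the directions of the acoustic modes. -/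
lemma IsLabelling.follows {θ : Labels} (hθ : p.IsLabelling θ) (hs : 0 < p.s)
    (hμ : p.μ₂ = 0 → (p.μ₁ = 0 → p.μ₀ ≠ 0) ∧ p.μ₁ ≠ I ∧ p.μ₁ ≠ -I)
    (hpole : p.acoustic 0 ≠ 0) (hzero : p.K 0 ≠ 0) :
    (Follows p.dirRight θ.Rp ∧ Follows p.dirLeft θ.Lp ∨
      Follows p.dirLeft θ.Rp ∧ Follows p.dirRight θ.Lp) ∧
    (Follows (-p.dirLeft) θ.Rm ∧ Follows (-p.dirRight) θ.Lm ∨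
      Follows (-p.dirRight) θ.Rm ∧ Follows (-p.dirLeft) θ.Lm) := by
  have hF := p.differentiable_duct
  have hF0 := p.duct_zero_ne hpole hzero
  have hR := p.dirRight_im_pos hs
  have hL := p.dirLeft_im_pos hs
  have hne : ∀ {a : ℂ}, 0 < a.im → a ≠ 0 := fun h h0 => by simp [h0] at h
  have hempty : ∀ {u : ℕ → ℂ} {z : ℂ}, (∀ m, u m ≠ z) → {m | u m = z}.encard = 0 := fun h =>
    Set.encard_eq_zero.mpr (Set.eq_empty_iff_forall_notMem.mpr h)
  have hup := hθ.upper
  have hlow := hθ.lower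
  have hz := hθ.duct_eq_zero
  by_cases hd : p.d = 0
  · obtain ⟨h1, h2⟩ := p.zerosAlong_duct_of_eq hs hd hμ hzero
    have hmono : ∀ {u v : ℕ → ℂ}, (∀ m, ‖u m‖ ≤ ‖v m‖ ∧ ‖v m‖ ≤ ‖u (m + 1)‖) →
        Monotone fun n => ‖(if Even n then u (n / 2) else v (n / 2))‖ := fun {u v} h => by
      refine monotone_nat_of_le_succ fun n => ?_
      obtain ⟨k, rfl | rfl⟩ := Nat.even_or_odd' n
      · have h2 : (2 * k + 1) / 2 = k := by omega
        simpa [h2] using (h k).1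
      · have h2 : (2 * k + 1) / 2 = k := by omega
        have h3 : (2 * k + 1 + 1) / 2 = k + 1 := by omega
        have h4 : Even (2 * k + 1 + 1) := ⟨k + 1, by ring⟩
        have h5 : ¬ Even (2 * k + 1) := by simp
        simp only [h2, h3, h4, h5, if_true, if_false]
        exact (h k).2
    have hall : ∀ {u v : ℕ → ℂ} {P : ℂ → Prop}, (∀ m, P (u m)) → (∀ m, P (v m)) → ∀ n,
        P (if Even n then u (n / 2) else v (n / 2)) := fun hu hv n => by
      split_ifs
      · exact hu _
      · exact hv _
    have hdir : p.dirLeft = p.dirRight := by rw [dirLeft, dirRight, hd]; simp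
    rw [hdir]
    have hup' := h1.follows (T := {z | 0 < z.im}) (hne (by simpa using hR)) hF hF0
      (fun v C hv => by
        filter_upwards [eventually_re_pos (b := -I) (by simpa using hR) hv] with n hn
        simpa using hn) (hmono (hθ.arranged_upper.2 hd))
      (hall (P := fun z => z ∈ {z : ℂ | 0 ≤ z.im} ∧ p.duct z = 0)
        (fun m => ⟨(hup m).1, (hz m).1⟩) (fun m => ⟨(hup m).2, (hz m).2.1⟩))
      (fun z (hz : 0 < z.im) => by
        rw [encard_interleave, ← hθ.multiplicity z,
          hempty (u := θ.Rm) (z := z) (fun m h => absurd (h ▸ (hlow m).1) (not_le.mpr hz)),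
          hempty (u := θ.Lm) (z := z) (fun m h => absurd (h ▸ (hlow m).2) (not_le.mpr hz)), add_zero,
          add_zero])
    have hlow' := h2.follows (T := {z | z.im < 0})
      (div_ne_zero (neg_ne_zero.mpr (hne hR)) two_ne_zero) hF hF0
      (fun v C hv => by
        filter_upwards [eventually_re_pos (b := I) (by simp; linarith) hv] with n hn
        simpa using hn) (hmono (hθ.arranged_lower.2 hd))
      (hall (P := fun z => z ∈ {z : ℂ | z.im ≤ 0} ∧ p.duct z = 0)
        (fun m => ⟨(hlow m).1, (hz m).2.2.1⟩) (fun m => ⟨(hlow m).2, (hz m).2.2.2⟩))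
      (fun z (hz : z.im < 0) => by
        rw [encard_interleave, ← hθ.multiplicity z,
          hempty (u := θ.Rp) (z := z) (fun m h => absurd (h ▸ (hup m).1) (not_le.mpr hz)),
          hempty (u := θ.Lp) (z := z) (fun m h => absurd (h ▸ (hup m).2) (not_le.mpr hz)), zero_add,
          zero_add])
    exact ⟨Or.inl hup'.of_interleave, Or.inl hlow'.of_interleave⟩
  · obtain ⟨a, b, hab, ha, hb, h1, h2, h3, h4⟩ := p.zerosAlong_duct_of_ne hs hd hμ
    have haim : 0 < a.im := by rcases hab with h | h <;> simp only [h.1, hR, hL]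
    have hbim : 0 < b.im := by rcases hab with h | h <;> simp only [h.2, hR, hL]
    obtain ⟨hRp, hLp, hm1, hm2⟩ := hθ.arranged_upper.1 hd
    obtain ⟨hRm, hLm, hm4, hm3⟩ := hθ.arranged_lower.1 hd
    have f1 : Follows a θ.Rp := h1.follows (T := {z | 0 < z.re ∧ 0 < z.im}) (hne haim) hF hF0
      (fun v C hv => by
        filter_upwards [eventually_re_pos (b := -I) (by simpa using haim) hv,
          eventually_re_pos (b := 1) (by simpa using ha) hv] with n hn hn'
        exact ⟨by simpa using hn', by simpa using hn⟩) hm1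
      (fun m => ⟨⟨hRp m, (hup m).1⟩, (hz m).1⟩) fun z hz => by
        rw [← hθ.multiplicity z,
          hempty (u := θ.Lp) (z := z) (fun m h => absurd (h ▸ hLp m) (not_le.mpr hz.1)),
          hempty (u := θ.Rm) (z := z) (fun m h => absurd (h ▸ (hlow m).1) (not_le.mpr hz.2)),
          hempty (u := θ.Lm) (z := z) (fun m h => absurd (h ▸ (hlow m).2) (not_le.mpr hz.2))]
        simp
    have f2 : Follows b θ.Lp := h2.follows (T := {z | z.re < 0 ∧ 0 < z.im}) (hne hbim) hF hF0
      (fun v C hv => by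
        filter_upwards [eventually_re_pos (b := -I) (by simpa using hbim) hv,
          eventually_re_pos (b := -1) (by simpa using hb) hv] with n hn hn'
        exact ⟨by simpa using hn', by simpa using hn⟩) hm2
      (fun m => ⟨⟨hLp m, (hup m).2⟩, (hz m).2.1⟩) fun z hz => by
        rw [← hθ.multiplicity z,
          hempty (u := θ.Rp) (z := z) (fun m h => absurd (h ▸ hRp m) (not_le.mpr hz.1)),
          hempty (u := θ.Rm) (z := z) (fun m h => absurd (h ▸ (hlow m).1) (not_le.mpr hz.2)),
          hempty (u := θ.Lm) (z := z) (fun m h => absurd (h ▸ (hlow m).2) (not_le.mpr hz.2))]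
        simp
    have f3 : Follows (-a) θ.Lm := h3.follows (T := {z | z.re < 0 ∧ z.im < 0})
      (neg_ne_zero.mpr (hne haim)) hF hF0
      (fun v C hv => by
        filter_upwards [eventually_re_pos (b := I) (by simpa using haim) hv,
          eventually_re_pos (b := -1) (by simpa using ha) hv] with n hn hn'
        exact ⟨by simpa using hn', by simpa using hn⟩) hm3
      (fun m => ⟨⟨hLm m, (hlow m).2⟩, (hz m).2.2.2⟩) fun z hz => by
        rw [← hθ.multiplicity z,
          hempty (u := θ.Rp) (z := z) (fun m h => absurd (h ▸ hRp m) (not_le.mpr hz.1)),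
          hempty (u := θ.Rm) (z := z) (fun m h => absurd (h ▸ hRm m) (not_le.mpr hz.1)),
          hempty (u := θ.Lp) (z := z) (fun m h => absurd (h ▸ (hup m).2) (not_le.mpr hz.2))]
        simp
    have f4 : Follows (-b) θ.Rm := h4.follows (T := {z | 0 < z.re ∧ z.im < 0})
      (neg_ne_zero.mpr (hne hbim)) hF hF0
      (fun v C hv => by
        filter_upwards [eventually_re_pos (b := I) (by simpa using hbim) hv,
          eventually_re_pos (b := 1) (by simpa using hb) hv] with n hn hn'
        exact ⟨by simpa using hn', by simpa using hn⟩) hm4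
      (fun m => ⟨⟨hRm m, (hlow m).1⟩, (hz m).2.2.1⟩) fun z hz => by
        rw [← hθ.multiplicity z,
          hempty (u := θ.Rp) (z := z) (fun m h => absurd (h ▸ (hup m).1) (not_le.mpr hz.2)),
          hempty (u := θ.Lm) (z := z) (fun m h => absurd (h ▸ hLm m) (not_le.mpr hz.1)),
          hempty (u := θ.Lp) (z := z) (fun m h => absurd (h ▸ (hup m).2) (not_le.mpr hz.2))]
        simp
    rcases hab with ⟨rfl, rfl⟩ | ⟨rfl, rfl⟩
    · exact ⟨Or.inl ⟨f1, f2⟩, Or.inl ⟨f4, f3⟩⟩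
    · exact ⟨Or.inr ⟨f1, f2⟩, Or.inr ⟨f4, f3⟩⟩

end Cascade

/-! ### Entire functions as products -/

lemma pairFactor_nearOne {a : ℂ} {u v : ℕ → ℂ} (ha : a ≠ 0) (hu : Follows a u) (hv : Follows a v) :
    NearOne (pairFactor u v) := fun ρ => by
  obtain ⟨N, K, h⟩ := pairFactor_local ha hu hv ρ
  exact ⟨N, K, fun m hm => (h m hm).2⟩

/-- Linear factors of two sequences in opposite directions cancel each other's leading term. -/
lemma oppositeFactor_nearOne {a : ℂ} {u w : ℕ → ℂ} (ha : a ≠ 0) (hu : Follows a u)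
    (hw : Follows (-a) w) : NearOne fun m z => (1 - z / u m) * (1 - z / w m) := by
  intro ρ
  have hw' : Follows a fun m => -w m := by simpa using hw.neg
  obtain ⟨C, hC, hsub⟩ := hu.exists_sub hw'
  obtain ⟨c, hc, hlow⟩ := hu.exists_lower ha
  obtain ⟨c', hc', hlow'⟩ := hw.exists_lower (neg_ne_zero.mpr ha)
  refine ⟨0, (|ρ| * C + |ρ| ^ 2) / (c * c'), fun m _ => ⟨by fun_prop, fun z hz => ?_⟩⟩
  have hz' : ‖z‖ ≤ |ρ| := (by simpa using hz : ‖z‖ < ρ).le.trans (le_abs_self ρ)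
  have h1 := hu.ne_zero m
  have h2 := hw.ne_zero m
  have e : (1 - z / u m) * (1 - z / w m) - 1 = (-(z * (u m - -w m)) + z ^ 2) / (u m * w m) := by
    field_simp; ring
  have hm1 : (0 : ℝ) < (m : ℝ) + 1 := by positivity
  have hs1 : 1 ≤ √((m : ℝ) + 1) := Real.one_le_sqrt.mpr (by linarith [m.cast_nonneg (α := ℝ)])
  rw [e, norm_div, norm_mul, ← sqrt_div_sq_eq hm1]
  calc ‖-(z * (u m - -w m)) + z ^ 2‖ / (‖u m‖ * ‖w m‖)
      ≤ (|ρ| * (C * √(m + 1)) + |ρ| ^ 2 * √(m + 1)) / ((c * (m + 1)) * (c' * (m + 1))) := by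
        gcongr
        · refine (norm_add_le _ _).trans ?_
          rw [norm_neg, norm_mul, norm_pow]
          have := hsub m
          gcongr
          exact (pow_le_pow_left₀ (norm_nonneg z) hz' 2).trans
            (le_mul_of_one_le_right (by positivity) hs1)
        · exact hlow m
        · exact hlow' m
    _ = _ := by field_simp

lemma analyticOrderAt_one_sub_div {u : ℂ} (hu : u ≠ 0) (z : ℂ) :
    analyticOrderAt (fun w => 1 - w / u) z = if u = z then 1 else 0 := by
  have han : AnalyticAt ℂ (fun w => 1 - w / u) z := by fun_prop
  split_ifs with h
  · subst h
    refine (han.analyticOrderAt_eq_natCast (n := 1)).mpr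
      ⟨fun _ => -u⁻¹, by fun_prop, by simpa using hu, Eventually.of_forall fun w => ?_⟩
    simp only [pow_one, smul_eq_mul]
    field_simp
    ring
  · exact han.analyticOrderAt_eq_zero.mpr (one_sub_div_ne_zero hu (Ne.symm h))

lemma analyticOrderAt_prod_range {g : ℕ → ℂ → ℂ} {z : ℂ} (hg : ∀ m, AnalyticAt ℂ (g m) z) (N : ℕ) :
    analyticOrderAt (fun w => ∏ m ∈ Finset.range N, g m w) z =
      ∑ m ∈ Finset.range N, analyticOrderAt (g m) z := by
  induction N with
  | zero => simpa using (analyticAt_const (v := (1 : ℂ))).analyticOrderAt_eq_zero.mpr one_ne_zero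
  | succ N ih =>
    simp only [Finset.prod_range_succ, Finset.sum_range_succ]
    rw [← ih]
    exact analyticOrderAt_mul (Finset.analyticAt_fun_prod _ fun m _ => hg m) (hg N)

/-- An infinite product of entire functions is entire, and its order at a point is the sum of the
orders of its factors. -/
lemma NearOne.exists_entire {g : ℕ → ℂ → ℂ} (hg : NearOne g) (hd : ∀ m, Differentiable ℂ (g m)) :
    ∃ Θ : ℂ → ℂ, Differentiable ℂ Θ ∧
      (∀ z, Tendsto (fun M => ∏ m ∈ Finset.range M, g m z) atTop (𝓝 (Θ z))) ∧
      ∀ z, ∃ N, (∀ m ≥ N, g m z ≠ 0) ∧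
        analyticOrderAt Θ z = ∑ m ∈ Finset.range N, analyticOrderAt (g m) z := by
  have hloc : ∀ z : ℂ, ∃ N, ∃ L : ℂ → ℂ, AnalyticAt ℂ L z ∧ (∀ m ≥ N, g m z ≠ 0) ∧
      ∀ᶠ w in 𝓝 z, Tendsto (fun M => ∏ m ∈ Finset.range M, g m w) atTop
        (𝓝 ((∏ m ∈ Finset.range N, g m w) * exp (L w))) := fun z => by
    obtain ⟨N, L, hL, hne, ht⟩ := hg.exists_local (‖z‖ + 1)
    have hmem : Metric.ball (0 : ℂ) (‖z‖ + 1) ∈ 𝓝 z := Metric.isOpen_ball.mem_nhds (by simp)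
    exact ⟨N, L, hL.analyticAt hmem, fun m hm => hne m hm z (mem_of_mem_nhds hmem),
      eventually_of_mem hmem ht⟩
  set Θ : ℂ → ℂ := fun z => limUnder atTop fun M => ∏ m ∈ Finset.range M, g m z
  have heq : ∀ z, ∀ N, ∀ L : ℂ → ℂ,
      (∀ᶠ w in 𝓝 z, Tendsto (fun M => ∏ m ∈ Finset.range M, g m w) atTop
        (𝓝 ((∏ m ∈ Finset.range N, g m w) * exp (L w)))) →
      Θ =ᶠ[𝓝 z] fun w => (∏ m ∈ Finset.range N, g m w) * exp (L w) :=
    fun z N L h => h.mono fun w hw => hw.limUnder_eq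
  have hga : ∀ z m, AnalyticAt ℂ (g m) z := fun z m => (hd m).analyticAt z
  refine ⟨Θ, fun z => ?_, fun z => ?_, fun z => ?_⟩
  · obtain ⟨N, L, hL, -, ht⟩ := hloc z
    refine AnalyticAt.differentiableAt (𝕜 := ℂ) ?_
    refine AnalyticAt.congr ?_ (heq z N L ht).symm
    exact (Finset.analyticAt_fun_prod _ fun m _ => hga z m).mul hL.cexp
  · obtain ⟨N, L, -, -, ht⟩ := hloc z
    rw [(heq z N L ht).self_of_nhds]
    exact ht.self_of_nhds
  · obtain ⟨N, L, hL, hne, ht⟩ := hloc z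
    refine ⟨N, hne, ?_⟩
    rw [analyticOrderAt_congr (heq z N L ht), ← analyticOrderAt_prod_range (hga z)]
    have h1 : AnalyticAt ℂ (fun w => exp (L w)) z := hL.cexp
    refine (analyticOrderAt_mul (Finset.analyticAt_fun_prod _ fun m _ => hga z m) h1).trans ?_
    rw [h1.analyticOrderAt_eq_zero.mpr (exp_ne_zero _), add_zero]

lemma encard_eq_sum_ite {u : ℕ → ℂ} {z : ℂ} {N : ℕ} (h : ∀ m ≥ N, u m ≠ z) :
    {m | u m = z}.encard = ∑ m ∈ Finset.range N, if u m = z then 1 else 0 := by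
  classical
  have e : {m | u m = z} = ((Finset.range N).filter fun m => u m = z : Finset ℕ) := by
    ext m
    simp only [Set.mem_ofPred_eq, Finset.coe_filter, Finset.mem_range]
    exact ⟨fun hm => ⟨not_le.mp fun hN => h m hN hm, hm⟩, fun hm => hm.2⟩
  rw [e, Set.encard_coe_eq_coe_finsetCard, Finset.card_filter]
  push_cast
  rfl

/-- Entire functions with the same zeros differ by a zero-free entire factor. -/
lemma exists_entire_quotient {f g : ℂ → ℂ} (hf : Differentiable ℂ f) (hg : Differentiable ℂ g)
    (hfin : ∀ z, analyticOrderAt g z ≠ ⊤) (h : ∀ z, analyticOrderAt f z = analyticOrderAt g z) :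
    ∃ V : ℂ → ℂ, Differentiable ℂ V ∧ (∀ z, V z ≠ 0) ∧ ∀ z, f z = V z * g z := by
  have hfa : ∀ z, AnalyticAt ℂ f z := fun z => hf.analyticAt z
  have hga : ∀ z, AnalyticAt ℂ g z := fun z => hg.analyticAt z
  have hm : MeromorphicOn (f / g) Set.univ := fun z _ =>
    (hfa z).meromorphicAt.div (hga z).meromorphicAt
  set V := toMeromorphicNFOn (f / g) Set.univ
  have hV : ∀ z, MeromorphicNFAt V z := fun z =>
    meromorphicNFOn_toMeromorphicNFOn _ _ (Set.mem_univ z)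
  have hord : ∀ z, meromorphicOrderAt V z = 0 := fun z => by
    rw [meromorphicOrderAt_toMeromorphicNFOn hm (Set.mem_univ z),
      meromorphicOrderAt_div (hfa z).meromorphicAt (hga z).meromorphicAt,
      (hfa z).meromorphicOrderAt_eq, (hga z).meromorphicOrderAt_eq, h z]
    obtain ⟨n, hn⟩ := ENat.ne_top_iff_exists.mp (hfin z)
    rw [← hn]
    simp
  have hVa : ∀ z, AnalyticAt ℂ V z := fun z =>
    (hV z).meromorphicOrderAt_nonneg_iff_analyticAt.mp (hord z).ge
  refine ⟨V, fun z => (hVa z).differentiableAt,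
    fun z => (hV z).meromorphicOrderAt_eq_zero_iff.mp (hord z), fun z => ?_⟩
  have h1 : ∀ᶠ w in 𝓝[≠] z, f w = V w * g w := by
    have h2 : ∀ᶠ w in 𝓝[≠] z, g w ≠ 0 := by
      rcases (hga z).eventually_eq_zero_or_eventually_ne_zero with h0 | h0
      · exact absurd (analyticOrderAt_eq_top.mpr h0) (hfin z)
      · exact h0
    filter_upwards [h2, hm.toMeromorphicNFOn_eq_self_on_nhdsNE (Set.mem_univ z)] with w hw hw'
    rw [show V w = (f / g) w from hw', Pi.div_apply, div_mul_cancel₀ _ hw]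
  have h3 := ((hfa z).frequently_eq_iff_eventually_eq ((hVa z).mul (hga z))).mp h1.frequently
  exact h3.self_of_nhds

/-! ### Convergence of the quotients -/

namespace Cascade

/-- Zero families `R`, `L` and a pole family `l` such that `R` accompanies the poles of positive
index and `L` those of negative index. -/
structure Matched (a b : ℂ) (R L : ℕ → ℂ) (l : ℤ → ℂ) : Prop where
  right : Follows a R
  left : Follows b L
  poles_right : Follows a fun m => l ((m : ℤ) + 1)
  poles_left : Follows b fun m => l (-((m : ℤ) + 1))
  pole_zero : l 0 ≠ 0

lemma partialQuotient_comm (R L : ℕ → ℂ) (l : ℤ → ℂ) :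
    partialQuotient R L l = partialQuotient L R l := by
  funext M γ
  simp only [partialQuotient, mul_comm]

/-- The factor of the partial quotient belonging to the poles `l (m + 1)` and `l (-(m + 1))`. -/
noncomputable def quotientFactor (R L : ℕ → ℂ) (l : ℤ → ℂ) (m : ℕ) (γ : ℂ) : ℂ :=
  pairFactor R (fun m => l ((m : ℤ) + 1)) m γ * pairFactor L (fun m => l (-((m : ℤ) + 1))) m γ

lemma partialQuotient_eq (R L : ℕ → ℂ) (l : ℤ → ℂ) (M : ℕ) (γ : ℂ) :
    partialQuotient R L l M γ =
      (∏ m ∈ Finset.range M, quotientFactor R L l m γ) / (1 - γ / l 0) := by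
  rw [partialQuotient, prod_Icc_neg (fun m => 1 - γ / l m)]
  simp only [quotientFactor, pairFactor]
  rw [mul_comm (1 - γ / l 0), ← div_div, ← Finset.prod_div_distrib]
  congr 1
  exact Finset.prod_congr rfl fun m _ => (div_mul_div_comm _ _ _ _).symm

namespace Matched

variable {a b : ℂ} {R L : ℕ → ℂ} {l : ℤ → ℂ}

lemma pole_ne_zero (h : Matched a b R L l) (m : ℤ) : l m ≠ 0 := by
  rcases lt_trichotomy m 0 with hm | rfl | hm
  · have := h.poles_left.ne_zero (-m - 1).toNat
    rwa [show -(((-m - 1).toNat : ℤ) + 1) = m by omega] at this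
  · exact h.pole_zero
  · have := h.poles_right.ne_zero (m - 1).toNat
    rwa [show ((m - 1).toNat : ℤ) + 1 = m by omega] at this

lemma nearOne (h : Matched a b R L l) (ha : a ≠ 0) (hb : b ≠ 0) : NearOne (quotientFactor R L l) :=
  (pairFactor_nearOne ha h.right h.poles_right).mul (pairFactor_nearOne hb h.left h.poles_left)

lemma exists_local (h : Matched a b R L l) (ha : a ≠ 0) (hb : b ≠ 0) (ρ : ℝ) :
    ∃ N : ℕ, ∃ H : ℂ → ℂ, DifferentiableOn ℂ H (Metric.ball 0 ρ) ∧
      ∀ z ∈ Metric.ball (0 : ℂ) ρ, Tendsto (fun M => partialQuotient R L l M z) atTop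
        (𝓝 ((∏ m ∈ Finset.range N, quotientFactor R L l m z) * exp (H z) / (1 - z / l 0))) := by
  obtain ⟨N, H, hH, -, ht⟩ := (h.nearOne ha hb).exists_local ρ
  refine ⟨N, H, hH, fun z hz => ?_⟩
  simp only [partialQuotient_eq]
  exact (ht z hz).div_const _

/-- The limit exists at the poles as well, where all late partial quotients vanish by convention.
-/
lemma tendsto_quotient (h : Matched a b R L l) (ha : a ≠ 0) (hb : b ≠ 0) (z : ℂ) :
    Tendsto (fun M => partialQuotient R L l M z) atTop (𝓝 (quotient R L l z)) := by
  obtain ⟨N, H, -, ht⟩ := h.exists_local ha hb (‖z‖ + 1)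
  have := ht z (by simp)
  unfold quotient
  rwa [this.limUnder_eq]

lemma analyticAt_quotientFactor (h : Matched a b R L l) {z : ℂ} (hz : ∀ m, z ≠ l m) (m : ℕ) :
    AnalyticAt ℂ (quotientFactor R L l m) z := by
  have h1 : ∀ u w : ℂ, w ≠ 0 → z ≠ w → AnalyticAt ℂ (fun z => (1 - z / u) / (1 - z / w)) z :=
    fun u w hw hzw => AnalyticAt.div (by fun_prop) (by fun_prop) (one_sub_div_ne_zero hw hzw)
  exact (h1 _ _ (h.pole_ne_zero _) (hz _)).mul (h1 _ _ (h.pole_ne_zero _) (hz _))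

lemma quotientFactor_ne_zero (h : Matched a b R L l) {z : ℂ} (hz : ∀ m, z ≠ l m)
    (hz' : ∀ m, z ≠ R m ∧ z ≠ L m) (m : ℕ) : quotientFactor R L l m z ≠ 0 :=
  mul_ne_zero
    (div_ne_zero (one_sub_div_ne_zero (h.right.ne_zero m) (hz' m).1)
      (one_sub_div_ne_zero (h.pole_ne_zero _) (hz _)))
    (div_ne_zero (one_sub_div_ne_zero (h.left.ne_zero m) (hz' m).2)
      (one_sub_div_ne_zero (h.pole_ne_zero _) (hz _)))

lemma analyticAt_quotient (h : Matched a b R L l) (ha : a ≠ 0) (hb : b ≠ 0) {z : ℂ}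
    (hz : ∀ m, z ≠ l m) : AnalyticAt ℂ (quotient R L l) z ∧
      ((∀ m, z ≠ R m ∧ z ≠ L m) → quotient R L l z ≠ 0) := by
  obtain ⟨N, H, hH, ht⟩ := h.exists_local ha hb (‖z‖ + 1)
  have hmem : Metric.ball (0 : ℂ) (‖z‖ + 1) ∈ 𝓝 z := Metric.isOpen_ball.mem_nhds (by simp)
  have heq : quotient R L l =ᶠ[𝓝 z] fun w =>
      (∏ m ∈ Finset.range N, quotientFactor R L l m w) * exp (H w) / (1 - w / l 0) :=
    eventually_of_mem hmem fun w hw => (ht w hw).limUnder_eq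
  have h0 := one_sub_div_ne_zero h.pole_zero (hz 0)
  refine ⟨AnalyticAt.congr ?_ heq.symm, fun hz' => ?_⟩
  · exact ((Finset.analyticAt_fun_prod _ fun m _ => h.analyticAt_quotientFactor hz m).mul
      (hH.analyticAt hmem).cexp).div (by fun_prop) h0
  · rw [heq.self_of_nhds]
    exact div_ne_zero (mul_ne_zero
      (Finset.prod_ne_zero_iff.mpr fun m _ => h.quotientFactor_ne_zero hz hz' m) (exp_ne_zero _)) h0

end Matched

end Cascade

/-! ### The factorization of the kernel -/

lemma eventually_mul_pow_le_exp (C : ℝ) (k : ℕ) {ε : ℝ} (hε : 0 < ε) :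
    ∀ᶠ r : ℝ in atTop, C * (1 + r) ^ k ≤ Real.exp (ε * r) := by
  have h1 := (isLittleO_pow_exp_pos_mul_atTop k hε).bound
    (show 0 < 1 / ((|C| + 1) * 2 ^ k) by positivity)
  filter_upwards [h1, eventually_ge_atTop 1] with r hr hr1
  rw [Real.norm_of_nonneg (by positivity), Real.norm_of_nonneg (Real.exp_pos _).le,
    one_div_mul_eq_div, le_div_iff₀ (by positivity)] at hr
  calc C * (1 + r) ^ k ≤ (|C| + 1) * (2 * r) ^ k := by
        have : C ≤ |C| + 1 := by linarith [le_abs_self C]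
        gcongr
        linarith
    _ = r ^ k * ((|C| + 1) * 2 ^ k) := by rw [mul_pow]; ring
    _ ≤ _ := hr

namespace Cascade

variable (p : Cascade)

/-- The acoustic modes are all the zeros of the dispersion function. -/
lemma eq_lam_of_acoustic_eq_zero (hs : 0 < p.s) {γ : ℂ} (h : p.acoustic γ = 0) :
    ∃ m, γ = p.lamPlus m ∨ γ = p.lamMinus m := by
  have hpair : ∃ m, p.modePair m γ = 0 := by
    rw [p.acoustic_eq_sin_mul_sin (p.zeta_sq γ)] at h
    rcases mul_eq_zero.mp ((mul_eq_zero.mp h).resolve_left (by norm_num)) with h | h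
    · obtain ⟨k, hk⟩ := sin_eq_zero_iff.mp h
      exact ⟨k, by rw [p.modePair_eq_mul k (p.zeta_sq γ), hk]; simp⟩
    · obtain ⟨k, hk⟩ := sin_eq_zero_iff.mp h
      exact ⟨-k, by rw [p.modePair_eq_mul (-k) (p.zeta_sq γ), hk]; push_cast; ring⟩
  obtain ⟨m, hm⟩ := hpair
  rw [p.modePair_eq hs] at hm
  have hΔ : (p.Δ : ℂ) ^ 2 ≠ 0 := pow_ne_zero 2 (by exact_mod_cast (p.Δ_pos hs).ne')
  refine ⟨m, ?_⟩
  rcases mul_eq_zero.mp ((mul_eq_zero.mp hm).resolve_left hΔ) with h | h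
  · exact Or.inl (sub_eq_zero.mp h)
  · exact Or.inr (sub_eq_zero.mp h)

/-- The product of the linear factors over all kernel zeros. -/
lemma exists_duct_product {a b : ℂ} {U V W X : ℕ → ℂ} (ha : a ≠ 0) (hb : b ≠ 0)
    (hU : Follows a U) (hV : Follows b V) (hW : Follows (-b) W) (hX : Follows (-a) X)
    (hpole : p.acoustic 0 ≠ 0) (hzero : p.K 0 ≠ 0)
    (hmult : ∀ z : ℂ, {m | U m = z}.encard + {m | V m = z}.encard
      + {m | W m = z}.encard + {m | X m = z}.encard = analyticOrderAt p.duct z) :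
    ∃ Θ G : ℂ → ℂ, (∀ z, Tendsto (fun M => ∏ m ∈ Finset.range M,
        ((1 - z / U m) * (1 - z / X m) * ((1 - z / V m) * (1 - z / W m)))) atTop (𝓝 (Θ z))) ∧
      Differentiable ℂ G ∧ (∀ z, G z ≠ 0) ∧ ∀ z, p.duct z = G z * Θ z := by
  set g : ℕ → ℂ → ℂ := fun m z => (1 - z / U m) * (1 - z / X m) * ((1 - z / V m) * (1 - z / W m))
    with hg
  have hnear : NearOne g := (oppositeFactor_nearOne ha hU hX).mul (oppositeFactor_nearOne hb hV hW)
  obtain ⟨Θ, hΘ, ht, hord⟩ := hnear.exists_entire (fun m => by simp only [hg]; fun_prop)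
  have hF0 := p.duct_zero_ne hpole hzero
  have hF := p.differentiable_duct
  have hfac : ∀ m z, analyticOrderAt (g m) z = (if U m = z then 1 else 0) +
      (if X m = z then 1 else 0) + ((if V m = z then 1 else 0) + if W m = z then 1 else 0) := by
    intro m z
    have hl : ∀ u : ℂ, AnalyticAt ℂ (fun w => 1 - w / u) z := fun u => by fun_prop
    rw [← analyticOrderAt_one_sub_div (hU.ne_zero m), ← analyticOrderAt_one_sub_div (hV.ne_zero m),
      ← analyticOrderAt_one_sub_div (hW.ne_zero m), ← analyticOrderAt_one_sub_div (hX.ne_zero m)]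
    rw [← analyticOrderAt_mul (hl _) (hl _), ← analyticOrderAt_mul (hl _) (hl _)]
    exact analyticOrderAt_mul ((hl _).mul (hl _)) ((hl _).mul (hl _))
  have heq : ∀ z, analyticOrderAt p.duct z = analyticOrderAt Θ z := by
    intro z
    obtain ⟨N, hN, ho⟩ := hord z
    have hne : ∀ m ≥ N, U m ≠ z ∧ V m ≠ z ∧ W m ≠ z ∧ X m ≠ z := by
      intro m hm
      have h1 := hN m hm
      refine ⟨?_, ?_, ?_, ?_⟩ <;> rintro rfl <;> apply h1 <;> simp only [hg]
      · rw [div_self (hU.ne_zero m)]; simp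
      · rw [div_self (hV.ne_zero m)]; simp
      · rw [div_self (hW.ne_zero m)]; simp
      · rw [div_self (hX.ne_zero m)]; simp
    rw [← hmult z, encard_eq_sum_ite fun m hm => (hne m hm).1,
      encard_eq_sum_ite fun m hm => (hne m hm).2.1,
      encard_eq_sum_ite fun m hm => (hne m hm).2.2.1,
      encard_eq_sum_ite fun m hm => (hne m hm).2.2.2, ho]
    simp only [hfac, Finset.sum_add_distrib]
    abel
  obtain ⟨G, hG, hG0, h⟩ := exists_entire_quotient hF hΘ
    (fun z => heq z ▸ analyticOrderAt_ne_top hF hF0 z) heq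
  exact ⟨Θ, G, ht, hG, hG0, h⟩

/-- There are arbitrarily large circles on which the product over the acoustic modes is not much
larger than the product over the kernel zeros, and which keep a distance from the acoustic modes. -/
lemma exists_circle_prod_le {U V W X : ℕ → ℂ} (ha : p.dirRight ≠ 0) (hb : p.dirLeft ≠ 0)
    (h₁ : Matched p.dirRight p.dirLeft U V p.lamPlus)
    (h₂ : Matched (-p.dirLeft) (-p.dirRight) W X p.lamMinus) :
    ∃ δ > 0, ∃ c > 0, ∀ ε > 0, ∀ R : ℝ, ∃ r > R, ∀ z : ℂ, ‖z‖ = r →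
      (∀ m, δ ≤ ‖z - p.lamPlus m‖) ∧ (∀ m, δ ≤ ‖z - p.lamMinus m‖) ∧
      ∀ M : ℕ, ‖∏ m ∈ Finset.Icc (-(M : ℤ)) M, ((1 - z / p.lamPlus m) * (1 - z / p.lamMinus m))‖ ≤
        c * (1 + r) ^ 2 * Real.exp (ε * r) * ‖∏ m ∈ Finset.range M,
          ((1 - z / U m) * (1 - z / X m) * ((1 - z / V m) * (1 - z / W m)))‖ := by
  have hna := neg_ne_zero.mpr ha
  have hnb := neg_ne_zero.mpr hb
  set lp : ℕ → ℂ := fun m => p.lamPlus ((m : ℤ) + 1) with hlp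
  set lp' : ℕ → ℂ := fun m => p.lamPlus (-((m : ℤ) + 1)) with hlp'
  set lm : ℕ → ℂ := fun m => p.lamMinus ((m : ℤ) + 1) with hlm
  set lm' : ℕ → ℂ := fun m => p.lamMinus (-((m : ℤ) + 1)) with hlm'
  -- the circles have to avoid the zeros and the modes simultaneously
  set u : Fin 8 → ℕ → ℂ := ![U, V, W, X, lp, lp', lm, lm'] with hu
  have hlow : ∀ i, ∃ c : ℝ, 0 < c ∧ ∀ m : ℕ, c * ((m : ℝ) + 1) ≤ ‖u i m‖ := by
    intro i
    fin_cases i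
    · exact h₁.right.exists_lower ha
    · exact h₁.left.exists_lower hb
    · exact h₂.right.exists_lower hnb
    · exact h₂.left.exists_lower hna
    · exact h₁.poles_right.exists_lower ha
    · exact h₁.poles_left.exists_lower hb
    · exact h₂.poles_right.exists_lower hnb
    · exact h₂.poles_left.exists_lower hna
  choose c hc hcu using hlow
  obtain ⟨i₀, hi₀⟩ := Finite.exists_min c
  obtain ⟨δ, hδ, hcirc⟩ := exists_circles (hc i₀) u
    fun i m => (mul_le_mul_of_nonneg_right (hi₀ i) (by positivity)).trans (hcu i m)
  set q : ℝ := 1 + 1 / ‖p.lamPlus 0‖ + 1 / ‖p.lamMinus 0‖ with hq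
  have hq0 : 0 < q := by positivity
  refine ⟨min δ 1, lt_min hδ one_pos, q ^ 2, by positivity, fun ε hε R => ?_⟩
  have hε' : 0 < ε / 4 := by positivity
  obtain ⟨r₁, hr₁⟩ := exists_prod_inv_pairFactor_le ha h₁.right h₁.poles_right hδ hε'
  obtain ⟨r₂, hr₂⟩ := exists_prod_inv_pairFactor_le hb h₁.left h₁.poles_left hδ hε'
  obtain ⟨r₃, hr₃⟩ := exists_prod_inv_pairFactor_le hnb h₂.right h₂.poles_right hδ hε'
  obtain ⟨r₄, hr₄⟩ := exists_prod_inv_pairFactor_le hna h₂.left h₂.poles_left hδ hε'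
  obtain ⟨r, hr, hrz⟩ := hcirc (max (max (max R (max r₁ r₂)) (max r₃ r₄))
    (max (‖p.lamPlus 0‖ + 1) (‖p.lamMinus 0‖ + 1)))
  simp only [gt_iff_lt, max_lt_iff] at hr
  obtain ⟨⟨⟨hR, hr1, hr2⟩, hr3, hr4⟩, hr5, hr6⟩ := hr
  refine ⟨r, hR, fun z hz => ?_⟩
  have hd := hrz z hz
  have hmin : ∀ {x : ℝ}, δ ≤ x → min δ 1 ≤ x := fun h => (min_le_left _ _).trans h
  have hidx : ∀ l : ℤ → ℂ, ‖l 0‖ + 1 < r → (∀ m : ℕ, δ ≤ ‖l ((m : ℤ) + 1) - z‖) →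
      (∀ m : ℕ, δ ≤ ‖l (-((m : ℤ) + 1)) - z‖) → ∀ m, min δ 1 ≤ ‖z - l m‖ := by
    intro l h0 hp hm m
    rcases lt_trichotomy m 0 with h | rfl | h
    · have := hm (-m - 1).toNat
      rw [show -(((-m - 1).toNat : ℤ) + 1) = m by omega, norm_sub_rev] at this
      exact hmin this
    · refine (min_le_right _ _).trans ?_
      have := norm_sub_norm_le z (l 0)
      linarith
    · have := hp (m - 1).toNat
      rw [show ((m - 1).toNat : ℤ) + 1 = m by omega, norm_sub_rev] at this
      exact hmin this
  refine ⟨hidx _ hr5 (hd 4) (hd 5), hidx _ hr6 (hd 6) (hd 7), fun M => ?_⟩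
  have hne : ∀ {v : ℕ → ℂ}, (∀ m, v m ≠ 0) → (∀ m, δ ≤ ‖v m - z‖) → ∀ m, 1 - z / v m ≠ 0 :=
    fun h0 h m => one_sub_div_ne_zero (h0 m) fun h' => by
      have := h m
      rw [← h', sub_self, norm_zero] at this
      linarith
  have e : ∏ m ∈ Finset.range M, (((1 - z / lp m) * (1 - z / lm m)) *
      ((1 - z / lp' m) * (1 - z / lm' m))) =
      (∏ m ∈ Finset.range M, pairFactor lp U m z) * (∏ m ∈ Finset.range M, pairFactor lp' V m z) *
      (∏ m ∈ Finset.range M, pairFactor lm W m z) * (∏ m ∈ Finset.range M, pairFactor lm' X m z) *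
      ∏ m ∈ Finset.range M, ((1 - z / U m) * (1 - z / X m) * ((1 - z / V m) * (1 - z / W m))) := by
    simp only [← Finset.prod_mul_distrib]
    refine Finset.prod_congr rfl fun m _ => ?_
    have i1 := hne h₁.right.ne_zero (hd 0) m
    have i2 := hne h₁.left.ne_zero (hd 1) m
    have i3 := hne h₂.right.ne_zero (hd 2) m
    have i4 := hne h₂.left.ne_zero (hd 3) m
    simp only [pairFactor]
    generalize 1 - z / U m = x1 at *
    generalize 1 - z / V m = x2 at *
    generalize 1 - z / W m = x3 at *
    generalize 1 - z / X m = x4 at *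
    field_simp
  have hr0 : 0 ≤ r := hz ▸ norm_nonneg z
  have hlin : ∀ w : ℂ, 1 / ‖w‖ ≤ q → ‖1 - z / w‖ ≤ q * (1 + r) := fun w hw => by
    have h1 : ‖1 - z / w‖ ≤ 1 + r * (1 / ‖w‖) := by
      refine (norm_sub_le _ _).trans_eq ?_
      rw [norm_one, norm_div, hz, mul_one_div]
    have h2 : 1 ≤ q := by
      have : 0 ≤ 1 / ‖p.lamPlus 0‖ + 1 / ‖p.lamMinus 0‖ := by positivity
      linarith
    nlinarith
  have hl1 := hlin (p.lamPlus 0) (by have : 0 ≤ 1 / ‖p.lamMinus 0‖ := by positivity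
                                     linarith)
  have hl2 := hlin (p.lamMinus 0) (by have : 0 ≤ 1 / ‖p.lamPlus 0‖ := by positivity
                                      linarith)
  rw [prod_Icc_neg fun m => (1 - z / p.lamPlus m) * (1 - z / p.lamMinus m), e]
  have j1 := hr₁ r hr1.le z hz (hd 0) M
  have j2 := hr₂ r hr2.le z hz (hd 1) M
  have j3 := hr₃ r hr3.le z hz (hd 2) M
  have j4 := hr₄ r hr4.le z hz (hd 3) M
  rw [← norm_prod] at j1 j2 j3 j4
  have hexp : Real.exp (ε * r) = Real.exp (ε / 4 * r) * Real.exp (ε / 4 * r) *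
      Real.exp (ε / 4 * r) * Real.exp (ε / 4 * r) := by
    rw [← Real.exp_add, ← Real.exp_add, ← Real.exp_add]; ring_nf
  simp only [norm_mul (_ * _) _, norm_mul (1 - z / p.lamPlus 0)]
  rw [hexp, norm_mul (∏ m ∈ Finset.range M, pairFactor lp U m z), ← mul_assoc]
  gcongr ?_ * _
  calc _ ≤ q * (1 + r) * (q * (1 + r)) * (Real.exp (ε / 4 * r) * Real.exp (ε / 4 * r) *
      Real.exp (ε / 4 * r) * Real.exp (ε / 4 * r)) := by gcongr
    _ = _ := by ring

/-- The entire function obtained on removing all zeros from the dispersion function is constant: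
it has no zeros, and it grows less than exponentially along a sequence of circles. -/
lemma K_eq_mul_quotient (hs : 0 < p.s) {U V W X : ℕ → ℂ}
    (h₁ : Matched p.dirRight p.dirLeft U V p.lamPlus)
    (h₂ : Matched (-p.dirLeft) (-p.dirRight) W X p.lamMinus)
    (hpole : p.acoustic 0 ≠ 0) (hzero : p.K 0 ≠ 0)
    (hmult : ∀ z : ℂ, {m | U m = z}.encard + {m | V m = z}.encard
      + {m | W m = z}.encard + {m | X m = z}.encard = analyticOrderAt p.duct z)
    {γ : ℂ} (hγ : p.acoustic γ ≠ 0) :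
    p.K γ = p.K 0 * quotient U V p.lamPlus γ * quotient W X p.lamMinus γ := by
  have ha : p.dirRight ≠ 0 := fun h => by simpa [h] using p.dirRight_im_pos hs
  have hb : p.dirLeft ≠ 0 := fun h => by simpa [h] using p.dirLeft_im_pos hs
  obtain ⟨Θ, G, ht, hG, hG0, hGΘ⟩ := p.exists_duct_product ha hb h₁.right h₁.left h₂.right h₂.left
    hpole hzero hmult
  have hpi : (Real.pi : ℂ) ≠ 0 := by exact_mod_cast Real.pi_ne_zero
  set P : ℕ → ℂ → ℂ := fun M z => ∏ m ∈ Finset.range M,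
    ((1 - z / U m) * (1 - z / X m) * ((1 - z / V m) * (1 - z / W m))) with hP
  set A : ℕ → ℂ → ℂ := fun M z => ∏ m ∈ Finset.Icc (-(M : ℤ)) M,
    ((1 - z / p.lamPlus m) * (1 - z / p.lamMinus m)) with hA
  have htA : ∀ z, Tendsto (fun M => A M z) atTop (𝓝 (p.acoustic z / p.acoustic 0)) :=
    p.tendsto_acoustic_prod hs hpole
  have hPA : ∀ M z, partialQuotient U V p.lamPlus M z * partialQuotient W X p.lamMinus M z =
      P M z / A M z := fun M z => by
    simp only [partialQuotient, hP, hA, div_mul_div_comm, ← Finset.prod_mul_distrib]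
    congr 1
    exact Finset.prod_congr rfl fun m _ => by ring
  have hΘ0 : Θ 0 = 1 := tendsto_nhds_unique (ht 0) (by simp)
  obtain ⟨δ, hδ, c, hc, hcirc⟩ := p.exists_circle_prod_le ha hb h₁ h₂
  obtain ⟨C, hC⟩ := p.exists_norm_K_le hs hδ
  -- on these circles `duct = 4 π K D`, where `K` is polynomially bounded and `D` is at most a
  -- subexponential multiple of the product `Θ` over the zeros
  have hGconst : ∀ z, G z = G 0 := by
    refine eq_const_of_nonvanishing hG hG0 fun ε hε R => ?_
    obtain ⟨r₀, hr₀⟩ := eventually_atTop.mp (eventually_mul_pow_le_exp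
      (4 * Real.pi * C * ‖p.acoustic 0‖ * c) 4 (half_pos hε))
    obtain ⟨r, hr, hrz⟩ := hcirc (ε / 2) (half_pos hε) (max R r₀)
    obtain ⟨hrR, hrr⟩ := max_lt_iff.mp hr
    refine ⟨r, hrR, fun z hz => ?_⟩
    obtain ⟨d1, d2, hle⟩ := hrz z hz
    have hac : p.acoustic z ≠ 0 := fun h => by
      obtain ⟨m, rfl | rfl⟩ := p.eq_lam_of_acoustic_eq_zero hs h
      · have := d1 m; rw [sub_self, norm_zero] at this; linarith
      · have := d2 m; rw [sub_self, norm_zero] at this; linarith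
    have hlim : ‖p.acoustic z / p.acoustic 0‖ ≤
        c * (1 + r) ^ 2 * Real.exp (ε / 2 * r) * ‖Θ z‖ :=
      le_of_tendsto_of_tendsto' (htA z).norm ((ht z).norm.const_mul _) hle
    have hr0 : 0 ≤ r := hz ▸ norm_nonneg z
    have hpos : 0 < c * (1 + r) ^ 2 * Real.exp (ε / 2 * r) := by positivity
    have hΘz : 0 < ‖Θ z‖ := by
      have h1 : 0 < ‖p.acoustic z / p.acoustic 0‖ := norm_pos_iff.mpr (div_ne_zero hac hpole)
      exact pos_of_mul_pos_right (h1.trans_le hlim) hpos.le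
    have hd : p.duct z = 4 * Real.pi * p.K z * p.acoustic 0 * (p.acoustic z / p.acoustic 0) := by
      rw [p.K_eq_duct_div hac]; field_simp
    refine le_of_mul_le_mul_right ?_ hΘz
    rw [← norm_mul, ← hGΘ z, hd, norm_mul, norm_mul, norm_mul, norm_mul]
    have hKz := hC z d1 d2
    rw [hz] at hKz
    have h4 : ‖(4 : ℂ)‖ * ‖(Real.pi : ℂ)‖ = 4 * Real.pi := by simp [abs_of_pos Real.pi_pos]
    have hfin := hr₀ r hrr.le
    calc ‖(4 : ℂ)‖ * ‖(Real.pi : ℂ)‖ * ‖p.K z‖ * ‖p.acoustic 0‖ * ‖p.acoustic z / p.acoustic 0‖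
        ≤ 4 * Real.pi * (C * (1 + r) ^ 2) * ‖p.acoustic 0‖ *
          (c * (1 + r) ^ 2 * Real.exp (ε / 2 * r) * ‖Θ z‖) := by
          have : 0 ≤ C * (1 + r) ^ 2 := (norm_nonneg _).trans hKz
          rw [h4]
          gcongr
      _ = (4 * Real.pi * C * ‖p.acoustic 0‖ * c * (1 + r) ^ 4) * Real.exp (ε / 2 * r) * ‖Θ z‖ := by
          ring
      _ ≤ Real.exp (ε / 2 * r) * Real.exp (ε / 2 * r) * ‖Θ z‖ := by gcongr
      _ = Real.exp (ε * r) * ‖Θ z‖ := by rw [← Real.exp_add]; ring_nf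
  have hQ : Θ γ / (p.acoustic γ / p.acoustic 0) =
      quotient U V p.lamPlus γ * quotient W X p.lamMinus γ := by
    refine tendsto_nhds_unique ((ht γ).div (htA γ) (div_ne_zero hγ hpole)) ?_
    refine ((h₁.tendsto_quotient ha hb γ).mul
      (h₂.tendsto_quotient (neg_ne_zero.mpr hb) (neg_ne_zero.mpr ha) γ)).congr fun M => hPA M γ
  rw [mul_assoc, ← hQ, p.K_eq_duct_div hγ, p.K_eq_duct_div hpole, hGΘ γ, hGΘ 0, hΘ0, hGconst γ]
  field_simp

end Cascade

/-! ### Algebraic growth -/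

/-- `f` has algebraic growth along `S`; the power is that of `κ z`. -/
def AlgebraicAlong (κ : ℂ) (S : Set ℂ) (f : ℂ → ℂ) : Prop :=
  ∃ A α : ℂ, A ≠ 0 ∧ Tendsto (fun z => f z / (κ * z) ^ α) (Bornology.cobounded ℂ ⊓ 𝓟 S) (𝓝 A)

namespace AlgebraicAlong

variable {κ : ℂ} {S : Set ℂ} {f g φ : ℂ → ℂ}

lemma const_mul (hf : AlgebraicAlong κ S f) {c : ℂ} (hc : c ≠ 0) :
    AlgebraicAlong κ S fun z => c * f z := by
  obtain ⟨A, α, hA, h⟩ := hf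
  refine ⟨c * A, α, mul_ne_zero hc hA, (h.const_mul c).congr fun z => ?_⟩
  rw [mul_div_assoc]

/-- The quotient of two functions of algebraic growth grows slower than every exponential. -/
lemma norm_quotient_le (hκ : ‖κ‖ = 1) (hf : AlgebraicAlong κ S f)
    (hg : AlgebraicAlong κ S fun z => φ z * f z) {ε : ℝ} (hε : 0 < ε) :
    ∀ᶠ z in Bornology.cobounded ℂ ⊓ 𝓟 S, ‖φ z‖ ≤ Real.exp (ε * ‖z‖) := by
  obtain ⟨A, α, hA, h⟩ := hf
  obtain ⟨B, β, hB, h'⟩ := hg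
  have hκ0 : κ ≠ 0 := fun h => by simp [h] at hκ
  set l := Bornology.cobounded ℂ ⊓ 𝓟 S
  have hl : l ≤ Bornology.cobounded ℂ := inf_le_left
  set D : ℝ := (‖B / A‖ + 1) * Real.exp (Real.pi * |(β - α).im|) with hD
  have hD0 : 0 < D := by positivity
  have h2 := (isLittleO_rpow_exp_pos_mul_atTop (β - α).re hε).bound (inv_pos.mpr hD0)
  filter_upwards [((h'.div h hA).norm).eventually_lt_const (lt_add_one _), h.eventually_ne hA,
    PowAsymp.eventually_ne hl, (tendsto_norm_cobounded_atTop.mono_left hl).eventually h2]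
    with z i1 i2 i3 i4
  have hw : κ * z ≠ 0 := mul_ne_zero hκ0 i3
  have hf0 : f z ≠ 0 := fun h0 => i2 (by rw [h0, zero_div])
  have e : φ z * f z / (κ * z) ^ β / (f z / (κ * z) ^ α) = φ z / (κ * z) ^ (β - α) := by
    rw [cpow_sub _ _ hw]
    have := cpow_ne_zero_iff.mpr (Or.inl hw : κ * z ≠ 0 ∨ α = 0)
    have := cpow_ne_zero_iff.mpr (Or.inl hw : κ * z ≠ 0 ∨ β = 0)
    field_simp
  simp only [Pi.div_apply] at i1
  rw [e, norm_div, div_lt_iff₀ (norm_pos_iff.mpr (cpow_ne_zero_iff.mpr (Or.inl hw)))] at i1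
  have i5 : ‖(κ * z) ^ (β - α)‖ ≤ ‖z‖ ^ (β - α).re * Real.exp (Real.pi * |(β - α).im|) := by
    refine (norm_cpow_le _ _).trans ?_
    rw [norm_mul, hκ, one_mul, div_eq_mul_inv, ← Real.exp_neg]
    gcongr
    have h3 : |arg (κ * z) * (β - α).im| ≤ Real.pi * |(β - α).im| := by
      rw [abs_mul]
      gcongr
      exact abs_arg_le_pi _
    linarith [neg_abs_le (arg (κ * z) * (β - α).im)]
  rw [Real.norm_of_nonneg (by positivity), Real.norm_of_nonneg (Real.exp_pos _).le,
    inv_mul_eq_div, le_div_iff₀ hD0] at i4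
  calc ‖φ z‖ ≤ (‖B / A‖ + 1) * ‖(κ * z) ^ (β - α)‖ := i1.le
    _ ≤ (‖B / A‖ + 1) * (‖z‖ ^ (β - α).re * Real.exp (Real.pi * |(β - α).im|)) := by gcongr
    _ = ‖z‖ ^ (β - α).re * D := by rw [hD]; ring
    _ ≤ _ := i4

end AlgebraicAlong

/-- A factor of power behaviour and the exponential of a function that is logarithmic up to a null
term together have algebraic growth. -/
lemma PowAsymp.algebraicAlong_mul_exp {κ : ℂ} {S : Set ℂ} {Q H : ℂ → ℂ} {q α c : ℂ} {n : ℤ} {A : ℝ}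
    (hκ : ‖κ‖ = 1) (hq : q ≠ 0) (hQ : PowAsymp (Bornology.cobounded ℂ) Q q n)
    (hS : ∀ z ∈ S, 0 ≤ (κ * z).re)
    (h : ∀ z ∈ S, ‖H z - α * log (2 + κ * z) - c‖ ≤ A * (1 + ‖z‖) ^ (-(1 / 2) : ℝ)) :
    AlgebraicAlong κ S fun z => Q z * exp (H z) := by
  have hκ0 : κ ≠ 0 := fun h => by simp [h] at hκ
  have h1 := tendsto_exp_div_cpow hκ hS h
  have hl : Bornology.cobounded ℂ ⊓ 𝓟 S ≤ Bornology.cobounded ℂ := inf_le_left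
  have h2 := ((hQ.mono hl).tendsto_one hl).const_mul (q * (κ ^ n)⁻¹)
  rw [mul_one] at h2
  refine ⟨q * (κ ^ n)⁻¹ * exp c, n + α, mul_ne_zero (mul_ne_zero hq (inv_ne_zero (zpow_ne_zero n hκ0)))
    (exp_ne_zero c), (h2.mul h1).congr' ?_⟩
  filter_upwards [PowAsymp.eventually_ne hl] with z hz
  have hw : κ * z ≠ 0 := mul_ne_zero hκ0 hz
  rw [cpow_add _ _ hw, cpow_intCast, mul_zpow]
  have := cpow_ne_zero_iff.mpr (Or.inl hw : κ * z ≠ 0 ∨ α = 0)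
  have := zpow_ne_zero n hκ0
  have := zpow_ne_zero n hz
  field_simp

namespace Cascade

lemma pairFactor_powAsymp {u v : ℕ → ℂ} {m : ℕ} (hu : u m ≠ 0) (hv : v m ≠ 0) :
    ∃ c ≠ 0, ∃ n, PowAsymp (Bornology.cobounded ℂ) (pairFactor u v m) c n := by
  have hlin : ∀ {w : ℂ}, w ≠ 0 → PowAsymp (Bornology.cobounded ℂ) (fun z => 1 - z / w) (-w⁻¹) 1 :=
    fun {w} hw => (PowAsymp.linear le_rfl 1 (neg_ne_zero.mpr (inv_ne_zero hw))).congr'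
      (Eventually.of_forall fun z => by simp only; field_simp; ring)
  refine ⟨_, ?_, _, (hlin hu).mul le_rfl ((hlin hv).inv le_rfl)⟩
  simp [hu, hv]

namespace Matched

variable {a b : ℂ} {R L : ℕ → ℂ} {l : ℤ → ℂ}

lemma neg (h : Matched a b R L l) :
    Matched (-a) (-b) (fun m => -R m) (fun m => -L m) (fun m => -l m) :=
  ⟨h.right.neg, h.left.neg, h.poles_right.neg, h.poles_left.neg, neg_ne_zero.mpr h.pole_zero⟩

/-- In the half-plane away from its poles the quotient is a rational function times the exponential
of a holomorphic function of sublinear growth. -/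
lemma exists_eq_mul_exp (h : Matched a b R L l) (ha : 0 < a.im) (hb : 0 < b.im) :
    ∃ (Q H : ℂ → ℂ) (c : ℂ) (n : ℤ) (C : ℝ), c ≠ 0 ∧ PowAsymp (Bornology.cobounded ℂ) Q c n ∧
      DifferentiableOn ℂ H {z | z.im < 1} ∧
      (∀ z : ℂ, z.im < 1 → ‖H z‖ ≤ C * (1 + ‖z‖) ^ (3 / 4 : ℝ)) ∧
      ∀ z : ℂ, z.im < 1 → quotient R L l z = Q z * exp (H z) := by
  obtain ⟨N₁, H₁, C₁, hd₁, hb₁, ht₁⟩ := exists_tail_log ha h.right h.poles_right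
  obtain ⟨N₂, H₂, C₂, hd₂, hb₂, ht₂⟩ := exists_tail_log hb h.left h.poles_left
  have h0 := h.pole_zero
  have hlin : PowAsymp (Bornology.cobounded ℂ) (fun z => 1 - z / l 0) (-(l 0)⁻¹) 1 :=
    (PowAsymp.linear le_rfl 1 (neg_ne_zero.mpr (inv_ne_zero h0))).congr'
      (Eventually.of_forall fun z => by simp only; field_simp; ring)
  obtain ⟨c₁, hc₁, n₁, hP₁⟩ := PowAsymp.prod le_rfl (Finset.range N₁)
    (pairFactor R fun m => l ((m : ℤ) + 1)) fun m _ =>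
    pairFactor_powAsymp (h.right.ne_zero m) (h.poles_right.ne_zero m)
  obtain ⟨c₂, hc₂, n₂, hP₂⟩ := PowAsymp.prod le_rfl (Finset.range N₂)
    (pairFactor L fun m => l (-((m : ℤ) + 1))) fun m _ =>
    pairFactor_powAsymp (h.left.ne_zero m) (h.poles_left.ne_zero m)
  refine ⟨_, fun z => H₁ z + H₂ z, _, _, C₁ + C₂, ?_,
    (hP₁.mul le_rfl hP₂).mul le_rfl (hlin.inv le_rfl), hd₁.add hd₂, fun z hz => ?_, fun z hz => ?_⟩
  · simp [hc₁, hc₂, h0]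
  · rw [add_mul]
    exact (norm_add_le _ _).trans (add_le_add (hb₁ z hz) (hb₂ z hz))
  · have ha0 : a ≠ 0 := fun h => by simp [h] at ha
    have hb0 : b ≠ 0 := fun h => by simp [h] at hb
    refine tendsto_nhds_unique (h.tendsto_quotient ha0 hb0 z) ?_
    have := ((tendsto_prod_shift (g := fun m => pairFactor R _ m z) (ht₁ z hz)).mul
      (tendsto_prod_shift (g := fun m => pairFactor L _ m z) (ht₂ z hz))).div_const (1 - z / l 0)
    convert this using 1
    · funext M
      rw [partialQuotient_eq, ← Finset.prod_mul_distrib]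
      rfl
    · rw [exp_add, div_eq_mul_inv]
      congr 1
      ring

end Matched

/-- Reflection, which reduces the upper half-plane to the lower one. -/
lemma quotient_neg (R L : ℕ → ℂ) (l : ℤ → ℂ) (z : ℂ) :
    quotient (fun m => -R m) (fun m => -L m) (fun m => -l m) z = quotient R L l (-z) := by
  simp only [quotient, partialQuotient, div_neg, neg_div]

variable (p : Cascade)

/-- The two ends `ε = ± 1` of the strip `|Im z| < 1`. -/
def stripEnd (ε : ℝ) : Set ℂ := {z | |z.im| < 1 ∧ 0 ≤ ε * z.re}

lemma eventually_le_re_stripEnd (ε T : ℝ) (hε : |ε| = 1) :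
    ∀ᶠ z in Bornology.cobounded ℂ ⊓ 𝓟 (stripEnd ε), |z.im| < 1 ∧ T ≤ ε * z.re := by
  refine eventually_cobounded_inf_principal.mpr ⟨|T| + 1, fun z hz hR => ⟨hz.1, ?_⟩⟩
  have h1 := norm_le_abs_re_add_abs_im z
  have h2 : |z.re| = ε * z.re := by
    rw [← abs_of_nonneg hz.2, abs_mul, hε, one_mul]
  linarith [hz.1, le_abs_self T]

/-- Power asymptotics at one end of the strip with explicit constants. -/
lemma exists_bound_of_powAsymp {f : ℂ → ℂ} {c : ℂ} {n : ℤ} {ε : ℝ} (hε : |ε| = 1)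
    (h : PowAsymp (Bornology.cobounded ℂ ⊓ 𝓟 (stripEnd ε)) f c n) :
    ∃ T M : ℝ, ∀ z : ℂ, |z.im| < 1 → T ≤ ε * z.re → ‖f z / (c * z ^ n) - 1‖ ≤ M / ‖z‖ := by
  obtain ⟨M, hM⟩ := Asymptotics.IsBigO.bound h
  obtain ⟨T, hT⟩ := eventually_cobounded_inf_principal.mp hM
  refine ⟨|T| + 1, M, fun z hz hre => ?_⟩
  have h1 : 0 ≤ ε * z.re := le_trans (by positivity) hre
  have h2 : ε * z.re ≤ ‖z‖ := by
    refine (le_abs_self _).trans ?_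
    rw [abs_mul, hε, one_mul]
    exact abs_re_le_norm z
  have := hT z ⟨hz, h1⟩ (by linarith [le_abs_self T])
  rwa [norm_inv] at this

/-- At each end of the strip the kernel is eventually regular and behaves like
`(symbol γ ∓ γ) / (4 π)`. -/
lemma powAsymp_K_aux (hs : 0 < p.s) {ε : ℝ} (hε : |ε| = 1) {c : ℂ} (hc : c ≠ 0) {n : ℤ} (hn : 0 ≤ n)
    (h : PowAsymp (Bornology.cobounded ℂ) (fun γ => p.symbol γ - ε * p.farRoot γ) c n) :
    (∀ᶠ z in Bornology.cobounded ℂ ⊓ 𝓟 (stripEnd ε), p.acoustic z ≠ 0) ∧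
      PowAsymp (Bornology.cobounded ℂ ⊓ 𝓟 (stripEnd ε)) p.K ((4 * Real.pi : ℂ)⁻¹ * c) n := by
  obtain ⟨T, M, hTM⟩ := p.exists_K_strip hs ε hε
  have hl : Bornology.cobounded ℂ ⊓ 𝓟 (stripEnd ε) ≤ Bornology.cobounded ℂ := inf_le_left
  have hev := eventually_le_re_stripEnd ε T hε
  have hpi : (4 * Real.pi : ℂ) ≠ 0 := by simp [Real.pi_ne_zero]
  refine ⟨hev.mono fun z hz => (hTM z hz.1 hz.2).1, ?_⟩
  have h1 : (fun γ => ε * (p.farRoot γ - γ) + (4 * Real.pi * p.K γ - (p.symbol γ - ε * γ)))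
      =O[Bornology.cobounded ℂ ⊓ 𝓟 (stripEnd ε)] fun γ => γ ^ (n - 1) := by
    have h2 : (fun γ => 4 * Real.pi * p.K γ - (p.symbol γ - ε * γ))
        =O[Bornology.cobounded ℂ ⊓ 𝓟 (stripEnd ε)] fun γ : ℂ => γ⁻¹ := by
      refine Asymptotics.IsBigO.of_bound M ?_
      filter_upwards [hev] with z hz
      rw [norm_inv, ← div_eq_mul_inv]
      exact (hTM z hz.1 hz.2).2
    refine (((p.farRoot_sub_isBigO.mono hl).const_mul_left (ε : ℂ)).add h2).trans
      (Asymptotics.IsBigO.of_bound 1 ?_)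
    filter_upwards [hl (tendsto_norm_cobounded_atTop.eventually_ge_atTop (1 : ℝ))] with γ h
    rw [one_mul, norm_zpow, norm_inv, ← zpow_neg_one]
    exact zpow_le_zpow_right₀ h (by omega)
  have h3 := (PowAsymp.const (l := Bornology.cobounded ℂ ⊓ 𝓟 (stripEnd ε)) (inv_ne_zero hpi)).mul hl
    ((h.mono hl).add_small hl hc h1)
  rw [zero_add] at h3
  refine h3.congr' (Eventually.of_forall fun z => ?_)
  simp only
  field_simp
  ring

/-- The kernel has a power behaviour at both ends of the strip, with the same exponent. -/
lemma exists_powAsymp_K (hs : 0 < p.s) (hμ : p.μ₂ = 0 → p.μ₁ ≠ I ∧ p.μ₁ ≠ -I) :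
    ∃ (n : ℤ) (c : ℝ → ℂ), ∀ ε : ℝ, ε = 1 ∨ ε = -1 → c ε ≠ 0 ∧
      (∀ᶠ z in Bornology.cobounded ℂ ⊓ 𝓟 (stripEnd ε), p.acoustic z ≠ 0) ∧
      PowAsymp (Bornology.cobounded ℂ ⊓ 𝓟 (stripEnd ε)) p.K (c ε) n := by
  obtain ⟨n, a, b, -, hn, ha, hb, hA, hB, -⟩ := p.exists_powAsymp_symbol hμ
  have hpi : (4 * Real.pi : ℂ) ≠ 0 := by simp [Real.pi_ne_zero]
  refine ⟨n, fun ε => (4 * Real.pi : ℂ)⁻¹ * if ε = 1 then a else b, ?_⟩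
  rintro ε (rfl | rfl)
  · simp only [if_true]
    exact ⟨mul_ne_zero (inv_ne_zero hpi) ha, p.powAsymp_K_aux hs (by simp) ha hn (by simpa using hA)⟩
  · have h : ¬ (-1 : ℝ) = 1 := by norm_num
    simp only [h, if_false]
    exact ⟨mul_ne_zero (inv_ne_zero hpi) hb, p.powAsymp_K_aux hs (by simp) hb hn (by simpa using hB)⟩

/-- The two quotients have algebraic growth in their half-planes: up to rational factors they are
exponentials of sublinear growth whose product is known on a strip. -/
lemma algebraic_quotients (hs : 0 < p.s) (hμ : p.μ₂ = 0 → p.μ₁ ≠ I ∧ p.μ₁ ≠ -I)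
    {U V W X : ℕ → ℂ} (h₁ : Matched p.dirRight p.dirLeft U V p.lamPlus)
    (h₂ : Matched (-p.dirLeft) (-p.dirRight) W X p.lamMinus) (hzero : p.K 0 ≠ 0)
    (hK : ∀ γ, p.acoustic γ ≠ 0 →
      p.K γ = p.K 0 * quotient U V p.lamPlus γ * quotient W X p.lamMinus γ) :
    AlgebraicAlong I {γ | γ.im ≤ 0} (quotient U V p.lamPlus) ∧
      AlgebraicAlong (-I) {γ | 0 ≤ γ.im} (quotient W X p.lamMinus) := by
  obtain ⟨Q, a, q, k, C, hq, hQ, had, hab, haq⟩ :=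
    h₁.exists_eq_mul_exp (p.dirRight_im_pos hs) (p.dirLeft_im_pos hs)
  obtain ⟨Q', b', q', k', C', hq', hQ', hbd', hbb', hbq'⟩ := h₂.neg.exists_eq_mul_exp
    (by simpa using p.dirLeft_im_pos hs) (by simpa using p.dirRight_im_pos hs)
  obtain ⟨n, c, hc⟩ := p.exists_powAsymp_K hs hμ
  have hneg : ∀ z : ℂ, -1 < z.im → (-z).im < 1 := fun z hz => by rw [neg_im]; linarith
  -- the factor for the upper half-plane, reflected back
  set b : ℂ → ℂ := fun z => b' (-z) with hb
  have hbq : ∀ z : ℂ, -1 < z.im → quotient W X p.lamMinus z = Q' (-z) * exp (b z) := fun z hz => by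
    have := hbq' (-z) (hneg z hz)
    rwa [quotient_neg, neg_neg] at this
  have hQ'' := hQ'.comp_mul (neg_ne_zero.mpr one_ne_zero)
  simp only [neg_one_mul] at hQ''
  have hq'' : q' * (-1) ^ k' ≠ 0 := mul_ne_zero hq' (zpow_ne_zero _ (by norm_num))
  have hbd : DifferentiableOn ℂ b {z | -1 < z.im} :=
    hbd'.comp differentiable_neg.differentiableOn fun z hz => hneg z hz
  have hends : ∀ ε : ℝ, ε = 1 ∨ ε = -1 → ∃ d : ℂ, d ≠ 0 ∧
      ∃ T M : ℝ, ∀ z : ℂ, |z.im| < 1 → T ≤ ε * z.re →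
        ‖exp (a z + b z) / (d * z ^ (n - k - k')) - 1‖ ≤ M / ‖z‖ := by
    intro ε hε
    obtain ⟨hc0, hac, hKc⟩ := hc ε hε
    have hl : Bornology.cobounded ℂ ⊓ 𝓟 (stripEnd ε) ≤ Bornology.cobounded ℂ := inf_le_left
    have hP := ((hKc.mul hl ((PowAsymp.const hzero).inv hl)).mul hl ((hQ.mono hl).inv hl)).mul hl
      ((hQ''.mono hl).inv hl)
    have hexp : n + -0 + -k + -k' = n - k - k' := by ring
    rw [hexp] at hP
    have hmem : ∀ᶠ z in Bornology.cobounded ℂ ⊓ 𝓟 (stripEnd ε), z ∈ stripEnd ε :=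
      mem_inf_of_right (mem_principal_self _)
    refine ⟨_, ?_, exists_bound_of_powAsymp (c := c ε * (p.K 0)⁻¹ * q⁻¹ * (q' * (-1) ^ k')⁻¹)
      (by rcases hε with rfl | rfl <;> simp) (hP.congr' ?_)⟩
    · simp only [ne_eq, mul_eq_zero, inv_eq_zero, not_or]
      exact ⟨⟨⟨hc0, hzero⟩, hq⟩, mul_ne_zero_iff.mp hq''⟩
    · filter_upwards [hac, hmem, (hQ.mono hl).eventually_ne_zero hl,
        (hQ''.mono hl).eventually_ne_zero hl] with z i1 i2 i3 i4
      obtain ⟨i5, i6⟩ := abs_lt.mp i2.1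
      rw [hK z i1, haq z i6, hbq z i5, exp_add]
      field_simp
  obtain ⟨d₁, hd₁, T₁, M₁, he₁⟩ := hends 1 (Or.inl rfl)
  obtain ⟨d₂, hd₂, T₂, M₂, he₂⟩ := hends (-1) (Or.inr rfl)
  obtain ⟨α, β, c₁, c₂, A, hA, hB⟩ := wienerHopf_asymptotic (C := max C C') had hbd
    (fun z hz => (hab z hz).trans (by gcongr; exact le_max_left _ _))
    (fun z hz => by
      have := hbb' (-z) (hneg z hz)
      rw [norm_neg] at this
      exact this.trans (by gcongr; exact le_max_right _ _))
    hd₁ hd₂ (T := max T₁ T₂) (M := max M₁ M₂)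
    (fun z hz hT => (he₁ z hz (by linarith [le_max_left T₁ T₂])).trans
      (by gcongr; exact le_max_left _ _))
    (fun z hz hT => (he₂ z hz (by linarith [le_max_right T₁ T₂])).trans
      (by gcongr; exact le_max_right _ _))
  constructor
  · obtain ⟨A', α', hA', ht⟩ := hQ.algebraicAlong_mul_exp (κ := I) (by simp) hq
      (S := {γ | γ.im ≤ 0}) (fun z hz => by simpa using hz) hA
    refine ⟨A', α', hA', ht.congr' ?_⟩
    filter_upwards [mem_inf_of_right (mem_principal_self _)] with z hz
    rw [haq z (lt_of_le_of_lt hz one_pos)]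
  · obtain ⟨A', α', hA', ht⟩ := hQ''.algebraicAlong_mul_exp (κ := -I) (by simp) hq''
      (S := {γ | 0 ≤ γ.im}) (fun z hz => by simpa using hz)
      (H := b) (α := β) (c := c₂) (A := A)
      (fun z hz => by rw [neg_mul, ← sub_eq_add_neg]; exact hB z hz)
    refine ⟨A', α', hA', ht.congr' ?_⟩
    filter_upwards [mem_inf_of_right (mem_principal_self _)] with z hz
    rw [hbq z (lt_of_lt_of_le (by norm_num) hz)]

/-- If multiplication by `exp E` and `exp (-E)` preserves algebraic growth in the two half-planes,
then `exp E`, which has no zeros, grows subexponentially and hence is constant. -/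
lemma exists_eq_const {E f g : ℂ → ℂ} (hE : Differentiable ℂ E)
    (hf : AlgebraicAlong I {γ | γ.im ≤ 0} f)
    (hf' : AlgebraicAlong I {γ | γ.im ≤ 0} fun z => exp (E z) * f z)
    (hg : AlgebraicAlong (-I) {γ | 0 ≤ γ.im} g)
    (hg' : AlgebraicAlong (-I) {γ | 0 ≤ γ.im} fun z => exp (-E z) * g z) :
    ∃ c, ∀ z, E z = c := by
  have hg'' : AlgebraicAlong (-I) {γ | 0 ≤ γ.im} fun z => exp (E z) * (exp (-E z) * g z) := by
    simpa [← mul_assoc, ← exp_add] using hg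
  have hconst : ∀ z, exp (E z) = exp (E 0) := by
    refine eq_const_of_nonvanishing (G := fun z => exp (E z)) hE.cexp (fun z => exp_ne_zero _)
      fun ε hε R => ?_
    obtain ⟨R₁, h₁⟩ := eventually_cobounded_inf_principal.mp (hf.norm_quotient_le (by simp) hf' hε)
    obtain ⟨R₂, h₂⟩ := eventually_cobounded_inf_principal.mp
      (hg'.norm_quotient_le (by simp) hg'' hε)
    refine ⟨max R (max R₁ R₂) + 1, by linarith [le_max_left R (max R₁ R₂)], fun z hz => ?_⟩
    have i1 : R₁ < ‖z‖ := by
      linarith [le_max_right R (max R₁ R₂), le_max_left R₁ R₂]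
    have i2 : R₂ < ‖z‖ := by
      linarith [le_max_right R (max R₁ R₂), le_max_right R₁ R₂]
    rw [← hz]
    rcases le_total z.im 0 with h | h
    · exact h₁ z h i1
    · exact h₂ z h i2
  refine ⟨E 0, fun z => is_const_of_deriv_eq_zero hE (fun w => ?_) z 0⟩
  have h1 := (hE w).hasDerivAt.cexp
  have h2 : HasDerivAt (fun z => exp (E z)) 0 w := by
    rw [show (fun z => exp (E z)) = fun _ => exp (E 0) from funext hconst]
    exact hasDerivAt_const _ _
  exact (mul_eq_zero.mp (h1.unique h2)).resolve_left (exp_ne_zero _)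

end Cascade

/-! ### The factorization theorem -/

namespace Cascade

/-- A labelling, up to exchange of the right and left families in each half-plane, accompanies the
acoustic modes. -/
lemma IsLabelling.exists_matched {p : Cascade} {θ : Labels} (hθ : p.IsLabelling θ) (hs : 0 < p.s)
    (hμ : p.μ₂ = 0 → (p.μ₁ = 0 → p.μ₀ ≠ 0) ∧ p.μ₁ ≠ I ∧ p.μ₁ ≠ -I)
    (hpole : p.acoustic 0 ≠ 0) (hzero : p.K 0 ≠ 0) :
    ∃ U V W X : ℕ → ℂ, Matched p.dirRight p.dirLeft U V p.lamPlus ∧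
      Matched (-p.dirLeft) (-p.dirRight) W X p.lamMinus ∧
      (U = θ.Rp ∧ V = θ.Lp ∨ U = θ.Lp ∧ V = θ.Rp) ∧ (W = θ.Rm ∧ X = θ.Lm ∨ W = θ.Lm ∧ X = θ.Rm) := by
  obtain ⟨h1, h2⟩ := p.follows_lamPlus hs hpole
  obtain ⟨h3, h4⟩ := p.follows_lamMinus hs hpole
  have h5 := p.lamPlus_ne_zero hs hpole 0
  have h6 := p.lamMinus_ne_zero hs hpole 0
  obtain ⟨hu, hl⟩ := hθ.follows hs hμ hpole hzero
  rcases hu with ⟨u1, u2⟩ | ⟨u1, u2⟩ <;> rcases hl with ⟨l1, l2⟩ | ⟨l1, l2⟩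
  · exact ⟨_, _, _, _, ⟨u1, u2, h1, h2, h5⟩, ⟨l1, l2, h3, h4, h6⟩, Or.inl ⟨rfl, rfl⟩,
      Or.inl ⟨rfl, rfl⟩⟩
  · exact ⟨_, _, _, _, ⟨u1, u2, h1, h2, h5⟩, ⟨l2, l1, h3, h4, h6⟩, Or.inl ⟨rfl, rfl⟩,
      Or.inr ⟨rfl, rfl⟩⟩
  · exact ⟨_, _, _, _, ⟨u2, u1, h1, h2, h5⟩, ⟨l1, l2, h3, h4, h6⟩, Or.inr ⟨rfl, rfl⟩,
      Or.inl ⟨rfl, rfl⟩⟩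
  · exact ⟨_, _, _, _, ⟨u2, u1, h1, h2, h5⟩, ⟨l2, l1, h3, h4, h6⟩, Or.inr ⟨rfl, rfl⟩,
      Or.inr ⟨rfl, rfl⟩⟩

end Cascade

theorem mainTheorem7 (p : Cascade) (hs : 0 < p.s)
    (hμ : p.μ₂ = 0 → (p.μ₁ = 0 → p.μ₀ ≠ 0) ∧ p.μ₁ ≠ I ∧ p.μ₁ ≠ -I)
    (hpole : p.acoustic 0 ≠ 0) (hzero : p.K 0 ≠ 0) :
    (∃ θ : Cascade.Labels, p.IsLabelling θ) ∧
    ∀ θ : Cascade.Labels, p.IsLabelling θ →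
      (∀ γ : ℂ, (∀ m, γ ≠ p.lamPlus m) →
        Tendsto (fun M => Cascade.partialQuotient θ.Rp θ.Lp p.lamPlus M γ) atTop
          (𝓝 (Cascade.quotient θ.Rp θ.Lp p.lamPlus γ))) ∧
      (∀ γ : ℂ, (∀ m, γ ≠ p.lamMinus m) →
        Tendsto (fun M => Cascade.partialQuotient θ.Rm θ.Lm p.lamMinus M γ) atTop
          (𝓝 (Cascade.quotient θ.Rm θ.Lm p.lamMinus γ))) ∧
      ∀ E : ℂ → ℂ, Differentiable ℂ E →
        (∀ γ : ℂ, p.acoustic γ ≠ 0 → p.K γ = p.KPlus θ E γ * p.KMinus θ E γ) ∧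
        (∀ γ : ℂ, γ.im ≤ 0 → (∀ m, γ ≠ p.lamPlus m) →
          AnalyticAt ℂ (p.KMinus θ E) γ ∧
          ((∀ m, γ ≠ θ.Rp m ∧ γ ≠ θ.Lp m) → p.KMinus θ E γ ≠ 0)) ∧
        (∀ γ : ℂ, 0 ≤ γ.im → (∀ m, γ ≠ p.lamMinus m) →
          AnalyticAt ℂ (p.KPlus θ E) γ ∧
          ((∀ m, γ ≠ θ.Rm m ∧ γ ≠ θ.Lm m) → p.KPlus θ E γ ≠ 0)) ∧
        ((Cascade.AlgebraicInLower (p.KMinus θ E) ∧ Cascade.AlgebraicInUpper (p.KPlus θ E)) ↔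
          ∃ c : ℂ, ∀ γ, E γ = c) := by
  have hμ' : p.μ₂ = 0 → p.μ₁ ≠ I ∧ p.μ₁ ≠ -I := fun h => (hμ h).2
  refine ⟨p.exists_labelling hs hμ hpole hzero, fun θ hθ => ?_⟩
  obtain ⟨U, V, W, X, h₁, h₂, hUV, hWX⟩ := hθ.exists_matched hs hμ hpole hzero
  have hmult : ∀ z : ℂ, {m | U m = z}.encard + {m | V m = z}.encard
      + {m | W m = z}.encard + {m | X m = z}.encard = analyticOrderAt p.duct z := by
    intro z
    rw [← hθ.multiplicity z]
    rcases hUV with ⟨rfl, rfl⟩ | ⟨rfl, rfl⟩ <;> rcases hWX with ⟨rfl, rfl⟩ | ⟨rfl, rfl⟩ <;> abel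
  -- the quotients are symmetric in their two families of zeros, so an exchange does not matter
  have hpm : Cascade.partialQuotient θ.Rp θ.Lp p.lamPlus =
      Cascade.partialQuotient U V p.lamPlus := by
    rcases hUV with ⟨rfl, rfl⟩ | ⟨rfl, rfl⟩
    exacts [rfl, Cascade.partialQuotient_comm _ _ _]
  have hqm : Cascade.quotient θ.Rp θ.Lp p.lamPlus = Cascade.quotient U V p.lamPlus := by
    funext γ
    simp only [Cascade.quotient, hpm]
  have hpp : Cascade.partialQuotient θ.Rm θ.Lm p.lamMinus =
      Cascade.partialQuotient W X p.lamMinus := by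
    rcases hWX with ⟨rfl, rfl⟩ | ⟨rfl, rfl⟩
    exacts [rfl, Cascade.partialQuotient_comm _ _ _]
  have hqp : Cascade.quotient θ.Rm θ.Lm p.lamMinus = Cascade.quotient W X p.lamMinus := by
    funext γ
    simp only [Cascade.quotient, hpp]
  have hzUV : ∀ γ, (∀ m, γ ≠ θ.Rp m ∧ γ ≠ θ.Lp m) → ∀ m, γ ≠ U m ∧ γ ≠ V m := fun γ h m => by
    rcases hUV with ⟨rfl, rfl⟩ | ⟨rfl, rfl⟩
    exacts [h m, (h m).symm]
  have hzWX : ∀ γ, (∀ m, γ ≠ θ.Rm m ∧ γ ≠ θ.Lm m) → ∀ m, γ ≠ W m ∧ γ ≠ X m := fun γ h m => by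
    rcases hWX with ⟨rfl, rfl⟩ | ⟨rfl, rfl⟩
    exacts [h m, (h m).symm]
  have ha : p.dirRight ≠ 0 := fun h => by simpa [h] using p.dirRight_im_pos hs
  have hb : p.dirLeft ≠ 0 := fun h => by simpa [h] using p.dirLeft_im_pos hs
  have hna := neg_ne_zero.mpr ha
  have hnb := neg_ne_zero.mpr hb
  have hK : ∀ γ, p.acoustic γ ≠ 0 → p.K γ = p.K 0 * Cascade.quotient U V p.lamPlus γ *
      Cascade.quotient W X p.lamMinus γ := fun γ hγ =>
    p.K_eq_mul_quotient hs h₁ h₂ hpole hzero hmult hγ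
  refine ⟨fun γ _ => ?_, fun γ _ => ?_, fun E hE => ⟨fun γ hγ => ?_, fun γ _ hγ => ?_,
    fun γ _ hγ => ?_, fun ⟨hlow, hupp⟩ => ?_, ?_⟩⟩
  · rw [hpm, hqm]
    exact h₁.tendsto_quotient ha hb γ
  · rw [hpp, hqp]
    exact h₂.tendsto_quotient hnb hna γ
  · rw [hK γ hγ, Cascade.KPlus, Cascade.KMinus, hqm, hqp, exp_neg]
    have := exp_ne_zero (E γ)
    field_simp
  · obtain ⟨han, hne⟩ := h₁.analyticAt_quotient ha hb hγ
    unfold Cascade.KMinus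
    rw [hqm]
    exact ⟨(hE.analyticAt γ).cexp.mul han, fun h => mul_ne_zero (exp_ne_zero _) (hne (hzUV γ h))⟩
  · obtain ⟨han, hne⟩ := h₂.analyticAt_quotient hnb hna hγ
    unfold Cascade.KPlus
    rw [hqp]
    exact ⟨((hE.analyticAt γ).neg.cexp.mul han).mul analyticAt_const,
      fun h => mul_ne_zero (mul_ne_zero (exp_ne_zero _) (hne (hzWX γ h))) hzero⟩
  · obtain ⟨hm, hp⟩ := p.algebraic_quotients hs hμ' h₁ h₂ hzero hK
    refine Cascade.exists_eq_const hE hm ?_ (hp.const_mul hzero) ?_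
    · rw [← hqm]
      exact hlow
    · obtain ⟨A, α, hA, ht⟩ := hupp
      refine ⟨A, α, hA, ht.congr fun z => ?_⟩
      rw [Cascade.KPlus, hqp]
      ring
  · rintro ⟨c, hc⟩
    obtain ⟨hm, hp⟩ := p.algebraic_quotients hs hμ' h₁ h₂ hzero hK
    constructor
    · obtain ⟨A, α, hA, ht⟩ := hm.const_mul (exp_ne_zero c)
      refine ⟨A, α, hA, ht.congr fun z => ?_⟩
      rw [Cascade.KMinus, hqm, hc]
    · obtain ⟨A, α, hA, ht⟩ := hp.const_mul (mul_ne_zero (exp_ne_zero (-c)) hzero)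
      refine ⟨A, α, hA, ht.congr fun z => ?_⟩
      rw [Cascade.KPlus, hqp, hc]
      ring
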